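/- Let $n\ge 1$ and $2\le q<\infty$, and let $q'$ be the dual exponent, $\frac1q+\frac1{q'}=1$. There is a constant $C$ depending only on $n$ and $q$ with the following property. Let $u:\mathbb R\to\mathcal S'(\mathbb R^n)$ be a solution of the linear beam equation $$\partial_{tt}u+\Delta^2u+u=0,\qquad u(0)=u_0,\quad u_t(0)=u_1,$$ in the sense of complex-valued tempered distributions, where the time derivatives are taken in the weak-$*$ sense, i.e. after pairing with each Schwartz function. Then for all $t\in\mathbb R$ $$\|u(t)\|_{L^q(\mathbb R^n)}\le C\,k(t)\left(\|u_0\|_{W^{2,q'}(\mathbb R^n)}+\|u_1\|_{L^{q'}(\mathbb R^n)}\right),$$ where $$k(t)=\begin{cases}|t|^{\min\left(1+\frac nq-\frac n2,\,0\right)},&|t|\le 1,\\[2pt] |t|^{\frac n{2q}-\frac n4},&|t|\ge 1.\end{cases}$$ Furthermore, if $u_0=0$, then for $|t|\le 1$ $$\|u(t)\|_{L^q(\mathbb R^n)}\le C\,|t|^{1+\frac nq-\frac n2}\,\|u_1\|_{L^{q'}(\mathbb R^n)}.$$ Here norms take the value $\infty$ on distributions that do not belong to the space in question, $\|f\|_{W^{2,p}}$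 is the sum of the $L^p$ norms of the distributional derivatives of $f$ of order at most two, and $0^s=\infty$ for $s<0$, $0^0=1$ (so at $t=0$ the first estimate says nothing for nonzero data if $1+\frac nq-\frac n2<0$). -/

import Mathlib

open MeasureTheory SchwartzMap
open scoped ENNReal NNReal LineDeriv Laplacian

noncomputable section

/-- The Euclidean space `ℝⁿ`. -/
abbrev RSpace (n : ℕ) : Type := EuclideanSpace ℝ (Fin n)

/-- The `i`-th standard unit vector of `ℝⁿ`. -/
def stdVec {n : ℕ} (i : Fin n) : RSpace n := EuclideanSpace.single i (1 : ℝ)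

/-- The tempered distribution `f` is (given by integration against) the function `g`. -/
def IsGivenBy {n : ℕ} (f : 𝓢'(RSpace n, ℂ)) (g : RSpace n → ℂ) : Prop :=
  ∀ φ : 𝓢(RSpace n, ℂ), f φ = ∫ x, φ x * g x

/-- The `L^p` norm (`1 ≤ p ≤ ∞`) of a tempered distribution on `ℝⁿ`, with values in `[0, ∞]`: it is
`‖g‖_p` if the distribution is given by a function `g ∈ L^p` (which is then unique almost
everywhere), and `∞` if there is no such function. -/
def lebesgueNorm {n : ℕ} (p : ℝ≥0∞) (f : 𝓢'(RSpace n, ℂ)) : ℝ≥0∞ :=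
  ⨅ (g : RSpace n → ℂ) (_ : MemLp g p volume) (_ : IsGivenBy f g), eLpNorm g p volume

/-- The norm of the Sobolev space `W^{2,p}(ℝⁿ)`: the sum of the `L^p` norms of the distributional
derivatives of order at most two (`∞` if one of them is not in `L^p`). -/
def sobolevTwoNorm {n : ℕ} (p : ℝ≥0∞) (f : 𝓢'(RSpace n, ℂ)) : ℝ≥0∞ :=
  lebesgueNorm p f
    + ∑ i : Fin n, lebesgueNorm p (∂_{stdVec i} f)
    + ∑ i : Fin n, ∑ j : Fin n, lebesgueNorm p (∂_{stdVec i} (∂_{stdVec j} f))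

/-- `u : ℝ → 𝓢'(ℝⁿ)` solves the Cauchy problem for the linear homogeneous beam equation
`∂ₜₜ u + Δ² u + u = 0`, `u(0) = u₀`, `uₜ(0) = u₁`. The time derivatives are taken in the
(weak-*) topology of tempered distributions, that is, after pairing with each fixed Schwartz
function; `v` is `∂ₜ u`. -/
def IsBeamSolution {n : ℕ} (u₀ u₁ : 𝓢'(RSpace n, ℂ)) (u : ℝ → 𝓢'(RSpace n, ℂ)) : Prop :=
  ∃ v : ℝ → 𝓢'(RSpace n, ℂ),
    (∀ (t : ℝ) (φ : 𝓢(RSpace n, ℂ)), HasDerivAt (fun s => u s φ) (v t φ) t) ∧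
    (∀ (t : ℝ) (φ : 𝓢(RSpace n, ℂ)),
      HasDerivAt (fun s => v s φ) ((-(Δ (Δ (u t))) - u t) φ) t) ∧
    u 0 = u₀ ∧ v 0 = u₁

/-- The function `k(t)`, with values in `[0, ∞]`, for which `0 ^ s = ∞` if `s < 0`, and
`0 ^ 0 = 1`. -/
def beamDecay (n : ℕ) (q t : ℝ) : ℝ≥0∞ :=
  if |t| ≤ 1 then ENNReal.ofReal |t| ^ (min (1 + (n : ℝ) / q - (n : ℝ) / 2) 0)
  else ENNReal.ofReal |t| ^ ((n : ℝ) / (2 * q) - (n : ℝ) / 4)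

end

/-! Let a = 4π²|ξ|² be the symbol of -Δ and ω = √(1+a²). A solution equals cos(tω)(D)u₀ +
(sin(tω)/ω)(D)u₁, so the theorem is about L^{q'} → L^q bounds of Fourier multipliers. As functions
of a, these multipliers are the propagators of the one-dimensional Klein–Gordon equation, hence
superpositions of e^{isa} with |s| ≤ t: with z = √(t²-s²), sin(tω)/ω has the density J₀(z)/2, and
cos(tω) - cos(ta) has the density -tJ₁(z)/(2z) (`sinDensity_cosDensity_integral`). The beam
propagators are therefore superpositions of Schrödinger propagators, whose kernels are bounded by
(4π|s|)^{-n/2}, also for complex s ≠ 0 with Im s ≥ 0 (`hasKernel_schrodinger`,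
`norm_schrodingerKernel_le`). Interpolation with L² turns a kernel bound M into the operator bound
M^θ, θ = 1 - 2/q (`norm_integral_kernel_le_interpolation`).

Short times. The densities are entire in s, so [-t,t] may be replaced by the upper half circle |s| =
t, which avoids the singularity s = 0; length times size gives t^{1-nθ/2}. The remaining term
cos(ta) involves no integration in s, and two derivatives of u₀ are spent on it: 1/(1+a) = ∫
e^{-τ(1+a)} dτ moves s to s+iτ, and the integral in τ gains one power of |s|. This loses a logarithm
only when nθ/2 = 1; there q' = 2n/(n+2), and Sobolev's inequality alone suffices
(`exists_formBound_of_norm_le_resolvent`).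

Long times. A kernel bound t^{-n/4} is wanted. For n ≥ 2 the part |s| ≤ √t/2 is moved to a half
circle, on which the density is O(t^{-1/2}), and the rest of [-t,t] is estimated by absolute values.
The exception is n = 2 on [√t/2, t/2], where ∫ ds/s would cost a logarithm; there the phases
|x|²/(4s) and ±z are combined and treated by van der Corput's lemma. For n = 1 van der Corput's
lemma is applied directly to the Fourier integral with phase t√(1+x⁴) + yx.

Weak solutions. For v = uₜ, each of the two first order factors v ∓ iωu is transported by a
unimodular symbol, which gives the propagator formula (`IsBeamSolution.eq_propagator`). The product
rule behind it, with u(t) only weak-* differentiable and the test function moving with t, rests on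
uniform boundedness in 𝓢'. Bounds on test functions pass to all data in L^{q'} by duality and
density. -/

/-! ### Oscillatory integrals: integration by parts and van der Corput's lemma. -/

open Set Filter Topology in
/-- Integration by parts against a complex exponential. -/
theorem norm_integral_mul_deriv_exp_le {a b : ℝ} (hab : a ≤ b) {φ φ' : ℝ → ℝ} {η η' : ℝ → ℂ}
    (hφ : ∀ x ∈ Icc a b, HasDerivAt φ (φ' x) x) (hφc : ContinuousOn φ' (Icc a b))
    (hη : ∀ x ∈ Icc a b, HasDerivAt η (η' x) x) (hηc : ContinuousOn η' (Icc a b)) :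
    ‖∫ x in a..b, η x * φ' x * Complex.exp (Complex.I * φ x)‖ ≤
      ‖η a‖ + ‖η b‖ + ∫ x in a..b, ‖η' x‖ := by
  have huIcc : uIcc a b = Icc a b := uIcc_of_le hab
  have hexp : ∀ x ∈ Icc a b, HasDerivAt (fun x => Complex.exp (Complex.I * φ x))
      (Complex.exp (Complex.I * φ x) * (Complex.I * φ' x)) x := fun x hx =>
    (((hφ x hx).ofReal_comp).const_mul Complex.I).cexp
  have hηcont : ContinuousOn η (Icc a b) := fun x hx =>
    (hη x hx).continuousAt.continuousWithinAt
  have hecont : ContinuousOn (fun x => Complex.exp (Complex.I * φ x)) (Icc a b) := fun x hx =>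
    (hexp x hx).continuousAt.continuousWithinAt
  have hφ'c : ContinuousOn (fun x => (φ' x : ℂ)) (Icc a b) :=
    Complex.continuous_ofReal.comp_continuousOn hφc
  have hibp := intervalIntegral.integral_mul_deriv_eq_deriv_mul (a := a) (b := b)
    (u := η) (u' := η') (v := fun x => Complex.exp (Complex.I * φ x))
    (v' := fun x => Complex.exp (Complex.I * φ x) * (Complex.I * φ' x))
    (fun x hx => hη x (huIcc ▸ hx)) (fun x hx => hexp x (huIcc ▸ hx))
    (ContinuousOn.intervalIntegrable (huIcc ▸ hηc))
    (ContinuousOn.intervalIntegrable (huIcc ▸ (hecont.mul (continuousOn_const.mul hφ'c))))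
  have hnorm : ∀ y : ℝ, ‖Complex.exp (Complex.I * φ y)‖ = 1 := fun y => by
    rw [mul_comm]; exact Complex.norm_exp_ofReal_mul_I _
  have h1 : ‖∫ x in a..b, η x * φ' x * Complex.exp (Complex.I * φ x)‖ =
      ‖∫ x in a..b, η x * (Complex.exp (Complex.I * φ x) * (Complex.I * φ' x))‖ := by
    have : (fun x => η x * (Complex.exp (Complex.I * φ x) * (Complex.I * φ' x))) =
        fun x => Complex.I * (η x * φ' x * Complex.exp (Complex.I * φ x)) := by
      ext x; ring
    rw [this, intervalIntegral.integral_const_mul, norm_mul, Complex.norm_I, one_mul]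
  rw [h1, hibp]
  have h2 : ‖∫ x in a..b, η' x * Complex.exp (Complex.I * φ x)‖ ≤ ∫ x in a..b, ‖η' x‖ := by
    refine (intervalIntegral.norm_integral_le_integral_norm hab).trans_eq ?_
    simp only [norm_mul, hnorm, mul_one]
  calc _ ≤ ‖η b * Complex.exp (Complex.I * φ b) - η a * Complex.exp (Complex.I * φ a)‖
        + ‖∫ x in a..b, η' x * Complex.exp (Complex.I * φ x)‖ := norm_sub_le _ _
    _ ≤ (‖η b‖ + ‖η a‖) + ∫ x in a..b, ‖η' x‖ := by
        gcongr
        · refine (norm_sub_le _ _).trans_eq ?_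
          simp only [norm_mul, hnorm, mul_one]
    _ = _ := by ring

open Set Filter Topology in
/-- **Van der Corput's lemma** (second derivative test) with an amplitude. -/
theorem van_der_corput_second {a b μ M : ℝ} (hab : a ≤ b) (hμ : 0 < μ)
    {φ φ' φ'' : ℝ → ℝ} {ψ ψ' : ℝ → ℂ}
    (hφ : ∀ x ∈ Icc a b, HasDerivAt φ (φ' x) x)
    (hφ' : ∀ x ∈ Icc a b, HasDerivAt φ' (φ'' x) x)
    (hφc : ContinuousOn φ'' (Icc a b)) (hμφ : ∀ x ∈ Icc a b, μ ^ 2 ≤ φ'' x)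
    (hψ : ∀ x ∈ Icc a b, HasDerivAt ψ (ψ' x) x) (hψc : ContinuousOn ψ' (Icc a b))
    (hM : ∀ x ∈ Icc a b, ‖ψ x‖ ≤ M) :
    ‖∫ x in a..b, ψ x * Complex.exp (Complex.I * φ x)‖ ≤
      (8 * M + ∫ x in a..b, ‖ψ' x‖) / μ := by
  have huIcc : uIcc a b = Icc a b := uIcc_of_le hab
  have hM0 : 0 ≤ M := (norm_nonneg _).trans (hM a (left_mem_Icc.2 hab))
  have hD : ∀ x, 0 < μ ^ 2 + φ' x ^ 2 := fun x => by positivity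
  -- No neighbourhood of the stationary point is cut out. Instead 1 = gφ' + (1 - gφ'), where g is a
  -- regularised 1/φ'. The first part is integrated by parts; |g'| and 1 - gφ' are both dominated by
  -- φ''/(μ²+φ'²), the derivative of arctan(φ'/μ)/μ, whose integral is at most π/μ.
  set g : ℝ → ℝ := fun x => φ' x / (μ ^ 2 + φ' x ^ 2) with hg
  set g' : ℝ → ℝ := fun x => φ'' x * (μ ^ 2 - φ' x ^ 2) / (μ ^ 2 + φ' x ^ 2) ^ 2 with hg'
  have hφ'cont : ContinuousOn φ' (Icc a b) := fun x hx =>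
    (hφ' x hx).continuousAt.continuousWithinAt
  have hφcont : ContinuousOn φ (Icc a b) := fun x hx =>
    (hφ x hx).continuousAt.continuousWithinAt
  have hψcont : ContinuousOn ψ (Icc a b) := fun x hx =>
    (hψ x hx).continuousAt.continuousWithinAt
  have hDc : ContinuousOn (fun x => μ ^ 2 + φ' x ^ 2) (Icc a b) :=
    continuousOn_const.add (hφ'cont.pow 2)
  have hgd : ∀ x ∈ Icc a b, HasDerivAt g (g' x) x := fun x hx => by
    have h := (hφ' x hx).div (((hφ' x hx).pow 2).const_add (μ ^ 2)) (hD x).ne'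
    refine h.congr_deriv ?_
    simp only [hg']
    congr 1
    simp
    ring
  have hgc : ContinuousOn g (Icc a b) := hφ'cont.div hDc fun x _ => (hD x).ne'
  have hg'c : ContinuousOn g' (Icc a b) :=
    (hφc.mul (continuousOn_const.sub (hφ'cont.pow 2))).div (hDc.pow 2)
      fun x _ => pow_ne_zero 2 (hD x).ne'
  have hgle : ∀ x, |g x| ≤ 1 / (2 * μ) := fun x => by
    rw [hg]; simp only
    rw [abs_div, abs_of_pos (hD x), div_le_div_iff₀ (hD x) (by positivity)]
    nlinarith [sq_nonneg (μ - |φ' x|), sq_abs (φ' x)]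
  -- the density controlling the error terms
  set d : ℝ → ℝ := fun x => φ'' x / (μ ^ 2 + φ' x ^ 2) with hd
  have hdc : ContinuousOn d (Icc a b) := hφc.div hDc fun x _ => (hD x).ne'
  have hd_int : ∫ x in a..b, d x ≤ Real.pi / μ := by
    have hder : ∀ x ∈ uIcc a b, HasDerivAt (fun x => Real.arctan (φ' x / μ) / μ) (d x) x := by
      intro x hx
      have h := (((hφ' x (huIcc ▸ hx)).div_const μ).arctan).div_const μ
      refine h.congr_deriv ?_
      have := hD x
      simp only [hd]
      have h1 : (1 + (φ' x / μ) ^ 2) = (μ ^ 2 + φ' x ^ 2) / μ ^ 2 := by field_simp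
      rw [h1]; field_simp
    rw [intervalIntegral.integral_eq_sub_of_hasDerivAt hder
      (ContinuousOn.intervalIntegrable (huIcc ▸ hdc)), ← sub_div]
    gcongr
    linarith [Real.arctan_lt_pi_div_two (φ' b / μ), Real.neg_pi_div_two_lt_arctan (φ' a / μ)]
  have hg'le : ∀ x ∈ Icc a b, |g' x| ≤ d x := fun x hx => by
    have hpos : 0 ≤ φ'' x := (sq_nonneg μ).trans (hμφ x hx)
    simp only [hg', hd]
    rw [abs_div, abs_mul, abs_of_nonneg hpos, abs_of_pos (pow_pos (hD x) 2),
      div_le_div_iff₀ (pow_pos (hD x) 2) (hD x)]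
    have : |μ ^ 2 - φ' x ^ 2| ≤ μ ^ 2 + φ' x ^ 2 := by
      rw [abs_le]; constructor <;> nlinarith [sq_nonneg μ, sq_nonneg (φ' x)]
    calc φ'' x * |μ ^ 2 - φ' x ^ 2| * (μ ^ 2 + φ' x ^ 2)
        ≤ φ'' x * (μ ^ 2 + φ' x ^ 2) * (μ ^ 2 + φ' x ^ 2) := by gcongr
      _ = _ := by ring
  have hrest : ∀ x ∈ Icc a b, 1 - g x * φ' x ≤ d x := fun x hx => by
    have : 1 - g x * φ' x = μ ^ 2 / (μ ^ 2 + φ' x ^ 2) := by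
      simp only [hg]; have := hD x; field_simp; ring
    rw [this]; simp only [hd]; gcongr; exact hμφ x hx
  have hrest0 : ∀ x, 0 ≤ 1 - g x * φ' x := fun x => by
    have : 1 - g x * φ' x = μ ^ 2 / (μ ^ 2 + φ' x ^ 2) := by
      simp only [hg]; have := hD x; field_simp; ring
    rw [this]; positivity
  have hηd : ∀ x ∈ Icc a b, HasDerivAt (fun x => ψ x * (g x : ℂ))
      (ψ' x * g x + ψ x * g' x) x := fun x hx => (hψ x hx).mul (hgd x hx).ofReal_comp
  have hgcC : ContinuousOn (fun x => (g x : ℂ)) (Icc a b) :=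
    Complex.continuous_ofReal.comp_continuousOn hgc
  have hg'cC : ContinuousOn (fun x => (g' x : ℂ)) (Icc a b) :=
    Complex.continuous_ofReal.comp_continuousOn hg'c
  have hφ'C : ContinuousOn (fun x => (φ' x : ℂ)) (Icc a b) :=
    Complex.continuous_ofReal.comp_continuousOn hφ'cont
  have hφC : ContinuousOn (fun x => Complex.exp (Complex.I * φ x)) (Icc a b) :=
    Complex.continuous_exp.comp_continuousOn
      (continuousOn_const.mul (Complex.continuous_ofReal.comp_continuousOn hφcont))
  have hη'c : ContinuousOn (fun x => ψ' x * (g x : ℂ) + ψ x * g' x) (Icc a b) :=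
    (hψc.mul hgcC).add (hψcont.mul hg'cC)
  have key := norm_integral_mul_deriv_exp_le hab hφ hφ'cont hηd hη'c
  have hnorm : ∀ y : ℝ, ‖Complex.exp (Complex.I * φ y)‖ = 1 := fun y => by
    rw [mul_comm]; exact Complex.norm_exp_ofReal_mul_I _
  have hsplit : ∫ x in a..b, ψ x * Complex.exp (Complex.I * φ x) =
      (∫ x in a..b, ψ x * (g x : ℂ) * φ' x * Complex.exp (Complex.I * φ x)) +
      ∫ x in a..b, ψ x * ((1 - g x * φ' x : ℝ) : ℂ) * Complex.exp (Complex.I * φ x) := by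
    rw [← intervalIntegral.integral_add]
    · congr 1; ext x; push_cast; ring
    · exact ContinuousOn.intervalIntegrable
        (huIcc ▸ (((hψcont.mul hgcC).mul hφ'C).mul hφC))
    · refine ContinuousOn.intervalIntegrable (huIcc ▸ ((hψcont.mul ?_).mul hφC))
      exact Complex.continuous_ofReal.comp_continuousOn
        (continuousOn_const.sub (hgc.mul hφ'cont))
  have hdi : IntervalIntegrable d volume a b :=
    ContinuousOn.intervalIntegrable (huIcc ▸ hdc)
  have h2 : ‖∫ x in a..b, ψ x * ((1 - g x * φ' x : ℝ) : ℂ) * Complex.exp (Complex.I * φ x)‖ ≤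
      M * (Real.pi / μ) := by
    refine (intervalIntegral.norm_integral_le_of_norm_le (g := fun x => M * d x) hab ?_
      (hdi.const_mul M)).trans ?_
    · refine Eventually.of_forall fun x hx => ?_
      have hx' := Ioc_subset_Icc_self hx
      rw [norm_mul, norm_mul, hnorm, mul_one, Complex.norm_real, Real.norm_of_nonneg (hrest0 x)]
      exact mul_le_mul (hM x hx') (hrest x hx') (hrest0 x) hM0
    · rw [intervalIntegral.integral_const_mul]
      exact mul_le_mul_of_nonneg_left hd_int hM0
  have h3 : ∫ x in a..b, ‖ψ' x * (g x : ℂ) + ψ x * g' x‖ ≤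
      (1 / (2 * μ)) * (∫ x in a..b, ‖ψ' x‖) + M * (Real.pi / μ) := by
    have hψ'i : IntervalIntegrable (fun x => ‖ψ' x‖) volume a b :=
      ContinuousOn.intervalIntegrable (huIcc ▸ hψc.norm)
    calc _ ≤ ∫ x in a..b, ((1 / (2 * μ)) * ‖ψ' x‖ + M * d x) := by
          refine intervalIntegral.integral_mono_on hab
            (ContinuousOn.intervalIntegrable (huIcc ▸ hη'c.norm))
            ((hψ'i.const_mul _).add (hdi.const_mul M)) fun x hx => ?_
          refine (norm_add_le _ _).trans ?_
          rw [norm_mul, norm_mul, Complex.norm_real, Complex.norm_real, Real.norm_eq_abs,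
            Real.norm_eq_abs, mul_comm ‖ψ' x‖]
          exact add_le_add (mul_le_mul_of_nonneg_right (hgle x) (norm_nonneg _))
            (mul_le_mul (hM x hx) (hg'le x hx) (abs_nonneg _) hM0)
      _ ≤ _ := by
          rw [intervalIntegral.integral_add (hψ'i.const_mul _) (hdi.const_mul M),
            intervalIntegral.integral_const_mul, intervalIntegral.integral_const_mul]
          gcongr
  have hend : ∀ x ∈ Icc a b, ‖ψ x * (g x : ℂ)‖ ≤ M * (1 / (2 * μ)) := fun x hx => by
    rw [norm_mul, Complex.norm_real, Real.norm_eq_abs]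
    exact mul_le_mul (hM x hx) (hgle x) (abs_nonneg _) hM0
  have hV : 0 ≤ ∫ x in a..b, ‖ψ' x‖ :=
    intervalIntegral.integral_nonneg hab fun x _ => norm_nonneg _
  rw [hsplit]
  refine (norm_add_le _ _).trans ?_
  have hea := hend a (left_mem_Icc.2 hab)
  have heb := hend b (right_mem_Icc.2 hab)
  -- The total is (1 + 2π)M/μ plus half the variation over μ: boundary terms M/μ, and πM/μ twice.
  -- The constant 8 needs 1 + 2π ≤ 8.
  have hpi : Real.pi ≤ 7 / 2 := by linarith [Real.pi_lt_d2]
  have hfin : M * (1 / (2 * μ)) + M * (1 / (2 * μ)) +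
      ((1 / (2 * μ)) * (∫ x in a..b, ‖ψ' x‖) + M * (Real.pi / μ)) + M * (Real.pi / μ) ≤
      (8 * M + ∫ x in a..b, ‖ψ' x‖) / μ := by
    have : (8 * M + ∫ x in a..b, ‖ψ' x‖) / μ - (M * (1 / (2 * μ)) + M * (1 / (2 * μ)) +
      ((1 / (2 * μ)) * (∫ x in a..b, ‖ψ' x‖) + M * (Real.pi / μ)) + M * (Real.pi / μ)) =
      ((7 - 2 * Real.pi) * M + (1 / 2) * ∫ x in a..b, ‖ψ' x‖) / μ := by
      field_simp; ring
    have h0 : 0 ≤ ((7 - 2 * Real.pi) * M + (1 / 2) * ∫ x in a..b, ‖ψ' x‖) / μ := by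
      have : 0 ≤ 7 - 2 * Real.pi := by linarith
      positivity
    linarith
  linarith

/-! ### Bessel functions as entire functions of the squared variable. -/

/-- The entire functions `∑ₖ (-w/4)ᵏ / (k! (k+ν)!)`; for `ν = 0` this is the Bessel function
`J₀(√w)`. -/
noncomputable def besselEntire (ν : ℕ) (w : ℂ) : ℂ :=
  ∑' k : ℕ, (-w / 4) ^ k / ((k.factorial : ℂ) * ((k + ν).factorial : ℂ))

theorem besselEntire_term_norm_le (ν k : ℕ) (w : ℂ) :
    ‖(-w / 4) ^ k / ((k.factorial : ℂ) * ((k + ν).factorial : ℂ))‖ ≤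
      (‖w‖ / 4) ^ k / k.factorial := by
  rw [norm_div, norm_pow, norm_mul, norm_div, norm_neg, Complex.norm_natCast, Complex.norm_natCast]
  have h4 : ‖(4 : ℂ)‖ = 4 := by simp
  rw [h4]
  have h1 : (1 : ℝ) ≤ ((k + ν).factorial : ℝ) := by exact_mod_cast Nat.succ_le_of_lt (Nat.factorial_pos _)
  have h2 : (0 : ℝ) < (k.factorial : ℝ) := by exact_mod_cast Nat.factorial_pos _
  apply div_le_div_of_nonneg_left (by positivity) h2
  nlinarith

theorem besselEntire_summable (ν : ℕ) (w : ℂ) :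
    Summable fun k : ℕ => (-w / 4) ^ k / ((k.factorial : ℂ) * ((k + ν).factorial : ℂ)) :=
  Summable.of_norm_bounded (Real.summable_pow_div_factorial (‖w‖ / 4))
    fun k => besselEntire_term_norm_le ν k w

/-- In the k-th term the factor k from differentiation turns k! into (k-1)!, which leaves -1/4 times
term k-1 of the series with index ν+1. On a ball the exponential series dominates the derivatives.
-/
theorem hasDerivAt_besselEntire (ν : ℕ) (w : ℂ) :
    HasDerivAt (besselEntire ν) (-(1 / 4) * besselEntire (ν + 1) w) w := by
  set R : ℝ := ‖w‖ + 1
  have hR : 0 < R := by positivity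
  have hw : w ∈ Metric.ball (0 : ℂ) R := by simp [R]
  set g' : ℕ → ℂ → ℂ := fun k y =>
    (k : ℂ) * (-y / 4) ^ (k - 1) * (-1 / 4) / ((k.factorial : ℂ) * ((k + ν).factorial : ℂ)) with hg'
  have hsucc : ∀ (k : ℕ) (y : ℂ), g' (k + 1) y =
      -(1 / 4) * ((-y / 4) ^ k / ((k.factorial : ℂ) * ((k + (ν + 1)).factorial : ℂ))) := by
    intro k y
    simp only [hg', Nat.add_sub_cancel]
    have h1 : ((k + 1).factorial : ℂ) = (k + 1) * (k.factorial : ℂ) := by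
      rw [Nat.factorial_succ]; push_cast; ring
    have h2 : (k + 1 + ν) = k + (ν + 1) := by ring
    have h3 : (k.factorial : ℂ) ≠ 0 := by exact_mod_cast Nat.factorial_ne_zero k
    have h4 : ((k + (ν + 1)).factorial : ℂ) ≠ 0 := by exact_mod_cast Nat.factorial_ne_zero _
    have h5 : ((k : ℂ) + 1) ≠ 0 := by exact_mod_cast Nat.succ_ne_zero k
    rw [h1, h2]; push_cast; field_simp
  set u : ℕ → ℝ := fun k => if k = 0 then 0 else (R / 4) ^ (k - 1) / (k - 1).factorial with hu
  have hus : Summable u := by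
    rw [← summable_nat_add_iff 1]
    simpa [hu] using Real.summable_pow_div_factorial (R / 4)
  have hbound : ∀ (k : ℕ) (y : ℂ), y ∈ Metric.ball (0 : ℂ) R → ‖g' k y‖ ≤ u k := by
    intro k y hy
    rcases k with _ | k
    · simp [hg', hu]
    · rw [hsucc, norm_mul]
      have hy' : ‖y‖ ≤ R := by simpa using (Metric.mem_ball.1 hy).le
      have h6 : ‖(-(1 / 4) : ℂ)‖ ≤ 1 := by norm_num
      have h7 := besselEntire_term_norm_le (ν + 1) k y
      calc _ ≤ 1 * ((‖y‖ / 4) ^ k / k.factorial) := by gcongr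
        _ ≤ u (k + 1) := by
          simp only [hu, Nat.succ_ne_zero, if_false, Nat.add_sub_cancel, one_mul]
          gcongr
  have hderiv := hasDerivAt_tsum_of_isPreconnected (𝕜 := ℂ) (F := ℂ) hus Metric.isOpen_ball
    (convex_ball (0 : ℂ) R).isPreconnected
    (g := fun (k : ℕ) (y : ℂ) => (-y / 4) ^ k / ((k.factorial : ℂ) * ((k + ν).factorial : ℂ)))
    (g' := g') (fun k y _ => by
      have h := ((((hasDerivAt_id y).neg).div_const 4).pow k).div_const
        ((k.factorial : ℂ) * ((k + ν).factorial : ℂ))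
      exact h) hbound hw (besselEntire_summable ν w) hw
  have hval : ∑' k, g' k w = -(1 / 4) * besselEntire (ν + 1) w := by
    have hs : Summable fun k => g' k w := Summable.of_norm_bounded hus fun k => hbound k w hw
    rw [hs.tsum_eq_zero_add, besselEntire, ← tsum_mul_left]
    simp only [hsucc]
    simp [hg']
  rw [hval] at hderiv
  exact hderiv

/-- With J_ν(z) = (z/2)^ν `besselEntire ν (z²)` this is the classical J₀ + J₂ = (2/z)J₁, compared
coefficient by coefficient. It is the only relation needed to derive both Bessel's equation and the
Klein–Gordon equation for the densities. -/
theorem besselEntire_recurrence (w : ℂ) :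
    w / 4 * besselEntire 2 w = besselEntire 1 w - besselEntire 0 w := by
  have h0 := besselEntire_summable 0 w
  have h1 := besselEntire_summable 1 w
  have h2 := besselEntire_summable 2 w
  have e : besselEntire 1 w - besselEntire 0 w = ∑' k : ℕ,
      ((-w / 4) ^ k / ((k.factorial : ℂ) * ((k + 1).factorial : ℂ)) -
        (-w / 4) ^ k / ((k.factorial : ℂ) * ((k + 0).factorial : ℂ))) :=
    (h1.tsum_sub h0).symm
  rw [e, (h1.sub h0).tsum_eq_zero_add, besselEntire, ← tsum_mul_left]
  simp only [pow_zero, Nat.factorial_zero, Nat.factorial_one, zero_add, sub_self]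
  simp only [add_zero]
  congr 1
  ext k
  have h3 : (k.factorial : ℂ) ≠ 0 := by exact_mod_cast Nat.factorial_ne_zero k
  have h5 : ((k : ℂ) + 1) ≠ 0 := by exact_mod_cast Nat.succ_ne_zero k
  have h6 : ((k : ℂ) + 1 + 1) ≠ 0 := by exact_mod_cast Nat.succ_ne_zero (k + 1)
  simp only [show k + 2 = k + 1 + 1 by ring, Nat.factorial_succ]
  push_cast
  field_simp
  ring

theorem besselEntire_zero_zero : besselEntire 0 0 = 1 := by
  rw [besselEntire, tsum_eq_single 0]
  · simp
  · intro k hk; simp [hk]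

theorem besselEntire_one_zero : besselEntire 1 0 = 1 := by
  rw [besselEntire, tsum_eq_single 0]
  · simp
  · intro k hk; simp [hk]

theorem besselEntire_differentiable (ν : ℕ) : Differentiable ℂ (besselEntire ν) :=
  fun w => (hasDerivAt_besselEntire ν w).differentiableAt

theorem besselEntire_continuous (ν : ℕ) : Continuous (besselEntire ν) :=
  (besselEntire_differentiable ν).continuous

theorem besselEntire_ofReal_im (ν : ℕ) (x : ℝ) : (besselEntire ν x).im = 0 := by
  have : besselEntire ν x =
      ((∑' k : ℕ, (-x / 4) ^ k / ((k.factorial : ℝ) * ((k + ν).factorial : ℝ)) : ℝ) : ℂ) := by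
    rw [Complex.ofReal_tsum, besselEntire]; push_cast; rfl
  rw [this, Complex.ofReal_im]

/-! ### Klein–Gordon propagators as superpositions of exponentials. -/

open Set Filter Topology in
/-- Leibniz' rule on the symmetric interval `[-t, t]`. -/
theorem hasDerivAt_integral_symm {f ft fs : ℝ → ℝ → ℂ}
    (hf : Continuous (Function.uncurry f)) (hft : Continuous (Function.uncurry ft))
    (hfs : Continuous (Function.uncurry fs))
    (h : ∀ t σ : ℝ, HasDerivAt (fun τ => f τ (τ * σ)) (ft t (t * σ) + σ * fs t (t * σ)) t)
    (hs : ∀ t s : ℝ, HasDerivAt (f t) (fs t s) s) (t : ℝ) :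
    HasDerivAt (fun t => ∫ s in (-t)..t, f t s) (f t t + f t (-t) + ∫ s in (-t)..t, ft t s) t := by
  -- The substitution s = tσ fixes the interval, so that only differentiation under the integral
  -- sign remains.
  have hsub : ∀ (g : ℝ → ℂ) (t : ℝ), ∫ s in (-t)..t, g s = t * ∫ σ in (-1)..1, g (t * σ) := by
    intro g t
    have := intervalIntegral.smul_integral_comp_mul_left (a := -1) (b := 1) g t
    rw [mul_neg, mul_one] at this
    rw [← this, Complex.real_smul]
  have hc1 : Continuous fun p : ℝ × ℝ => ft p.1 (p.1 * p.2) + p.2 * fs p.1 (p.1 * p.2) := by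
    have h1 : Continuous fun p : ℝ × ℝ => (p.1, p.1 * p.2) := by fun_prop
    exact (hft.comp h1).add ((Complex.continuous_ofReal.comp continuous_snd).mul (hfs.comp h1))
  have hcs : ∀ t : ℝ, Continuous fun σ : ℝ => f t (t * σ) := fun t =>
    hf.comp (by fun_prop : Continuous fun σ : ℝ => (t, t * σ))
  have hct : ∀ t : ℝ, Continuous fun σ : ℝ => ft t (t * σ) := fun t =>
    hft.comp (by fun_prop : Continuous fun σ : ℝ => (t, t * σ))
  have hcfs : ∀ t : ℝ, Continuous fun σ : ℝ => fs t (t * σ) := fun t =>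
    hfs.comp (by fun_prop : Continuous fun σ : ℝ => (t, t * σ))
  obtain ⟨C, hC⟩ := (isCompact_Icc.prod isCompact_Icc :
    IsCompact (Icc (t - 1) (t + 1) ×ˢ Icc (-1 : ℝ) 1)).exists_bound_of_continuousOn hc1.continuousOn
  have hD : HasDerivAt (fun t => ∫ σ in (-1 : ℝ)..1, f t (t * σ))
      (∫ σ in (-1 : ℝ)..1, (ft t (t * σ) + σ * fs t (t * σ))) t := by
    refine (intervalIntegral.hasDerivAt_integral_of_dominated_loc_of_deriv_le (bound := fun _ => C)
      (F := fun t σ => f t (t * σ)) (F' := fun t σ => ft t (t * σ) + σ * fs t (t * σ))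
      (Metric.ball_mem_nhds t one_pos) ?_ ?_ ?_ ?_ ?_ ?_).2
    · exact Eventually.of_forall fun t => (hcs t).aestronglyMeasurable
    · exact (hcs t).intervalIntegrable _ _
    · exact ((hct t).add ((Complex.continuous_ofReal).mul (hcfs t))).aestronglyMeasurable
    · refine Eventually.of_forall fun σ hσ x hx => ?_
      rw [uIoc_of_le (by norm_num)] at hσ
      rw [Real.ball_eq_Ioo] at hx
      exact hC (x, σ) ⟨Ioo_subset_Icc_self hx, Ioc_subset_Icc_self hσ⟩
    · exact intervalIntegrable_const
    · exact Eventually.of_forall fun σ _ x _ => h x σ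
  have hfun : (fun t => ∫ s in (-t)..t, f t s) =
      fun t : ℝ => (t : ℂ) * ∫ σ in (-1 : ℝ)..1, f t (t * σ) := funext fun t => hsub (f t) t
  rw [hfun, hsub (ft t) t]
  refine ((hasDerivAt_id t).ofReal_comp.mul hD).congr_deriv ?_
  -- The boundary values at s = ±t reappear as the integral of the σ-derivative of σ f(t, tσ).
  have hFTC : ∫ σ in (-1 : ℝ)..1, (f t (t * σ) + σ * (t * fs t (t * σ))) =
      f t t + f t (-t) := by
    rw [intervalIntegral.integral_eq_sub_of_hasDerivAt (f := fun σ : ℝ => (σ : ℂ) * f t (t * σ))]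
    · simp
    · intro σ _
      have h1 := (hs t (t * σ)).scomp σ ((hasDerivAt_id σ).const_mul t)
      have h2 := (hasDerivAt_id σ).ofReal_comp.mul h1
      refine h2.congr_deriv ?_
      simp
    · exact ((hcs t).add (Complex.continuous_ofReal.mul
        (continuous_const.mul (hcfs t)))).intervalIntegrable _ _
  have i1 : IntervalIntegrable (fun σ : ℝ => ft t (t * σ)) volume (-1) 1 :=
    (hct t).intervalIntegrable _ _
  have i2 : IntervalIntegrable (fun σ : ℝ => σ * fs t (t * σ)) volume (-1) 1 :=
    (Complex.continuous_ofReal.mul (hcfs t)).intervalIntegrable _ _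
  have i3 : IntervalIntegrable (fun σ : ℝ => f t (t * σ)) volume (-1) 1 :=
    (hcs t).intervalIntegrable _ _
  have i4 : IntervalIntegrable (fun σ : ℝ => (σ : ℂ) * (t * fs t (t * σ))) volume (-1) 1 :=
    (Complex.continuous_ofReal.mul (continuous_const.mul (hcfs t))).intervalIntegrable _ _
  rw [← hFTC, intervalIntegral.integral_add i3 i4, intervalIntegral.integral_add i1 i2]
  have : ∫ σ in (-1 : ℝ)..1, (σ : ℂ) * (t * fs t (t * σ)) =
      t * ∫ σ in (-1 : ℝ)..1, (σ : ℂ) * fs t (t * σ) := by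
    rw [← intervalIntegral.integral_const_mul]; congr 1; ext σ; ring
  rw [this]; simp; ring

/-- The density of `sin (t √(1 + a²)) / √(1 + a²)` as a superposition of `exp (i s a)`. -/
noncomputable def sinDensity (t : ℝ) (s : ℂ) : ℂ := 1 / 2 * besselEntire 0 (t ^ 2 - s ^ 2)

/-- The density of `cos (t √(1 + a²)) - cos (t a)` as a superposition of `exp (i s a)`. -/
noncomputable def cosDensity (t : ℝ) (s : ℂ) : ℂ := -(t / 4) * besselEntire 1 (t ^ 2 - s ^ 2)

/-- The two left-hand sides, as functions G and Φ of t, satisfy G' = Φ, Φ' = -(1+a²)G, G(0) = 0,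
Φ(0) = 1, a system with a unique solution. The cosine in Φ is the boundary term produced by
differentiating G, since the sine density equals 1/2 at s = ±t. -/
theorem sinDensity_cosDensity_integral (a t : ℝ) :
    (∫ s in (-t)..t, sinDensity t s * Complex.exp (Complex.I * s * a)) =
        Real.sin (t * √(1 + a ^ 2)) / √(1 + a ^ 2) ∧
    Real.cos (t * a) + (∫ s in (-t)..t, cosDensity t s * Complex.exp (Complex.I * s * a)) =
        Real.cos (t * √(1 + a ^ 2)) := by
  set e : ℝ → ℂ := fun s => Complex.exp (Complex.I * s * a) with he
  have hec : Continuous e := by fun_prop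
  have hed : ∀ s : ℝ, HasDerivAt e (Complex.I * a * e s) s := fun s => by
    have h := ((((hasDerivAt_id s).ofReal_comp).const_mul Complex.I).mul_const (a : ℂ)).cexp
    refine h.congr_deriv ?_
    simp [he]; ring
  have heneg : ∀ s : ℝ, e s + e (-s) = 2 * Complex.cos (s * a) := fun s => by
    simp only [he]
    rw [Complex.cos]; push_cast
    rw [show Complex.I * (s : ℂ) * a = s * a * Complex.I by ring,
      show Complex.I * -(s : ℂ) * a = -(s * a) * Complex.I by ring]
    ring
  have heneg' : ∀ s : ℝ, e s - e (-s) = 2 * Complex.I * Complex.sin (s * a) := fun s => by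
    simp only [he]
    rw [Complex.sin]; push_cast
    rw [show Complex.I * (s : ℂ) * a = s * a * Complex.I by ring,
      show Complex.I * -(s : ℂ) * a = -(s * a) * Complex.I by ring]
    linear_combination (Complex.exp (s * a * Complex.I) - Complex.exp (-(s * a) * Complex.I)) *
      Complex.I_mul_I
  have hb : ∀ (ν : ℕ) (t s : ℝ), HasDerivAt (fun s : ℝ => besselEntire ν ((t : ℂ) ^ 2 - (s : ℂ) ^ 2))
      (s / 2 * besselEntire (ν + 1) (t ^ 2 - s ^ 2)) s := fun ν t s => by
    have h1 : HasDerivAt (fun s : ℝ => (t : ℂ) ^ 2 - (s : ℂ) ^ 2) (-(2 * s)) s := by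
      have := (((hasDerivAt_id s).ofReal_comp).pow 2).const_sub ((t : ℂ) ^ 2)
      refine this.congr_deriv ?_; simp
    refine ((hasDerivAt_besselEntire ν _).comp s h1).congr_deriv ?_
    ring
  have hb2 : ∀ (ν : ℕ) (t σ : ℝ), HasDerivAt
      (fun τ : ℝ => besselEntire ν ((τ : ℂ) ^ 2 - ((τ * σ : ℝ) : ℂ) ^ 2))
      (-(t / 2) * besselEntire (ν + 1) (t ^ 2 - ((t * σ : ℝ) : ℂ) ^ 2) +
        σ * ((t * σ : ℝ) / 2 * besselEntire (ν + 1) (t ^ 2 - ((t * σ : ℝ) : ℂ) ^ 2))) t :=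
      fun ν t σ => by
    have h1 : HasDerivAt (fun τ : ℝ => (τ : ℂ) ^ 2 - ((τ * σ : ℝ) : ℂ) ^ 2)
        (2 * t - 2 * (t * σ) * σ) t := by
      have h2 := ((hasDerivAt_id t).ofReal_comp).pow 2
      have h3 := (((hasDerivAt_id t).mul_const σ).ofReal_comp).pow 2
      refine (h2.sub h3).congr_deriv ?_; simp
    refine ((hasDerivAt_besselEntire ν _).comp t h1).congr_deriv ?_
    push_cast
    ring
  have he2 : ∀ t σ : ℝ, HasDerivAt (fun τ : ℝ => e (τ * σ)) (σ * (Complex.I * a * e (t * σ))) t :=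
    fun t σ => by
    have := (hed (t * σ)).scomp t ((hasDerivAt_id t).mul_const σ)
    refine this.congr_deriv ?_; simp
  have hbc : ∀ ν : ℕ, Continuous fun p : ℝ × ℝ => besselEntire ν ((p.1 : ℂ) ^ 2 - (p.2 : ℂ) ^ 2) :=
    fun ν => (besselEntire_continuous ν).comp (by fun_prop)
  have hbcs : ∀ (ν : ℕ) (t : ℝ), Continuous fun s : ℝ => besselEntire ν ((t : ℂ) ^ 2 - (s : ℂ) ^ 2) :=
    fun ν t => (besselEntire_continuous ν).comp (by fun_prop)
  have hec2 : Continuous fun p : ℝ × ℝ => e p.2 := hec.comp continuous_snd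
  have ht2 : Continuous fun p : ℝ × ℝ => (p.1 : ℂ) := by fun_prop
  have hs2 : Continuous fun p : ℝ × ℝ => (p.2 : ℂ) := by fun_prop
  -- the two integrals and their derivatives
  set G : ℝ → ℂ := fun t => ∫ s in (-t)..t, sinDensity t s * e s with hG
  set Φ : ℝ → ℂ := fun t => Complex.cos (t * a) + ∫ s in (-t)..t, cosDensity t s * e s with hΦ
  have hG' : ∀ t, HasDerivAt G (Φ t) t := by
    intro t
    have := hasDerivAt_integral_symm (f := fun t s => sinDensity t s * e s)
      (ft := fun t s => cosDensity t s * e s)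
      (fs := fun t s => (s / 4 * besselEntire 1 (t ^ 2 - s ^ 2)) * e s +
        sinDensity t s * (Complex.I * a * e s))
      ((continuous_const.mul (hbc 0)).mul hec2)
      (((ht2.div_const 4).neg.mul (hbc 1)).mul hec2)
      ((((hs2.div_const 4).mul (hbc 1)).mul hec2).add
        ((continuous_const.mul (hbc 0)).mul (continuous_const.mul hec2)))
      (fun t σ => by
        have := ((hb2 0 t σ).const_mul (1 / 2)).mul (he2 t σ)
        refine this.congr_deriv ?_
        simp only [sinDensity, cosDensity]; push_cast; ring)
      (fun t s => by
        have := ((hb 0 t s).const_mul (1 / 2)).mul (hed s)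
        refine this.congr_deriv ?_
        simp only [sinDensity]; ring) t
    refine this.congr_deriv ?_
    simp only [hΦ, sinDensity]
    congr 1
    push_cast
    rw [neg_sq, sub_self, besselEntire_zero_zero]
    linear_combination (1 / 2 : ℂ) * heneg t
  have hΦ' : ∀ t, HasDerivAt Φ (-(1 + a ^ 2) * G t) t := by
    intro t
    have hftc : Continuous fun p : ℝ × ℝ =>
        (-(1 / 4) * besselEntire 1 ((p.1 : ℂ) ^ 2 - (p.2 : ℂ) ^ 2) +
          (p.1 : ℂ) ^ 2 / 8 * besselEntire 2 ((p.1 : ℂ) ^ 2 - (p.2 : ℂ) ^ 2)) * e p.2 := by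
      have := hbc 1
      have := hbc 2
      fun_prop
    have h1 := hasDerivAt_integral_symm (f := fun t s => cosDensity t s * e s)
      (ft := fun t s => (-(1 / 4) * besselEntire 1 (t ^ 2 - s ^ 2) +
        t ^ 2 / 8 * besselEntire 2 (t ^ 2 - s ^ 2)) * e s)
      (fs := fun t s => -(t / 4) * (s / 2 * besselEntire 2 (t ^ 2 - s ^ 2)) * e s +
        cosDensity t s * (Complex.I * a * e s))
      (((ht2.div_const 4).neg.mul (hbc 1)).mul hec2)
      hftc
      ((((ht2.div_const 4).neg.mul ((hs2.div_const 2).mul (hbc 2))).mul hec2).add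
        (((ht2.div_const 4).neg.mul (hbc 1)).mul (continuous_const.mul hec2)))
      (fun t σ => by
        have := ((((hasDerivAt_id t).ofReal_comp.div_const 4).neg.mul (hb2 1 t σ))).mul (he2 t σ)
        refine this.congr_deriv ?_
        simp only [cosDensity]; simp; ring)
      (fun t s => by
        have := ((hb 1 t s).const_mul (-(t / 4) : ℂ)).mul (hed s)
        refine this.congr_deriv ?_
        simp only [cosDensity]) t
    have h2 : HasDerivAt (fun t : ℝ => Complex.cos (t * a)) (-(a * Complex.sin (t * a))) t := by
      have := (Complex.hasDerivAt_cos _).comp t (((hasDerivAt_id t).ofReal_comp).mul_const (a : ℂ))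
      refine this.congr_deriv ?_
      simp; ring
    refine (h2.add h1).congr_deriv ?_
    -- With k the sine density, the integrand is (∂ₛ²k + a²k)e^{isa}, which is the derivative of
    -- (∂ₛk - iak)e^{isa}.
    have hFTC : ∫ s in (-t)..t, (1 / 4 * besselEntire 1 (t ^ 2 - s ^ 2) +
        s ^ 2 / 8 * besselEntire 2 (t ^ 2 - s ^ 2) +
        a ^ 2 / 2 * besselEntire 0 (t ^ 2 - s ^ 2)) * e s =
        t / 2 * Complex.cos (t * a) + a * Complex.sin (t * a) := by
      rw [intervalIntegral.integral_eq_sub_of_hasDerivAt (f := fun s : ℝ =>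
        ((s : ℂ) / 4 * besselEntire 1 (t ^ 2 - s ^ 2) -
          Complex.I * a / 2 * besselEntire 0 (t ^ 2 - s ^ 2)) * e s)]
      · push_cast
        rw [neg_sq, sub_self, besselEntire_zero_zero, besselEntire_one_zero]
        linear_combination (t / 4 : ℂ) * heneg t - (Complex.I * a / 2) * heneg' t -
          a * Complex.sin (t * a) * Complex.I_mul_I
      · intro s _
        have := ((((hasDerivAt_id s).ofReal_comp.div_const 4).mul (hb 1 t s)).sub
          ((hb 0 t s).const_mul (Complex.I * a / 2))).mul (hed s)
        refine this.congr_deriv ?_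
        simp
        linear_combination -(a ^ 2 / 2 * besselEntire 0 (t ^ 2 - s ^ 2) * e s) * Complex.I_mul_I
      · refine Continuous.intervalIntegrable ?_ _ _
        exact (((continuous_const.mul (hbcs 1 t)).add
          (((Complex.continuous_ofReal.pow 2).div_const 8).mul (hbcs 2 t))).add
          (continuous_const.mul (hbcs 0 t))).mul hec
    -- The density solves the Klein–Gordon equation ∂ₜ²k + k = ∂ₛ²k, where ∂ₜk is the cosine
    -- density; this is the Bessel recurrence at w = t² - s².
    have hint : (∫ s in (-t)..t, (-(1 / 4) * besselEntire 1 (t ^ 2 - s ^ 2) +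
        t ^ 2 / 8 * besselEntire 2 (t ^ 2 - s ^ 2)) * e s) + (1 + a ^ 2) * G t =
        ∫ s in (-t)..t, (1 / 4 * besselEntire 1 (t ^ 2 - s ^ 2) +
        s ^ 2 / 8 * besselEntire 2 (t ^ 2 - s ^ 2) +
        a ^ 2 / 2 * besselEntire 0 (t ^ 2 - s ^ 2)) * e s := by
      simp only [hG]
      rw [← intervalIntegral.integral_const_mul, ← intervalIntegral.integral_add]
      · congr 1
        ext s
        simp only [sinDensity]
        linear_combination (1 / 2 * e s) * besselEntire_recurrence (t ^ 2 - s ^ 2)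
      · exact Continuous.intervalIntegrable (((continuous_const.mul (hbcs 1 t)).add
          (continuous_const.mul (hbcs 2 t))).mul hec) _ _
      · exact Continuous.intervalIntegrable (continuous_const.mul
          ((continuous_const.mul (hbcs 0 t)).mul hec)) _ _
    rw [hFTC] at hint
    simp only [cosDensity]
    push_cast
    rw [neg_sq, sub_self, besselEntire_one_zero]
    linear_combination hint - (t / 4 : ℂ) * heneg t
  -- solve the system
  set ω : ℝ := √(1 + a ^ 2) with hω
  have hω0 : 0 < ω := Real.sqrt_pos.2 (by positivity)
  have hω2 : (ω : ℂ) ^ 2 = 1 + a ^ 2 := by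
    have : ω ^ 2 = 1 + a ^ 2 := Real.sq_sqrt (by positivity)
    exact_mod_cast this
  have hG0 : G 0 = 0 := by simp [hG]
  have hΦ0 : Φ 0 = 1 := by simp [hΦ]
  -- For ε = ±i the combination Φ + εωG solves Y' = εωY, so its product with e^{-εωt} is constant.
  have hsolve : ∀ ε : ℂ, ε ^ 2 = -1 → Φ t + ε * ω * G t = Complex.exp (ε * ω * t) := by
    intro ε hε
    set Y : ℝ → ℂ := fun t => (Φ t + ε * ω * G t) * Complex.exp (-(ε * ω * t)) with hY
    have hYd : ∀ t, HasDerivAt Y 0 t := fun t => by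
      have h1 := (hΦ' t).add ((hG' t).const_mul (ε * ω))
      have h2 := (((hasDerivAt_id t).ofReal_comp).const_mul (ε * ω)).neg.cexp
      refine (h1.mul h2).congr_deriv ?_
      simp
      linear_combination (-(G t * Complex.exp (-(ε * ω * t))) * ω ^ 2) * hε +
        (G t * Complex.exp (-(ε * ω * t))) * hω2
    have hconst := is_const_of_deriv_eq_zero (fun t => (hYd t).differentiableAt)
      (fun t => (hYd t).deriv) t 0
    simp only [hY, hG0, hΦ0] at hconst
    have h3 : Complex.exp (-(ε * ω * t)) * Complex.exp (ε * ω * t) = 1 := by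
      rw [← Complex.exp_add]; simp
    simp at hconst
    linear_combination Complex.exp (ε * ω * t) * hconst - (Φ t + ε * ω * G t) * h3
  have h1 := hsolve Complex.I Complex.I_sq
  have h2 := hsolve (-Complex.I) (by rw [neg_sq, Complex.I_sq])
  have hωC : (ω : ℂ) ≠ 0 := by exact_mod_cast hω0.ne'
  have r1 : Complex.exp (Complex.I * ω * t) = Complex.exp (t * ω * Complex.I) := by
    congr 1; ring
  have r2 : Complex.exp (-Complex.I * ω * t) = Complex.exp (-(t * ω) * Complex.I) := by
    congr 1; ring
  rw [r1] at h1; rw [r2] at h2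
  constructor
  · change G t = _
    rw [eq_div_iff hωC]
    push_cast
    rw [Complex.sin]
    linear_combination (-Complex.I / 2) * (h1 - h2) + (G t * ω) * Complex.I_mul_I
  · have : ((Real.cos (t * a) : ℝ) : ℂ) + (∫ s in (-t)..t, cosDensity t s * e s) = Φ t := by
      simp [hΦ]
    rw [this]
    push_cast
    rw [Complex.cos]
    linear_combination (1 / 2 : ℂ) * (h1 + h2)

/-! ### Decay of the Bessel functions on and near the real axis. -/

/-- The real function `z ↦ J₀(z)`. -/
noncomputable def besselJ (z : ℝ) : ℝ := (besselEntire 0 ((z : ℂ) ^ 2)).re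

/-- The derivative of `besselJ`. -/
noncomputable def besselJ' (z : ℝ) : ℝ := -(z / 2) * (besselEntire 1 ((z : ℂ) ^ 2)).re

theorem besselEntire_sq_eq_re (ν : ℕ) (z : ℝ) :
    besselEntire ν ((z : ℂ) ^ 2) = ((besselEntire ν ((z : ℂ) ^ 2)).re : ℂ) := by
  apply Complex.ext
  · simp
  · rw [Complex.ofReal_im, ← Complex.ofReal_pow, besselEntire_ofReal_im]

theorem hasDerivAt_re_besselEntire_sq (ν : ℕ) (z : ℝ) :
    HasDerivAt (fun z : ℝ => (besselEntire ν ((z : ℂ) ^ 2)).re)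
      (-(z / 2) * (besselEntire (ν + 1) ((z : ℂ) ^ 2)).re) z := by
  have h1 : HasDerivAt (fun z : ℝ => (z : ℂ) ^ 2) (2 * z) z := by
    have := (hasDerivAt_id z).ofReal_comp.pow 2
    refine this.congr_deriv ?_; simp
  have h2 := (hasDerivAt_besselEntire ν _).comp z h1
  have h3 := (Complex.reCLM.hasFDerivAt).comp_hasDerivAt z h2
  refine h3.congr_deriv ?_
  have : (-(1 / 4) * besselEntire (ν + 1) ((z : ℂ) ^ 2) * (2 * z)) =
      ((-(z / 2) : ℝ) : ℂ) * besselEntire (ν + 1) ((z : ℂ) ^ 2) := by push_cast; ring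
  rw [this, Complex.reCLM_apply, Complex.re_ofReal_mul]

theorem hasDerivAt_besselJ (z : ℝ) : HasDerivAt besselJ (besselJ' z) z :=
  hasDerivAt_re_besselEntire_sq 0 z

/-- This is Bessel's equation of order zero, in the form of the recurrence at z². -/
theorem hasDerivAt_besselJ' {z : ℝ} (hz : 0 < z) :
    HasDerivAt besselJ' (-besselJ z - besselJ' z / z) z := by
  have h := (((hasDerivAt_id z).div_const 2).neg).mul (hasDerivAt_re_besselEntire_sq 1 z)
  refine h.congr_deriv ?_
  have hr := congrArg Complex.re (besselEntire_recurrence ((z : ℂ) ^ 2))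
  rw [Complex.sub_re, show ((z : ℂ) ^ 2 / 4) = ((z ^ 2 / 4 : ℝ) : ℂ) by push_cast; ring,
    Complex.re_ofReal_mul] at hr
  simp only [besselJ, besselJ', id]
  field_simp
  simp
  linear_combination 2 * hr

-- The energy z(J² + J'²) is not monotone, but adding JJ' leaves a quantity F with F' = -JJ'/z ≤
-- F/z² for z ≥ 1. Hence F e^{1/z} is nonincreasing on [1,∞), and F controls half the energy. The
-- decay z^{-1/2} of J₀ and J₀' follows.
open Set in
theorem besselJ_energy_le {z : ℝ} (hz : 1 ≤ z) :
    z * (besselJ z ^ 2 + besselJ' z ^ 2) ≤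
      2 * Real.exp 1 * (2 * (besselJ 1 ^ 2 + besselJ' 1 ^ 2)) := by
  set F : ℝ → ℝ := fun z => z * (besselJ z ^ 2 + besselJ' z ^ 2) + besselJ z * besselJ' z with hF
  have hFd : ∀ z, 0 < z → HasDerivAt F (-(besselJ z * besselJ' z) / z) z := fun z hz => by
    have h1 := hasDerivAt_besselJ z
    have h2 := hasDerivAt_besselJ' hz
    refine (((hasDerivAt_id z).mul ((h1.pow 2).add (h2.pow 2))).add (h1.mul h2)).congr_deriv ?_
    simp
    field_simp
    ring
  have hFlow : ∀ z, 1 ≤ z → z / 2 * (besselJ z ^ 2 + besselJ' z ^ 2) ≤ F z := fun z hz => by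
    simp only [hF]
    nlinarith [sq_nonneg (besselJ z + besselJ' z), sq_nonneg (besselJ z), sq_nonneg (besselJ' z)]
  have hanti : AntitoneOn (fun z => F z * Real.exp (1 / z)) (Ici 1) := by
    have hd : ∀ z, 0 < z → HasDerivAt (fun z => F z * Real.exp (1 / z))
        ((-(besselJ z * besselJ' z) / z - F z / z ^ 2) * Real.exp (1 / z)) z := fun z hz => by
      have h1 : HasDerivAt (fun z : ℝ => 1 / z) (-(z ^ 2)⁻¹) z := by
        simpa using hasDerivAt_inv hz.ne'
      refine ((hFd z hz).mul h1.exp).congr_deriv ?_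
      ring
    refine antitoneOn_of_deriv_nonpos (convex_Ici 1) (fun z hz => ?_) (fun z hz => ?_)
      (fun z hz => ?_)
    · exact (hd z (lt_of_lt_of_le one_pos hz)).continuousAt.continuousWithinAt
    · rw [interior_Ici] at hz
      exact (hd z (one_pos.trans hz)).differentiableAt.differentiableWithinAt
    · rw [interior_Ici] at hz
      have hz1 : 1 < z := hz
      have hz0 : 0 < z := one_pos.trans hz1
      rw [(hd z hz0).deriv]
      refine mul_nonpos_of_nonpos_of_nonneg ?_ (Real.exp_pos _).le
      have h1 := hFlow z hz1.le
      have h2 : -(besselJ z * besselJ' z) / z ≤ F z / z ^ 2 := by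
        rw [div_le_div_iff₀ hz0 (by positivity)]
        have : -(besselJ z * besselJ' z) * z ≤ F z := by
          nlinarith [sq_nonneg (besselJ z + besselJ' z)]
        nlinarith
      linarith
  have h1 := hanti (mem_Ici.2 le_rfl) (mem_Ici.2 hz) hz
  have hFz : F z ≤ F z * Real.exp (1 / z) := by
    have h2 : 0 ≤ F z := le_trans (by positivity) (hFlow z hz)
    have h3 : 1 ≤ Real.exp (1 / z) := Real.one_le_exp (by positivity)
    nlinarith
  have h4 : F 1 ≤ 2 * (besselJ 1 ^ 2 + besselJ' 1 ^ 2) := by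
    simp only [hF]
    nlinarith [sq_nonneg (besselJ 1 - besselJ' 1)]
  have h5 := hFlow z hz
  simp only [div_one] at h1
  have h6 : F 1 * Real.exp 1 ≤ 2 * (besselJ 1 ^ 2 + besselJ' 1 ^ 2) * Real.exp 1 := by gcongr
  nlinarith

/-- Decay of `J₀` and `J₀'`. -/
theorem exists_besselJ_le : ∃ C : ℝ, 0 < C ∧ ∀ z : ℝ, 1 ≤ z →
    |besselJ z| * √z ≤ C ∧ |besselJ' z| * √z ≤ C := by
  set A : ℝ := 2 * Real.exp 1 * (2 * (besselJ 1 ^ 2 + besselJ' 1 ^ 2)) with hA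
  have hA0 : 0 ≤ A := by positivity
  refine ⟨√A + 1, by positivity, fun z hz => ?_⟩
  have h := besselJ_energy_le hz
  have hz0 : 0 ≤ z := by linarith
  constructor
  · have : |besselJ z| * √z ≤ √A := by
      rw [← Real.sqrt_sq_eq_abs, ← Real.sqrt_mul (sq_nonneg _)]
      apply Real.sqrt_le_sqrt
      nlinarith [sq_nonneg (besselJ' z)]
    linarith
  · have : |besselJ' z| * √z ≤ √A := by
      rw [← Real.sqrt_sq_eq_abs, ← Real.sqrt_mul (sq_nonneg _)]
      apply Real.sqrt_le_sqrt
      nlinarith [sq_nonneg (besselJ z)]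
    linarith

-- Beyond z = 1 this is the decay of J₀ and J₀', because `besselEntire 1 (z²)` equals -2J₀'(z)/z; on
-- [0,1] it is continuity.
open Set in
theorem exists_besselEntire_sq_le : ∃ C : ℝ, 0 < C ∧ ∀ z : ℝ, 0 < z →
    ‖besselEntire 0 ((z : ℂ) ^ 2)‖ * √z ≤ C ∧ ‖besselEntire 1 ((z : ℂ) ^ 2)‖ * (z * √z) ≤ C := by
  obtain ⟨C, hC, h⟩ := exists_besselJ_le
  have hc : ∀ ν : ℕ, Continuous fun z : ℝ => besselEntire ν ((z : ℂ) ^ 2) := fun ν =>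
    (besselEntire_continuous ν).comp (by fun_prop)
  obtain ⟨C0, h0⟩ := (isCompact_Icc : IsCompact (Icc (0 : ℝ) 1)).exists_bound_of_continuousOn
    (hc 0).continuousOn
  obtain ⟨C1, h1⟩ := (isCompact_Icc : IsCompact (Icc (0 : ℝ) 1)).exists_bound_of_continuousOn
    (hc 1).continuousOn
  refine ⟨2 * C + |C0| + |C1|, by positivity, fun z hz => ?_⟩
  have hn : ∀ ν : ℕ, ‖besselEntire ν ((z : ℂ) ^ 2)‖ = |(besselEntire ν ((z : ℂ) ^ 2)).re| :=
    fun ν => by conv_lhs => rw [besselEntire_sq_eq_re, Complex.norm_real, Real.norm_eq_abs]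
  rcases le_total 1 z with hz1 | hz1
  · obtain ⟨ha, hb⟩ := h z hz1
    have hb' : ‖besselEntire 1 ((z : ℂ) ^ 2)‖ * (z * √z) = 2 * (|besselJ' z| * √z) := by
      rw [besselJ', abs_mul, abs_neg, abs_of_pos (half_pos hz), hn]; ring
    rw [hb', hn]
    change |besselJ z| * √z ≤ _ ∧ _
    constructor <;> nlinarith [abs_nonneg C0, abs_nonneg C1]
  · have hs : √z ≤ 1 := Real.sqrt_le_one.2 hz1
    have hs0 : 0 ≤ √z := Real.sqrt_nonneg _
    have e0 := (h0 z ⟨hz.le, hz1⟩).trans (le_abs_self C0)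
    have e1 := (h1 z ⟨hz.le, hz1⟩).trans (le_abs_self C1)
    constructor
    · calc _ ≤ |C0| * 1 := by gcongr
        _ ≤ _ := by linarith [abs_nonneg C1]
    · have : z * √z ≤ 1 := mul_le_one₀ hz1 hs0 hs
      calc _ ≤ |C1| * 1 := by gcongr
        _ ≤ _ := by linarith [abs_nonneg C0]

-- The real decay persists at complex arguments t² + ζ with |ζ| ≤ t/4. Along the segment t² + τζ the
-- pair (E₀, tE₁), with E_ν the entire functions of index ν, has a τ-derivative bounded by its own
-- norm: |ζ| is small against t, and the recurrence bounds E₂ by E₀ and E₁ with a factor t^{-2}.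
-- Grönwall's inequality then costs a factor e. This covers the half circle |s| = √t/2, on which
-- |s²| = t/4.
open Set in
theorem exists_besselEntire_sq_add_le : ∃ C : ℝ, 0 < C ∧ ∀ (t : ℝ) (ζ : ℂ), 1 ≤ t → ‖ζ‖ ≤ t / 4 →
    ‖besselEntire 0 ((t : ℂ) ^ 2 + ζ)‖ * √t ≤ C ∧
    ‖besselEntire 1 ((t : ℂ) ^ 2 + ζ)‖ * (t * √t) ≤ C := by
  obtain ⟨C, hC, h⟩ := exists_besselEntire_sq_le
  refine ⟨Real.exp 1 * C, by positivity, fun t ζ ht hζ => ?_⟩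
  have ht0 : 0 < t := by linarith
  set f : ℝ → ℂ × ℂ := fun τ =>
    (besselEntire 0 ((t : ℂ) ^ 2 + τ * ζ), t * besselEntire 1 ((t : ℂ) ^ 2 + τ * ζ)) with hf
  set f' : ℝ → ℂ × ℂ := fun τ =>
    (-(1 / 4) * besselEntire 1 ((t : ℂ) ^ 2 + τ * ζ) * ζ,
      t * (-(1 / 4) * besselEntire 2 ((t : ℂ) ^ 2 + τ * ζ) * ζ)) with hf'
  have hfd : ∀ τ, HasDerivAt f (f' τ) τ := fun τ => by
    have h1 : HasDerivAt (fun τ : ℝ => (t : ℂ) ^ 2 + τ * ζ) ζ τ := by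
      have := ((hasDerivAt_id τ).ofReal_comp.mul_const ζ).const_add ((t : ℂ) ^ 2)
      refine this.congr_deriv ?_; simp
    exact ((hasDerivAt_besselEntire 0 _).comp τ h1).prodMk
      (((hasDerivAt_besselEntire 1 _).comp τ h1).const_mul (t : ℂ))
  have hδ : ‖f 0‖ ≤ C / √t := by
    obtain ⟨ha, hb⟩ := h t ht0
    have hst : 0 < √t := Real.sqrt_pos.2 ht0
    simp only [hf, Complex.ofReal_zero, zero_mul, add_zero]
    rw [Prod.norm_mk, max_le_iff, norm_mul, Complex.norm_real, Real.norm_of_nonneg ht0.le,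
      le_div_iff₀ hst, le_div_iff₀ hst]
    exact ⟨ha, by linarith⟩
  have hbound : ∀ τ ∈ Ico (0 : ℝ) 1, ‖f' τ‖ ≤ 1 * ‖f τ‖ + 0 := by
    intro τ hτ
    set w : ℂ := (t : ℂ) ^ 2 + τ * ζ with hw
    have hτζ : ‖(τ : ℂ) * ζ‖ ≤ t / 4 := by
      rw [norm_mul, Complex.norm_real, Real.norm_of_nonneg hτ.1]
      nlinarith [hτ.1, hτ.2, norm_nonneg ζ]
    have hwlow : 3 * t ^ 2 / 4 ≤ ‖w‖ := by
      have h1 : ‖(t : ℂ) ^ 2‖ = t ^ 2 := by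
        rw [norm_pow, Complex.norm_real, Real.norm_of_nonneg ht0.le]
      have h2 : ‖(t : ℂ) ^ 2‖ - ‖(τ : ℂ) * ζ‖ ≤ ‖w‖ := by
        have := norm_sub_norm_le ((t : ℂ) ^ 2) (-((τ : ℂ) * ζ))
        rw [norm_neg, sub_neg_eq_add] at this; exact this
      nlinarith
    have hrec := congrArg norm (besselEntire_recurrence w)
    rw [norm_mul, norm_div] at hrec
    have h4 : ‖(4 : ℂ)‖ = 4 := by simp
    rw [h4] at hrec
    have hsub := norm_sub_le (besselEntire 1 w) (besselEntire 0 w)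
    have hn0 : ‖besselEntire 0 w‖ ≤ ‖f τ‖ := by
      simp only [hf]; rw [Prod.norm_mk]; exact le_max_left _ _
    have hn1 : t * ‖besselEntire 1 w‖ ≤ ‖f τ‖ := by
      have : ‖(t : ℂ) * besselEntire 1 w‖ ≤ ‖f τ‖ := by
        simp only [hf]; rw [Prod.norm_mk]; exact le_max_right _ _
      rwa [norm_mul, Complex.norm_real, Real.norm_of_nonneg ht0.le] at this
    have hn1' : ‖besselEntire 1 w‖ ≤ ‖f τ‖ := by nlinarith [norm_nonneg (besselEntire 1 w)]
    have hb2 : 3 * t ^ 2 / 16 * ‖besselEntire 2 w‖ ≤ 2 * ‖f τ‖ := by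
      nlinarith [norm_nonneg (besselEntire 2 w)]
    have h14 : ‖(-(1 / 4) : ℂ)‖ = 1 / 4 := by rw [norm_neg]; norm_num
    simp only [hf']
    rw [Prod.norm_mk, max_le_iff, norm_mul, norm_mul, norm_mul, norm_mul, norm_mul, h14,
      Complex.norm_real, Real.norm_of_nonneg ht0.le, ← hw]
    have hb1n := norm_nonneg (besselEntire 1 w)
    have hb2n := norm_nonneg (besselEntire 2 w)
    have hζn := norm_nonneg ζ
    constructor
    · have : ‖besselEntire 1 w‖ * ‖ζ‖ ≤ ‖besselEntire 1 w‖ * (t / 4) := by gcongr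
      nlinarith
    · have : t * ‖besselEntire 2 w‖ * ‖ζ‖ ≤ t * ‖besselEntire 2 w‖ * (t / 4) := by gcongr
      nlinarith
  have hg := norm_le_gronwallBound_of_norm_deriv_right_le (f := f) (f' := f') (a := 0) (b := 1)
    (fun τ _ => (hfd τ).continuousAt.continuousWithinAt)
    (fun τ _ => (hfd τ).hasDerivWithinAt) hδ hbound 1 (right_mem_Icc.2 zero_le_one)
  rw [gronwallBound_ε0, sub_zero, mul_one] at hg
  have hst : 0 < √t := Real.sqrt_pos.2 ht0
  have hg2 : ‖f 1‖ * √t ≤ Real.exp 1 * C := by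
    calc _ ≤ (C / √t * Real.exp 1) * √t := by gcongr
      _ = _ := by field_simp
  have e0 : ‖besselEntire 0 ((t : ℂ) ^ 2 + ζ)‖ ≤ ‖f 1‖ := by
    simp only [hf, Complex.ofReal_one, one_mul]; rw [Prod.norm_mk]; exact le_max_left _ _
  have e1 : t * ‖besselEntire 1 ((t : ℂ) ^ 2 + ζ)‖ ≤ ‖f 1‖ := by
    have : ‖(t : ℂ) * besselEntire 1 ((t : ℂ) ^ 2 + ζ)‖ ≤ ‖f 1‖ := by
      simp only [hf, Complex.ofReal_one, one_mul]; rw [Prod.norm_mk]; exact le_max_right _ _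
    rwa [norm_mul, Complex.norm_real, Real.norm_of_nonneg ht0.le] at this
  constructor
  · exact (mul_le_mul_of_nonneg_right e0 hst.le).trans hg2
  · calc _ = (t * ‖besselEntire 1 ((t : ℂ) ^ 2 + ζ)‖) * √t := by ring
      _ ≤ ‖f 1‖ * √t := by gcongr
      _ ≤ _ := hg2

/-! ### The oscillatory integral that removes the logarithm in dimension two. -/

open Set in
theorem integral_inv_sq_le {ρ b : ℝ} (hρ : 0 < ρ) (hb : ρ ≤ b) :
    ∫ s in ρ..b, 1 / s ^ 2 ≤ 1 / ρ := by
  have hpos : ∀ s ∈ uIcc ρ b, 0 < s := fun s hs => by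
    rw [uIcc_of_le hb] at hs; exact hρ.trans_le hs.1
  rw [intervalIntegral.integral_eq_sub_of_hasDerivAt (f := fun s => -(1 / s))]
  · have : 0 < b := hρ.trans_le hb
    have : 0 ≤ 1 / b := by positivity
    linarith
  · intro s hs
    have h := (hasDerivAt_inv (hpos s hs).ne').fun_neg
    simpa using h
  · exact ContinuousOn.intervalIntegrable fun s hs =>
      (continuousAt_const.div (continuousAt_id.pow 2)
        (pow_ne_zero 2 (hpos s hs).ne')).continuousWithinAt

open Set in
theorem integral_inv_cube_le {ρ b : ℝ} (hρ : 0 < ρ) (hb : ρ ≤ b) :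
    ∫ s in ρ..b, 1 / s ^ 3 ≤ 1 / (2 * ρ ^ 2) := by
  have hpos : ∀ s ∈ uIcc ρ b, 0 < s := fun s hs => by
    rw [uIcc_of_le hb] at hs; exact hρ.trans_le hs.1
  rw [intervalIntegral.integral_eq_sub_of_hasDerivAt (f := fun s => -(1 / (2 * s ^ 2)))]
  · have : 0 < b := hρ.trans_le hb
    have : 0 ≤ 1 / (2 * b ^ 2) := by positivity
    linarith
  · intro s hs
    have hs0 := (hpos s hs).ne'
    have h : HasDerivAt (fun s : ℝ => -(1 / (2 * s ^ 2))) _ s :=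
      ((hasDerivAt_const s (1 : ℝ)).fun_div (((hasDerivAt_id' s).fun_pow 2).const_mul 2)
        (by simpa using hs0)).fun_neg
    refine h.congr_deriv ?_
    simp
    field_simp
  · exact ContinuousOn.intervalIntegrable fun s hs =>
      (continuousAt_const.div (continuousAt_id.pow 3)
        (pow_ne_zero 3 (hpos s hs).ne')).continuousWithinAt

open Set in
/-- The oscillatory integral with phase `X / s ± √(t² - s²)`. -/
theorem norm_integral_hyperbolic_phase_le {t X α ε : ℝ} (ht : 1 ≤ t) (hX : 0 ≤ X)
    (hε : ε = 1 ∨ ε = -1) {A A' : ℝ → ℂ}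
    (hA : ∀ s ∈ Icc (√t / 2) (t / 2), HasDerivAt A (A' s) s)
    (hA'c : ContinuousOn A' (Icc (√t / 2) (t / 2)))
    (hAb : ∀ s ∈ Icc (√t / 2) (t / 2), ‖A s‖ ≤ α)
    (hA'b : ∀ s ∈ Icc (√t / 2) (t / 2), ‖A' s‖ ≤ α / t) :
    ‖∫ s in (√t / 2)..(t / 2), A s * (1 / s) *
      Complex.exp (Complex.I * ((X / s + ε * √(t ^ 2 - s ^ 2) : ℝ) : ℂ))‖ ≤ 20 * α := by
  have ht0 : 0 < t := by linarith
  have hst : 1 ≤ √t := Real.one_le_sqrt.2 ht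
  have hsq : √t * √t = t := Real.mul_self_sqrt ht0.le
  set ρ : ℝ := √t / 2 with hρ
  have hρ0 : 0 < ρ := by positivity
  have hρ2 : ρ ^ 2 = t / 4 := by rw [hρ, div_pow, pow_two, hsq]; norm_num
  have hρh : 1 / 2 ≤ ρ := by rw [hρ]; linarith
  have hρb : ρ ≤ t / 2 := by rw [hρ]; nlinarith
  have hα : 0 ≤ α := (norm_nonneg _).trans (hAb ρ (left_mem_Icc.2 hρb))
  have hpos : ∀ s ∈ Icc ρ (t / 2), 0 < s := fun s hs => hρ0.trans_le hs.1
  set z : ℝ → ℝ := fun s => √(t ^ 2 - s ^ 2) with hz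
  have hz2 : ∀ s ∈ Icc ρ (t / 2), z s ^ 2 = t ^ 2 - s ^ 2 := fun s hs => by
    have := hpos s hs
    exact Real.sq_sqrt (by nlinarith [hs.2])
  have hzpos : ∀ s ∈ Icc ρ (t / 2), 0 < z s := fun s hs => by
    have := hpos s hs
    exact Real.sqrt_pos.2 (by nlinarith [hs.2])
  have hzle : ∀ s ∈ Icc ρ (t / 2), z s ≤ t := fun s hs => by
    have := hz2 s hs
    have := hzpos s hs
    nlinarith [sq_nonneg s]
  have hzd : ∀ s ∈ Icc ρ (t / 2), HasDerivAt z (-(s / z s)) s := fun s hs => by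
    have h1 : HasDerivAt (fun s : ℝ => t ^ 2 - s ^ 2) (-(2 * s)) s := by
      have := ((hasDerivAt_id s).pow 2).const_sub (t ^ 2)
      refine this.congr_deriv ?_; simp
    have hne : t ^ 2 - s ^ 2 ≠ 0 := by rw [← hz2 s hs]; exact (pow_pos (hzpos s hs) 2).ne'
    refine (h1.sqrt hne).congr_deriv ?_
    change -(2 * s) / (2 * z s) = _
    have := (hzpos s hs).ne'
    field_simp
  have hzc : ContinuousOn z (Icc ρ (t / 2)) := fun s hs =>
    (hzd s hs).continuousAt.continuousWithinAt
  have hidc : ContinuousOn (fun s : ℝ => s) (Icc ρ (t / 2)) := continuousOn_id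
  have hs0 : ∀ s ∈ Icc ρ (t / 2), s ≠ 0 := fun s hs => (hpos s hs).ne'
  have hφ : ∀ s ∈ Icc ρ (t / 2), HasDerivAt (fun s => X / s + ε * z s)
      (-(X / s ^ 2) - ε * (s / z s)) s := fun s hs => by
    have h1 := ((hasDerivAt_inv (hs0 s hs)).const_mul X).add ((hzd s hs).const_mul ε)
    simp only [div_eq_mul_inv] at h1 ⊢
    refine h1.congr_deriv ?_
    ring
  have hAc : ContinuousOn A (Icc ρ (t / 2)) := fun s hs =>
    (hA s hs).continuousAt.continuousWithinAt
  have hinvC : ContinuousOn (fun s : ℝ => (1 : ℂ) / (s : ℂ)) (Icc ρ (t / 2)) :=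
    continuousOn_const.div Complex.continuous_ofReal.continuousOn
      fun s hs => by exact_mod_cast hs0 s hs
  have hinvC2 : ContinuousOn (fun s : ℝ => (1 : ℂ) / (s : ℂ) ^ 2) (Icc ρ (t / 2)) :=
    continuousOn_const.div (Complex.continuous_ofReal.pow 2).continuousOn
      fun s hs => by exact_mod_cast pow_ne_zero 2 (hs0 s hs)
  have hi2 : IntervalIntegrable (fun s : ℝ => 1 / s ^ 2) volume ρ (t / 2) :=
    ContinuousOn.intervalIntegrable (by
      rw [uIcc_of_le hρb]
      exact continuousOn_const.div (hidc.pow 2) fun s hs => pow_ne_zero 2 (hs0 s hs))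
  have hi3 : IntervalIntegrable (fun s : ℝ => 1 / s ^ 3) volume ρ (t / 2) :=
    ContinuousOn.intervalIntegrable (by
      rw [uIcc_of_le hρb]
      exact continuousOn_const.div (hidc.pow 3) fun s hs => pow_ne_zero 3 (hs0 s hs))
  have hI2 := integral_inv_sq_le hρ0 hρb
  have hI3 := integral_inv_cube_le hρ0 hρb
  rcases hε with rfl | rfl
  · -- non-stationary phase
    -- Both terms of φ' have the same sign and φ' = -g/s, so the factor 1/s of the integrand is used
    -- up: A/s = ηφ' with η = -A/g. Moreover g ≥ s²/t ≥ 1/4, which is where the lower limit √t/2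
    -- enters.
    set g : ℝ → ℝ := fun s => X / s + s ^ 2 / z s with hg
    set g' : ℝ → ℝ := fun s => -(X / s ^ 2) + 2 * s / z s + s ^ 3 / z s ^ 3 with hg'
    have hgd : ∀ s ∈ Icc ρ (t / 2), HasDerivAt g (g' s) s := fun s hs => by
      have hzp := (hzpos s hs).ne'
      have hsn := hs0 s hs
      have h2 : HasDerivAt g _ s := ((hasDerivAt_const s X).fun_div (hasDerivAt_id' s) hsn).fun_add
        (((hasDerivAt_id' s).fun_pow 2).fun_div (hzd s hs) hzp)
      refine h2.congr_deriv ?_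
      simp only [hg']
      simp
      field_simp
      ring
    have hglow : ∀ s ∈ Icc ρ (t / 2), s ^ 2 / t ≤ g s := fun s hs => by
      have h1 : 0 ≤ X / s := div_nonneg hX (hpos s hs).le
      have h2 : s ^ 2 / t ≤ s ^ 2 / z s :=
        div_le_div_of_nonneg_left (sq_nonneg _) (hzpos s hs) (hzle s hs)
      simp only [hg]; linarith
    have hgpos : ∀ s ∈ Icc ρ (t / 2), 0 < g s := fun s hs =>
      lt_of_lt_of_le (by have := hpos s hs; positivity) (hglow s hs)
    have hg'le : ∀ s ∈ Icc ρ (t / 2), |g' s| ≤ 4 * g s / s := fun s hs => by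
      have hsp := hpos s hs
      have hzp := hzpos s hs
      have h1 : 0 ≤ X / s := div_nonneg hX hsp.le
      have h2 : 0 ≤ s ^ 2 / z s := by positivity
      have e1 : X / s ^ 2 = X / s / s := by field_simp
      have e2 : 2 * s / z s = 2 * (s ^ 2 / z s) / s := by field_simp
      have h3 : s ^ 3 / z s ^ 3 ≤ s ^ 2 / z s / s := by
        have h4 : s ^ 2 / z s ^ 2 ≤ 1 := by
          rw [div_le_one (by positivity), hz2 s hs]; nlinarith [hs.2]
        calc s ^ 3 / z s ^ 3 = s ^ 2 / z s ^ 2 * (s / z s) := by field_simp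
          _ ≤ 1 * (s / z s) := by gcongr
          _ = _ := by field_simp
      have h3' : 0 ≤ s ^ 3 / z s ^ 3 := by positivity
      simp only [hg', hg]
      rw [e1, e2, abs_le]
      have k1 : 0 ≤ X / s / s := by positivity
      have k2 : 0 ≤ s ^ 2 / z s / s := by positivity
      have k3 : 4 * (X / s + s ^ 2 / z s) / s = 4 * (X / s / s) + 4 * (s ^ 2 / z s / s) := by ring
      have k4 : 2 * (s ^ 2 / z s) / s = 2 * (s ^ 2 / z s / s) := by ring
      rw [k3, k4]
      constructor <;> linarith
    have hgc : ContinuousOn (fun s => (g s : ℂ)) (Icc ρ (t / 2)) := fun s hs =>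
      (hgd s hs).ofReal_comp.continuousAt.continuousWithinAt
    have hg'c : ContinuousOn (fun s => (g' s : ℂ)) (Icc ρ (t / 2)) := by
      refine Complex.continuous_ofReal.comp_continuousOn ?_
      refine ContinuousOn.add (ContinuousOn.add ?_ ?_) ?_
      · exact (continuousOn_const.div (hidc.pow 2) fun s hs => pow_ne_zero 2 (hs0 s hs)).neg
      · exact (continuousOn_const.mul hidc).div hzc fun s hs => (hzpos s hs).ne'
      · exact (hidc.pow 3).div (hzc.pow 3) fun s hs => pow_ne_zero 3 (hzpos s hs).ne'
    set η : ℝ → ℂ := fun s => -(A s / (g s : ℂ)) with hη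
    set η' : ℝ → ℂ := fun s => -((A' s * g s - A s * g' s) / (g s : ℂ) ^ 2) with hη'
    have hgne : ∀ s ∈ Icc ρ (t / 2), (g s : ℂ) ≠ 0 := fun s hs => by
      exact_mod_cast (hgpos s hs).ne'
    have hηd : ∀ s ∈ Icc ρ (t / 2), HasDerivAt η (η' s) s := fun s hs =>
      ((hA s hs).div (hgd s hs).ofReal_comp (hgne s hs)).neg
    have hη'c : ContinuousOn η' (Icc ρ (t / 2)) :=
      (((hA'c.mul hgc).sub (hAc.mul hg'c)).div (hgc.pow 2)
        fun s hs => pow_ne_zero 2 (hgne s hs)).neg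
    have hφ'c : ContinuousOn (fun s => -(X / s ^ 2) - 1 * (s / z s)) (Icc ρ (t / 2)) :=
      (continuousOn_const.div (hidc.pow 2) fun s hs => pow_ne_zero 2 (hs0 s hs)).neg.sub
        (continuousOn_const.mul (hidc.div hzc fun s hs => (hzpos s hs).ne'))
    have key := norm_integral_mul_deriv_exp_le hρb hφ hφ'c hηd hη'c
    have heq : ∫ s in ρ..(t / 2), A s * (1 / s) *
        Complex.exp (Complex.I * ((X / s + 1 * √(t ^ 2 - s ^ 2) : ℝ) : ℂ)) =
        ∫ s in ρ..(t / 2), η s * ((-(X / s ^ 2) - 1 * (s / z s) : ℝ) : ℂ) *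
          Complex.exp (Complex.I * ((X / s + 1 * z s : ℝ) : ℂ)) := by
      refine intervalIntegral.integral_congr fun s hs => ?_
      rw [uIcc_of_le hρb] at hs
      congr 1
      have h1 : ((-(X / s ^ 2) - 1 * (s / z s) : ℝ) : ℂ) = -((g s : ℂ) / s) := by
        have : -(X / s ^ 2) - 1 * (s / z s) = -(g s / s) := by
          have := hs0 s hs
          have := (hzpos s hs).ne'
          simp only [hg]; field_simp; ring
        rw [this]; push_cast; ring
      rw [h1]
      have := hgne s hs
      simp only [hη]
      field_simp
    rw [heq]
    refine key.trans ?_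
    have hηb : ∀ s ∈ Icc ρ (t / 2), ‖η s‖ ≤ 4 * α := fun s hs => by
      simp only [hη]
      rw [norm_neg, norm_div, Complex.norm_real, Real.norm_of_nonneg (hgpos s hs).le,
        div_le_iff₀ (hgpos s hs)]
      have h1 := hAb s hs
      have h2 := hglow s hs
      have h3 : 1 / 4 ≤ s ^ 2 / t := by
        rw [le_div_iff₀ ht0]
        nlinarith [hs.1]
      nlinarith
    have hη'b : ∀ s ∈ Icc ρ (t / 2), ‖η' s‖ ≤ α * (1 / s ^ 2) + 4 * α * t * (1 / s ^ 3) :=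
      fun s hs => by
      have hgp := hgpos s hs
      have hsp := hpos s hs
      have e : η' s = -(A' s / g s) + A s * g' s / (g s : ℂ) ^ 2 := by
        have := hgne s hs
        simp only [hη']; field_simp; ring
      have hginv : 1 / g s ≤ t / s ^ 2 := by
        rw [div_le_div_iff₀ hgp (by positivity), one_mul]
        have := hglow s hs
        rw [div_le_iff₀ ht0] at this; linarith
      rw [e]
      refine (norm_add_le _ _).trans (add_le_add ?_ ?_)
      · rw [norm_neg, norm_div, Complex.norm_real, Real.norm_of_nonneg hgp.le]
        calc ‖A' s‖ / g s = ‖A' s‖ * (1 / g s) := by ring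
          _ ≤ (α / t) * (t / s ^ 2) := by
              gcongr
              exact hA'b s hs
          _ = _ := by field_simp
      · rw [norm_div, norm_mul, norm_pow, Complex.norm_real, Complex.norm_real,
          Real.norm_of_nonneg hgp.le, Real.norm_eq_abs]
        calc ‖A s‖ * |g' s| / g s ^ 2 ≤ α * (4 * g s / s) / g s ^ 2 := by
              gcongr
              · exact hAb s hs
              · exact hg'le s hs
          _ = 4 * α / s * (1 / g s) := by field_simp
          _ ≤ 4 * α / s * (t / s ^ 2) := by gcongr
          _ = _ := by field_simp
    have hint : ∫ s in ρ..(t / 2), ‖η' s‖ ≤ 10 * α := by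
      calc _ ≤ ∫ s in ρ..(t / 2), (α * (1 / s ^ 2) + 4 * α * t * (1 / s ^ 3)) :=
            intervalIntegral.integral_mono_on hρb
              (ContinuousOn.intervalIntegrable (by rw [uIcc_of_le hρb]; exact hη'c.norm))
              ((hi2.const_mul _).add (hi3.const_mul _)) hη'b
        _ ≤ α * (1 / ρ) + 4 * α * t * (1 / (2 * ρ ^ 2)) := by
            rw [intervalIntegral.integral_add (hi2.const_mul _) (hi3.const_mul _),
              intervalIntegral.integral_const_mul, intervalIntegral.integral_const_mul]
            gcongr
        _ ≤ 10 * α := by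
            rw [hρ2]
            have h1 : 1 / ρ ≤ 2 := by rw [div_le_iff₀ hρ0]; linarith
            have h2 : 4 * α * t * (1 / (2 * (t / 4))) = 8 * α := by field_simp; ring
            rw [h2]
            nlinarith
    have h1 := hηb ρ (left_mem_Icc.2 hρb)
    have h2 := hηb (t / 2) (right_mem_Icc.2 hρb)
    linarith
  · -- stationary phase
    have hφ' : ∀ s ∈ Icc ρ (t / 2), HasDerivAt (fun s => -(X / s ^ 2) - (-1) * (s / z s))
        (2 * X / s ^ 3 + t ^ 2 / z s ^ 3) s := fun s hs => by
      have hzp := (hzpos s hs).ne'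
      have hsn := hs0 s hs
      have h3 : HasDerivAt (fun s => -(X / s ^ 2) - (-1) * (s / z s)) _ s :=
        ((hasDerivAt_const s X).fun_div ((hasDerivAt_id' s).fun_pow 2)
          (pow_ne_zero 2 hsn)).fun_neg.fun_sub
          (((hasDerivAt_id' s).fun_div (hzd s hs) hzp).const_mul (-1))
      refine h3.congr_deriv ?_
      have hzz := hz2 s hs
      have : t ^ 2 = z s ^ 2 + s ^ 2 := by linarith
      rw [this]
      simp
      field_simp
    -- Now φ'' is a sum of nonnegative terms and t²/z³ ≥ 1/t, whence μ = 1/√t. The amplitude A/s is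
    -- at most α/ρ = 2α/√t, so that the powers of t cancel.
    have hμ : ∀ s ∈ Icc ρ (t / 2), (1 / √t) ^ 2 ≤ 2 * X / s ^ 3 + t ^ 2 / z s ^ 3 := fun s hs => by
      have hzp := hzpos s hs
      have hsp := hpos s hs
      have h1 : 0 ≤ 2 * X / s ^ 3 := by positivity
      have h2 : t ^ 2 / t ^ 3 ≤ t ^ 2 / z s ^ 3 := by
        gcongr; exact hzle s hs
      have h3 : (1 / √t) ^ 2 = t ^ 2 / t ^ 3 := by
        rw [div_pow, Real.sq_sqrt ht0.le]; field_simp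
      rw [h3]; linarith
    have hφ''c : ContinuousOn (fun s => 2 * X / s ^ 3 + t ^ 2 / z s ^ 3) (Icc ρ (t / 2)) :=
      (continuousOn_const.div (hidc.pow 3) fun s hs => pow_ne_zero 3 (hs0 s hs)).add
        (continuousOn_const.div (hzc.pow 3) fun s hs => pow_ne_zero 3 (hzpos s hs).ne')
    have hψd : ∀ s ∈ Icc ρ (t / 2), HasDerivAt (fun s => A s * (1 / (s : ℂ)))
        (A' s * (1 / (s : ℂ)) - A s * (1 / (s : ℂ) ^ 2)) s := fun s hs => by
      have hsC : (s : ℂ) ≠ 0 := by exact_mod_cast hs0 s hs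
      have h1 : HasDerivAt (fun s : ℝ => 1 / (s : ℂ)) (-(1 / (s : ℂ) ^ 2)) s := by
        have := ((hasDerivAt_id s).ofReal_comp).fun_inv hsC
        simpa [neg_div] using this
      refine ((hA s hs).mul h1).congr_deriv ?_
      ring
    have hψ'c : ContinuousOn (fun s : ℝ => A' s * (1 / (s : ℂ)) - A s * (1 / (s : ℂ) ^ 2))
        (Icc ρ (t / 2)) := (hA'c.mul hinvC).sub (hAc.mul hinvC2)
    have hM : ∀ s ∈ Icc ρ (t / 2), ‖A s * (1 / (s : ℂ))‖ ≤ α / ρ := fun s hs => by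
      rw [norm_mul, norm_div, norm_one, Complex.norm_real, Real.norm_of_nonneg (hpos s hs).le,
        mul_one_div]
      gcongr
      · exact hAb s hs
      · exact hs.1
    have key := van_der_corput_second hρb (by positivity : 0 < 1 / √t) hφ hφ' hφ''c hμ hψd hψ'c hM
    refine key.trans ?_
    have hint : ∫ s in ρ..(t / 2), ‖A' s * (1 / (s : ℂ)) - A s * (1 / (s : ℂ) ^ 2)‖ ≤
        2 * (α / ρ) := by
      calc _ ≤ ∫ s in ρ..(t / 2), (α / t / ρ + α * (1 / s ^ 2)) := by
            refine intervalIntegral.integral_mono_on hρb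
              (ContinuousOn.intervalIntegrable (by rw [uIcc_of_le hρb]; exact hψ'c.norm))
              (intervalIntegrable_const.add (hi2.const_mul _)) fun s hs => ?_
            refine (norm_sub_le _ _).trans (add_le_add ?_ ?_)
            · rw [norm_mul, norm_div, norm_one, Complex.norm_real,
                Real.norm_of_nonneg (hpos s hs).le, mul_one_div]
              gcongr
              · exact hA'b s hs
              · exact hs.1
            · rw [norm_mul, norm_div, norm_one, norm_pow, Complex.norm_real,
                Real.norm_of_nonneg (hpos s hs).le]
              gcongr
              exact hAb s hs
        _ ≤ (t / 2 - ρ) * (α / t / ρ) + α * (1 / ρ) := by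
            rw [intervalIntegral.integral_add intervalIntegrable_const (hi2.const_mul _),
              intervalIntegral.integral_const_mul, intervalIntegral.integral_const, smul_eq_mul]
            gcongr
        _ ≤ t * (α / t / ρ) + α * (1 / ρ) := by
            gcongr; linarith
        _ = 2 * (α / ρ) := by field_simp; ring
    calc _ ≤ (8 * (α / ρ) + 2 * (α / ρ)) / (1 / √t) := by gcongr
      _ = 20 * α := by rw [hρ]; field_simp; ring

/-- The amplitude of the wave `exp (i ε z)` in `J₀`. -/
noncomputable def besselAmp (ε z : ℝ) : ℂ :=
  ((besselJ z : ℂ) - ε * Complex.I * besselJ' z) / 2 * Complex.exp (-(ε * Complex.I * z))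

/-- The derivative of `besselAmp`. -/
noncomputable def besselAmp' (ε z : ℝ) : ℂ :=
  ε * Complex.I / 2 * (besselJ' z / z) * Complex.exp (-(ε * Complex.I * z))

/-- By Bessel's equation all terms without a factor 1/z cancel once the oscillation e^{iεz} is
divided out. The derivative is therefore smaller than the amplitude by a factor of order 1/z. -/
theorem hasDerivAt_besselAmp {ε z : ℝ} (hε : ε ^ 2 = 1) (hz : 0 < z) :
    HasDerivAt (besselAmp ε) (besselAmp' ε z) z := by
  have h1 := (hasDerivAt_besselJ z).ofReal_comp
  have h2 := (hasDerivAt_besselJ' hz).ofReal_comp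
  have h3 := (((hasDerivAt_id' z).ofReal_comp).const_mul ((ε : ℂ) * Complex.I)).neg.cexp
  refine (((h1.sub (h2.const_mul ((ε : ℂ) * Complex.I))).div_const 2).mul h3).congr_deriv ?_
  have hzC : (z : ℂ) ≠ 0 := by exact_mod_cast hz.ne'
  have hεC : (ε : ℂ) ^ 2 = 1 := by exact_mod_cast hε
  simp only [besselAmp']
  simp
  field_simp
  linear_combination ((besselJ' z : ℂ) * z) *
    (Complex.I ^ 2 * hεC + Complex.I_sq)

theorem besselAmp_sum (z : ℝ) :
    (besselJ z : ℂ) = besselAmp 1 z * Complex.exp (Complex.I * z) +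
      besselAmp (-1) z * Complex.exp (-(Complex.I * z)) ∧
    (besselJ' z : ℂ) = Complex.I * (besselAmp 1 z * Complex.exp (Complex.I * z)) -
      Complex.I * (besselAmp (-1) z * Complex.exp (-(Complex.I * z))) := by
  have h1 : Complex.exp (-(Complex.I * z)) * Complex.exp (Complex.I * z) = 1 := by
    rw [← Complex.exp_add]; simp
  simp only [besselAmp]
  push_cast
  rw [show -((1 : ℂ) * Complex.I * z) = -(Complex.I * z) by ring,
    show -(-(1 : ℂ) * Complex.I * z) = Complex.I * z by ring]
  constructor
  · linear_combination (-(besselJ z : ℂ)) * h1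
  · linear_combination ((besselJ' z : ℂ) * Complex.I ^ 2) * h1 + (besselJ' z : ℂ) * Complex.I_sq

theorem exists_besselAmp_le : ∃ C : ℝ, 0 < C ∧ ∀ ε z : ℝ, |ε| = 1 → 0 < z →
    ‖besselAmp ε z‖ * √z ≤ C ∧ ‖besselAmp' ε z‖ * (z * √z) ≤ C := by
  obtain ⟨C, hC, h⟩ := exists_besselEntire_sq_le
  refine ⟨C, hC, fun ε z hε hz => ?_⟩
  obtain ⟨h0, h1⟩ := h z hz
  have hJ : |besselJ z| ≤ ‖besselEntire 0 ((z : ℂ) ^ 2)‖ := Complex.abs_re_le_norm _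
  have hJ' : |besselJ' z| ≤ z / 2 * ‖besselEntire 1 ((z : ℂ) ^ 2)‖ := by
    rw [besselJ', abs_mul, abs_neg, abs_of_pos (half_pos hz)]
    gcongr
    exact Complex.abs_re_le_norm _
  have hexp : ‖Complex.exp (-(ε * Complex.I * z))‖ = 1 := by
    rw [show -(ε * Complex.I * z) = ((-(ε * z) : ℝ) : ℂ) * Complex.I by push_cast; ring]
    exact Complex.norm_exp_ofReal_mul_I _
  have hs : 0 < √z := Real.sqrt_pos.2 hz
  have hεn : ‖(ε : ℂ)‖ = 1 := by rw [Complex.norm_real, Real.norm_eq_abs, hε]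
  constructor
  · rw [besselAmp, norm_mul, hexp, mul_one, norm_div]
    have h2 : ‖(besselJ z : ℂ) - ε * Complex.I * besselJ' z‖ ≤ |besselJ z| + |besselJ' z| := by
      refine (norm_sub_le _ _).trans_eq ?_
      rw [norm_mul, norm_mul, hεn, Complex.norm_I, Complex.norm_real, Complex.norm_real]
      simp
    have h3 : ‖(2 : ℂ)‖ = 2 := by simp
    rw [h3]
    have h4 : |besselJ z| * √z ≤ C := (mul_le_mul_of_nonneg_right hJ hs.le).trans h0
    have h5 : |besselJ' z| * √z ≤ C / 2 := by
      have := mul_le_mul_of_nonneg_right hJ' hs.le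
      nlinarith
    have := mul_le_mul_of_nonneg_right h2 hs.le
    linarith
  · rw [besselAmp', norm_mul, hexp, mul_one, norm_mul, norm_div, norm_mul, hεn, Complex.norm_I,
      norm_div, Complex.norm_real, Complex.norm_real, Real.norm_of_nonneg hz.le, Real.norm_eq_abs]
    have h3 : ‖(2 : ℂ)‖ = 2 := by simp
    rw [h3]
    have h5 : |besselJ' z| * √z ≤ C / 2 := by
      have := mul_le_mul_of_nonneg_right hJ' hs.le
      nlinarith
    have : 1 * 1 / 2 * (|besselJ' z| / z) * (z * √z) = (|besselJ' z| * √z) / 2 := by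
      field_simp
    rw [this]; linarith

open Set in
/-- The part of the two-dimensional kernel near the origin. -/
theorem exists_norm_integral_density_le : ∃ C : ℝ, 0 < C ∧ ∀ t X : ℝ, 1 ≤ t → 0 ≤ X →
    ‖∫ s in (√t / 2)..(t / 2), sinDensity t s * (1 / s) *
      Complex.exp (Complex.I * ((X / s : ℝ) : ℂ))‖ ≤ C / √t ∧
    ‖∫ s in (√t / 2)..(t / 2), cosDensity t s * (1 / s) *
      Complex.exp (Complex.I * ((X / s : ℝ) : ℂ))‖ ≤ C / √t := by
  obtain ⟨C, hC, h⟩ := exists_besselAmp_le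
  refine ⟨40 * (30 * C), by positivity, fun t X ht hX => ?_⟩
  have ht0 : 0 < t := by linarith
  have hst : 1 ≤ √t := Real.one_le_sqrt.2 ht
  have hsq : √t * √t = t := Real.mul_self_sqrt ht0.le
  have hρb : √t / 2 ≤ t / 2 := by nlinarith
  -- This has to dominate the amplitudes of both densities and t times their derivatives. The
  -- largest of these bounds is 8C/√t, from the derivative of the cosine amplitude; 30 is a generous
  -- choice.
  set α : ℝ := 30 * C / √t with hα
  set I : Set ℝ := Icc (√t / 2) (t / 2) with hI
  have hpos : ∀ s ∈ I, 0 < s := fun s hs => lt_of_lt_of_le (by positivity) hs.1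
  set z : ℝ → ℝ := fun s => √(t ^ 2 - s ^ 2) with hz
  have hz2 : ∀ s ∈ I, z s ^ 2 = t ^ 2 - s ^ 2 := fun s hs => by
    have := hpos s hs
    exact Real.sq_sqrt (by nlinarith [hs.2])
  have hzt : ∀ s ∈ I, t / 2 ≤ z s := fun s hs => by
    have := hpos s hs
    exact Real.le_sqrt_of_sq_le (by nlinarith [hs.2])
  have hzpos : ∀ s ∈ I, 0 < z s := fun s hs => lt_of_lt_of_le (by positivity) (hzt s hs)
  have hzd : ∀ s ∈ I, HasDerivAt z (-(s / z s)) s := fun s hs => by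
    have h1 : HasDerivAt (fun s : ℝ => t ^ 2 - s ^ 2) (-(2 * s)) s := by
      have := ((hasDerivAt_id s).pow 2).const_sub (t ^ 2)
      refine this.congr_deriv ?_; simp
    have hne : t ^ 2 - s ^ 2 ≠ 0 := by rw [← hz2 s hs]; exact (pow_pos (hzpos s hs) 2).ne'
    refine (h1.sqrt hne).congr_deriv ?_
    change -(2 * s) / (2 * z s) = _
    have := (hzpos s hs).ne'
    field_simp
  have hzc : ContinuousOn z I := fun s hs => (hzd s hs).continuousAt.continuousWithinAt
  have hzCc : ContinuousOn (fun s => (z s : ℂ)) I :=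
    Complex.continuous_ofReal.comp_continuousOn hzc
  have hzne : ∀ s ∈ I, (z s : ℂ) ≠ 0 := fun s hs => by exact_mod_cast (hzpos s hs).ne'
  have hszle : ∀ s ∈ I, |-(s / z s)| ≤ 1 := fun s hs => by
    rw [abs_neg, abs_of_pos (div_pos (hpos s hs) (hzpos s hs)), div_le_one (hzpos s hs)]
    exact hs.2.trans (hzt s hs)
  have hsz : ∀ s ∈ I, √t / 2 ≤ √(z s) := fun s hs => by
    apply Real.le_sqrt_of_sq_le
    rw [div_pow, Real.sq_sqrt ht0.le]
    linarith [hzt s hs]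
  have hamp : ∀ ε : ℝ, |ε| = 1 → ∀ s ∈ I, ‖besselAmp ε (z s)‖ ≤ 2 * C / √t ∧
      ‖besselAmp' ε (z s)‖ ≤ 4 * C / √t / t := fun ε hε s hs => by
    obtain ⟨h0, h1⟩ := h ε (z s) hε (hzpos s hs)
    have a1 := hsz s hs
    have a2 := hzt s hs
    have p0 := norm_nonneg (besselAmp ε (z s))
    have p1 := norm_nonneg (besselAmp' ε (z s))
    constructor
    · rw [le_div_iff₀ (by positivity)]
      nlinarith
    · rw [le_div_iff₀ (by positivity), le_div_iff₀ (by positivity)]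
      have : t / 2 * (√t / 2) ≤ z s * √(z s) := mul_le_mul a2 a1 (by positivity) (hzpos s hs).le
      nlinarith
  have hampc : ∀ ε : ℝ, ε ^ 2 = 1 → ContinuousOn (fun s => besselAmp ε (z s)) I := fun ε hε s hs =>
    ((hasDerivAt_besselAmp hε (hzpos s hs)).scomp s (hzd s hs)).continuousAt.continuousWithinAt
  have hJ'c : ContinuousOn (fun s => (besselJ' (z s) : ℂ)) I := fun s hs =>
    ContinuousAt.continuousWithinAt (Complex.continuous_ofReal.continuousAt.comp
      ((hasDerivAt_besselJ' (hzpos s hs)).continuousAt.comp (hzd s hs).continuousAt))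
  have hamp'c : ∀ ε : ℝ, ContinuousOn (fun s => besselAmp' ε (z s)) I := fun ε =>
    (continuousOn_const.mul (hJ'c.div hzCc hzne)).mul
      (Complex.continuous_exp.comp_continuousOn (continuousOn_const.mul hzCc).neg)
  have hdz : ContinuousOn (fun s => -(s / z s)) I :=
    (continuousOn_id.div hzc fun s hs => (hzpos s hs).ne').neg
  have hdzC : ContinuousOn (fun s => ((-(s / z s) : ℝ) : ℂ)) I :=
    Complex.continuous_ofReal.comp_continuousOn hdz
  -- combine the two waves
  have hcomb : ∀ (D : ℝ → ℂ) (A A' : ℝ → ℝ → ℂ),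
      (∀ s ∈ I, D s = A 1 s * Complex.exp (Complex.I * z s) +
        A (-1) s * Complex.exp (-(Complex.I * z s))) →
      (∀ ε : ℝ, (ε = 1 ∨ ε = -1) → ∀ s ∈ I, HasDerivAt (A ε) (A' ε s) s ∧ ‖A ε s‖ ≤ α ∧
        ‖A' ε s‖ ≤ α / t) →
      (∀ ε : ℝ, (ε = 1 ∨ ε = -1) → ContinuousOn (A' ε) I) →
      ‖∫ s in (√t / 2)..(t / 2), D s * (1 / s) * Complex.exp (Complex.I * ((X / s : ℝ) : ℂ))‖ ≤
        40 * (30 * C) / √t := by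
    intro D A A' hD hA hA'
    have key : ∀ ε : ℝ, (ε = 1 ∨ ε = -1) → _ := fun ε hε =>
      norm_integral_hyperbolic_phase_le ht hX hε (fun s hs => (hA ε hε s hs).1) (hA' ε hε)
        (fun s hs => (hA ε hε s hs).2.1) (fun s hs => (hA ε hε s hs).2.2)
    have hint : ∀ ε : ℝ, (ε = 1 ∨ ε = -1) → IntervalIntegrable (fun s : ℝ => A ε s * (1 / s) *
        Complex.exp (Complex.I * ((X / s + ε * √(t ^ 2 - s ^ 2) : ℝ) : ℂ))) volume
        (√t / 2) (t / 2) := fun ε hε => by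
      refine ContinuousOn.intervalIntegrable ?_
      rw [uIcc_of_le hρb]
      refine ContinuousOn.mul (ContinuousOn.mul
        (fun s hs => (hA ε hε s hs).1.continuousAt.continuousWithinAt) ?_) ?_
      · exact continuousOn_const.div Complex.continuous_ofReal.continuousOn
          fun s hs => by exact_mod_cast (hpos s hs).ne'
      · refine Complex.continuous_exp.comp_continuousOn (continuousOn_const.mul
          (Complex.continuous_ofReal.comp_continuousOn ?_))
        exact (continuousOn_const.div continuousOn_id fun s hs => (hpos s hs).ne').add
          (continuousOn_const.mul hzc)
    have heq : ∫ s in (√t / 2)..(t / 2), D s * (1 / s) *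
        Complex.exp (Complex.I * ((X / s : ℝ) : ℂ)) =
        (∫ s in (√t / 2)..(t / 2), A 1 s * (1 / s) *
          Complex.exp (Complex.I * ((X / s + 1 * √(t ^ 2 - s ^ 2) : ℝ) : ℂ))) +
        ∫ s in (√t / 2)..(t / 2), A (-1) s * (1 / s) *
          Complex.exp (Complex.I * ((X / s + (-1) * √(t ^ 2 - s ^ 2) : ℝ) : ℂ)) := by
      rw [← intervalIntegral.integral_add (hint 1 (Or.inl rfl)) (hint (-1) (Or.inr rfl))]
      refine intervalIntegral.integral_congr fun s hs => ?_
      rw [uIcc_of_le hρb] at hs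
      rw [hD s hs]
      have e1 : Complex.exp (Complex.I * ((X / s + 1 * √(t ^ 2 - s ^ 2) : ℝ) : ℂ)) =
          Complex.exp (Complex.I * z s) * Complex.exp (Complex.I * ((X / s : ℝ) : ℂ)) := by
        rw [← Complex.exp_add]; congr 1; simp only [hz]; push_cast; ring
      have e2 : Complex.exp (Complex.I * ((X / s + (-1) * √(t ^ 2 - s ^ 2) : ℝ) : ℂ)) =
          Complex.exp (-(Complex.I * z s)) * Complex.exp (Complex.I * ((X / s : ℝ) : ℂ)) := by
        rw [← Complex.exp_add]; congr 1; simp only [hz]; push_cast; ring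
      rw [e1, e2]; ring
    rw [heq]
    refine (norm_add_le _ _).trans ?_
    have k1 := key 1 (Or.inl rfl)
    have k2 := key (-1) (Or.inr rfl)
    have : 40 * (30 * C) / √t = 20 * α + 20 * α := by rw [hα]; ring
    rw [this]
    exact add_le_add k1 k2
  have hsqC : ∀ s ∈ I, (t : ℂ) ^ 2 - (s : ℂ) ^ 2 = (z s : ℂ) ^ 2 := fun s hs => by
    have := hz2 s hs
    exact_mod_cast this.symm
  have habs : ∀ ε : ℝ, (ε = 1 ∨ ε = -1) → |ε| = 1 ∧ ε ^ 2 = 1 := by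
    rintro ε (rfl | rfl) <;> norm_num
  constructor
  · refine hcomb (fun s => sinDensity t s) (fun ε s => 1 / 2 * besselAmp ε (z s))
      (fun ε s => 1 / 2 * ((-(s / z s) : ℝ) • besselAmp' ε (z s))) ?_ ?_ ?_
    · intro s hs
      simp only [sinDensity]
      rw [hsqC s hs, besselEntire_sq_eq_re]
      have := (besselAmp_sum (z s)).1
      rw [besselJ] at this
      linear_combination (1 / 2 : ℂ) * this
    · intro ε hε s hs
      obtain ⟨hε1, hε2⟩ := habs ε hε
      obtain ⟨b0, b1⟩ := hamp ε hε1 s hs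
      refine ⟨((hasDerivAt_besselAmp hε2 (hzpos s hs)).scomp s (hzd s hs)).const_mul _, ?_, ?_⟩
      · have h12 : ‖(1 / 2 : ℂ)‖ = 1 / 2 := by norm_num
        rw [norm_mul, h12]
        have : 2 * C / √t ≤ α := by rw [hα]; gcongr; norm_num
        have := norm_nonneg (besselAmp ε (z s))
        linarith
      · have h12 : ‖(1 / 2 : ℂ)‖ = 1 / 2 := by norm_num
        rw [norm_mul, norm_smul, h12, Real.norm_eq_abs]
        have h3 : 4 * C / √t / t ≤ α / t := by rw [hα]; gcongr; norm_num
        have h4 : |-(s / z s)| * ‖besselAmp' ε (z s)‖ ≤ 1 * ‖besselAmp' ε (z s)‖ := by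
          gcongr; exact hszle s hs
        have := norm_nonneg (besselAmp' ε (z s))
        linarith
    · intro ε hε
      exact continuousOn_const.mul (hdz.smul (hamp'c ε))
  -- The cosine density is tJ₀'(z)/(2z), so the amplitudes of J₀' are multiplied by t/(2z), which is
  -- at most 1 because z ≥ t/2.
  · refine hcomb (fun s => cosDensity t s)
      (fun ε s => ε * Complex.I * t / 2 * (besselAmp ε (z s) / z s))
      (fun ε s => ε * Complex.I * t / 2 * ((((-(s / z s) : ℝ) • besselAmp' ε (z s)) * z s -
        besselAmp ε (z s) * ((-(s / z s) : ℝ) : ℂ)) / (z s : ℂ) ^ 2)) ?_ ?_ ?_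
    · intro s hs
      simp only [cosDensity]
      rw [hsqC s hs, besselEntire_sq_eq_re]
      have h1 := (besselAmp_sum (z s)).2
      have h2 : ((besselJ' (z s) : ℝ) : ℂ) =
          -(z s / 2) * ((besselEntire 1 ((z s : ℂ) ^ 2)).re : ℂ) := by
        rw [besselJ']; push_cast; ring
      rw [h2] at h1
      have := hzne s hs
      generalize Complex.exp (Complex.I * z s) = e₁ at h1 ⊢
      generalize Complex.exp (-(Complex.I * z s)) = e₂ at h1 ⊢
      push_cast
      field_simp
      linear_combination (4 : ℂ) * t * h1
    · intro ε hε s hs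
      obtain ⟨hε1, hε2⟩ := habs ε hε
      obtain ⟨b0, b1⟩ := hamp ε hε1 s hs
      have hcoef : ‖(ε : ℂ) * Complex.I * t / 2‖ = t / 2 := by
        rw [norm_div, norm_mul, norm_mul, Complex.norm_real, Real.norm_eq_abs, hε1,
          Complex.norm_I, Complex.norm_real, Real.norm_of_nonneg ht0.le]
        simp
      have hzt' := hzt s hs
      have hzp := hzpos s hs
      have hzinv : 1 / z s ≤ 2 / t := by
        rw [div_le_div_iff₀ hzp ht0]; linarith
      refine ⟨((((hasDerivAt_besselAmp hε2 hzp).scomp s (hzd s hs)).div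
        (hzd s hs).ofReal_comp (hzne s hs))).const_mul _, ?_, ?_⟩
      · rw [norm_mul, hcoef, norm_div, Complex.norm_real, Real.norm_of_nonneg hzp.le]
        calc t / 2 * (‖besselAmp ε (z s)‖ / z s) = t / 2 * (‖besselAmp ε (z s)‖ * (1 / z s)) := by
              ring
          _ ≤ t / 2 * (2 * C / √t * (2 / t)) := by gcongr
          _ = 2 * C / √t := by field_simp
          _ ≤ α := by rw [hα]; gcongr; norm_num
      · rw [norm_mul, hcoef, norm_div, norm_pow, Complex.norm_real, Real.norm_of_nonneg hzp.le]
        have e1 : ‖((-(s / z s) : ℝ) • besselAmp' ε (z s)) * (z s : ℂ) -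
            besselAmp ε (z s) * ((-(s / z s) : ℝ) : ℂ)‖ ≤
            4 * C / √t / t * z s + 2 * C / √t := by
          refine (norm_sub_le _ _).trans (add_le_add ?_ ?_)
          · rw [norm_mul, norm_smul, Complex.norm_real, Real.norm_of_nonneg hzp.le,
              Real.norm_eq_abs]
            calc _ ≤ 1 * (4 * C / √t / t) * z s := by gcongr; exact hszle s hs
              _ = _ := by ring
          · rw [norm_mul, Complex.norm_real, Real.norm_eq_abs]
            calc _ ≤ (2 * C / √t) * 1 := by gcongr; exact hszle s hs
              _ = _ := by ring
        calc _ ≤ t / 2 * ((4 * C / √t / t * z s + 2 * C / √t) / z s ^ 2) := by gcongr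
          _ = t / 2 * (4 * C / √t / t * (1 / z s) + 2 * C / √t * (1 / z s) ^ 2) := by
              field_simp
          _ ≤ t / 2 * (4 * C / √t / t * (2 / t) + 2 * C / √t * (2 / t) ^ 2) := by gcongr
          _ = 8 * C / √t / t := by field_simp; ring
          _ ≤ α / t := by rw [hα]; gcongr; norm_num
    · intro ε hε
      have hε2 := (habs ε hε).2
      exact continuousOn_const.mul ((((hdz.smul (hamp'c ε)).mul hzCc).sub
        ((hampc ε hε2).mul hdzC)).div (hzCc.pow 2) fun s hs => pow_ne_zero 2 (hzne s hs))

/-! ### The oscillatory integral with quartic dispersion in dimension one. -/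

/-- The dispersion relation of the one-dimensional beam equation. -/
noncomputable def quarticDisp (x : ℝ) : ℝ := √(1 + x ^ 4)

theorem quarticDisp_pos (x : ℝ) : 0 < quarticDisp x := Real.sqrt_pos.2 (by positivity)

theorem quarticDisp_sq (x : ℝ) : quarticDisp x ^ 2 = 1 + x ^ 4 := Real.sq_sqrt (by positivity)

theorem one_le_quarticDisp (x : ℝ) : 1 ≤ quarticDisp x :=
  Real.one_le_sqrt.2 (by nlinarith [sq_nonneg (x ^ 2)])

theorem hasDerivAt_quarticDisp (x : ℝ) :
    HasDerivAt quarticDisp (2 * x ^ 3 / quarticDisp x) x := by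
  have h1 : HasDerivAt (fun x : ℝ => 1 + x ^ 4) (4 * x ^ 3) x := by
    have := ((hasDerivAt_id' x).fun_pow 4).const_add 1
    refine this.congr_deriv ?_; simp
  refine (h1.sqrt (by positivity)).congr_deriv ?_
  change 4 * x ^ 3 / (2 * quarticDisp x) = _
  have := (quarticDisp_pos x).ne'
  field_simp
  ring

theorem hasDerivAt_quarticDisp' (x : ℝ) :
    HasDerivAt (fun x => 2 * x ^ 3 / quarticDisp x)
      ((6 * x ^ 2 + 2 * x ^ 6) / quarticDisp x ^ 3) x := by
  have hp := (quarticDisp_pos x).ne'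
  have h : HasDerivAt (fun x => 2 * x ^ 3 / quarticDisp x) _ x :=
    (((hasDerivAt_id' x).fun_pow 3).const_mul 2).fun_div (hasDerivAt_quarticDisp x) hp
  refine h.congr_deriv ?_
  have h2 := quarticDisp_sq x
  field_simp
  simp
  linear_combination (6 * x ^ 2) * h2

theorem quarticDisp_continuous : Continuous quarticDisp := by
  unfold quarticDisp; fun_prop

-- The second derivative of the phase is r⁴(6x²+2x⁶)/(1+x⁴)^{3/2}; it degenerates only at the
-- origin. The interval [0,1/r] is estimated trivially, and for x ≥ 1/r the second derivative is at
-- least (r/2)², so that van der Corput's lemma gives the same order 1/r. The linear term yx is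
-- invisible to the second derivative, and a decreasing amplitude with values in [0,1] has variation
-- at most 1.
open Set in
theorem norm_integral_quartic_phase_le {r y R : ℝ} (hr : 1 ≤ r) (hR : 0 ≤ R)
    {ψ ψ' : ℝ → ℝ} (hψ : ∀ x, HasDerivAt ψ (ψ' x) x) (hψ'c : Continuous ψ')
    (hψ' : ∀ x, 0 ≤ x → ψ' x ≤ 0) (h0 : ∀ x, 0 ≤ ψ x) (h1 : ∀ x, ψ x ≤ 1) :
    ‖∫ x in (0 : ℝ)..R, (ψ x : ℂ) *
      Complex.exp (Complex.I * ((r ^ 4 * quarticDisp x + y * x : ℝ) : ℂ))‖ ≤ 20 / r := by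
  have hr0 : 0 < r := by linarith
  set f : ℝ → ℂ := fun x => (ψ x : ℂ) *
      Complex.exp (Complex.I * ((r ^ 4 * quarticDisp x + y * x : ℝ) : ℂ)) with hf
  have hψc : Continuous ψ := continuous_iff_continuousAt.2 fun x => (hψ x).continuousAt
  have hfc : Continuous f := by
    have := quarticDisp_continuous
    fun_prop
  have hfn : ∀ x, ‖f x‖ ≤ 1 := fun x => by
    simp only [hf]
    rw [norm_mul, mul_comm Complex.I, Complex.norm_exp_ofReal_mul_I, mul_one, Complex.norm_real,
      Real.norm_of_nonneg (h0 x)]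
    exact h1 x
  rcases le_total R (1 / r) with hRr | hRr
  · have := intervalIntegral.norm_integral_le_of_norm_le_const (a := 0) (b := R) (f := f)
      (fun x _ => hfn x)
    rw [sub_zero, abs_of_nonneg hR, one_mul] at this
    refine this.trans (hRr.trans ?_)
    gcongr; norm_num
  · have hr1 : 0 < 1 / r := by positivity
    have hr1' : 1 / r ≤ 1 := by rw [div_le_one hr0]; exact hr
    rw [← intervalIntegral.integral_add_adjacent_intervals (hfc.intervalIntegrable 0 (1 / r))
      (hfc.intervalIntegrable (1 / r) R)]
    refine (norm_add_le _ _).trans ?_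
    have e1 : ‖∫ x in (0 : ℝ)..(1 / r), f x‖ ≤ 1 / r := by
      have := intervalIntegral.norm_integral_le_of_norm_le_const (a := 0) (b := 1 / r) (f := f)
        (fun x _ => hfn x)
      rwa [sub_zero, abs_of_pos hr1, one_mul] at this
    have e2 : ‖∫ x in (1 / r)..R, f x‖ ≤ (8 * 1 + ∫ x in (1 / r)..R, ‖(ψ' x : ℂ)‖) / (r / 2) := by
      refine van_der_corput_second hRr (by positivity)
        (φ' := fun x => r ^ 4 * (2 * x ^ 3 / quarticDisp x) + y)
        (φ'' := fun x => r ^ 4 * ((6 * x ^ 2 + 2 * x ^ 6) / quarticDisp x ^ 3)) ?_ ?_ ?_ ?_ ?_ ?_ ?_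
      · intro x _
        refine (((hasDerivAt_quarticDisp x).const_mul (r ^ 4)).add
          ((hasDerivAt_id' x).const_mul y)).congr_deriv ?_
        ring
      · intro x _
        exact ((hasDerivAt_quarticDisp' x).const_mul (r ^ 4)).add_const y
      · refine Continuous.continuousOn (continuous_const.mul (Continuous.div (by fun_prop)
          (quarticDisp_continuous.pow 3) fun x => pow_ne_zero 3 (quarticDisp_pos x).ne'))
      · intro x hx
        have hx0 : 0 < x := hr1.trans_le hx.1
        have hq := quarticDisp_pos x
        have hq2 := quarticDisp_sq x
        have hqle : quarticDisp x ≤ 1 + x ^ 2 := by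
          apply Real.sqrt_le_iff.2
          constructor
          · positivity
          · nlinarith [sq_nonneg x]
        have hq3 : quarticDisp x ^ 3 ≤ (1 + x ^ 2) * (1 + x ^ 4) := by
          rw [pow_succ, hq2, mul_comm]
          gcongr
        have hrx : 1 ≤ r * x := by
          have := hx.1
          rw [div_le_iff₀ hr0] at this; linarith
        have hrx2 : 1 ≤ r ^ 2 * x ^ 2 := by nlinarith
        have hmain : (1 + x ^ 2) * (1 + x ^ 4) ≤ r ^ 2 * (6 * x ^ 2 + 2 * x ^ 6) := by
          have hr2 : 1 ≤ r ^ 2 := by nlinarith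
          have hx2 : 0 ≤ x ^ 2 := sq_nonneg x
          have hx6 : 0 ≤ x ^ 6 := by positivity
          have a1 : x ^ 2 ≤ r ^ 2 * x ^ 2 := by nlinarith
          have a2 : x ^ 6 ≤ r ^ 2 * x ^ 6 := by nlinarith
          have a3 : 2 * x ^ 4 ≤ x ^ 2 + x ^ 6 := by nlinarith [mul_nonneg hx2 (sq_nonneg (x ^ 2 - 1))]
          nlinarith
        rw [div_pow, ← mul_div_assoc, le_div_iff₀ (pow_pos hq 3)]
        have hr2 : 0 ≤ r ^ 2 := sq_nonneg r
        calc r ^ 2 / 2 ^ 2 * quarticDisp x ^ 3 ≤ r ^ 2 / 2 ^ 2 * ((1 + x ^ 2) * (1 + x ^ 4)) := by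
              gcongr
          _ ≤ r ^ 2 / 2 ^ 2 * (r ^ 2 * (6 * x ^ 2 + 2 * x ^ 6)) := by gcongr
          _ ≤ r ^ 4 * (6 * x ^ 2 + 2 * x ^ 6) := by
              have : 0 ≤ r ^ 4 * (6 * x ^ 2 + 2 * x ^ 6) := by positivity
              nlinarith
      · exact fun x _ => (hψ x).ofReal_comp
      · exact (Complex.continuous_ofReal.comp hψ'c).continuousOn
      · intro x _
        rw [Complex.norm_real, Real.norm_of_nonneg (h0 x)]
        exact h1 x
    have e3 : ∫ x in (1 / r)..R, ‖(ψ' x : ℂ)‖ ≤ 1 := by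
      have : ∫ x in (1 / r)..R, ‖(ψ' x : ℂ)‖ = ∫ x in (1 / r)..R, -ψ' x := by
        refine intervalIntegral.integral_congr fun x hx => ?_
        rw [uIcc_of_le hRr] at hx
        rw [Complex.norm_real, Real.norm_of_nonpos (hψ' x (hr1.le.trans hx.1))]
      rw [this, intervalIntegral.integral_neg, intervalIntegral.integral_eq_sub_of_hasDerivAt
        (fun x _ => hψ x) (hψ'c.intervalIntegrable _ _)]
      linarith [h0 R, h1 (1 / r)]
    calc _ ≤ 1 / r + (8 * 1 + 1) / (r / 2) := by gcongr; exact e2.trans (by gcongr)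
      _ = 19 / r := by field_simp; norm_num
      _ ≤ 20 / r := by gcongr; norm_num

/-- The same on a symmetric interval, for both signs of the time variable. -/
theorem norm_integral_quartic_phase_symm_le {r y R ε : ℝ} (hr : 1 ≤ r) (hR : 0 ≤ R)
    (hε : ε = 1 ∨ ε = -1)
    {ψ ψ' : ℝ → ℝ} (hψ : ∀ x, HasDerivAt ψ (ψ' x) x) (hψ'c : Continuous ψ')
    (hψ' : ∀ x, 0 ≤ x → ψ' x ≤ 0) (h0 : ∀ x, 0 ≤ ψ x) (h1 : ∀ x, ψ x ≤ 1)
    (heven : ∀ x, ψ (-x) = ψ x) :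
    ‖∫ x in (-R)..R, (ψ x : ℂ) *
      Complex.exp (Complex.I * ((ε * r ^ 4 * quarticDisp x + y * x : ℝ) : ℂ))‖ ≤ 40 / r := by
  have hψc : Continuous ψ := continuous_iff_continuousAt.2 fun x => (hψ x).continuousAt
  have hq := quarticDisp_continuous
  set g : ℝ → ℝ → ℝ → ℂ := fun ε y x => (ψ x : ℂ) *
      Complex.exp (Complex.I * ((ε * r ^ 4 * quarticDisp x + y * x : ℝ) : ℂ)) with hg
  have hgc : ∀ ε y, Continuous (g ε y) := fun ε y => by simp only [hg]; fun_prop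
  have hpos : ∀ y, ‖∫ x in (0 : ℝ)..R, g 1 y x‖ ≤ 20 / r := fun y => by
    have := norm_integral_quartic_phase_le (y := y) hr hR hψ hψ'c hψ' h0 h1
    simpa only [hg, one_mul] using this
  -- Since ψ is real, reversing time amounts to conjugation together with y ↦ -y.
  have hconj : ∀ y x, g (-1) y x = (starRingEnd ℂ) (g 1 (-y) x) := fun y x => by
    simp only [hg]
    rw [map_mul, Complex.conj_ofReal, ← Complex.exp_conj, map_mul, Complex.conj_I,
      Complex.conj_ofReal]
    congr 2; push_cast; ring
  have hhalf : ∀ ε : ℝ, (ε = 1 ∨ ε = -1) → ∀ y, ‖∫ x in (0 : ℝ)..R, g ε y x‖ ≤ 20 / r := by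
    rintro ε (rfl | rfl) y
    · exact hpos y
    · simp only [hconj]
      rw [intervalIntegral.integral_of_le hR, integral_conj, RCLike.norm_conj,
        ← intervalIntegral.integral_of_le hR]
      exact hpos (-y)
  have hneg : ∫ x in (-R)..0, g ε y x = ∫ x in (0 : ℝ)..R, g ε (-y) x := by
    have := intervalIntegral.integral_comp_neg (a := 0) (b := R) (fun x => g ε y x)
    rw [neg_zero] at this
    rw [← this]
    congr 1; ext x
    simp only [hg, heven, quarticDisp]
    congr 3
    push_cast
    rw [show ((-x) ^ 4 : ℝ) = x ^ 4 by ring]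
    ring
  change ‖∫ x in (-R)..R, g ε y x‖ ≤ _
  rw [← intervalIntegral.integral_add_adjacent_intervals ((hgc ε y).intervalIntegrable (-R) 0)
    ((hgc ε y).intervalIntegrable 0 R), hneg]
  refine (norm_add_le _ _).trans ?_
  have a1 := hhalf ε hε (-y)
  have a2 := hhalf ε hε y
  calc _ ≤ 20 / r + 20 / r := add_le_add a1 a2
    _ = 40 / r := by ring

/-! ### Complex interpolation for bilinear forms with a bounded kernel. -/

/-- The complex power `w |w|^(c-1)`. -/
noncomputable def signedPow (c w : ℂ) : ℂ :=
  w / (‖w‖ : ℂ) * Complex.exp (c * ((Real.log ‖w‖ : ℝ) : ℂ))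

theorem signedPow_zero (c : ℂ) : signedPow c 0 = 0 := by simp [signedPow]

theorem norm_signedPow {c : ℂ} (hc : 0 < c.re) (w : ℂ) : ‖signedPow c w‖ = ‖w‖ ^ c.re := by
  rcases eq_or_ne w 0 with rfl | hw
  · rw [signedPow_zero, norm_zero, Real.zero_rpow hc.ne']
  · have h : 0 < ‖w‖ := norm_pos_iff.2 hw
    rw [signedPow, norm_mul, norm_div, Complex.norm_real, norm_norm, div_self h.ne', one_mul,
      Complex.norm_exp, Complex.re_mul_ofReal, Real.rpow_def_of_pos h, mul_comm]

theorem signedPow_one (w : ℂ) : signedPow 1 w = w := by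
  rcases eq_or_ne w 0 with rfl | hw
  · exact signedPow_zero _
  · have h : 0 < ‖w‖ := norm_pos_iff.2 hw
    rw [signedPow, one_mul, ← Complex.ofReal_exp, Real.exp_log h, div_mul_cancel₀]
    exact_mod_cast h.ne'

theorem signedPow_continuous {c : ℂ} (hc : 0 < c.re) : Continuous (signedPow c) := by
  rw [continuous_iff_continuousAt]
  intro w
  rcases eq_or_ne w 0 with rfl | hw
  · rw [ContinuousAt, signedPow_zero]
    refine squeeze_zero_norm (fun w => (norm_signedPow hc w).le) ?_
    have : ContinuousAt (fun w : ℂ => ‖w‖ ^ c.re) 0 :=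
      continuous_norm.continuousAt.rpow_const (Or.inr hc.le)
    have h := this.tendsto
    rwa [norm_zero, Real.zero_rpow hc.ne'] at h
  · have h : ‖w‖ ≠ 0 := (norm_pos_iff.2 hw).ne'
    have h1 : ContinuousAt (fun w : ℂ => (‖w‖ : ℂ)) w := by fun_prop
    have h2 : ContinuousAt (fun w : ℂ => ((Real.log ‖w‖ : ℝ) : ℂ)) w :=
      Complex.continuous_ofReal.continuousAt.comp (continuous_norm.continuousAt.log h)
    exact (continuousAt_id.div h1 (by exact_mod_cast h)).mul
      (Complex.continuous_exp.continuousAt.comp (continuousAt_const.mul h2))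

theorem hasDerivAt_signedPow (c w : ℂ) :
    HasDerivAt (fun c => signedPow c w) (((Real.log ‖w‖ : ℝ) : ℂ) * signedPow c w) c := by
  have := (((hasDerivAt_id' c).mul_const ((Real.log ‖w‖ : ℝ) : ℂ)).cexp).const_mul (w / (‖w‖ : ℂ))
  refine this.congr_deriv ?_
  simp only [signedPow]; ring

/-- This keeps the derivative in c bounded near the zeros of a function, where the logarithm is
singular. -/
theorem norm_log_mul_signedPow_le {c w : ℂ} (hc : 0 < c.re) (hw : ‖w‖ ≤ 1) :
    ‖((Real.log ‖w‖ : ℝ) : ℂ) * signedPow c w‖ ≤ 1 / c.re := by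
  rcases eq_or_ne w 0 with rfl | h
  · rw [signedPow_zero, mul_zero, norm_zero]; positivity
  · have h0 : 0 < ‖w‖ := norm_pos_iff.2 h
    rw [norm_mul, Complex.norm_real, norm_signedPow hc, Real.norm_eq_abs,
      ← abs_of_pos (Real.rpow_pos_of_pos h0 c.re), ← abs_mul]
    exact (Real.abs_log_mul_self_rpow_lt _ _ h0 hw hc).le

theorem norm_signedPow_le_one {c w : ℂ} (hc : 0 < c.re) (hw : ‖w‖ ≤ 1) : ‖signedPow c w‖ ≤ 1 := by
  rw [norm_signedPow hc]; exact Real.rpow_le_one (norm_nonneg _) hw hc.le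

section Interpolation

variable {E : Type*} [NormedAddCommGroup E] [NormedSpace ℝ E] [FiniteDimensional ℝ E]
  [MeasurableSpace E] [BorelSpace E] {μ : Measure E} [IsFiniteMeasureOnCompacts μ] [SFinite μ]

open Set Filter Topology

omit [NormedSpace ℝ E] [FiniteDimensional ℝ E] [SFinite μ] in
theorem integrable_kernel_mul {k : E × E → ℂ} {M : ℝ} (hk : AEStronglyMeasurable k (μ.prod μ))
    (hM : ∀ z, ‖k z‖ ≤ M) {f g : E → ℂ} (hf : Continuous f) (hfc : HasCompactSupport f)
    (hg : Continuous g) (hgc : HasCompactSupport g) :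
    Integrable (fun z : E × E => k z * (f z.1 * g z.2)) (μ.prod μ) :=
  ((hf.integrable_of_hasCompactSupport hfc).mul_prod
    (hg.integrable_of_hasCompactSupport hgc)).bdd_mul hk (Eventually.of_forall hM)

-- Holomorphy of the family to which the three lines theorem is applied. The normalisation |f|, |g|
-- ≤ 1 bounds the logarithmic derivatives by 1/Re d ≤ 2/Re c on the half plane Re d > Re c/2, and
-- compact support makes this bound integrable.
omit [NormedSpace ℝ E] [FiniteDimensional ℝ E] in
theorem differentiableAt_integral_kernel_signedPow {k : E × E → ℂ} {M : ℝ}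
    (hk : AEStronglyMeasurable k (μ.prod μ)) (hM : ∀ z, ‖k z‖ ≤ M) {f g : E → ℂ}
    (hf : Continuous f) (hfc : HasCompactSupport f) (hf1 : ∀ x, ‖f x‖ ≤ 1)
    (hg : Continuous g) (hgc : HasCompactSupport g) (hg1 : ∀ x, ‖g x‖ ≤ 1)
    {c : ℂ} (hc : 0 < c.re) :
    DifferentiableAt ℂ (fun c => ∫ z : E × E, k z * (signedPow c (f z.1) * signedPow c (g z.2))
      ∂(μ.prod μ)) c := by
  set T : Set (E × E) := tsupport f ×ˢ tsupport g
  have hM0 : 0 ≤ M := (norm_nonneg _).trans (hM 0)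
  have hTm : MeasurableSet T := (isClosed_tsupport f).measurableSet.prod
    (isClosed_tsupport g).measurableSet
  have hTf : (μ.prod μ) T ≠ ⊤ := by
    rw [Measure.prod_prod]
    exact ENNReal.mul_ne_top hfc.measure_lt_top.ne hgc.measure_lt_top.ne
  have hcomp : ∀ {c : ℂ}, 0 < c.re → ∀ {f : E → ℂ}, Continuous f → HasCompactSupport f →
      Continuous (fun x => signedPow c (f x)) ∧ HasCompactSupport fun x => signedPow c (f x) :=
    fun hc f hf hfc => ⟨(signedPow_continuous hc).comp hf, hfc.comp_left (signedPow_zero _)⟩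
  have hopen : IsOpen {d : ℂ | c.re / 2 < d.re} := isOpen_lt continuous_const Complex.continuous_re
  have hmem : {d : ℂ | c.re / 2 < d.re} ∈ 𝓝 c := hopen.mem_nhds (by simp only [mem_ofPred_eq]; linarith)
  have hlog : ∀ {f : E → ℂ}, Continuous f → AEStronglyMeasurable
      (fun x => ((Real.log ‖f x‖ : ℝ) : ℂ)) μ := fun hf =>
    (Complex.measurable_ofReal.comp (Real.measurable_log.comp hf.norm.measurable)).aestronglyMeasurable
  have hI : ∀ d : ℂ, 0 < d.re → Integrable
      (fun z : E × E => k z * (signedPow d (f z.1) * signedPow d (g z.2))) (μ.prod μ) := fun d hd =>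
    integrable_kernel_mul (f := fun x => signedPow d (f x)) (g := fun x => signedPow d (g x)) hk hM
      (hcomp hd hf hfc).1 (hcomp hd hf hfc).2 (hcomp hd hg hgc).1 (hcomp hd hg hgc).2
  have key := hasDerivAt_integral_of_dominated_loc_of_deriv_le (μ := μ.prod μ) (𝕜 := ℂ)
    (F := fun c z => k z * (signedPow c (f z.1) * signedPow c (g z.2)))
    (F' := fun c z => k z * ((((Real.log ‖f z.1‖ : ℝ) : ℂ) * signedPow c (f z.1)) *
      signedPow c (g z.2) + signedPow c (f z.1) *
        (((Real.log ‖g z.2‖ : ℝ) : ℂ) * signedPow c (g z.2))))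
    (x₀ := c) (s := {d : ℂ | c.re / 2 < d.re})
    (bound := T.indicator fun _ => M * (1 / (c.re / 2) * 1 + 1 * (1 / (c.re / 2)))) hmem ?_ ?_ ?_
    ?_ ?_ ?_
  · exact key.2.differentiableAt
  · filter_upwards [hmem] with d hd
    have hd0 : 0 < d.re := (half_pos hc).trans hd
    exact (hI d hd0).aestronglyMeasurable
  · exact hI c hc
  · have a1 := (hcomp hc hf hfc).1.aestronglyMeasurable (μ := μ)
    have a2 := (hcomp hc hg hgc).1.aestronglyMeasurable (μ := μ)
    have m1 : AEStronglyMeasurable (fun z : E × E => signedPow c (f z.1)) (μ.prod μ) := a1.comp_fst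
    have m2 : AEStronglyMeasurable (fun z : E × E => signedPow c (g z.2)) (μ.prod μ) := a2.comp_snd
    have m3 : AEStronglyMeasurable (fun z : E × E => ((Real.log ‖f z.1‖ : ℝ) : ℂ)) (μ.prod μ) :=
      (hlog hf).comp_fst
    have m4 : AEStronglyMeasurable (fun z : E × E => ((Real.log ‖g z.2‖ : ℝ) : ℂ)) (μ.prod μ) :=
      (hlog hg).comp_snd
    exact hk.mul (((m3.mul m1).mul m2).add (m1.mul (m4.mul m2)))
  · refine Eventually.of_forall fun z d hd => ?_
    have hd0 : 0 < d.re := (half_pos hc).trans hd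
    by_cases hz : z ∈ T
    · rw [indicator_of_mem hz, norm_mul]
      refine mul_le_mul (hM z) ?_ (norm_nonneg _) hM0
      refine (norm_add_le _ _).trans ?_
      have e : 1 / d.re ≤ 1 / (c.re / 2) := one_div_le_one_div_of_le (half_pos hc) (le_of_lt hd)
      refine add_le_add ?_ ?_
      · rw [norm_mul]
        exact mul_le_mul ((norm_log_mul_signedPow_le hd0 (hf1 _)).trans e)
          (norm_signedPow_le_one hd0 (hg1 _)) (norm_nonneg _) (by positivity)
      · rw [norm_mul]
        exact mul_le_mul (norm_signedPow_le_one hd0 (hf1 _))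
          ((norm_log_mul_signedPow_le hd0 (hg1 _)).trans e) (norm_nonneg _) zero_le_one
    · rw [indicator_of_notMem hz]
      have : f z.1 = 0 ∨ g z.2 = 0 := by
        by_contra! h
        exact hz ⟨subset_tsupport _ h.1, subset_tsupport _ h.2⟩
      rcases this with h | h <;> simp [h, signedPow_zero]
  · exact (integrable_indicator_iff hTm).2 (integrableOn_const hTf)
  · refine Eventually.of_forall fun z d hd => ?_
    exact ((hasDerivAt_signedPow d (f z.1)).mul (hasDerivAt_signedPow d (g z.2))).const_mul (k z)

omit [SFinite μ] in
/-- An `L²` bound for a bilinear form with bounded kernel extends from smooth to continuous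
functions. -/
theorem norm_integral_kernel_le_of_smooth {k : E × E → ℂ} {M : ℝ}
    (hk : AEStronglyMeasurable k (μ.prod μ)) (hM : ∀ z, ‖k z‖ ≤ M)
    (h2 : ∀ f g : E → ℂ, ContDiff ℝ ((⊤ : ℕ∞) : WithTop ℕ∞) f → HasCompactSupport f → ContDiff ℝ ((⊤ : ℕ∞) : WithTop ℕ∞) g →
      HasCompactSupport g → ‖∫ z : E × E, k z * (f z.1 * g z.2) ∂(μ.prod μ)‖ ≤
        √(∫ x, ‖f x‖ ^ 2 ∂μ) * √(∫ x, ‖g x‖ ^ 2 ∂μ))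
    {f g : E → ℂ} (hf : Continuous f) (hfc : HasCompactSupport f)
    (hg : Continuous g) (hgc : HasCompactSupport g) :
    ‖∫ z : E × E, k z * (f z.1 * g z.2) ∂(μ.prod μ)‖ ≤
        √(∫ x, ‖f x‖ ^ 2 ∂μ) * √(∫ x, ‖g x‖ ^ 2 ∂μ) := by
  -- Complex powers of smooth functions are merely continuous, which is why the L² bound must be
  -- extended. The approximations are uniformly close to f and vanish outside its support, so that
  -- one integrable majorant serves all of them.
  have happ : ∀ {f : E → ℂ}, Continuous f → HasCompactSupport f → ∃ F : ℕ → E → ℂ,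
      (∀ j, ContDiff ℝ ((⊤ : ℕ∞) : WithTop ℕ∞) (F j)) ∧ (∀ j, HasCompactSupport (F j)) ∧
      (∀ j x, ‖F j x‖ ≤ (tsupport f).indicator (fun x => ‖f x‖ + 1) x) ∧
      (∀ x, Tendsto (fun j => F j x) atTop (𝓝 (f x))) := by
    intro f hf hfc
    have : ∀ j : ℕ, ∃ g : E → ℂ, ContDiff ℝ ((⊤ : ℕ∞) : WithTop ℕ∞) g ∧ (∀ x, dist (g x) (f x) < 1 / ((j : ℝ) + 1)) ∧
        Function.support g ⊆ Function.support f := fun j => by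
      have := hf.exists_contDiff_approx (ε := fun _ => 1 / ((j : ℝ) + 1)) ⊤ continuous_const
        (fun _ => by positivity)
      exact this
    choose F h1 h2 h3 using this
    refine ⟨F, h1, fun j => hfc.mono (h3 j), fun j x => ?_, fun x => ?_⟩
    · by_cases hx : x ∈ tsupport f
      · rw [indicator_of_mem hx]
        have e1 := h2 j x
        rw [dist_eq_norm] at e1
        have e2 : 1 / ((j : ℝ) + 1) ≤ 1 := by
          rw [div_le_one (by positivity)]; linarith [(Nat.cast_nonneg j : (0 : ℝ) ≤ j)]
        have := norm_le_norm_add_norm_sub' (F j x) (f x)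
        linarith
      · rw [indicator_of_notMem hx]
        have : F j x = 0 := by
          by_contra h
          exact hx (subset_tsupport _ (h3 j h))
        rw [this, norm_zero]
    · rw [tendsto_iff_dist_tendsto_zero]
      exact squeeze_zero (fun _ => dist_nonneg) (fun j => (h2 j x).le)
        tendsto_one_div_add_atTop_nhds_zero_nat
  obtain ⟨F, F1, F2, F3, F4⟩ := happ hf hfc
  obtain ⟨G, G1, G2, G3, G4⟩ := happ hg hgc
  have hint : ∀ {f : E → ℂ}, Continuous f → HasCompactSupport f → ∀ m : ℕ, m ≠ 0 →
      Integrable (fun x => ((tsupport f).indicator (fun x => ‖f x‖ + 1) x) ^ m) μ := by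
    intro f hf hfc m hm
    have : (fun x => ((tsupport f).indicator (fun x => ‖f x‖ + 1) x) ^ m) =
        (tsupport f).indicator fun x => (‖f x‖ + 1) ^ m := by
      ext x; by_cases hx : x ∈ tsupport f
      · rw [indicator_of_mem hx, indicator_of_mem hx]
      · rw [indicator_of_notMem hx, indicator_of_notMem hx, zero_pow hm]
    rw [this, integrable_indicator_iff (isClosed_tsupport f).measurableSet]
    exact (by fun_prop : Continuous fun x => (‖f x‖ + 1) ^ m).continuousOn.integrableOn_compact hfc
  have hlim2 : ∀ {f : E → ℂ}, Continuous f → HasCompactSupport f → ∀ {F : ℕ → E → ℂ},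
      (∀ j, ContDiff ℝ ((⊤ : ℕ∞) : WithTop ℕ∞) (F j)) →
      (∀ j x, ‖F j x‖ ≤ (tsupport f).indicator (fun x => ‖f x‖ + 1) x) →
      (∀ x, Tendsto (fun j => F j x) atTop (𝓝 (f x))) →
      Tendsto (fun j => √(∫ x, ‖F j x‖ ^ 2 ∂μ)) atTop (𝓝 (√(∫ x, ‖f x‖ ^ 2 ∂μ))) := by
    intro f hf hfc F F1 F3 F4
    refine (Real.continuous_sqrt.tendsto _).comp ?_
    refine tendsto_integral_of_dominated_convergence _ (fun j => ?_) (hint hf hfc 2 two_ne_zero)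
      (fun j => Eventually.of_forall fun x => ?_) (Eventually.of_forall fun x => ?_)
    · exact ((F1 j).continuous.norm.pow 2).aestronglyMeasurable
    · rw [norm_pow, norm_norm]
      exact pow_le_pow_left₀ (norm_nonneg _) (F3 j x) 2
    · exact ((F4 x).norm).pow 2
  have hlim : Tendsto (fun j => ‖∫ z : E × E, k z * (F j z.1 * G j z.2) ∂(μ.prod μ)‖) atTop
      (𝓝 ‖∫ z : E × E, k z * (f z.1 * g z.2) ∂(μ.prod μ)‖) := by
    refine Tendsto.norm ?_
    have h1f := hint hf hfc 1 one_ne_zero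
    have h1g := hint hg hgc 1 one_ne_zero
    simp only [pow_one] at h1f h1g
    refine tendsto_integral_of_dominated_convergence _ (fun j => ?_)
      ((h1f.mul_prod h1g).const_mul M)
      (fun j => Eventually.of_forall fun z => ?_) (Eventually.of_forall fun z => ?_)
    · exact (integrable_kernel_mul hk hM (F1 j).continuous (F2 j) (G1 j).continuous
        (G2 j)).aestronglyMeasurable
    · rw [norm_mul, norm_mul]
      exact mul_le_mul (hM z) (mul_le_mul (F3 j _) (G3 j _) (norm_nonneg _)
        ((norm_nonneg _).trans (F3 j _))) (by positivity) ((norm_nonneg _).trans (hM z))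
    · exact ((F4 z.1).mul (G4 z.2)).const_mul _
  exact le_of_tendsto_of_tendsto' hlim ((hlim2 hf hfc F1 F3 F4).mul (hlim2 hg hgc G1 G3 G4))
    fun j => h2 _ _ (F1 j) (F2 j) (G1 j) (G2 j)

/-- Riesz–Thorin interpolation on the diagonal for bilinear forms given by a bounded kernel. -/
theorem norm_integral_kernel_le_interpolation {k : E × E → ℂ} {M : ℝ}
    (hk : AEStronglyMeasurable k (μ.prod μ)) (hM : ∀ z, ‖k z‖ ≤ M)
    (h2 : ∀ f g : E → ℂ, ContDiff ℝ ((⊤ : ℕ∞) : WithTop ℕ∞) f → HasCompactSupport f → ContDiff ℝ ((⊤ : ℕ∞) : WithTop ℕ∞) g →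
      HasCompactSupport g → ‖∫ z : E × E, k z * (f z.1 * g z.2) ∂(μ.prod μ)‖ ≤
        √(∫ x, ‖f x‖ ^ 2 ∂μ) * √(∫ x, ‖g x‖ ^ 2 ∂μ))
    {θ p : ℝ} (hθ0 : 0 ≤ θ) (hθ1 : θ ≤ 1) (hp : p * (1 + θ) = 2)
    {f g : E → ℂ} (hf : Continuous f) (hfc : HasCompactSupport f)
    (hg : Continuous g) (hgc : HasCompactSupport g) :
    ‖∫ z : E × E, k z * (f z.1 * g z.2) ∂(μ.prod μ)‖ ≤
      M ^ θ * (∫ x, ‖f x‖ ^ p ∂μ) ^ (1 / p) * (∫ x, ‖g x‖ ^ p ∂μ) ^ (1 / p) := by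
  have hp0 : 0 < p := by
    by_contra h
    nlinarith
  have hM0 : 0 ≤ M := (norm_nonneg _).trans (hM 0)
  have core : ∀ f g : E → ℂ, Continuous f → HasCompactSupport f → (∀ x, ‖f x‖ ≤ 1) →
      Continuous g → HasCompactSupport g → (∀ x, ‖g x‖ ≤ 1) →
      ‖∫ z : E × E, k z * (f z.1 * g z.2) ∂(μ.prod μ)‖ ≤
      M ^ θ * (∫ x, ‖f x‖ ^ p ∂μ) ^ (1 / p) * (∫ x, ‖g x‖ ^ p ∂μ) ^ (1 / p) := by
    intro f g hf hfc hf1 hg hgc hg1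
    set a := ∫ x, ‖f x‖ ^ p ∂μ with ha
    set b := ∫ x, ‖g x‖ ^ p ∂μ with hb
    have ha0 : 0 ≤ a := integral_nonneg fun x => by positivity
    have hb0 : 0 ≤ b := integral_nonneg fun x => by positivity
    have hre : ∀ z : ℂ, ((p : ℂ) / 2 * (1 + z)).re = p / 2 * (1 + z.re) := fun z => by
      have : (p : ℂ) / 2 * (1 + z) = ((p / 2 : ℝ) : ℂ) * (1 + z) := by push_cast; ring
      rw [this, Complex.re_ofReal_mul, Complex.add_re, Complex.one_re]
    have hpos : ∀ z : ℂ, -1 < z.re → 0 < ((p : ℂ) / 2 * (1 + z)).re := fun z hz => by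
      rw [hre]; have : 0 < 1 + z.re := by linarith
      positivity
    have hcomp : ∀ {c : ℂ}, 0 < c.re → ∀ {f : E → ℂ}, Continuous f → HasCompactSupport f →
        Continuous (fun x => signedPow c (f x)) ∧ HasCompactSupport fun x => signedPow c (f x) :=
      fun hc f hf hfc => ⟨(signedPow_continuous hc).comp hf, hfc.comp_left (signedPow_zero _)⟩
    -- The exponent is c = (p/2)(1+z). On Re z = 0 the powers have modulus |f|^{p/2}, with L² norm
    -- √a; on Re z = 1 they have modulus |f|^p, with L¹ norm a. At z = θ the exponent is 1, because
    -- p(1+θ) = 2, and f, g themselves return. The interpolated bound is (√(ab))^{1-θ}(Mab)^θ =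
    -- M^θ(ab)^{1/p}.
    set B : ℂ → ℂ := fun c => ∫ z : E × E, k z * (signedPow c (f z.1) * signedPow c (g z.2))
      ∂(μ.prod μ) with hB
    have hd : ∀ z : ℂ, -1 < z.re → DifferentiableAt ℂ (fun z => B ((p : ℂ) / 2 * (1 + z))) z := by
      intro z hz
      have h1 : DifferentiableAt ℂ B ((p : ℂ) / 2 * (1 + z)) :=
        differentiableAt_integral_kernel_signedPow hk hM hf hfc hf1 hg hgc hg1 (hpos z hz)
      have h2 : DifferentiableAt ℂ (fun z : ℂ => (p : ℂ) / 2 * (1 + z)) z := by fun_prop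
      change DifferentiableAt ℂ (B ∘ fun z : ℂ => (p : ℂ) / 2 * (1 + z)) z
      exact h1.comp z h2
    have hBle1 : ∀ c : ℂ, 0 < c.re → ‖B c‖ ≤ M * ((∫ x, ‖f x‖ ^ c.re ∂μ) * ∫ x, ‖g x‖ ^ c.re ∂μ) := by
      intro c hc
      have hi := (hcomp hc hf hfc).1.integrable_of_hasCompactSupport (hcomp hc hf hfc).2 (μ := μ)
      have hj := (hcomp hc hg hgc).1.integrable_of_hasCompactSupport (hcomp hc hg hgc).2 (μ := μ)
      have := norm_integral_le_of_norm_le (μ := μ.prod μ)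
        (f := fun z : E × E => k z * (signedPow c (f z.1) * signedPow c (g z.2)))
        ((hi.norm.mul_prod hj.norm).const_mul M) (Eventually.of_forall fun z => by
          rw [norm_mul, norm_mul]
          exact mul_le_mul_of_nonneg_right (hM z) (by positivity))
      rw [integral_const_mul, integral_prod_mul (fun x => ‖signedPow c (f x)‖)
        (fun x => ‖signedPow c (g x)‖)] at this
      simpa only [norm_signedPow hc] using this
    have hB2 : ∀ c : ℂ, 0 < c.re → c.re = p / 2 → ‖B c‖ ≤ √a * √b := by
      intro c hc hcp
      have := norm_integral_kernel_le_of_smooth hk hM h2 (hcomp hc hf hfc).1 (hcomp hc hf hfc).2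
        (hcomp hc hg hgc).1 (hcomp hc hg hgc).2
      have e : ∀ w : ℂ, ‖signedPow c w‖ ^ 2 = ‖w‖ ^ p := fun w => by
        rw [norm_signedPow hc, hcp, ← Real.rpow_natCast, ← Real.rpow_mul (norm_nonneg _)]
        congr 1; push_cast; ring
      simpa only [e] using this
    -- As |f| ≤ 1, the integral of |f|^s decreases in s; this gives the boundedness on the closed
    -- strip that the three lines theorem requires.
    have hmono : ∀ {f : E → ℂ}, Continuous f → HasCompactSupport f → (∀ x, ‖f x‖ ≤ 1) →
        ∀ s, p / 2 ≤ s → ∫ x, ‖f x‖ ^ s ∂μ ≤ ∫ x, ‖f x‖ ^ (p / 2) ∂μ := by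
      intro f hf hfc hf1 s hs
      have hh : ∀ s : ℝ, 0 < s → Integrable (fun x => ‖f x‖ ^ s) μ := fun s hs =>
        (hf.norm.rpow_const fun _ => Or.inr hs.le).integrable_of_hasCompactSupport
          (hfc.norm.comp_left (g := fun y : ℝ => y ^ s) (Real.zero_rpow hs.ne'))
      have hp2 : 0 < p / 2 := by positivity
      refine integral_mono (hh s (hp2.trans_le hs)) (hh _ hp2) fun x => ?_
      rcases (norm_nonneg (f x)).eq_or_lt with h | h
      · simp only [← h]
        rw [Real.zero_rpow hp2.ne', Real.zero_rpow (hp2.trans_le hs).ne']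
      · exact Real.rpow_le_rpow_of_exponent_ge h (hf1 x) hs
    have hthree := Complex.HadamardThreeLines.norm_le_interp_of_mem_verticalClosedStrip₀₁'
      (fun z => B ((p : ℂ) / 2 * (1 + z))) (z := (θ : ℂ)) (a := √a * √b) (b := M * (a * b))
      ?_ ?_ ?_ ?_ ?_
    · have e1 : (p : ℂ) / 2 * (1 + (θ : ℂ)) = 1 := by
        have : (p : ℂ) * (1 + θ) = 2 := by exact_mod_cast hp
        linear_combination this / 2
      simp only [e1, hB, signedPow_one, Complex.ofReal_re] at hthree
      refine hthree.trans (le_of_eq ?_)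
      rw [← Real.sqrt_mul ha0, Real.sqrt_eq_rpow, ← Real.rpow_mul (by positivity),
        Real.mul_rpow hM0 (by positivity), mul_left_comm, mul_assoc, ← Real.mul_rpow ha0 hb0]
      congr 1
      have hab : 0 ≤ a * b := by positivity
      rw [← Real.rpow_add_of_nonneg hab (by nlinarith) hθ0]
      congr 1
      field_simp
      linarith
    · simp [Complex.HadamardThreeLines.verticalClosedStrip, hθ0, hθ1]
    · refine DifferentiableOn.diffContOnCl fun z hz => (hd z ?_).differentiableWithinAt
      have : closure (Complex.HadamardThreeLines.verticalStrip 0 1) ⊆ {z : ℂ | 0 ≤ z.re} := by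
        refine closure_minimal (fun z hz => ?_) (isClosed_le continuous_const Complex.continuous_re)
        exact hz.1.le
      have := this hz
      simp only [mem_ofPred_eq] at this
      linarith
    · refine ⟨M * ((∫ x, ‖f x‖ ^ (p / 2) ∂μ) * ∫ x, ‖g x‖ ^ (p / 2) ∂μ), ?_⟩
      rintro _ ⟨z, hz, rfl⟩
      have hz0 : 0 ≤ z.re := hz.1
      refine (hBle1 _ (hpos z (by linarith))).trans ?_
      have hs : p / 2 ≤ ((p : ℂ) / 2 * (1 + z)).re := by rw [hre]; nlinarith
      refine mul_le_mul_of_nonneg_left (mul_le_mul (hmono hf hfc hf1 _ hs) (hmono hg hgc hg1 _ hs)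
        (integral_nonneg fun x => by positivity) (integral_nonneg fun x => by positivity)) hM0
    · intro z hz
      have hz0 : z.re = 0 := hz
      exact hB2 _ (hpos z (by linarith)) (by rw [hre, hz0]; ring)
    · intro z hz
      have hz0 : z.re = 1 := hz
      have := hBle1 _ (hpos z (by linarith))
      rwa [hre, hz0, show p / 2 * (1 + 1) = p by ring] at this
  -- Both sides are homogeneous of degree one in f and in g, so rescaling reduces to sup norm at
  -- most 1; the maximum with 1 avoids division by zero.
  obtain ⟨A, hA⟩ := hfc.exists_bound_of_continuous hf
  obtain ⟨A', hA'⟩ := hgc.exists_bound_of_continuous hg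
  set r := max A 1
  set s := max A' 1
  have hr : 0 < r := lt_max_of_lt_right one_pos
  have hs : 0 < s := lt_max_of_lt_right one_pos
  have hrC : (r : ℂ) ≠ 0 := by exact_mod_cast hr.ne'
  have hsC : (s : ℂ) ≠ 0 := by exact_mod_cast hs.ne'
  have := core (fun x => (r : ℂ)⁻¹ * f x) (fun x => (s : ℂ)⁻¹ * g x) (by fun_prop) hfc.mul_left ?_
    (by fun_prop) hgc.mul_left ?_
  · have e : ∀ r : ℝ, 0 < r → ∀ f : E → ℂ, (∫ x, ‖(r : ℂ)⁻¹ * f x‖ ^ p ∂μ) ^ (1 / p) =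
        r⁻¹ * (∫ x, ‖f x‖ ^ p ∂μ) ^ (1 / p) := by
      intro r hr f
      have : ∀ x, ‖(r : ℂ)⁻¹ * f x‖ ^ p = r⁻¹ ^ p * ‖f x‖ ^ p := fun x => by
        rw [norm_mul, norm_inv, Complex.norm_real, Real.norm_of_nonneg hr.le,
          Real.mul_rpow (by positivity) (norm_nonneg _)]
      simp only [this]
      rw [integral_const_mul, Real.mul_rpow (by positivity) (integral_nonneg fun x => by positivity),
        ← Real.rpow_mul (by positivity), mul_one_div_cancel hp0.ne', Real.rpow_one]
    rw [e r hr, e s hs] at this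
    have e2 : ∫ z : E × E, k z * ((r : ℂ)⁻¹ * f z.1 * ((s : ℂ)⁻¹ * g z.2)) ∂(μ.prod μ) =
        (r : ℂ)⁻¹ * (s : ℂ)⁻¹ * ∫ z : E × E, k z * (f z.1 * g z.2) ∂(μ.prod μ) := by
      rw [← integral_const_mul]; congr 1; ext z; ring
    rw [e2, norm_mul, norm_mul, norm_inv, norm_inv, Complex.norm_real, Complex.norm_real,
      Real.norm_of_nonneg hr.le, Real.norm_of_nonneg hs.le] at this
    have h3 : 0 < r⁻¹ * s⁻¹ := by positivity
    refine le_of_mul_le_mul_left (this.trans (le_of_eq ?_)) h3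
    ring
  · intro x
    rw [norm_mul, norm_inv, Complex.norm_real, Real.norm_of_nonneg hr.le, inv_mul_le_iff₀ hr, mul_one]
    exact (hA x).trans (le_max_left _ _)
  · intro x
    rw [norm_mul, norm_inv, Complex.norm_real, Real.norm_of_nonneg hs.le, inv_mul_le_iff₀ hs, mul_one]
    exact (hA' x).trans (le_max_left _ _)

end Interpolation

/-! ### Fourier multipliers as bilinear forms, and the Schrödinger propagator at complex time. -/

section Multipliers

open Set Filter Topology FourierTransform

variable {n : ℕ}

/-- The `L^p` norm as a real number. -/
noncomputable def realLpNorm (p : ℝ) (f : RSpace n → ℂ) : ℝ := (∫ x, ‖f x‖ ^ p) ^ (1 / p)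

theorem realLpNorm_nonneg (p : ℝ) (f : RSpace n → ℂ) : 0 ≤ realLpNorm p f :=
  Real.rpow_nonneg (integral_nonneg fun _ => by positivity) _

/-- The bilinear form `∫ (m(D) f) g` is bounded by `N ‖f‖_p ‖g‖_p`. -/
def FormBound (p : ℝ) (m : RSpace n → ℂ) (N : ℝ) : Prop :=
  ∀ f g : 𝓢(RSpace n, ℂ), HasCompactSupport f → HasCompactSupport g →
    ‖∫ ξ, m ξ * (𝓕 f ξ * 𝓕⁻ g ξ)‖ ≤ N * (realLpNorm p f * realLpNorm p g)

/-- The Fourier multiplier `m` is the convolution with `K`. -/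
def HasKernel (m K : RSpace n → ℂ) : Prop :=
  ∀ f g : 𝓢(RSpace n, ℂ), HasCompactSupport f → HasCompactSupport g →
    ∫ ξ, m ξ * (𝓕 f ξ * 𝓕⁻ g ξ) = ∫ z : RSpace n × RSpace n, K (z.2 - z.1) * (f z.1 * g z.2)

theorem integral_norm_sq_fourierInv (g : 𝓢(RSpace n, ℂ)) :
    ∫ ξ, ‖𝓕⁻ g ξ‖ ^ 2 = ∫ x, ‖g x‖ ^ 2 := by
  rw [← integral_norm_sq_fourier, FourierTransform.fourier_fourierInv_eq]

theorem integrable_fourier_mul_fourierInv (f g : 𝓢(RSpace n, ℂ)) :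
    Integrable fun ξ => 𝓕 f ξ * 𝓕⁻ g ξ := by
  obtain ⟨C, hC⟩ : ∃ C, ∀ x, ‖𝓕 f x‖ ≤ C := by
    obtain ⟨C, hC⟩ := (𝓕 f).decay 0 0
    exact ⟨C, fun x => by simpa using hC.2 x⟩
  exact (𝓕⁻ g).integrable.bdd_mul (𝓕 f).continuous.aestronglyMeasurable
    (Eventually.of_forall hC)

theorem integral_norm_mul_le_sqrt (f g : 𝓢(RSpace n, ℂ)) :
    ∫ x, ‖f x‖ * ‖g x‖ ≤ √(∫ x, ‖f x‖ ^ 2) * √(∫ x, ‖g x‖ ^ 2) := by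
  have h : (2 : ℝ).HolderConjugate 2 := Real.HolderConjugate.two_two
  have := integral_mul_norm_le_Lp_mul_Lq (μ := (volume : Measure (RSpace n))) h
    (f.memLp (ENNReal.ofReal 2)) (g.memLp (ENNReal.ofReal 2))
  simpa only [Real.sqrt_eq_rpow, Real.rpow_two] using this

/-- Plancherel and Cauchy–Schwarz; this is the L² endpoint of the interpolation. -/
theorem norm_integral_multiplier_le {m : RSpace n → ℂ} (hm1 : ∀ ξ, ‖m ξ‖ ≤ 1)
    (f g : 𝓢(RSpace n, ℂ)) :
    ‖∫ ξ, m ξ * (𝓕 f ξ * 𝓕⁻ g ξ)‖ ≤ √(∫ x, ‖f x‖ ^ 2) * √(∫ x, ‖g x‖ ^ 2) := by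
  rw [← integral_norm_sq_fourier f, ← integral_norm_sq_fourierInv g]
  refine le_trans ?_ (integral_norm_mul_le_sqrt (𝓕 f) (𝓕⁻ g))
  refine norm_integral_le_of_norm_le ?_ (Eventually.of_forall fun ξ => ?_)
  · simpa only [norm_mul] using (integrable_fourier_mul_fourierInv f g).norm
  · rw [norm_mul, norm_mul]
    exact mul_le_of_le_one_left (by positivity) (hm1 ξ)

theorem HasKernel.formBound {m K : RSpace n → ℂ} {M θ p : ℝ} (h : HasKernel m K)
    (hm1 : ∀ ξ, ‖m ξ‖ ≤ 1) (hK : Measurable K) (hM : ∀ z, ‖K z‖ ≤ M)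
    (hθ0 : 0 ≤ θ) (hθ1 : θ ≤ 1) (hp : p * (1 + θ) = 2) : FormBound p m (M ^ θ) := by
  intro f g hf hg
  rw [h f g hf hg]
  have := norm_integral_kernel_le_interpolation (μ := (volume : Measure (RSpace n)))
    (k := fun z => K (z.2 - z.1)) (M := M)
    (hK.comp (measurable_snd.sub measurable_fst)).aestronglyMeasurable (fun z => hM _) ?_
    hθ0 hθ1 hp f.continuous hf g.continuous hg
  · rw [mul_assoc] at this
    exact this
  · intro f g hf hfc hg hgc
    have e := h (hfc.toSchwartzMap hf) (hgc.toSchwartzMap hg) hfc hgc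
    have e' := norm_integral_multiplier_le hm1 (hfc.toSchwartzMap hf) (hgc.toSchwartzMap hg)
    rw [e] at e'
    exact e'

theorem HasKernel.of_integrable {m : RSpace n → ℂ} (hm : Integrable m) : HasKernel m (𝓕⁻ m) := by
  intro f g _ _
  have hfg : Integrable (fun z : RSpace n × RSpace n => f z.1 * g z.2) :=
    f.integrable.mul_prod g.integrable
  set c : RSpace n → RSpace n × RSpace n → ℂ := fun ξ z =>
    Complex.exp (((2 * Real.pi * inner ℝ ξ (z.2 - z.1) : ℝ) : ℂ) * Complex.I) with hc
  have hI : Integrable (Function.uncurry fun (ξ : RSpace n) (z : RSpace n × RSpace n) =>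
      c ξ z * (m ξ * (f z.1 * g z.2))) := by
    refine (hm.mul_prod hfg).bdd_mul (c := 1) ?_ (Eventually.of_forall fun z => ?_)
    · refine Continuous.aestronglyMeasurable ?_
      simp only [hc]
      fun_prop
    · exact (Complex.norm_exp_ofReal_mul_I _).le
  have e1 : ∀ ξ, m ξ * (𝓕 f ξ * 𝓕⁻ g ξ) = ∫ z, c ξ z * (m ξ * (f z.1 * g z.2)) := by
    intro ξ
    rw [fourier_coe, fourierInv_coe, Real.fourier_eq', Real.fourierInv_eq',
      ← integral_prod_mul, ← integral_const_mul]
    congr 1; ext z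
    simp only [hc, inner_sub_right, smul_eq_mul]
    rw [real_inner_comm, real_inner_comm ξ z.2]
    have : Complex.exp (((2 * Real.pi * (inner ℝ z.2 ξ - inner ℝ z.1 ξ) : ℝ) : ℂ) * Complex.I) =
      Complex.exp (((-2 * Real.pi * inner ℝ z.1 ξ : ℝ) : ℂ) * Complex.I) *
      Complex.exp (((2 * Real.pi * inner ℝ z.2 ξ : ℝ) : ℂ) * Complex.I) := by
      rw [← Complex.exp_add]; congr 1; push_cast; ring
    rw [real_inner_comm z.1 ξ, real_inner_comm z.2 ξ] at *
    rw [this]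
    ring
  simp only [e1]
  rw [integral_integral_swap hI]
  congr 1; ext z
  rw [Real.fourierInv_eq', ← integral_mul_const]
  congr 1; ext ξ
  simp only [hc, smul_eq_mul]
  ring

theorem FormBound.mono {p N N' : ℝ} {m : RSpace n → ℂ} (h : FormBound p m N) (hN : N ≤ N') :
    FormBound p m N' := fun f g hf hg => (h f g hf hg).trans <|
  mul_le_mul_of_nonneg_right hN (mul_nonneg (realLpNorm_nonneg _ _) (realLpNorm_nonneg _ _))

theorem FormBound.const_mul {p N : ℝ} {m : RSpace n → ℂ} (h : FormBound p m N) (c : ℂ) :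
    FormBound p (fun ξ => c * m ξ) (‖c‖ * N) := fun f g hf hg => by
  simp only [mul_assoc]
  rw [integral_const_mul, norm_mul]
  exact mul_le_mul_of_nonneg_left (h f g hf hg) (norm_nonneg c)

theorem integrable_multiplier_form {m : RSpace n → ℂ} {B : ℝ} (hm : AEStronglyMeasurable m)
    (hB : ∀ ξ, ‖m ξ‖ ≤ B) (f g : 𝓢(RSpace n, ℂ)) :
    Integrable fun ξ => m ξ * (𝓕 f ξ * 𝓕⁻ g ξ) :=
  (integrable_fourier_mul_fourierInv f g).bdd_mul hm (Eventually.of_forall hB)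

theorem FormBound.add {p N N' B B' : ℝ} {m m' : RSpace n → ℂ} (h : FormBound p m N)
    (h' : FormBound p m' N') (hm : AEStronglyMeasurable m) (hm' : AEStronglyMeasurable m')
    (hB : ∀ ξ, ‖m ξ‖ ≤ B) (hB' : ∀ ξ, ‖m' ξ‖ ≤ B') :
    FormBound p (fun ξ => m ξ + m' ξ) (N + N') := fun f g hf hg => by
  simp only [add_mul]
  rw [integral_add (integrable_multiplier_form hm hB f g) (integrable_multiplier_form hm' hB' f g)]
  exact (norm_add_le _ _).trans (add_le_add (h f g hf hg) (h' f g hf hg))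

variable {α : Type*} [MeasurableSpace α] {ν : Measure α} [SFinite ν]

omit [SFinite ν] in
theorem integrable_multiplier_form_prod {c : α → RSpace n → ℂ} {b : α → ℝ}
    (hc : AEStronglyMeasurable (Function.uncurry c) (ν.prod volume))
    (hb : Integrable b ν) (hcb : ∀ᵐ x ∂ν, ∀ ξ, ‖c x ξ‖ ≤ b x) (f g : 𝓢(RSpace n, ℂ)) :
    Integrable (Function.uncurry fun x ξ => c x ξ * (𝓕 f ξ * 𝓕⁻ g ξ)) (ν.prod volume) := by
  have hF := integrable_fourier_mul_fourierInv f g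
  refine (hb.mul_prod hF.norm).mono' (hc.mul hF.aestronglyMeasurable.comp_snd) ?_
  have : ∀ᵐ z ∂(ν.prod (volume : Measure (RSpace n))), ∀ ξ, ‖c z.1 ξ‖ ≤ b z.1 :=
    Measure.quasiMeasurePreserving_fst.ae hcb
  filter_upwards [this] with z hz
  simp only [Function.uncurry, norm_mul]
  exact mul_le_mul_of_nonneg_right (hz _) (by positivity)

/-- Superposition of Fourier multipliers. -/
theorem FormBound.integral {p : ℝ} {c : α → RSpace n → ℂ} {b N : α → ℝ}
    (hc : AEStronglyMeasurable (Function.uncurry c) (ν.prod volume))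
    (hb : Integrable b ν) (hcb : ∀ᵐ x ∂ν, ∀ ξ, ‖c x ξ‖ ≤ b x)
    (hN : Integrable N ν) (h : ∀ᵐ x ∂ν, FormBound p (c x) (N x)) :
    FormBound p (fun ξ => ∫ x, c x ξ ∂ν) (∫ x, N x ∂ν) := fun f g hf hg => by
  simp only [← integral_mul_const]
  rw [← integral_integral_swap (integrable_multiplier_form_prod hc hb hcb f g)]
  refine norm_integral_le_of_norm_le (hN.mul_const _) ?_
  filter_upwards [h] with x hx using hx f g hf hg

/-- Superposition of convolution kernels. -/
theorem HasKernel.integral {c K : α → RSpace n → ℂ} {b d : α → ℝ}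
    (hc : AEStronglyMeasurable (Function.uncurry c) (ν.prod volume))
    (hb : Integrable b ν) (hcb : ∀ᵐ x ∂ν, ∀ ξ, ‖c x ξ‖ ≤ b x)
    (hK : Measurable (Function.uncurry K))
    (hd : Integrable d ν) (hKd : ∀ᵐ x ∂ν, ∀ z, ‖K x z‖ ≤ d x)
    (h : ∀ᵐ x ∂ν, HasKernel (c x) (K x)) :
    HasKernel (fun ξ => ∫ x, c x ξ ∂ν) (fun z => ∫ x, K x z ∂ν) := fun f g hf hg => by
  have hfg : Integrable (fun z : RSpace n × RSpace n => f z.1 * g z.2) :=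
    f.integrable.mul_prod g.integrable
  have hI : Integrable (Function.uncurry fun (x : α) (z : RSpace n × RSpace n) =>
      K x (z.2 - z.1) * (f z.1 * g z.2)) (ν.prod volume) := by
    refine (hd.mul_prod hfg.norm).mono' ?_ ?_
    · have m1 : Measurable fun z : α × (RSpace n × RSpace n) => (z.1, z.2.2 - z.2.1) := by fun_prop
      exact (hK.comp m1).aestronglyMeasurable.mul hfg.aestronglyMeasurable.comp_snd
    · have : ∀ᵐ z ∂(ν.prod (volume : Measure (RSpace n × RSpace n))), ∀ w, ‖K z.1 w‖ ≤ d z.1 :=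
        Measure.quasiMeasurePreserving_fst.ae hKd
      filter_upwards [this] with z hz
      simp only [Function.uncurry]
      rw [norm_mul]
      exact mul_le_mul_of_nonneg_right (hz _) (by positivity)
  simp only [← integral_mul_const]
  rw [← integral_integral_swap (integrable_multiplier_form_prod hc hb hcb f g),
    ← integral_integral_swap hI]
  refine integral_congr_ae ?_
  filter_upwards [h] with x hx using hx f g hf hg

/-- The symbol of `-Δ`. -/
noncomputable def laplaceSymbol (ξ : RSpace n) : ℝ := (2 * Real.pi * ‖ξ‖) ^ 2

theorem laplaceSymbol_nonneg (ξ : RSpace n) : 0 ≤ laplaceSymbol ξ := sq_nonneg _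

@[fun_prop]
theorem laplaceSymbol_continuous : Continuous (laplaceSymbol (n := n)) := by
  unfold laplaceSymbol; fun_prop

/-- The kernel of the complex Schrödinger propagator `e^{-isΔ}`, `Im s ≥ 0`. -/
noncomputable def schrodingerKernel (s : ℂ) (z : RSpace n) : ℂ :=
  (Complex.I / (4 * Real.pi * s)) ^ ((n : ℂ) / 2) *
    Complex.exp (-Complex.I * (‖z‖ : ℂ) ^ 2 / (4 * s))

theorem norm_schrodingerMultiplier_le {s : ℂ} (hs : 0 ≤ s.im) {a : ℝ} (ha : 0 ≤ a) :
    ‖Complex.exp (Complex.I * s * a)‖ ≤ 1 := by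
  rw [Complex.norm_exp, ← Real.exp_zero]
  refine Real.exp_le_exp.2 ?_
  rw [Complex.re_mul_ofReal, Complex.I_mul_re]
  nlinarith

/-- For Im s ≥ 0 the exponential factor has modulus at most 1, so only the power of s counts. The
uniformity over the closed upper half plane is what makes contour deformation possible. -/
theorem norm_schrodingerKernel_le {s : ℂ} (hs : 0 ≤ s.im) (hs0 : s ≠ 0) (z : RSpace n) :
    ‖schrodingerKernel s z‖ ≤ (4 * Real.pi * ‖s‖) ^ (-(n : ℝ) / 2) := by
  have hns : 0 < ‖s‖ := norm_pos_iff.2 hs0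
  rw [schrodingerKernel, norm_mul, show ((n : ℂ) / 2) = (((n : ℝ) / 2 : ℝ) : ℂ) by push_cast; ring,
    Complex.norm_cpow_real, norm_div, Complex.norm_I, norm_mul, norm_mul, Complex.norm_real,
    Real.norm_of_nonneg Real.pi_pos.le, Complex.norm_ofNat, one_div, Real.inv_rpow (by positivity),
    ← Real.rpow_neg (by positivity), neg_div]
  refine mul_le_of_le_one_right (by positivity) ?_
  rw [Complex.norm_exp, ← Real.exp_zero]
  refine Real.exp_le_exp.2 ?_
  have : -Complex.I * (‖z‖ : ℂ) ^ 2 / (4 * s) = (-(‖z‖ ^ 2 / 4) : ℝ) * (Complex.I * s⁻¹) := by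
    push_cast; field_simp
  rw [this, Complex.re_ofReal_mul, Complex.I_mul_re, Complex.inv_im]
  have h1 : 0 ≤ s.im / Complex.normSq s := div_nonneg hs (Complex.normSq_nonneg _)
  have h2 : 0 ≤ ‖z‖ ^ 2 / 4 := by positivity
  rw [neg_div, neg_neg]
  nlinarith

/-- The base is a positive multiple of i s̄, whose real part is Im s ≥ 0. The principal power is
therefore continuous up to the real axis. -/
theorem schrodingerBase_mem_slitPlane {s : ℂ} (hs : 0 ≤ s.im) (hs0 : s ≠ 0) :
    Complex.I / (4 * Real.pi * s) ∈ Complex.slitPlane := by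
  have hN : 0 < Complex.normSq s := Complex.normSq_pos.2 hs0
  have hpi := Real.pi_pos
  have e : Complex.I / (4 * Real.pi * s) =
      (((4 * Real.pi * Complex.normSq s)⁻¹ : ℝ) : ℂ) * (Complex.I * (starRingEnd ℂ) s) := by
    have : s * (starRingEnd ℂ) s = (Complex.normSq s : ℂ) := Complex.mul_conj s
    have hc : (starRingEnd ℂ) s ≠ 0 := by simpa using hs0
    have hpi' : (Real.pi : ℂ) ≠ 0 := by exact_mod_cast hpi.ne'
    push_cast
    rw [← this]
    field_simp
  rw [e, Complex.mem_slitPlane_iff]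
  have h4 : 0 < (4 * Real.pi * Complex.normSq s)⁻¹ := by positivity
  rw [Complex.re_ofReal_mul, Complex.im_ofReal_mul, Complex.I_mul_re, Complex.I_mul_im,
    Complex.conj_im, Complex.conj_re, neg_neg]
  rcases hs.eq_or_lt with h | h
  · right
    have : s.re ≠ 0 := fun h' => hs0 (Complex.ext h' h.symm)
    positivity
  · left; positivity

theorem continuousAt_schrodingerKernel {s : ℂ} (hs : 0 ≤ s.im) (hs0 : s ≠ 0) (z : RSpace n) :
    ContinuousAt (fun s => schrodingerKernel s z) s := by
  have hpi' : (Real.pi : ℂ) ≠ 0 := by exact_mod_cast Real.pi_pos.ne'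
  refine ContinuousAt.mul (ContinuousAt.cpow ?_ continuousAt_const
    (schrodingerBase_mem_slitPlane hs hs0)) (Complex.continuous_exp.continuousAt.comp ?_)
  · exact continuousAt_const.div (by fun_prop) (by simp [hs0, hpi'])
  · exact continuousAt_const.div (by fun_prop) (by simp [hs0])

@[fun_prop]
theorem measurable_schrodingerKernel_right (s : ℂ) :
    Measurable (schrodingerKernel s : RSpace n → ℂ) := by
  unfold schrodingerKernel
  fun_prop

theorem hasKernel_schrodinger_of_im_pos {s : ℂ} (hs : 0 < s.im) :
    HasKernel (fun ξ : RSpace n => Complex.exp (Complex.I * s * laplaceSymbol ξ))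
      (schrodingerKernel s) := by
  have hs0 : s ≠ 0 := fun h => by rw [h] at hs; simp at hs
  have hpi' : (Real.pi : ℂ) ≠ 0 := by exact_mod_cast Real.pi_pos.ne'
  set b : ℂ := -(Complex.I * s) * (2 * Real.pi) ^ 2 with hb
  have hbre : 0 < b.re := by
    have : b = (((2 * Real.pi) ^ 2 : ℝ) : ℂ) * -(Complex.I * s) := by rw [hb]; push_cast; ring
    rw [this, Complex.re_ofReal_mul, Complex.neg_re, Complex.I_mul_re, neg_neg]
    have := Real.pi_pos
    positivity
  have e : (fun ξ : RSpace n => Complex.exp (Complex.I * s * laplaceSymbol ξ)) =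
      fun ξ : RSpace n => Complex.exp (-b * (‖ξ‖ : ℂ) ^ 2) := by
    ext ξ
    rw [laplaceSymbol, hb]
    congr 1; push_cast; ring
  have hint : Integrable (fun ξ : RSpace n => Complex.exp (-b * (‖ξ‖ : ℂ) ^ 2)) := by
    simpa using GaussianFourier.integrable_cexp_neg_mul_sq_norm_add (V := RSpace n) hbre 0 0
  have hK : 𝓕⁻ (fun ξ : RSpace n => Complex.exp (-b * (‖ξ‖ : ℂ) ^ 2)) = schrodingerKernel s := by
    ext z
    rw [Real.fourierInv_eq_fourier_neg, fourier_gaussian_innerProductSpace hbre,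
      finrank_euclideanSpace_fin, norm_neg, schrodingerKernel]
    congr 2
    · rw [hb]; field_simp; linear_combination -4 * Complex.I_sq
    · rw [hb]; field_simp; linear_combination (4 * (‖z‖ : ℂ) ^ 2) * Complex.I_sq
  rw [e, ← hK]
  exact HasKernel.of_integrable hint

/-- At real s the multiplier is not integrable. It is approached through the Gaussians at s +
i/(j+1), whose modulus is at least |s|, so that one bound dominates all the kernels. -/
theorem hasKernel_schrodinger {s : ℂ} (hs : 0 ≤ s.im) (hs0 : s ≠ 0) :
    HasKernel (fun ξ : RSpace n => Complex.exp (Complex.I * s * laplaceSymbol ξ))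
      (schrodingerKernel s) := by
  intro f g hf hg
  have hfg : Integrable (fun z : RSpace n × RSpace n => f z.1 * g z.2) :=
    f.integrable.mul_prod g.integrable
  set σ : ℕ → ℂ := fun j => s + ((1 / ((j : ℝ) + 1) : ℝ) : ℂ) * Complex.I with hσ
  have hσim : ∀ j, s.im < (σ j).im := fun j => by
    simp only [hσ, Complex.add_im, Complex.im_ofReal_mul, Complex.I_im]
    have : 0 < 1 / ((j : ℝ) + 1) := by positivity
    linarith
  have hσn : ∀ j, ‖s‖ ≤ ‖σ j‖ := fun j => by
    have hre : (σ j).re = s.re := by simp [hσ]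
    rw [Complex.norm_eq_sqrt_sq_add_sq, Complex.norm_eq_sqrt_sq_add_sq, hre]
    have := hσim j
    exact Real.sqrt_le_sqrt (by nlinarith)
  have hlim : Tendsto σ atTop (𝓝 s) := by
    have h := tendsto_one_div_add_atTop_nhds_zero_nat (𝕜 := ℝ)
    have h2 := ((Complex.continuous_ofReal.tendsto 0).comp h).mul_const Complex.I
    simpa [hσ] using h2.const_add s
  have hns : 0 < ‖s‖ := norm_pos_iff.2 hs0
  have hσ0 : ∀ j, σ j ≠ 0 := fun j => norm_pos_iff.1 (hns.trans_le (hσn j))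
  have t1 : Tendsto (fun j => ∫ ξ : RSpace n, Complex.exp (Complex.I * σ j * laplaceSymbol ξ) *
      (𝓕 f ξ * 𝓕⁻ g ξ)) atTop
      (𝓝 (∫ ξ : RSpace n, Complex.exp (Complex.I * s * laplaceSymbol ξ) * (𝓕 f ξ * 𝓕⁻ g ξ))) := by
    refine tendsto_integral_of_dominated_convergence (fun ξ => ‖𝓕 f ξ * 𝓕⁻ g ξ‖) (fun j => ?_)
      (integrable_fourier_mul_fourierInv f g).norm (fun j => Eventually.of_forall fun ξ => ?_)
      (Eventually.of_forall fun ξ => ?_)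
    · refine (Continuous.aestronglyMeasurable ?_).mul
        (integrable_fourier_mul_fourierInv f g).aestronglyMeasurable
      fun_prop
    · rw [norm_mul]
      exact mul_le_of_le_one_left (norm_nonneg _)
        (norm_schrodingerMultiplier_le (hs.trans (hσim j).le) (laplaceSymbol_nonneg ξ))
    · have : Continuous fun s : ℂ => Complex.exp (Complex.I * s * laplaceSymbol ξ) := by fun_prop
      exact ((this.tendsto s).comp hlim).mul_const _
  have t2 : Tendsto (fun j => ∫ z : RSpace n × RSpace n, schrodingerKernel (σ j) (z.2 - z.1) *
      (f z.1 * g z.2)) atTop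
      (𝓝 (∫ z : RSpace n × RSpace n, schrodingerKernel s (z.2 - z.1) * (f z.1 * g z.2))) := by
    refine tendsto_integral_of_dominated_convergence
      (fun z => (4 * Real.pi * ‖s‖) ^ (-(n : ℝ) / 2) * ‖f z.1 * g z.2‖) (fun j => ?_)
      (hfg.norm.const_mul _) (fun j => Eventually.of_forall fun z => ?_)
      (Eventually.of_forall fun z => ?_)
    · refine (Measurable.aestronglyMeasurable ?_).mul hfg.aestronglyMeasurable
      exact (measurable_schrodingerKernel_right (σ j)).comp (measurable_snd.sub measurable_fst)
    · rw [norm_mul]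
      refine mul_le_mul_of_nonneg_right ((norm_schrodingerKernel_le (hs.trans (hσim j).le)
        (hσ0 j) _).trans ?_) (norm_nonneg _)
      have hpi := Real.pi_pos
      refine Real.rpow_le_rpow_of_nonpos (by positivity) ?_ ?_
      · exact mul_le_mul_of_nonneg_left (hσn j) (by positivity)
      · rw [neg_div]; exact neg_nonpos.2 (by positivity)
    · have h : Tendsto (fun j => schrodingerKernel (σ j) (z.2 - z.1)) atTop
          (𝓝 (schrodingerKernel s (z.2 - z.1))) :=
        (continuousAt_schrodingerKernel hs hs0 (z.2 - z.1)).tendsto.comp hlim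
      exact h.mul_const _
  refine tendsto_nhds_unique t1 (t2.congr fun j => ?_)
  exact (hasKernel_schrodinger_of_im_pos (hs.trans_lt (hσim j)) f g hf hg).symm

/-- The `L^p → L^{p'}` bound of the complex Schrödinger propagator. -/
theorem formBound_schrodinger {s : ℂ} (hs : 0 ≤ s.im) (hs0 : s ≠ 0) {θ p : ℝ}
    (hθ0 : 0 ≤ θ) (hθ1 : θ ≤ 1) (hp : p * (1 + θ) = 2) :
    FormBound p (fun ξ : RSpace n => Complex.exp (Complex.I * s * laplaceSymbol ξ))
      (((4 * Real.pi * ‖s‖) ^ (-(n : ℝ) / 2)) ^ θ) := by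
  refine (hasKernel_schrodinger hs hs0).formBound
    (fun ξ => norm_schrodingerMultiplier_le hs (laplaceSymbol_nonneg ξ))
    (measurable_schrodingerKernel_right s) (norm_schrodingerKernel_le hs hs0) hθ0 hθ1 hp

end Multipliers

/-! ### Short times: contour deformation and the resolvent. -/

section ShortTime

open Set Filter Topology FourierTransform

/-- An entire function has a primitive, so both paths give the difference of its end values. The
half circle runs from ρ to -ρ, hence the sign. -/
theorem integral_real_segment_eq_arc {h : ℂ → ℂ} (hh : Differentiable ℂ h) (ρ : ℝ) :
    ∫ s in (-ρ)..ρ, h s =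
      -∫ φ in (0 : ℝ)..Real.pi, h (circleMap 0 ρ φ) * (circleMap 0 ρ φ * Complex.I) := by
  obtain ⟨H, hH⟩ := hh.isExactOn_univ
  have hH' : ∀ z, HasDerivAt H (h z) z := fun z => hH z (mem_univ z)
  have hc := hh.continuous
  rw [intervalIntegral.integral_eq_sub_of_hasDerivAt (f := fun s : ℝ => H s)
    (fun s _ => (hH' s).comp_ofReal) (by apply Continuous.intervalIntegrable; fun_prop),
    intervalIntegral.integral_eq_sub_of_hasDerivAt (f := fun φ : ℝ => H (circleMap 0 ρ φ))
    (fun φ _ => (hH' _).scomp φ (hasDerivAt_circleMap 0 ρ φ) |>.congr_deriv ?_)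
    (by apply Continuous.intervalIntegrable; have := continuous_circleMap 0 ρ; fun_prop)]
  · simp [circleMap]
  · rw [smul_eq_mul, mul_comm]

theorem circleMap_im_nonneg {ρ φ : ℝ} (hρ : 0 ≤ ρ) (h : φ ∈ Ioc 0 Real.pi) :
    0 ≤ (circleMap 0 ρ φ).im := by
  have := Real.sin_nonneg_of_nonneg_of_le_pi h.1.le h.2
  simp only [circleMap, zero_add, Complex.im_ofReal_mul, Complex.exp_ofReal_mul_I_im]
  positivity

variable {n : ℕ}

/-- A superposition over a half circle of multiples of `e^{isa} r`. -/
theorem formBound_arc {p ρ D N : ℝ} (hρ : 0 ≤ ρ) {w : ℂ → ℂ} (hw : Continuous w)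
    (hD : ∀ s, ‖s‖ = ρ → ‖w s‖ ≤ D) {r : RSpace n → ℂ} (hr : Continuous r) (hr1 : ∀ ξ, ‖r ξ‖ ≤ 1)
    (hN : ∀ s : ℂ, 0 ≤ s.im → ‖s‖ = ρ →
      FormBound p (fun ξ : RSpace n => Complex.exp (Complex.I * s * laplaceSymbol ξ) * r ξ) N) :
    FormBound p (fun ξ : RSpace n => ∫ φ in (0 : ℝ)..Real.pi, w (circleMap 0 ρ φ) *
      (Complex.exp (Complex.I * circleMap 0 ρ φ * laplaceSymbol ξ) * r ξ)) (Real.pi * (D * N)) := by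
  have hcm := continuous_circleMap 0 ρ
  have hnorm : ∀ φ, ‖circleMap 0 ρ φ‖ = ρ := fun φ => by
    rw [norm_circleMap_zero, abs_of_nonneg hρ]
  have hvol : ∫ _ in Ioc (0 : ℝ) Real.pi, D * N = Real.pi * (D * N) := by
    rw [setIntegral_const, measureReal_def, Real.volume_Ioc, sub_zero,
      ENNReal.toReal_ofReal Real.pi_pos.le, smul_eq_mul]
  have hfin : ∀ c : ℝ, Integrable (fun _ : ℝ => c) (volume.restrict (Ioc 0 Real.pi)) := fun c =>
    integrableOn_const (by simp)
  have hN0 : ∀ s : ℂ, ‖s‖ = ρ → 0 ≤ s.im → FormBound p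
      (fun ξ => w s * (Complex.exp (Complex.I * s * laplaceSymbol ξ) * r ξ)) (D * N) := by
    intro s hs him f g hf hg
    refine ((hN s him hs).const_mul (w s) f g hf hg).trans ?_
    have h1 := (norm_nonneg _).trans (hN s him hs f g hf hg)
    rw [mul_assoc, mul_assoc]
    exact mul_le_mul_of_nonneg_right (hD s hs) h1
  rw [← hvol]
  simp only [intervalIntegral.integral_of_le Real.pi_pos.le]
  refine FormBound.integral (ν := volume.restrict (Ioc 0 Real.pi)) (b := fun _ => D) ?_ (hfin D) ?_
    (hfin _) ?_
  · refine Continuous.aestronglyMeasurable ?_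
    simp only [Function.uncurry_def]
    have := laplaceSymbol_continuous (n := n)
    fun_prop
  · refine (ae_restrict_iff' measurableSet_Ioc).2 (Eventually.of_forall fun φ hφ ξ => ?_)
    rw [norm_mul, norm_mul]
    have h1 := norm_schrodingerMultiplier_le (circleMap_im_nonneg hρ hφ) (laplaceSymbol_nonneg ξ)
    have h2 := hD _ (hnorm φ)
    have h3 : ‖Complex.exp (Complex.I * circleMap 0 ρ φ * laplaceSymbol ξ)‖ * ‖r ξ‖ ≤ 1 :=
      mul_le_one₀ h1 (norm_nonneg _) (hr1 ξ)
    calc _ ≤ D * 1 := mul_le_mul h2 h3 (by positivity) ((norm_nonneg _).trans h2)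
      _ = D := mul_one D
  · refine (ae_restrict_iff' measurableSet_Ioc).2 (Eventually.of_forall fun φ hφ => ?_)
    exact hN0 _ (hnorm φ) (circleMap_im_nonneg hρ hφ)

theorem schrodinger_bound_le {θ r : ℝ} (hr : 0 < r) (hθ : 0 ≤ θ) :
    ((4 * Real.pi * r) ^ (-(n : ℝ) / 2)) ^ θ ≤ r ^ (-((n : ℝ) * θ / 2)) := by
  have hpi := Real.pi_gt_three
  rw [← Real.rpow_mul (by positivity), show -(n : ℝ) / 2 * θ = -((n : ℝ) * θ / 2) by ring]
  refine Real.rpow_le_rpow_of_nonpos hr (by nlinarith) ?_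
  have : 0 ≤ (n : ℝ) * θ / 2 := by positivity
  linarith

theorem one_add_laplaceSymbol_pos (ξ : RSpace n) : 0 < 1 + laplaceSymbol ξ := by
  have := laplaceSymbol_nonneg ξ
  linarith

/-- The `L^p → L^{p'}` bound of the Schrödinger propagator applied after `(1 - Δ)⁻¹`. -/
theorem formBound_schrodinger_resolvent {s : ℂ} (hs : 0 ≤ s.im) {θ p : ℝ}
    (hθ0 : 0 ≤ θ) (hθ1 : θ ≤ 1) (hp : p * (1 + θ) = 2) {d : ℝ → ℝ}
    (hd : IntegrableOn d (Ioi 0))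
    (h : ∀ τ : ℝ, 0 < τ → Real.exp (-τ) * ‖s + τ * Complex.I‖ ^ (-((n : ℝ) * θ / 2)) ≤ d τ) :
    FormBound p (fun ξ : RSpace n => Complex.exp (Complex.I * s * laplaceSymbol ξ) *
      (1 / (1 + laplaceSymbol ξ : ℂ))) (∫ τ in Ioi 0, d τ) := by
  -- The resolvent is the Laplace integral ∫ e^{-τ(1+a)} dτ, and the factor e^{-τa} moves s to s +
  -- iτ, further into the upper half plane.
  have e : ∀ ξ : RSpace n, Complex.exp (Complex.I * s * laplaceSymbol ξ) *
      (1 / (1 + laplaceSymbol ξ : ℂ)) = ∫ τ in Ioi (0 : ℝ), (Real.exp (-τ) : ℂ) *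
        Complex.exp (Complex.I * (s + τ * Complex.I) * laplaceSymbol ξ) := by
    intro ξ
    have h1 : ∀ τ : ℝ, (Real.exp (-τ) : ℂ) *
        Complex.exp (Complex.I * (s + τ * Complex.I) * laplaceSymbol ξ) =
        Complex.exp (Complex.I * s * laplaceSymbol ξ) *
          ((Real.exp (-(1 + laplaceSymbol ξ) * τ) : ℝ) : ℂ) := fun τ => by
      push_cast
      rw [← Complex.exp_add, ← Complex.exp_add]
      congr 1
      linear_combination (laplaceSymbol ξ : ℂ) * τ * Complex.I_sq
    simp only [h1]
    have hpos := one_add_laplaceSymbol_pos ξ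
    rw [integral_const_mul, integral_complex_ofReal, integral_exp_mul_Ioi (by linarith)]
    congr 1
    push_cast
    rw [mul_zero, Complex.exp_zero, neg_div_neg_eq]
  simp only [e]
  have him : ∀ τ : ℝ, 0 < τ → 0 < (s + τ * Complex.I).im := fun τ hτ => by
    simp; linarith
  refine FormBound.integral (ν := volume.restrict (Ioi (0 : ℝ))) (b := fun τ => Real.exp (-τ)) ?_
    (integrableOn_exp_neg_Ioi 0) ?_ hd ?_
  · refine Continuous.aestronglyMeasurable ?_
    simp only [Function.uncurry_def]
    have := laplaceSymbol_continuous (n := n)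
    fun_prop
  · refine (ae_restrict_iff' measurableSet_Ioi).2 (Eventually.of_forall fun τ hτ ξ => ?_)
    rw [norm_mul, Complex.norm_real, Real.norm_of_nonneg (Real.exp_pos _).le]
    exact mul_le_of_le_one_right (Real.exp_pos _).le
      (norm_schrodingerMultiplier_le (him τ hτ).le (laplaceSymbol_nonneg ξ))
  · refine (ae_restrict_iff' measurableSet_Ioi).2 (Eventually.of_forall fun τ hτ => ?_)
    have h0 : s + τ * Complex.I ≠ 0 := fun h0 => by
      have := him τ hτ; rw [h0] at this; simp at this
    have := (formBound_schrodinger (n := n) (him τ hτ).le h0 hθ0 hθ1 hp).const_mul (Real.exp (-τ))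
    refine this.mono ((mul_le_mul_of_nonneg_left (schrodinger_bound_le (norm_pos_iff.2 h0) hθ0)
      (norm_nonneg _)).trans ?_)
    rw [Complex.norm_real, Real.norm_of_nonneg (Real.exp_pos _).le]
    exact h τ hτ

theorem norm_le_norm_add_im {s : ℂ} (hs : 0 ≤ s.im) {τ : ℝ} (hτ : 0 ≤ τ) :
    ‖s‖ ≤ ‖s + τ * Complex.I‖ ∧ τ ≤ ‖s + τ * Complex.I‖ := by
  have him : (s + τ * Complex.I).im = s.im + τ := by simp
  have hre : (s + τ * Complex.I).re = s.re := by simp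
  constructor
  · rw [Complex.norm_eq_sqrt_sq_add_sq, Complex.norm_eq_sqrt_sq_add_sq, hre, him]
    exact Real.sqrt_le_sqrt (by nlinarith)
  · have := Complex.im_le_norm (s + τ * Complex.I)
    rw [him] at this
    linarith

/-- On the arc the factor (1-Δ)⁻¹ need not gain anything, because the integration over the arc
already supplies a power of t; it only must not lose. -/
theorem formBound_schrodinger_resolvent_of_ne {s : ℂ} (hs : 0 ≤ s.im) (hs0 : s ≠ 0) {θ p : ℝ}
    (hθ0 : 0 ≤ θ) (hθ1 : θ ≤ 1) (hp : p * (1 + θ) = 2) :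
    FormBound p (fun ξ : RSpace n => Complex.exp (Complex.I * s * laplaceSymbol ξ) *
      (1 / (1 + laplaceSymbol ξ : ℂ))) (‖s‖ ^ (-((n : ℝ) * θ / 2))) := by
  have hns := norm_pos_iff.2 hs0
  have := formBound_schrodinger_resolvent (n := n) hs hθ0 hθ1 hp
    (d := fun τ => Real.exp (-τ) * ‖s‖ ^ (-((n : ℝ) * θ / 2)))
    ((integrableOn_exp_neg_Ioi 0).mul_const _) fun τ hτ => by
      refine mul_le_mul_of_nonneg_left ?_ (Real.exp_pos _).le
      refine Real.rpow_le_rpow_of_nonpos hns (norm_le_norm_add_im hs hτ.le).1 ?_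
      have : 0 ≤ (n : ℝ) * θ / 2 := by positivity
      linarith
  rwa [integral_mul_const, integral_exp_neg_Ioi_zero, one_mul] at this

/-- The bound is ∫ e^{-τ}|s+iτ|^{-κ} dτ with κ = nθ/2. For κ < 1 it is at most the Gamma integral
with exponent 1 - κ; for κ > 1 the majorant min(|s|^{-κ}, τ^{-κ}) integrates to a multiple of
|s|^{1-κ}. At κ = 1 a logarithm would appear. -/
theorem exists_formBound_schrodinger_resolvent {θ p : ℝ}
    (hθ0 : 0 ≤ θ) (hθ1 : θ ≤ 1) (hp : p * (1 + θ) = 2) (hκ : (n : ℝ) * θ / 2 ≠ 1) :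
    ∃ C : ℝ, 0 ≤ C ∧ ∀ s : ℂ, 0 ≤ s.im → s ≠ 0 → ‖s‖ ≤ 1 →
      FormBound p (fun ξ : RSpace n => Complex.exp (Complex.I * s * laplaceSymbol ξ) *
      (1 / (1 + laplaceSymbol ξ : ℂ))) (C * ‖s‖ ^ min (1 - (n : ℝ) * θ / 2) 0) := by
  set κ := (n : ℝ) * θ / 2 with hκd
  have hκ0 : 0 ≤ κ := by positivity
  rcases lt_or_gt_of_ne hκ with h | h
  · have hG := Real.GammaIntegral_convergent (s := 1 - κ) (by linarith)
    refine ⟨∫ τ in Ioi (0 : ℝ), Real.exp (-τ) * τ ^ (1 - κ - 1),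
      setIntegral_nonneg measurableSet_Ioi fun τ hτ => ?_, fun s hs hs0 _ => ?_⟩
    · have : 0 < τ := hτ
      positivity
    · rw [min_eq_right (by linarith), Real.rpow_zero, mul_one]
      refine formBound_schrodinger_resolvent (n := n) hs hθ0 hθ1 hp hG fun τ hτ => ?_
      refine mul_le_mul_of_nonneg_left ?_ (Real.exp_pos _).le
      rw [show 1 - κ - 1 = -κ by ring]
      exact Real.rpow_le_rpow_of_nonpos hτ (norm_le_norm_add_im hs hτ.le).2 (by linarith)
  · refine ⟨1 + 1 / (κ - 1), by have : 0 < κ - 1 := by linarith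
                                positivity, fun s hs hs0 _ => ?_⟩
    rw [min_eq_left (by linarith)]
    set r := ‖s‖ with hr
    have hr0 : 0 < r := norm_pos_iff.2 hs0
    have hi1 : IntegrableOn (fun _ : ℝ => r ^ (-κ)) (Ioc 0 r) := integrableOn_const (by simp)
    have hi2 : IntegrableOn (fun τ : ℝ => τ ^ (-κ)) (Ioi r) :=
      integrableOn_Ioi_rpow_of_lt (by linarith) hr0
    set d : ℝ → ℝ := fun τ => if τ ≤ r then r ^ (-κ) else τ ^ (-κ) with hd
    have hd1 : EqOn (fun _ : ℝ => r ^ (-κ)) d (Ioc 0 r) := fun τ hτ => by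
      simp only [hd]; rw [if_pos hτ.2]
    have hd2 : EqOn (fun τ : ℝ => τ ^ (-κ)) d (Ioi r) := fun τ hτ => by
      simp only [hd]; rw [if_neg (not_le.2 hτ)]
    have hi1' := hi1.congr_fun hd1 measurableSet_Ioc
    have hi2' := hi2.congr_fun hd2 measurableSet_Ioi
    have hU : Ioc 0 r ∪ Ioi r = Ioi 0 := Ioc_union_Ioi_eq_Ioi hr0.le
    have hval : ∫ τ in Ioi 0, d τ = (1 + 1 / (κ - 1)) * r ^ (1 - κ) := by
      rw [← hU, setIntegral_union (Ioc_disjoint_Ioi le_rfl) measurableSet_Ioi hi1' hi2',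
        ← setIntegral_congr_fun measurableSet_Ioc hd1, ← setIntegral_congr_fun measurableSet_Ioi hd2,
        setIntegral_const, integral_Ioi_rpow_of_lt (by linarith) hr0, measureReal_def,
        Real.volume_Ioc, sub_zero, ENNReal.toReal_ofReal hr0.le, smul_eq_mul,
        show 1 - κ = -κ + 1 by ring, Real.rpow_add_one hr0.ne']
      have h1 : κ - 1 ≠ 0 := by linarith
      have h2 : -κ + 1 ≠ 0 := by linarith
      field_simp
      ring
    rw [← hval]
    refine formBound_schrodinger_resolvent (n := n) hs hθ0 hθ1 hp ?_ fun τ hτ => ?_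
    · rw [← hU]; exact hi1'.union hi2'
    · have hexp : Real.exp (-τ) ≤ 1 := Real.exp_le_one_iff.2 (by linarith)
      refine (mul_le_of_le_one_left (by positivity) hexp).trans ?_
      simp only [hd]
      have hn := norm_le_norm_add_im hs hτ.le
      split_ifs
      · exact Real.rpow_le_rpow_of_nonpos hr0 hn.1 (by linarith)
      · exact Real.rpow_le_rpow_of_nonpos hτ hn.2 (by linarith)

/-- The dispersion relation `√(1 + |2πξ|⁴)` of the beam equation. -/
noncomputable def beamFreq (ξ : RSpace n) : ℝ := √(1 + laplaceSymbol ξ ^ 2)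

theorem exists_norm_besselEntire_le (ν : ℕ) (R : ℝ) :
    ∃ D : ℝ, 0 ≤ D ∧ ∀ w : ℂ, ‖w‖ ≤ R → ‖besselEntire ν w‖ ≤ D := by
  obtain ⟨D, hD⟩ := (isCompact_closedBall (0 : ℂ) R).exists_bound_of_continuousOn
    (besselEntire_continuous ν).continuousOn
  refine ⟨max D 0, le_max_right _ _, fun w hw => (hD w ?_).trans (le_max_left _ _)⟩
  rwa [mem_closedBall_zero_iff]

theorem exists_density_le : ∃ D : ℝ, 0 ≤ D ∧ ∀ (t : ℝ) (s : ℂ), 0 ≤ t → t ≤ 1 → ‖s‖ = t →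
    ‖sinDensity t s‖ ≤ D ∧ ‖cosDensity t s‖ ≤ D := by
  obtain ⟨D, hD0, hD⟩ := exists_norm_besselEntire_le 0 2
  obtain ⟨D', hD0', hD'⟩ := exists_norm_besselEntire_le 1 2
  refine ⟨D + D', by positivity, fun t s ht ht1 hs => ?_⟩
  have hw : ‖(t : ℂ) ^ 2 - s ^ 2‖ ≤ 2 := by
    refine (norm_sub_le _ _).trans ?_
    rw [norm_pow, norm_pow, hs, Complex.norm_real, Real.norm_of_nonneg ht]
    nlinarith
  have h1 := hD _ hw
  have h2 := hD' _ hw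
  rw [sinDensity, cosDensity, norm_mul, norm_mul, norm_neg, norm_div, norm_div, norm_one,
    Complex.norm_real, Real.norm_of_nonneg ht, Complex.norm_ofNat, Complex.norm_ofNat]
  constructor
  · nlinarith
  · have : t / 4 * ‖besselEntire 1 ((t : ℂ) ^ 2 - s ^ 2)‖ ≤ 1 * D' :=
      mul_le_mul (by linarith) h2 (norm_nonneg _) zero_le_one
    linarith

theorem differentiable_sinDensity (t : ℝ) : Differentiable ℂ (sinDensity t) := by
  have := besselEntire_differentiable 0
  unfold sinDensity; fun_prop

theorem differentiable_cosDensity (t : ℝ) : Differentiable ℂ (cosDensity t) := by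
  have := besselEntire_differentiable 1
  unfold cosDensity; fun_prop

/-- The short time bound of `sin(t√(1+Δ²))/√(1+Δ²)`. -/
theorem exists_formBound_sin_short {θ p : ℝ}
    (hθ0 : 0 ≤ θ) (hθ1 : θ ≤ 1) (hp : p * (1 + θ) = 2) :
    ∃ C : ℝ, 0 ≤ C ∧ ∀ t : ℝ, 0 < t → t ≤ 1 →
      FormBound p (fun ξ : RSpace n => ((Real.sin (t * beamFreq ξ) / beamFreq ξ : ℝ) : ℂ))
        (C * t ^ (1 - (n : ℝ) * θ / 2)) := by
  obtain ⟨D, hD0, hD⟩ := exists_density_le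
  refine ⟨Real.pi * D, by positivity, fun t ht ht1 => ?_⟩
  have e : ∀ ξ : RSpace n, ((Real.sin (t * beamFreq ξ) / beamFreq ξ : ℝ) : ℂ) =
      ∫ φ in (0 : ℝ)..Real.pi, (fun s => -(sinDensity t s * (s * Complex.I))) (circleMap 0 t φ) *
        (Complex.exp (Complex.I * circleMap 0 t φ * laplaceSymbol ξ) * 1) := by
    intro ξ
    have h1 := (sinDensity_cosDensity_integral (laplaceSymbol ξ) t).1
    rw [Complex.ofReal_div, beamFreq, ← h1, integral_real_segment_eq_arc
      (h := fun s => sinDensity t s * Complex.exp (Complex.I * s * laplaceSymbol ξ)),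
      ← intervalIntegral.integral_neg]
    · congr 1; ext φ; ring
    · have := differentiable_sinDensity t
      fun_prop
  simp only [e]
  have hc := (differentiable_sinDensity t).continuous
  refine (formBound_arc (p := p) (ρ := t) (D := D * t) (N := t ^ (-((n : ℝ) * θ / 2))) ht.le
    (w := fun s => -(sinDensity t s * (s * Complex.I))) (by fun_prop) (fun s hs => ?_)
    (r := fun _ => 1) continuous_const (fun _ => by simp) (fun s him hs => ?_)).mono (le_of_eq ?_)
  · rw [norm_neg, norm_mul, norm_mul, Complex.norm_I, mul_one, hs]
    exact mul_le_mul_of_nonneg_right (hD t s ht.le ht1 hs).1 ht.le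
  · simp only [mul_one]
    have hs0 : s ≠ 0 := norm_pos_iff.1 (hs ▸ ht)
    have := formBound_schrodinger (n := n) him hs0 hθ0 hθ1 hp
    rw [hs] at this
    exact this.mono (schrodinger_bound_le ht hθ0)
  · rw [sub_eq_add_neg, Real.rpow_add ht, Real.rpow_one]
    ring

/-- The short time bound of `cos(t√(1+Δ²)) (1-Δ)⁻¹` away from the critical exponent. -/
theorem exists_formBound_cos_short {θ p : ℝ}
    (hθ0 : 0 ≤ θ) (hθ1 : θ ≤ 1) (hp : p * (1 + θ) = 2) (hκ : (n : ℝ) * θ / 2 ≠ 1) :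
    ∃ C : ℝ, 0 ≤ C ∧ ∀ t : ℝ, 0 < t → t ≤ 1 →
      FormBound p (fun ξ : RSpace n => ((Real.cos (t * beamFreq ξ) : ℝ) : ℂ) *
        (1 / (1 + laplaceSymbol ξ : ℂ))) (C * t ^ min (1 - (n : ℝ) * θ / 2) 0) := by
  obtain ⟨D, hD0, hD⟩ := exists_density_le
  obtain ⟨A, hA0, hA⟩ := exists_formBound_schrodinger_resolvent (n := n) hθ0 hθ1 hp hκ
  refine ⟨A + Real.pi * D, by positivity, fun t ht ht1 => ?_⟩
  set r : RSpace n → ℂ := fun ξ => 1 / (1 + laplaceSymbol ξ : ℂ) with hr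
  have hne : ∀ ξ : RSpace n, (1 + laplaceSymbol ξ : ℂ) ≠ 0 := fun ξ => by
    exact_mod_cast (one_add_laplaceSymbol_pos ξ).ne'
  have hLc := laplaceSymbol_continuous (n := n)
  have hrc : Continuous r := continuous_const.div (by fun_prop) hne
  have hr1 : ∀ ξ, ‖r ξ‖ ≤ 1 := fun ξ => by
    have h := laplaceSymbol_nonneg ξ
    simp only [hr]
    rw [show (1 + laplaceSymbol ξ : ℂ) = ((1 + laplaceSymbol ξ : ℝ) : ℂ) by push_cast; ring,
      norm_div, norm_one, Complex.norm_real, Real.norm_of_nonneg (by linarith),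
      div_le_one (by linarith)]
    linarith
  have hc := (differentiable_cosDensity t).continuous
  -- The point masses at s = ±t stay on the real axis and rely on the gain of the resolvent. Only
  -- the density part moves to the arc, where length times the plain Schrödinger bound already gives
  -- t^{1-κ} with κ = nθ/2.
  have e : ∀ ξ : RSpace n, ((Real.cos (t * beamFreq ξ) : ℝ) : ℂ) * r ξ =
      (1 / 2 * (Complex.exp (Complex.I * t * laplaceSymbol ξ) * r ξ) +
       1 / 2 * (Complex.exp (Complex.I * (-t : ℂ) * laplaceSymbol ξ) * r ξ)) +
      ∫ φ in (0 : ℝ)..Real.pi, (fun s => -(cosDensity t s * (s * Complex.I))) (circleMap 0 t φ) *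
        (Complex.exp (Complex.I * circleMap 0 t φ * laplaceSymbol ξ) * r ξ) := by
    intro ξ
    have h1 := (sinDensity_cosDensity_integral (laplaceSymbol ξ) t).2
    rw [beamFreq, ← h1, integral_real_segment_eq_arc
      (h := fun s => cosDensity t s * Complex.exp (Complex.I * s * laplaceSymbol ξ)),
      ← intervalIntegral.integral_neg, add_mul, ← intervalIntegral.integral_mul_const]
    · congr 1
      · rw [Complex.ofReal_cos, Complex.cos]
        push_cast
        rw [show (t : ℂ) * laplaceSymbol ξ * Complex.I = Complex.I * t * laplaceSymbol ξ by ring,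
          show -((t : ℂ) * laplaceSymbol ξ) * Complex.I = Complex.I * -t * laplaceSymbol ξ by ring]
        ring
      · congr 1; ext φ; ring
    · have := differentiable_cosDensity t
      fun_prop
  have hE : ∀ s : ℂ, 0 ≤ s.im → ∀ ξ : RSpace n,
      ‖Complex.exp (Complex.I * s * laplaceSymbol ξ) * r ξ‖ ≤ 1 := fun s hs ξ => by
    rw [norm_mul]
    exact mul_le_one₀ (norm_schrodingerMultiplier_le hs (laplaceSymbol_nonneg ξ))
      (norm_nonneg _) (hr1 ξ)
  have hpos : ∀ s : ℂ, s.im = 0 → ‖s‖ = t → FormBound p (fun ξ : RSpace n => (1 / 2 : ℂ) *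
      (Complex.exp (Complex.I * s * laplaceSymbol ξ) * r ξ))
      (1 / 2 * (A * t ^ min (1 - (n : ℝ) * θ / 2) 0)) := fun s hs hst => by
    have := (hA s hs.ge (norm_pos_iff.1 (hst ▸ ht)) (hst ▸ ht1)).const_mul (1 / 2)
    rw [hst] at this
    refine this.mono (le_of_eq ?_)
    norm_num
  have harc := formBound_arc (p := p) (ρ := t) (D := D * t) (N := t ^ (-((n : ℝ) * θ / 2))) ht.le
    (w := fun s => -(cosDensity t s * (s * Complex.I))) (by fun_prop) (fun s hs => by
      rw [norm_neg, norm_mul, norm_mul, Complex.norm_I, mul_one, hs]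
      exact mul_le_mul_of_nonneg_right (hD t s ht.le ht1 hs).2 ht.le)
    hrc hr1 (fun s him hs => by
      have hs0 : s ≠ 0 := norm_pos_iff.1 (hs ▸ ht)
      have := formBound_schrodinger_resolvent_of_ne (n := n) him hs0 hθ0 hθ1 hp
      rwa [hs] at this)
  have hhalf : ∀ s : ℂ, s.im = 0 → ∀ ξ : RSpace n,
      ‖(1 / 2 : ℂ) * (Complex.exp (Complex.I * s * laplaceSymbol ξ) * r ξ)‖ ≤ 1 := fun s hs ξ => by
    rw [norm_mul]
    exact mul_le_one₀ (by norm_num) (norm_nonneg _) (hE s hs.ge ξ)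
  have hrtc : ∀ s : ℂ, AEStronglyMeasurable (fun ξ : RSpace n => (1 / 2 : ℂ) *
      (Complex.exp (Complex.I * s * laplaceSymbol ξ) * r ξ)) := fun s =>
    Continuous.aestronglyMeasurable (by fun_prop)
  have hsum := (hpos t (by simp) (by simp [abs_of_pos ht])).add
    (hpos (-t : ℂ) (by simp) (by simp [abs_of_pos ht])) (hrtc _) (hrtc _) (hhalf _ (by simp))
    (hhalf _ (by simp))
  have hsum2 := hsum.add (B := 2) (B' := Real.pi * (D * t)) harc ((hrtc _).add (hrtc _)) ?_ ?_ ?_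
  · simp only [← e] at hsum2
    refine hsum2.mono ?_
    have h1 : t ^ (1 - (n : ℝ) * θ / 2) ≤ t ^ min (1 - (n : ℝ) * θ / 2) 0 :=
      Real.rpow_le_rpow_of_exponent_ge ht ht1 (min_le_left _ _)
    have h2 : t ^ (1 - (n : ℝ) * θ / 2) = t * t ^ (-((n : ℝ) * θ / 2)) := by
      rw [sub_eq_add_neg, Real.rpow_add ht, Real.rpow_one]
    rw [h2] at h1
    have h3 := mul_le_mul_of_nonneg_left h1 (show 0 ≤ Real.pi * D by positivity)
    linarith
  · refine Continuous.aestronglyMeasurable ?_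
    refine intervalIntegral.continuous_parametric_intervalIntegral_of_continuous' ?_ 0 Real.pi
    simp only [Function.uncurry_def]
    have := continuous_circleMap 0 t
    fun_prop
  · intro ξ
    refine (norm_add_le _ _).trans ?_
    have h1 := hhalf t (by simp) ξ
    have h2 := hhalf (-t : ℂ) (by simp) ξ
    linarith
  · intro ξ
    have := intervalIntegral.norm_integral_le_of_norm_le_const (a := 0) (b := Real.pi) (C := D * t)
      (f := fun φ => (fun s => -(cosDensity t s * (s * Complex.I))) (circleMap 0 t φ) *
        (Complex.exp (Complex.I * circleMap 0 t φ * laplaceSymbol ξ) * r ξ)) ?_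
    · rw [sub_zero, abs_of_pos Real.pi_pos] at this
      linarith
    · intro φ hφ
      rw [uIoc_of_le Real.pi_pos.le] at hφ
      have hn : ‖circleMap 0 t φ‖ = t := by rw [norm_circleMap_zero, abs_of_pos ht]
      rw [norm_mul]
      refine (mul_le_of_le_one_right (norm_nonneg _) (hE _ (circleMap_im_nonneg ht.le hφ) ξ)).trans ?_
      rw [norm_neg, norm_mul, norm_mul, Complex.norm_I, mul_one, hn]
      exact mul_le_mul_of_nonneg_right (hD t _ ht.le ht1 hn).2 ht.le

end ShortTime

/-! ### The critical exponent nθ/2 = 1: the endpoint Sobolev inequality. -/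

section Sobolev

open Set Filter Topology FourierTransform

variable {n : ℕ}

theorem exists_cutoff_seq (n : ℕ) : ∃ (χ : ℕ → RSpace n → ℝ) (ε : ℕ → ℝ),
    (∀ j, ContDiff ℝ 1 (χ j)) ∧ (∀ j, HasCompactSupport (χ j)) ∧ (∀ j x, 0 ≤ χ j x) ∧
    (∀ j x, χ j x ≤ 1) ∧ (∀ j x, ‖fderiv ℝ (χ j) x‖ ≤ ε j) ∧ (∀ j, 0 ≤ ε j) ∧
    Tendsto ε atTop (𝓝 0) ∧ ∀ x, Tendsto (fun j => χ j x) atTop (𝓝 1) := by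
  let χ : ContDiffBump (0 : RSpace n) := ⟨1, 2, one_pos, one_lt_two⟩
  have hχ : ContDiff ℝ 1 χ := χ.contDiff
  obtain ⟨M, hM⟩ := (χ.hasCompactSupport.fderiv (𝕜 := ℝ)).exists_bound_of_continuous
    (hχ.continuous_fderiv one_ne_zero)
  have hM0 : 0 ≤ M := (norm_nonneg _).trans (hM 0)
  set c : ℕ → ℝ := fun j => 1 / ((j : ℝ) + 1) with hc
  have hc0 : ∀ j, 0 < c j := fun j => by positivity
  have hclim : Tendsto c atTop (𝓝 0) := tendsto_one_div_add_atTop_nhds_zero_nat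
  refine ⟨fun j x => χ (c j • x), fun j => M * c j, fun j => hχ.comp (contDiff_const_smul (c j)),
    fun j => χ.hasCompactSupport.comp_homeomorph (Homeomorph.smulOfNeZero (c j) (hc0 j).ne'),
    fun j x => χ.nonneg, fun j x => χ.le_one, fun j x => ?_,
    fun j => mul_nonneg hM0 (hc0 j).le, ?_, fun x => ?_⟩
  · have : HasFDerivAt (fun x : RSpace n => χ (c j • x))
        ((fderiv ℝ χ (c j • x)).comp (c j • ContinuousLinearMap.id ℝ (RSpace n))) x :=
      (hχ.differentiable one_ne_zero (c j • x)).hasFDerivAt.comp x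
        ((hasFDerivAt_id x).const_smul (c j))
    rw [this.fderiv]
    refine (ContinuousLinearMap.opNorm_comp_le _ _).trans ?_
    refine mul_le_mul (hM _) ?_ (norm_nonneg _) hM0
    rw [norm_smul, Real.norm_of_nonneg (hc0 j).le]
    exact mul_le_of_le_one_right (hc0 j).le ContinuousLinearMap.norm_id_le
  · simpa using hclim.const_mul M
  · have h1 : Tendsto (fun j => c j • x) atTop (𝓝 0) := by simpa using hclim.smul_const x
    have h2 := (χ.continuous.tendsto 0).comp h1
    rwa [χ.one_of_mem_closedBall (Metric.mem_closedBall_self zero_le_one)] at h2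

theorem exists_eLpNorm_le_eLpNorm_fderiv (hn : 0 < n) {q : ℝ≥0}
    (hq : (q : ℝ)⁻¹ = ((2 : ℝ≥0) : ℝ)⁻¹ - (n : ℝ)⁻¹) :
    ∃ K : ℝ≥0, ∀ u : RSpace n → ℂ, ContDiff ℝ 1 u → HasCompactSupport u →
      eLpNorm u q volume ≤ K * eLpNorm (fderiv ℝ u) 2 volume := by
  have hfin : Module.finrank ℝ (RSpace n) = n := finrank_euclideanSpace_fin
  refine ⟨eLpNormLESNormFDerivOfEqInnerConst (volume : Measure (RSpace n)) ((2 : ℝ≥0) : ℝ),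
    fun u hu hus => ?_⟩
  have h0 := eLpNorm_le_eLpNorm_fderiv_of_eq_inner volume hu hus (p := 2) one_le_two
    (by rw [hfin]; exact hn) (by rw [hfin]; exact hq)
  rw [ENNReal.coe_ofNat] at h0
  exact h0

/-- The Gagliardo–Nirenberg–Sobolev inequality for Schwartz functions. -/
theorem exists_eLpNorm_schwartz_le_eLpNorm_fderiv (hn : 0 < n) {q : ℝ≥0}
    (hq : (q : ℝ)⁻¹ = ((2 : ℝ≥0) : ℝ)⁻¹ - (n : ℝ)⁻¹) :
    ∃ K : ℝ≥0, ∀ v : 𝓢(RSpace n, ℂ),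
      eLpNorm v q volume ≤ K * eLpNorm (fderiv ℝ v) 2 volume := by
  obtain ⟨K, hK⟩ := exists_eLpNorm_le_eLpNorm_fderiv hn hq
  refine ⟨K, fun v => ?_⟩
  -- Sobolev's inequality is applied to χⱼv. The gradient of the cut-off contributes at most εⱼ‖v‖₂,
  -- which tends to zero, and Fatou's lemma passes to the limit on the left.
  obtain ⟨χ, ε, hcd, hcs, hχ0, hχ1, hχd, hε0, hε, hχlim⟩ := exists_cutoff_seq n
  set u : ℕ → RSpace n → ℂ := fun j x => χ j x • v x with hu
  have hvd : ContDiff ℝ 1 v := v.smooth 1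
  have hud : ∀ j, ContDiff ℝ 1 (u j) := fun j => (hcd j).smul hvd
  have hus : ∀ j, HasCompactSupport (u j) := fun j => (hcs j).smul_right
  have hfd : ∀ j x, ‖fderiv ℝ (u j) x‖ ≤ ‖‖fderiv ℝ v x‖ + ε j * ‖v x‖‖ := fun j x => by
    have h1 : DifferentiableAt ℝ (χ j) x := (hcd j).differentiable one_ne_zero x
    have h2 : DifferentiableAt ℝ v x := v.differentiableAt
    rw [Real.norm_of_nonneg (by have := hε0 j; positivity)]
    simp only [hu]
    rw [fderiv_fun_smul h1 h2]
    refine (norm_add_le _ _).trans (add_le_add ?_ ?_)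
    · rw [norm_smul, Real.norm_of_nonneg (hχ0 j x)]
      exact mul_le_of_le_one_left (norm_nonneg _) (hχ1 j x)
    · refine (ContinuousLinearMap.norm_smulRight_apply _ _).le.trans ?_
      exact mul_le_mul_of_nonneg_right (hχd j x) (norm_nonneg _)
  have hfdm : AEStronglyMeasurable (fun x => ‖fderiv ℝ v x‖) (volume : Measure (RSpace n)) :=
    (hvd.continuous_fderiv one_ne_zero).norm.aestronglyMeasurable
  have hb : ∀ j, eLpNorm (u j) q volume ≤ K * (eLpNorm (fderiv ℝ v) 2 volume +
      ENNReal.ofReal (ε j) * eLpNorm v 2 volume) := fun j => by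
    refine (hK (u j) (hud j) (hus j)).trans ?_
    refine mul_le_mul_right ?_ _
    refine (eLpNorm_mono (hfd j)).trans ?_
    refine (eLpNorm_add_le hfdm (v.continuous.norm.aestronglyMeasurable.const_mul _)
      (by norm_num)).trans ?_
    refine add_le_add (eLpNorm_norm _).le ?_
    have := eLpNorm_const_smul (ε j) (fun x => ‖v x‖) 2 (volume : Measure (RSpace n))
    rw [eLpNorm_norm, ← ofReal_norm, Real.norm_of_nonneg (hε0 j)] at this
    exact this.le
  have hlim : ∀ x, Tendsto (fun j => u j x) atTop (𝓝 (v x)) := fun x => by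
    have h := (hχlim x).smul_const (v x)
    rwa [one_smul] at h
  have hv2 : eLpNorm v 2 (volume : Measure (RSpace n)) ≠ ⊤ :=
    (v.memLp 2 volume).eLpNorm_ne_top
  have hrhs : Tendsto (fun j => (K : ℝ≥0∞) * (eLpNorm (fderiv ℝ v) 2 volume +
      ENNReal.ofReal (ε j) * eLpNorm v 2 volume)) atTop
      (𝓝 (K * (eLpNorm (fderiv ℝ v) 2 volume + ENNReal.ofReal 0 * eLpNorm v 2 volume))) := by
    refine ENNReal.Tendsto.const_mul ?_ (Or.inr ENNReal.coe_ne_top)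
    refine tendsto_const_nhds.add ?_
    exact ENNReal.Tendsto.mul_const ((ENNReal.continuous_ofReal.tendsto 0).comp hε) (Or.inr hv2)
  rw [ENNReal.ofReal_zero, zero_mul, add_zero] at hrhs
  have h1 := Lp.eLpNorm_lim_le_liminf_eLpNorm (p := (q : ℝ≥0∞)) (μ := (volume : Measure (RSpace n)))
    (fun j => (hud j).continuous.aestronglyMeasurable) v (Eventually.of_forall hlim)
  refine h1.trans ?_
  rw [← hrhs.liminf_eq]
  exact liminf_le_liminf (Eventually.of_forall hb)

theorem fourier_fourierMultiplierCLM {m : RSpace n → ℂ} (hm : m.HasTemperateGrowth)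
    (f : 𝓢(RSpace n, ℂ)) (ξ : RSpace n) : 𝓕 (fourierMultiplierCLM ℂ m f) ξ = m ξ * 𝓕 f ξ := by
  rw [fourierMultiplierCLM_apply, FourierTransform.fourier_fourierInv_eq,
    smulLeftCLM_apply_apply hm, smul_eq_mul]

@[fun_prop]
theorem hasTemperateGrowth_laplaceSymbol : (laplaceSymbol (n := n)).HasTemperateGrowth := by
  have : laplaceSymbol (n := n) = fun ξ => (2 * Real.pi) ^ 2 * ‖ξ‖ ^ 2 := by
    ext ξ; rw [laplaceSymbol, mul_pow]
  rw [this]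
  exact (Function.HasTemperateGrowth.const _).mul (Function.hasTemperateGrowth_norm_sq _)

theorem hasTemperateGrowth_resolvent :
    (fun ξ : RSpace n => (1 / (1 + laplaceSymbol ξ) : ℝ)).HasTemperateGrowth := by
  have h := Function.hasTemperateGrowth_one_add_norm_sq_rpow (RSpace n) (-1)
  have h2 : (fun ξ : RSpace n => (2 * Real.pi) • ξ).HasTemperateGrowth :=
    ((2 * Real.pi) • ContinuousLinearMap.id ℝ (RSpace n)).hasTemperateGrowth
  have e : (fun ξ : RSpace n => (1 / (1 + laplaceSymbol ξ) : ℝ)) =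
      (fun x : RSpace n => (1 + ‖x‖ ^ 2) ^ (-1 : ℝ)) ∘ fun ξ => (2 * Real.pi) • ξ := by
    ext ξ
    simp only [Function.comp, laplaceSymbol]
    rw [norm_smul, Real.norm_of_nonneg (by positivity), Real.rpow_neg_one, one_div]
  rw [e]
  exact h.comp h2

theorem norm_fderiv_sq_le (v : 𝓢(RSpace n, ℂ)) (x : RSpace n) :
    ‖fderiv ℝ v x‖ ^ 2 ≤ ∑ i, ‖(∂_{(stdVec i : RSpace n)} v : 𝓢(RSpace n, ℂ)) x‖ ^ 2 := by
  have h : ‖fderiv ℝ v x‖ ≤ √(∑ i, ‖(∂_{(stdVec i : RSpace n)} v : 𝓢(RSpace n, ℂ)) x‖ ^ 2) := by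
    refine ContinuousLinearMap.opNorm_le_bound _ (Real.sqrt_nonneg _) fun y => ?_
    have hy : y = ∑ i, y i • (stdVec i : RSpace n) := by
      have := (EuclideanSpace.basisFun (Fin n) ℝ).sum_repr y
      simpa [stdVec] using this.symm
    have e : fderiv ℝ v x y = ∑ i, y i • (∂_{(stdVec i : RSpace n)} v : 𝓢(RSpace n, ℂ)) x := by
      conv_lhs => rw [hy]
      simp only [map_sum, map_smul, lineDerivOp_apply_eq_fderiv]
    rw [e, EuclideanSpace.norm_eq, ← Real.sqrt_mul (Finset.sum_nonneg fun _ _ => sq_nonneg _)]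
    refine (norm_sum_le _ _).trans (Real.le_sqrt_of_sq_le ?_)
    simp only [norm_smul]
    refine (Finset.sum_mul_sq_le_sq_mul_sq _ _ _).trans (le_of_eq (mul_comm _ _))
  calc _ ≤ √(∑ i, ‖(∂_{(stdVec i : RSpace n)} v : 𝓢(RSpace n, ℂ)) x‖ ^ 2) ^ 2 := by gcongr
    _ = _ := Real.sq_sqrt (Finset.sum_nonneg fun _ _ => sq_nonneg _)

theorem integral_norm_sq_lineDeriv (v : 𝓢(RSpace n, ℂ)) :
    ∑ i, ∫ x, ‖(∂_{(stdVec i : RSpace n)} v : 𝓢(RSpace n, ℂ)) x‖ ^ 2 = ∫ ξ, laplaceSymbol ξ * ‖𝓕 v ξ‖ ^ 2 := by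
  have e : ∀ i ξ, ‖𝓕 (∂_{(stdVec i : RSpace n)} v : 𝓢(RSpace n, ℂ)) ξ‖ ^ 2 = (2 * Real.pi * ξ i) ^ 2 * ‖𝓕 v ξ‖ ^ 2 := by
    intro i ξ
    have hg : (fun x : RSpace n => inner ℝ x (stdVec i)).HasTemperateGrowth := by fun_prop
    rw [fourier_lineDerivOp_eq, smul_apply, smulLeftCLM_apply_apply hg, norm_smul, norm_smul]
    have : (inner ℝ ξ (stdVec i : RSpace n) : ℝ) = ξ i := by
      simp [stdVec, EuclideanSpace.inner_single_right]
    rw [this]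
    simp only [norm_mul, Complex.norm_I, Complex.norm_ofNat, Complex.norm_real]
    rw [Real.norm_of_nonneg Real.pi_pos.le, Real.norm_eq_abs]
    simp only [mul_pow, sq_abs, one_pow]
    ring
  simp only [← integral_norm_sq_fourier (∂_{(stdVec _ : RSpace n)} v : 𝓢(RSpace n, ℂ))]
  rw [← integral_finsetSum]
  · congr 1; ext ξ
    simp only [e]
    rw [← Finset.sum_mul, laplaceSymbol, mul_pow, EuclideanSpace.norm_sq_eq, Finset.mul_sum]
    simp only [mul_pow, Real.norm_eq_abs, sq_abs]
  · intro i _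
    exact (𝓕 (∂_{(stdVec i : RSpace n)} v : 𝓢(RSpace n, ℂ))).memLp 2 |>.integrable_norm_pow two_ne_zero

/-- The dual Sobolev inequality at the exponent `2n/(n+2)`. -/
theorem exists_integral_fourier_resolvent_le {θ p : ℝ} (hθ1 : θ < 1) (hp : p * (1 + θ) = 2)
    (hκ : (n : ℝ) * θ / 2 = 1) :
    ∃ C : ℝ, 0 ≤ C ∧ ∀ f : 𝓢(RSpace n, ℂ),
      ∫ ξ, 1 / (1 + laplaceSymbol ξ) * ‖𝓕 f ξ‖ ^ 2 ≤ (C * realLpNorm p f) ^ 2 := by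
  have hn : 0 < n := by
    rcases Nat.eq_zero_or_pos n with rfl | h
    · simp at hκ
    · exact h
  have hnR : (0 : ℝ) < n := by exact_mod_cast hn
  have hθ : θ = 2 / n := by field_simp; linarith
  have hθ0 : 0 < θ := by rw [hθ]; positivity
  have h1θ : 0 < 1 - θ := by linarith
  have hp0 : 0 < p := by
    by_contra h
    nlinarith
  -- This exponent is conjugate to p and, since θ = 2/n, satisfies 1/q = 1/2 - 1/n, as Sobolev's
  -- inequality for gradients in L² requires.
  set q : ℝ≥0 := (2 / (1 - θ)).toNNReal with hqdef
  have hq : (q : ℝ) = 2 / (1 - θ) := Real.coe_toNNReal _ (by positivity)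
  have hqp : (q : ℝ).HolderConjugate p := by
    rw [Real.holderConjugate_iff]
    constructor
    · rw [hq, lt_div_iff₀ h1θ]; linarith
    · have hpe : p = 2 / (1 + θ) := by field_simp; linarith
      rw [hq, hpe]
      field_simp
      ring
  obtain ⟨K, hK⟩ := exists_eLpNorm_schwartz_le_eLpNorm_fderiv hn (q := q) (by
      rw [hq, hθ]; push_cast; field_simp)
  refine ⟨K, K.coe_nonneg, fun f => ?_⟩
  set m : RSpace n → ℂ := fun ξ => ((1 / (1 + laplaceSymbol ξ) : ℝ) : ℂ) with hm
  have hmt : m.HasTemperateGrowth :=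
    Function.Complex.hasTemperateGrowth_ofReal.comp hasTemperateGrowth_resolvent
  set v := fourierMultiplierCLM ℂ m f with hv
  set A := ∫ ξ, 1 / (1 + laplaceSymbol ξ) * ‖𝓕 f ξ‖ ^ 2 with hA
  have hpos := one_add_laplaceSymbol_pos (n := n)
  have hA0 : 0 ≤ A := integral_nonneg fun ξ => by have := hpos ξ; positivity
  -- Duality with v = (1-Δ)⁻¹f: A is the pairing of v and f, hence at most ‖v‖_q ‖f‖_p, while
  -- Sobolev's inequality and Plancherel give ‖v‖_q ≤ K‖∇v‖₂ ≤ K√A. Cancelling √A bounds it by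
  -- K‖f‖_p.
  have h1 : A ≤ realLpNorm q v * realLpNorm p f := by
    have e : ((A : ℝ) : ℂ) = ∫ x, inner ℂ (v x) (f x) := by
      rw [← integral_inner_fourier_fourier, hA, ← integral_complex_ofReal]
      congr 1; ext ξ
      rw [hv, fourier_fourierMultiplierCLM hmt, RCLike.inner_apply, map_mul]
      simp only [hm, Complex.conj_ofReal]
      rw [mul_left_comm, Complex.mul_conj, Complex.normSq_eq_norm_sq]
      push_cast; ring
    have e2 : A = ‖((A : ℝ) : ℂ)‖ := by rw [Complex.norm_real, Real.norm_of_nonneg hA0]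
    rw [e2, e]
    refine (norm_integral_le_integral_norm _).trans ?_
    have e3 := integral_mul_norm_le_Lp_mul_Lq (μ := (volume : Measure (RSpace n))) hqp
      (v.memLp (ENNReal.ofReal q)) (f.memLp (ENNReal.ofReal p))
    refine le_trans (integral_mono_of_nonneg (Eventually.of_forall fun _ => norm_nonneg _) ?_
      (Eventually.of_forall fun x => norm_inner_le_norm (v x) (f x))) e3
    obtain ⟨B, hB⟩ := v.decay 0 0
    exact f.integrable.norm.bdd_mul (c := B) v.continuous.norm.aestronglyMeasurable
      (Eventually.of_forall fun x => by simpa using hB.2 x)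
  have h2 : realLpNorm q v ≤ K * √A := by
    have hs := hK v
    have hq0 : (q : ℝ≥0∞) ≠ 0 := by
      rw [ENNReal.coe_ne_zero, ← NNReal.coe_ne_zero]; exact hqp.pos.ne'
    have hfd : MemLp (fderiv ℝ v) 2 (volume : Measure (RSpace n)) :=
      (SchwartzMap.fderivCLM ℝ (RSpace n) ℂ v).memLp 2 volume
    rw [(v.memLp q volume).eLpNorm_eq_integral_rpow_norm hq0 ENNReal.coe_ne_top,
      hfd.eLpNorm_eq_integral_rpow_norm two_ne_zero ENNReal.ofNat_ne_top,
      ← ENNReal.ofReal_coe_nnreal (p := K), ← ENNReal.ofReal_mul K.coe_nonneg,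
      ENNReal.ofReal_le_ofReal_iff (by positivity)] at hs
    rw [realLpNorm, one_div]
    simp only [ENNReal.coe_toReal, ENNReal.toReal_ofNat, Real.rpow_two] at hs
    refine hs.trans (mul_le_mul_of_nonneg_left ?_ K.coe_nonneg)
    rw [Real.sqrt_eq_rpow, one_div]
    refine Real.rpow_le_rpow (integral_nonneg fun _ => by positivity) ?_ (by positivity)
    have i1 : ∀ i, Integrable fun x => ‖(∂_{(stdVec i : RSpace n)} v : 𝓢(RSpace n, ℂ)) x‖ ^ 2 := fun i =>
      ((∂_{(stdVec i : RSpace n)} v : 𝓢(RSpace n, ℂ)).memLp 2).integrable_norm_pow two_ne_zero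
    calc ∫ x, ‖fderiv ℝ v x‖ ^ 2 ≤ ∫ x, ∑ i, ‖(∂_{(stdVec i : RSpace n)} v : 𝓢(RSpace n, ℂ)) x‖ ^ 2 :=
          integral_mono (hfd.integrable_norm_pow two_ne_zero) (integrable_finsetSum _ fun i _ => i1 i)
            (norm_fderiv_sq_le v)
      _ = ∫ ξ, laplaceSymbol ξ * ‖𝓕 v ξ‖ ^ 2 := by
          rw [integral_finsetSum _ fun i _ => i1 i, integral_norm_sq_lineDeriv]
      _ ≤ A := by
          refine integral_mono_of_nonneg (Eventually.of_forall fun ξ => ?_) ?_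
            (Eventually.of_forall fun ξ => ?_)
          · exact mul_nonneg (laplaceSymbol_nonneg ξ) (sq_nonneg _)
          · refine (((𝓕 f).memLp 2).integrable_norm_pow two_ne_zero).bdd_mul (c := 1) ?_ ?_
            · exact (hasTemperateGrowth_resolvent (n := n)).1.continuous.aestronglyMeasurable
            · refine Eventually.of_forall fun ξ => ?_
              have := laplaceSymbol_nonneg ξ
              rw [Real.norm_of_nonneg (by positivity), div_le_one (hpos ξ)]
              linarith
          · simp only
            rw [hv, fourier_fourierMultiplierCLM hmt, norm_mul, mul_pow, ← mul_assoc]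
            refine mul_le_mul_of_nonneg_right ?_ (sq_nonneg _)
            have h0 := hpos ξ
            have h0' := laplaceSymbol_nonneg ξ
            simp only [hm]
            rw [Complex.norm_real, Real.norm_of_nonneg (by positivity), one_div_pow, mul_one_div,
              div_le_div_iff₀ (by positivity) h0]
            nlinarith
  have hP := realLpNorm_nonneg p f
  have h3 : √A ^ 2 ≤ √A * (K * realLpNorm p f) := by
    rw [Real.sq_sqrt hA0]
    calc A ≤ realLpNorm q v * realLpNorm p f := h1
      _ ≤ K * √A * realLpNorm p f := mul_le_mul_of_nonneg_right h2 hP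
      _ = _ := by ring
  have h4 : √A ≤ K * realLpNorm p f := by
    rcases (Real.sqrt_nonneg A).eq_or_lt with h | h
    · rw [← h]; exact mul_nonneg K.coe_nonneg hP
    · rw [sq] at h3; exact le_of_mul_le_mul_left h3 h
  rw [← Real.sq_sqrt hA0]
  exact pow_le_pow_left₀ (Real.sqrt_nonneg A) h4 2

/-- At the critical exponent every multiplier bounded by `(1-Δ)⁻¹` is bounded. -/
theorem exists_formBound_of_norm_le_resolvent {θ p : ℝ} (hθ1 : θ < 1) (hp : p * (1 + θ) = 2)
    (hκ : (n : ℝ) * θ / 2 = 1) :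
    ∃ C : ℝ, 0 ≤ C ∧ ∀ m : RSpace n → ℂ, (∀ ξ, ‖m ξ‖ ≤ 1 / (1 + laplaceSymbol ξ)) →
      FormBound p m C := by
  obtain ⟨C, hC0, hC⟩ := exists_integral_fourier_resolvent_le hθ1 hp hκ
  refine ⟨C ^ 2, sq_nonneg C, fun m hm f g _ _ => ?_⟩
  have hpos := one_add_laplaceSymbol_pos (n := n)
  -- The majorant 1/(1+a) is split evenly between f and g, and Cauchy–Schwarz leaves the quadratic
  -- form of the Sobolev estimate on each side.
  set r : RSpace n → ℝ := fun ξ => √(1 / (1 + laplaceSymbol ξ)) with hr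
  have hr2 : ∀ ξ, r ξ ^ 2 = 1 / (1 + laplaceSymbol ξ) := fun ξ =>
    Real.sq_sqrt (by have := hpos ξ; positivity)
  have hr0 : ∀ ξ, 0 ≤ r ξ := fun ξ => Real.sqrt_nonneg _
  have hr1 : ∀ ξ, ‖r ξ‖ ≤ 1 := fun ξ => by
    rw [Real.norm_of_nonneg (hr0 ξ)]
    refine Real.sqrt_le_one.2 ?_
    rw [div_le_one (hpos ξ)]
    linarith [laplaceSymbol_nonneg ξ]
  have hrc : Continuous r :=
    Real.continuous_sqrt.comp (hasTemperateGrowth_resolvent (n := n)).1.continuous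
  have hmem : ∀ h : 𝓢(RSpace n, ℂ), MemLp (fun ξ => r ξ * ‖h ξ‖) (ENNReal.ofReal 2) volume :=
    fun h => by
      refine (h.memLp (ENNReal.ofReal 2)).of_le
        (hrc.mul h.continuous.norm).aestronglyMeasurable (Eventually.of_forall fun ξ => ?_)
      change ‖r ξ * ‖h ξ‖‖ ≤ _
      rw [norm_mul, norm_norm]
      exact mul_le_of_le_one_left (norm_nonneg _) (hr1 ξ)
  have hA : ∀ h : 𝓢(RSpace n, ℂ), (∫ ξ, (r ξ * ‖𝓕 h ξ‖) ^ (2 : ℝ)) ^ (1 / (2 : ℝ)) ≤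
      C * realLpNorm p h := fun h => by
    have hCP : 0 ≤ C * realLpNorm p h := mul_nonneg hC0 (realLpNorm_nonneg _ _)
    rw [← Real.sqrt_eq_rpow]
    refine Real.sqrt_le_iff.2 ⟨hCP, ?_⟩
    simp only [Real.rpow_two, mul_pow (r _), hr2]
    exact hC h
  have hneg : ∀ h : 𝓢(RSpace n, ℂ), ∫ ξ, (r ξ * ‖𝓕⁻ h ξ‖) ^ (2 : ℝ) =
      ∫ ξ, (r ξ * ‖𝓕 h ξ‖) ^ (2 : ℝ) := fun h => by
    rw [← integral_neg_eq_self]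
    congr 1; ext ξ
    rw [fourierInv_coe, fourier_coe, Real.fourierInv_eq_fourier_neg, neg_neg]
    simp only [hr, laplaceSymbol, norm_neg]
  have h1 := integral_mul_le_Lp_mul_Lq_of_nonneg (μ := (volume : Measure (RSpace n)))
    Real.HolderConjugate.two_two (f := fun ξ => r ξ * ‖𝓕 f ξ‖) (g := fun ξ => r ξ * ‖𝓕⁻ g ξ‖)
    (Eventually.of_forall fun ξ => mul_nonneg (hr0 ξ) (norm_nonneg _))
    (Eventually.of_forall fun ξ => mul_nonneg (hr0 ξ) (norm_nonneg _)) (hmem (𝓕 f)) (hmem (𝓕⁻ g))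
  rw [hneg] at h1
  calc ‖∫ ξ, m ξ * (𝓕 f ξ * 𝓕⁻ g ξ)‖ ≤ ∫ ξ, r ξ * ‖𝓕 f ξ‖ * (r ξ * ‖𝓕⁻ g ξ‖) := by
        refine norm_integral_le_of_norm_le ?_ (Eventually.of_forall fun ξ => ?_)
        · have := (integrable_fourier_mul_fourierInv f g).norm.bdd_mul (c := 1)
            (f := fun ξ => r ξ ^ 2) (hrc.pow 2).aestronglyMeasurable (Eventually.of_forall fun ξ => by
              rw [norm_pow]; exact pow_le_one₀ (norm_nonneg _) (hr1 ξ))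
          refine this.congr (Eventually.of_forall fun ξ => ?_)
          simp only [norm_mul]; ring
        · rw [norm_mul, norm_mul]
          calc _ ≤ r ξ ^ 2 * (‖𝓕 f ξ‖ * ‖𝓕⁻ g ξ‖) := by
                rw [hr2]; exact mul_le_mul_of_nonneg_right (hm ξ) (by positivity)
            _ = _ := by ring
    _ ≤ _ := h1
    _ ≤ (C * realLpNorm p f) * (C * realLpNorm p g) :=
        mul_le_mul (hA f) (hA g) (Real.rpow_nonneg (integral_nonneg fun ξ => Real.rpow_nonneg
          (mul_nonneg (hr0 ξ) (norm_nonneg _)) _) _) (mul_nonneg hC0 (realLpNorm_nonneg _ _))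
    _ = _ := by ring

end Sobolev

/-! ### Long times in dimension at least two: the kernel bound t^{-n/4}. -/

section LongTime

open Set Filter Topology FourierTransform

variable {n : ℕ}

/-- The bounded multiplier `m` has a convolution kernel that is bounded by `N`. -/
def KernelBound (m : RSpace n → ℂ) (N : ℝ) : Prop :=
  AEStronglyMeasurable m ∧ (∃ B, ∀ ξ, ‖m ξ‖ ≤ B) ∧
    ∃ K : RSpace n → ℂ, Measurable K ∧ (∀ z, ‖K z‖ ≤ N) ∧ HasKernel m K

theorem KernelBound.mono {m : RSpace n → ℂ} {N N' : ℝ} (h : KernelBound m N) (hN : N ≤ N') :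
    KernelBound m N' := by
  obtain ⟨h1, h2, K, h3, h4, h5⟩ := h
  exact ⟨h1, h2, K, h3, fun z => (h4 z).trans hN, h5⟩

theorem KernelBound.add {m m' : RSpace n → ℂ} {N N' : ℝ} (h : KernelBound m N)
    (h' : KernelBound m' N') : KernelBound (fun ξ => m ξ + m' ξ) (N + N') := by
  obtain ⟨h1, ⟨B, h2⟩, K, h3, h4, h5⟩ := h
  obtain ⟨h1', ⟨B', h2'⟩, K', h3', h4', h5'⟩ := h'
  refine ⟨h1.add h1', ⟨B + B', fun ξ => (norm_add_le _ _).trans (add_le_add (h2 ξ) (h2' ξ))⟩,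
    fun z => K z + K' z, h3.add h3', fun z => (norm_add_le _ _).trans (add_le_add (h4 z) (h4' z)),
    fun f g hf hg => ?_⟩
  have hfg : Integrable (fun z : RSpace n × RSpace n => f z.1 * g z.2) :=
    f.integrable.mul_prod g.integrable
  have hI : ∀ {K : RSpace n → ℂ} {N : ℝ}, Measurable K → (∀ z, ‖K z‖ ≤ N) →
      Integrable fun z : RSpace n × RSpace n => K (z.2 - z.1) * (f z.1 * g z.2) := fun hK hN =>
    hfg.bdd_mul (hK.comp (measurable_snd.sub measurable_fst)).aestronglyMeasurable
      (Eventually.of_forall fun z => hN _)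
  simp only [add_mul]
  rw [integral_add (integrable_multiplier_form h1 h2 f g) (integrable_multiplier_form h1' h2' f g),
    integral_add (hI h3 h4) (hI h3' h4'), h5 f g hf hg, h5' f g hf hg]

theorem KernelBound.formBound {m : RSpace n → ℂ} {N θ p : ℝ} (h : KernelBound m N)
    (hm1 : ∀ ξ, ‖m ξ‖ ≤ 1) (hθ0 : 0 ≤ θ) (hθ1 : θ ≤ 1) (hp : p * (1 + θ) = 2) :
    FormBound p m (N ^ θ) := by
  obtain ⟨-, -, K, h3, h4, h5⟩ := h
  exact h5.formBound hm1 h3 h4 hθ0 hθ1 hp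

/-- Superpositions of Schrödinger propagators at times of absolute value at least `ρ`. -/
theorem kernelBound_superposition {α : Type*} [MeasurableSpace α] {ν : Measure α} [SFinite ν]
    {w σ : α → ℂ} (hw : Measurable w) (hσ : Measurable σ) (hwi : Integrable w ν) {ρ N : ℝ}
    (hρ : 0 < ρ) (him : ∀ᵐ x ∂ν, 0 ≤ (σ x).im) (hσρ : ∀ᵐ x ∂ν, ρ ≤ ‖σ x‖)
    (hN : ∀ z : RSpace n, ‖∫ x, w x * schrodingerKernel (σ x) z ∂ν‖ ≤ N) :
    KernelBound (fun ξ : RSpace n => ∫ x, w x *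
      Complex.exp (Complex.I * σ x * laplaceSymbol ξ) ∂ν) N := by
  have hLc := (laplaceSymbol_continuous (n := n)).measurable
  have hmeas : Measurable (Function.uncurry fun (x : α) (ξ : RSpace n) => w x *
      Complex.exp (Complex.I * σ x * laplaceSymbol ξ)) := by
    simp only [Function.uncurry_def]
    fun_prop
  have hKmeas : Measurable (Function.uncurry fun (x : α) (z : RSpace n) =>
      w x * schrodingerKernel (σ x) z) := by
    have h2 : Measurable fun x : α × RSpace n => schrodingerKernel (σ x.1) x.2 := by
      unfold schrodingerKernel; fun_prop
    exact (hw.comp measurable_fst).mul h2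
  have hb : ∀ᵐ x ∂ν, ∀ ξ : RSpace n,
      ‖w x * Complex.exp (Complex.I * σ x * laplaceSymbol ξ)‖ ≤ ‖w x‖ := by
    filter_upwards [him] with x hx ξ
    rw [norm_mul]
    exact mul_le_of_le_one_right (norm_nonneg _)
      (norm_schrodingerMultiplier_le hx (laplaceSymbol_nonneg ξ))
  have hpi := Real.pi_pos
  refine ⟨?_, ⟨∫ x, ‖w x‖ ∂ν, fun ξ => ?_⟩, fun z => ∫ x, w x * schrodingerKernel (σ x) z ∂ν, ?_, hN,
    HasKernel.integral (b := fun x => ‖w x‖)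
      (d := fun x => ‖w x‖ * (4 * Real.pi * ρ) ^ (-(n : ℝ) / 2)) hmeas.aestronglyMeasurable
      hwi.norm hb hKmeas (hwi.norm.mul_const _) ?_ ?_⟩
  · exact (hmeas.stronglyMeasurable.integral_prod_left (μ := ν)).aestronglyMeasurable
  · exact norm_integral_le_of_norm_le hwi.norm (hb.mono fun x hx => hx ξ)
  · exact (hKmeas.stronglyMeasurable.integral_prod_left (μ := ν)).measurable
  · filter_upwards [him, hσρ] with x hx hx' z
    have hx0 : σ x ≠ 0 := norm_pos_iff.1 (hρ.trans_le hx')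
    rw [norm_mul]
    refine mul_le_mul_of_nonneg_left ((norm_schrodingerKernel_le hx hx0 z).trans ?_) (norm_nonneg _)
    refine Real.rpow_le_rpow_of_nonpos (by positivity) (by gcongr) ?_
    rw [neg_div]; exact neg_nonpos.2 (by positivity)
  · filter_upwards [him, hσρ] with x hx hx'
    have hx0 : σ x ≠ 0 := norm_pos_iff.1 (hρ.trans_le hx')
    intro f g hf hg
    have := hasKernel_schrodinger hx hx0 f g hf hg
    simp only [mul_assoc]
    rw [integral_const_mul, integral_const_mul]
    simp only [← mul_assoc] at this ⊢
    rw [this]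

theorem norm_schrodingerKernel_le_rpow {s : ℂ} (hs : 0 ≤ s.im) {ρ : ℝ} (hρ : 0 < ρ) (h : ρ ≤ ‖s‖)
    (z : RSpace n) : ‖schrodingerKernel s z‖ ≤ ρ ^ (-(n : ℝ) / 2) := by
  have hpi := Real.pi_gt_three
  refine (norm_schrodingerKernel_le hs (norm_pos_iff.1 (hρ.trans_le h)) z).trans ?_
  refine Real.rpow_le_rpow_of_nonpos hρ (by nlinarith) ?_
  rw [neg_div]; exact neg_nonpos.2 (by positivity)

theorem kernelBound_segment {w : ℂ → ℂ} (hw : Continuous w) {a b ε N : ℝ} (ha : 0 < a) (hab : a ≤ b)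
    (hε : |ε| = 1)
    (hN : ∀ z : RSpace n, ‖∫ s in a..b, w s * schrodingerKernel ((ε * s : ℝ) : ℂ) z‖ ≤ N) :
    KernelBound (fun ξ : RSpace n => ∫ s in a..b, w s *
      Complex.exp (Complex.I * ((ε * s : ℝ) : ℂ) * laplaceSymbol ξ)) N := by
  simp only [intervalIntegral.integral_of_le hab] at hN ⊢
  refine kernelBound_superposition (ν := volume.restrict (Ioc a b)) (w := fun s : ℝ => w s)
    (σ := fun s : ℝ => ((ε * s : ℝ) : ℂ)) (by fun_prop) (by fun_prop) ?_ ha ?_ ?_ hN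
  · have : Continuous fun s : ℝ => w s := by fun_prop
    exact (this.integrableOn_Icc).mono_set Ioc_subset_Icc_self
  · exact Eventually.of_forall fun s => by simp
  · refine (ae_restrict_iff' measurableSet_Ioc).2 (Eventually.of_forall fun s hs => ?_)
    rw [Complex.norm_real, Real.norm_eq_abs, abs_mul, hε, one_mul, abs_of_pos (ha.trans hs.1)]
    exact hs.1.le

theorem kernelBound_arc {w : ℂ → ℂ} (hw : Continuous w) {ρ D : ℝ} (hρ : 0 < ρ)
    (hD : ∀ s, ‖s‖ = ρ → ‖w s‖ ≤ D) :
    KernelBound (fun ξ : RSpace n => ∫ φ in (0 : ℝ)..Real.pi, w (circleMap 0 ρ φ) *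
      Complex.exp (Complex.I * circleMap 0 ρ φ * laplaceSymbol ξ))
      (D * ρ ^ (-(n : ℝ) / 2) * Real.pi) := by
  have hnorm : ∀ φ, ‖circleMap 0 ρ φ‖ = ρ := fun φ => by
    rw [norm_circleMap_zero, abs_of_pos hρ]
  have hcm := continuous_circleMap 0 ρ
  have hc : Continuous fun φ => w (circleMap 0 ρ φ) := by fun_prop
  simp only [intervalIntegral.integral_of_le Real.pi_pos.le]
  refine kernelBound_superposition (ν := volume.restrict (Ioc 0 Real.pi)) hc.measurable hcm.measurable
    ((hc.integrableOn_Icc).mono_set Ioc_subset_Icc_self) hρ ?_ ?_ fun z => ?_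
  · exact (ae_restrict_iff' measurableSet_Ioc).2 (Eventually.of_forall fun φ hφ =>
      circleMap_im_nonneg hρ.le hφ)
  · exact Eventually.of_forall fun φ => (hnorm φ).ge
  · have := norm_setIntegral_le_of_norm_le_const (μ := volume) (s := Ioc 0 Real.pi)
      (f := fun φ => w (circleMap 0 ρ φ) * schrodingerKernel (circleMap 0 ρ φ) z)
      (C := D * ρ ^ (-(n : ℝ) / 2)) (by simp) (fun φ hφ => by
        rw [norm_mul]
        exact mul_le_mul (hD _ (hnorm φ)) (norm_schrodingerKernel_le_rpow
          (circleMap_im_nonneg hρ.le hφ) hρ (hnorm φ).ge z) (norm_nonneg _)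
          ((norm_nonneg _).trans (hD _ (hnorm φ))))
    rwa [measureReal_def, Real.volume_Ioc, sub_zero, ENNReal.toReal_ofReal Real.pi_pos.le] at this

theorem sqrt_half_rpow {t : ℝ} (ht : 0 < t) (r : ℝ) :
    (√t / 2) ^ r = 2 ^ (-r) * t ^ (r / 2) := by
  rw [Real.div_rpow (Real.sqrt_nonneg t) (by norm_num), Real.sqrt_eq_rpow, ← Real.rpow_mul ht.le,
    Real.rpow_neg (by norm_num), div_eq_inv_mul]
  congr 2; ring

/-- The estimates on the densities `sinDensity`, `cosDensity` that are used for long times. -/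
structure LongDensity (w : ℂ → ℂ) (t C : ℝ) : Prop where
  diff : Differentiable ℂ w
  even : ∀ s, w (-s) = w s
  real : ∀ s : ℝ, (w s).im = 0
  arc : ∀ s, ‖s‖ = √t / 2 → ‖w s‖ ≤ C * t ^ (-(1 / 2) : ℝ)
  -- A common majorant for both densities: of order t^{-1/2} for s ≤ t/2, and integrable at s = t.
  segment : ∀ s : ℝ, 0 ≤ s → s < t → ‖w s‖ ≤ C * t ^ (1 / 4 : ℝ) * (t - s) ^ (-(3 / 4) : ℝ)
  osc : ∀ X : ℝ, 0 ≤ X → ‖∫ s in (√t / 2)..(t / 2), w s * (1 / s) *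
      Complex.exp (Complex.I * ((X / s : ℝ) : ℂ))‖ ≤ C * t ^ (-(1 / 2) : ℝ)

/-- Size alone suffices: the kernel is O(t^{-n/2}) and the density integrates to O(t^{1/2}). For t ≥
1 the product is at most t^{-n/4} up to a constant, precisely because n ≥ 2. -/
theorem LongDensity.norm_integral_outer_le {w : ℂ → ℂ} {t C ε : ℝ} (h : LongDensity w t C)
    (ht : 1 ≤ t) (hC : 0 ≤ C) (hn : 2 ≤ n) (hε : |ε| = 1) (z : RSpace n) :
    ‖∫ s in (t / 2)..t, w s * schrodingerKernel ((ε * s : ℝ) : ℂ) z‖ ≤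
      4 * C * 2 ^ ((n : ℝ) / 2) * t ^ (-(n : ℝ) / 4) := by
  have ht0 : 0 < t := by linarith
  have hn' : (2 : ℝ) ≤ n := by exact_mod_cast hn
  have hi : IntervalIntegrable (fun s : ℝ => (t - s) ^ (-(3 / 4) : ℝ)) volume (t / 2) t := by
    have := (intervalIntegral.intervalIntegrable_rpow' (a := t / 2) (b := 0)
      (r := (-(3 / 4) : ℝ)) (by norm_num)).comp_sub_left t
    simpa [sub_half] using this
  have hval : ∫ s in (t / 2)..t, (t - s) ^ (-(3 / 4) : ℝ) = 4 * (t / 2) ^ (1 / 4 : ℝ) := by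
    rw [intervalIntegral.integral_comp_sub_left (fun s => s ^ (-(3 / 4) : ℝ)) t, sub_self, sub_half,
      integral_rpow (Or.inl (by norm_num))]
    norm_num
    ring
  have hae : ∀ᵐ s : ℝ, s ∈ Ioc (t / 2) t → ‖w s * schrodingerKernel ((ε * s : ℝ) : ℂ) z‖ ≤
      C * t ^ (1 / 4 : ℝ) * (t - s) ^ (-(3 / 4) : ℝ) * (t / 2) ^ (-(n : ℝ) / 2) := by
    have : ∀ᵐ s : ℝ, s ≠ t := by simp [ae_iff, measure_singleton]
    filter_upwards [this] with s hs1 hs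
    have hs0 : 0 < s := by linarith [hs.1]
    rw [norm_mul]
    refine mul_le_mul (h.segment s hs0.le (lt_of_le_of_ne hs.2 hs1))
      (norm_schrodingerKernel_le_rpow (by simp) (by positivity) ?_ z) (norm_nonneg _) ?_
    · rw [Complex.norm_real, Real.norm_eq_abs, abs_mul, hε, one_mul, abs_of_pos hs0]
      exact hs.1.le
    · have : 0 ≤ t - s := by linarith [hs.2]
      positivity
  have hle : t / 2 ≤ t := by linarith
  refine (intervalIntegral.norm_integral_le_of_norm_le hle hae
    ((hi.const_mul _).mul_const _)).trans ?_
  rw [intervalIntegral.integral_mul_const, intervalIntegral.integral_const_mul, hval]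
  have e1 : (t / 2) ^ (1 / 4 : ℝ) ≤ t ^ (1 / 4 : ℝ) := by gcongr
  have e2 : (t / 2) ^ (-(n : ℝ) / 2) = 2 ^ ((n : ℝ) / 2) * t ^ (-(n : ℝ) / 2) := by
    rw [Real.div_rpow ht0.le (by norm_num), neg_div, Real.rpow_neg (by norm_num : (0 : ℝ) ≤ 2),
      div_inv_eq_mul, mul_comm]
  have e3 : t ^ (1 / 4 : ℝ) * t ^ (1 / 4 : ℝ) * t ^ (-(n : ℝ) / 2) ≤ t ^ (-(n : ℝ) / 4) := by
    rw [← Real.rpow_add ht0, ← Real.rpow_add ht0]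
    exact Real.rpow_le_rpow_of_exponent_le ht (by linarith)
  rw [e2]
  calc C * t ^ (1 / 4 : ℝ) * (4 * (t / 2) ^ (1 / 4 : ℝ)) * (2 ^ ((n : ℝ) / 2) * t ^ (-(n : ℝ) / 2))
      ≤ C * t ^ (1 / 4 : ℝ) * (4 * t ^ (1 / 4 : ℝ)) * (2 ^ ((n : ℝ) / 2) * t ^ (-(n : ℝ) / 2)) := by
        gcongr
    _ = 4 * C * 2 ^ ((n : ℝ) / 2) * (t ^ (1 / 4 : ℝ) * t ^ (1 / 4 : ℝ) * t ^ (-(n : ℝ) / 2)) := by ring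
    _ ≤ _ := by gcongr

/-- Here the density is O(t^{-1/2}). For n ≥ 3 the integral of s^{-n/2} is governed by its lower end
√t/2 and gives t^{-1/2}(√t)^{1-n/2} = t^{-n/4}. For n = 2 the integral of 1/s would produce a
logarithm, and the oscillation of the kernel is used through `osc`. -/
theorem LongDensity.norm_integral_inner_le {w : ℂ → ℂ} {t C ε : ℝ} (h : LongDensity w t C)
    (ht : 1 ≤ t) (hC : 0 ≤ C) (hn : 2 ≤ n) (hε : |ε| = 1) (z : RSpace n) :
    ‖∫ s in (√t / 2)..(t / 2), w s * schrodingerKernel ((ε * s : ℝ) : ℂ) z‖ ≤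
      4 * C * 2 ^ ((n : ℝ) / 2) * t ^ (-(n : ℝ) / 4) := by
  have ht0 : 0 < t := by linarith
  have hst : 1 ≤ √t := Real.one_le_sqrt.2 ht
  have hsq : √t * √t = t := Real.mul_self_sqrt ht0.le
  have hρb : √t / 2 ≤ t / 2 := by nlinarith
  have hρ0 : 0 < √t / 2 := by positivity
  have hpi := Real.pi_gt_three
  rcases hn.eq_or_lt with rfl | hn3
  · have hX : 0 ≤ ‖z‖ ^ 2 / 4 := by positivity
    have e : ∀ s ∈ uIcc (√t / 2) (t / 2), w s * schrodingerKernel ((ε * s : ℝ) : ℂ) z =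
        Complex.I * ε / (4 * Real.pi) * (w s * (1 / s) *
          Complex.exp (Complex.I * ((-ε : ℝ) * ((‖z‖ ^ 2 / 4) / s : ℝ) : ℂ))) := by
      intro s hs
      rw [uIcc_of_le hρb] at hs
      have hs0 : (s : ℂ) ≠ 0 := by exact_mod_cast (hρ0.trans_le hs.1).ne'
      have hpi' : (Real.pi : ℂ) ≠ 0 := by exact_mod_cast Real.pi_pos.ne'
      have hε2 : (ε : ℂ) * ε = 1 := by
        have : ε * ε = 1 := by rw [← abs_mul_abs_self, hε]; norm_num
        exact_mod_cast this
      have hε0 : (ε : ℂ) ≠ 0 := fun h0 => by rw [h0] at hε2; simp at hε2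
      rw [schrodingerKernel]
      have e1 : -Complex.I * (‖z‖ : ℂ) ^ 2 / (4 * ((ε * s : ℝ) : ℂ)) =
          Complex.I * ((-ε : ℝ) * ((‖z‖ ^ 2 / 4) / s : ℝ) : ℂ) := by
        push_cast
        field_simp
        linear_combination (‖z‖ : ℂ) ^ 2 * hε2
      have e2 : (Complex.I / (4 * Real.pi * ((ε * s : ℝ) : ℂ))) ^ (((2 : ℕ) : ℂ) / 2) =
          Complex.I * ε / (4 * Real.pi) * (1 / s) := by
        rw [Nat.cast_ofNat, div_self two_ne_zero, Complex.cpow_one]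
        push_cast
        field_simp
        linear_combination -hε2
      rw [e1, e2]
      ring
    rw [intervalIntegral.integral_congr e, intervalIntegral.integral_const_mul, norm_mul]
    have hc : ‖Complex.I * (ε : ℂ) / (4 * Real.pi)‖ ≤ 1 := by
      rw [norm_div, norm_mul, norm_mul, Complex.norm_I, Complex.norm_real, Complex.norm_real,
        Real.norm_eq_abs, hε, Complex.norm_ofNat, Real.norm_of_nonneg Real.pi_pos.le, div_le_one]
      · linarith
      · positivity
    have hmain : ‖∫ s in (√t / 2)..(t / 2), w s * (1 / s) *
          Complex.exp (Complex.I * ((-ε : ℝ) * ((‖z‖ ^ 2 / 4) / s : ℝ) : ℂ))‖ ≤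
        C * t ^ (-(1 / 2) : ℝ) := by
      have h1 := h.osc _ hX
      rcases eq_or_eq_neg_of_abs_eq hε with rfl | rfl
      -- For ε = 1 the phase is -X/s; the density is real on the axis, so this is the conjugate of
      -- the integral in `osc`.
      · have hconj : ∀ s : ℝ, w s * (1 / s) *
            Complex.exp (Complex.I * ((-1 : ℝ) * ((‖z‖ ^ 2 / 4) / s : ℝ) : ℂ)) =
            (starRingEnd ℂ) (w s * (1 / s) *
              Complex.exp (Complex.I * (((‖z‖ ^ 2 / 4) / s : ℝ) : ℂ))) := fun s => by
          rw [map_mul, map_mul, ← Complex.exp_conj, map_mul, Complex.conj_I, Complex.conj_ofReal,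
            map_div₀, map_one, Complex.conj_ofReal, Complex.conj_eq_iff_im.2 (h.real s)]
          congr 2; push_cast; ring
        simp only [hconj]
        rw [intervalIntegral.integral_of_le hρb, integral_conj, RCLike.norm_conj,
          ← intervalIntegral.integral_of_le hρb]
        exact h1
      · simpa using h1
    have e3 : t ^ (-((2 : ℕ) : ℝ) / 4) = t ^ (-(1 / 2) : ℝ) := by norm_num
    rw [e3]
    have h0 : 0 ≤ C * t ^ (-(1 / 2) : ℝ) := by positivity
    calc _ ≤ 1 * (C * t ^ (-(1 / 2) : ℝ)) := mul_le_mul hc hmain (norm_nonneg _) zero_le_one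
      _ ≤ 4 * C * 2 ^ (((2 : ℕ) : ℝ) / 2) * t ^ (-(1 / 2) : ℝ) := by
          norm_num
          nlinarith
  · have hn' : (3 : ℝ) ≤ n := by exact_mod_cast hn3
    have hbound : ∀ s ∈ Ioc (√t / 2) (t / 2), ‖w s * schrodingerKernel ((ε * s : ℝ) : ℂ) z‖ ≤
        2 * C * t ^ (-(1 / 2) : ℝ) * s ^ (-(n : ℝ) / 2) := by
      intro s hs
      have hs0 : 0 < s := hρ0.trans hs.1
      rw [norm_mul]
      refine mul_le_mul ((h.segment s hs0.le (by linarith [hs.2])).trans ?_)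
        (norm_schrodingerKernel_le_rpow (by simp) hs0 ?_ z) (norm_nonneg _) (by positivity)
      · have e1 : (t - s) ^ (-(3 / 4) : ℝ) ≤ (t / 2) ^ (-(3 / 4) : ℝ) :=
          Real.rpow_le_rpow_of_nonpos (by positivity) (by linarith [hs.2]) (by norm_num)
        have e2 : (t / 2) ^ (-(3 / 4) : ℝ) ≤ 2 * t ^ (-(3 / 4) : ℝ) := by
          rw [Real.div_rpow ht0.le (by norm_num), Real.rpow_neg (by norm_num : (0 : ℝ) ≤ 2),
            div_inv_eq_mul, mul_comm]
          refine mul_le_mul_of_nonneg_right ?_ (by positivity)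
          calc (2 : ℝ) ^ (3 / 4 : ℝ) ≤ 2 ^ (1 : ℝ) :=
                Real.rpow_le_rpow_of_exponent_le (by norm_num) (by norm_num)
            _ = 2 := Real.rpow_one 2
        calc C * t ^ (1 / 4 : ℝ) * (t - s) ^ (-(3 / 4) : ℝ)
            ≤ C * t ^ (1 / 4 : ℝ) * (2 * t ^ (-(3 / 4) : ℝ)) := by gcongr; exact e1.trans e2
          _ = 2 * C * (t ^ (1 / 4 : ℝ) * t ^ (-(3 / 4) : ℝ)) := by ring
          _ = 2 * C * t ^ (-(1 / 2) : ℝ) := by rw [← Real.rpow_add ht0]; norm_num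
      · rw [Complex.norm_real, Real.norm_eq_abs, abs_mul, hε, one_mul, abs_of_pos hs0]
    have hne : -(n : ℝ) / 2 ≠ -1 := by linarith
    have h0 : (0 : ℝ) ∉ uIcc (√t / 2) (t / 2) := by
      rw [uIcc_of_le hρb]; exact fun h => absurd h.1 (not_le.2 hρ0)
    have hi : IntervalIntegrable (fun s : ℝ => s ^ (-(n : ℝ) / 2)) volume (√t / 2) (t / 2) :=
      intervalIntegral.intervalIntegrable_rpow (Or.inr h0)
    refine (intervalIntegral.norm_integral_le_of_norm_le hρb (Eventually.of_forall hbound)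
      (hi.const_mul _)).trans ?_
    rw [intervalIntegral.integral_const_mul, integral_rpow (Or.inr ⟨hne, h0⟩)]
    have e1 : ((t / 2) ^ (-(n : ℝ) / 2 + 1) - (√t / 2) ^ (-(n : ℝ) / 2 + 1)) / (-(n : ℝ) / 2 + 1) ≤
        2 * (√t / 2) ^ (-(n : ℝ) / 2 + 1) := by
      have hneg : -(n : ℝ) / 2 + 1 < 0 := by linarith
      rw [div_le_iff_of_neg hneg]
      have p1 : 0 ≤ (t / 2) ^ (-(n : ℝ) / 2 + 1) := by positivity
      have p2 : 0 ≤ (√t / 2) ^ (-(n : ℝ) / 2 + 1) := by positivity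
      nlinarith
    calc _ ≤ 2 * C * t ^ (-(1 / 2) : ℝ) *
          (2 * (2 ^ (-(-(n : ℝ) / 2 + 1)) * t ^ ((-(n : ℝ) / 2 + 1) / 2))) := by
            refine mul_le_mul_of_nonneg_left (e1.trans_eq ?_) (by positivity)
            rw [sqrt_half_rpow ht0]
      _ = 4 * C * 2 ^ (-(-(n : ℝ) / 2 + 1)) * (t ^ (-(1 / 2) : ℝ) * t ^ ((-(n : ℝ) / 2 + 1) / 2)) := by
          ring
      _ = 4 * C * 2 ^ (-(-(n : ℝ) / 2 + 1)) * t ^ (-(n : ℝ) / 4) := by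
          rw [← Real.rpow_add ht0]; congr 2; ring
      _ ≤ _ := by
          gcongr
          · norm_num
          · linarith

/-- The interval is cut at ±√t/2 and ±t/2, and the middle piece is moved to a half circle. The
radius √t/2 is the balanced choice: density, length and kernel multiply to t^{-1/2}·√t·(√t)^{-n/2} =
t^{-n/4}. The negative segments are the positive ones with s reversed, because the density is even;
the four segments account for 16 = 4·4. -/
theorem LongDensity.kernelBound {w : ℂ → ℂ} {t C : ℝ} (h : LongDensity w t C)
    (ht : 1 ≤ t) (hC : 0 ≤ C) (hn : 2 ≤ n) :
    KernelBound (fun ξ : RSpace n => ∫ s in (-t)..t, w s *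
      Complex.exp (Complex.I * s * laplaceSymbol ξ))
      ((16 + Real.pi) * C * 2 ^ ((n : ℝ) / 2) * t ^ (-(n : ℝ) / 4)) := by
  have ht0 : 0 < t := by linarith
  have hst : 1 ≤ √t := Real.one_le_sqrt.2 ht
  have hsq : √t * √t = t := Real.mul_self_sqrt ht0.le
  have hρb : √t / 2 ≤ t / 2 := by nlinarith
  have hρ0 : 0 < √t / 2 := by positivity
  have hwc := h.diff.continuous
  set N := 4 * C * 2 ^ ((n : ℝ) / 2) * t ^ (-(n : ℝ) / 4) with hN
  have k1 : ∀ ε : ℝ, |ε| = 1 → KernelBound (fun ξ : RSpace n =>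
      (∫ s in (√t / 2)..(t / 2), w s *
        Complex.exp (Complex.I * ((ε * s : ℝ) : ℂ) * laplaceSymbol ξ)) +
      ∫ s in (t / 2)..t, w s *
        Complex.exp (Complex.I * ((ε * s : ℝ) : ℂ) * laplaceSymbol ξ)) (N + N) := fun ε hε =>
    (kernelBound_segment hwc hρ0 hρb hε (h.norm_integral_inner_le ht hC hn hε)).add
      (kernelBound_segment hwc (by positivity) (by linarith) hε
        (h.norm_integral_outer_le ht hC hn hε))
  have k2 := kernelBound_arc (n := n) (w := fun s => -(w s * (s * Complex.I))) (by fun_prop) hρ0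
    (D := C * t ^ (-(1 / 2) : ℝ) * (√t / 2)) (fun s hs => by
      rw [norm_neg, norm_mul, norm_mul, Complex.norm_I, mul_one, hs]
      exact mul_le_mul_of_nonneg_right (h.arc s hs) hρ0.le)
  have k3 := ((k1 1 (by simp)).add (k1 (-1) (by simp))).add k2
  have hval : C * t ^ (-(1 / 2) : ℝ) * (√t / 2) * (√t / 2) ^ (-(n : ℝ) / 2) * Real.pi ≤
      Real.pi * C * 2 ^ ((n : ℝ) / 2) * t ^ (-(n : ℝ) / 4) := by
    have e : (√t / 2) * (√t / 2) ^ (-(n : ℝ) / 2) =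
        2 ^ (-(1 + -(n : ℝ) / 2)) * t ^ ((1 + -(n : ℝ) / 2) / 2) := by
      rw [← sqrt_half_rpow ht0, Real.rpow_add hρ0, Real.rpow_one]
    calc _ = Real.pi * C * 2 ^ (-(1 + -(n : ℝ) / 2)) *
          (t ^ (-(1 / 2) : ℝ) * t ^ ((1 + -(n : ℝ) / 2) / 2)) := by
          rw [mul_assoc (C * _), e]; ring
      _ = Real.pi * C * 2 ^ (-(1 + -(n : ℝ) / 2)) * t ^ (-(n : ℝ) / 4) := by
          rw [← Real.rpow_add ht0]; congr 2; ring
      _ ≤ _ := by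
          have := Real.pi_pos
          gcongr
          · norm_num
          · linarith
  have hfin := k3.mono (N' := (16 + Real.pi) * C * 2 ^ ((n : ℝ) / 2) * t ^ (-(n : ℝ) / 4)) (by
    rw [hN] at *; linarith)
  convert hfin using 2 with ξ
  set F : ℝ → ℂ := fun s => w s * Complex.exp (Complex.I * s * laplaceSymbol ξ) with hF
  have hFc : Continuous F := by simp only [hF]; fun_prop
  have hFi : ∀ a b, IntervalIntegrable F volume a b := fun a b => hFc.intervalIntegrable a b
  have hneg : ∀ a b : ℝ, ∫ s in a..b, w s *
      Complex.exp (Complex.I * ((-1 * s : ℝ) : ℂ) * laplaceSymbol ξ) = ∫ s in (-b)..(-a), F s := by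
    intro a b
    rw [← intervalIntegral.integral_comp_neg]
    congr 1; ext s
    simp only [hF]
    push_cast
    rw [h.even]
    congr 3; ring
  have hpos : ∀ a b : ℝ, ∫ s in a..b, w s *
      Complex.exp (Complex.I * ((1 * s : ℝ) : ℂ) * laplaceSymbol ξ) = ∫ s in a..b, F s := by
    intro a b; simp only [hF, one_mul]
  have harc : ∫ φ in (0 : ℝ)..Real.pi, (fun s => -(w s * (s * Complex.I)))
      (circleMap 0 (√t / 2) φ) *
      Complex.exp (Complex.I * circleMap 0 (√t / 2) φ * laplaceSymbol ξ) =
      ∫ s in (-(√t / 2))..(√t / 2), F s := by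
    have hd := h.diff
    have := integral_real_segment_eq_arc
      (h := fun s => w s * Complex.exp (Complex.I * s * laplaceSymbol ξ)) (by fun_prop) (√t / 2)
    simp only [hF]
    rw [this, ← intervalIntegral.integral_neg]
    congr 1; ext φ; ring
  rw [hpos, hpos, hneg, hneg, harc, intervalIntegral.integral_add_adjacent_intervals (hFi _ _) (hFi _ _),
    add_comm (∫ s in (-(t / 2))..(-(√t / 2)), F s),
    intervalIntegral.integral_add_adjacent_intervals (hFi _ _) (hFi _ _), add_assoc,
    intervalIntegral.integral_add_adjacent_intervals (hFi _ _) (hFi _ _), add_comm,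
    intervalIntegral.integral_add_adjacent_intervals (hFi _ _) (hFi _ _)]

end LongTime

/-! ### Long-time multiplier bounds, and the case of dimension one. -/

section LongTimeBounds

open Set Filter Topology FourierTransform

variable {n : ℕ}

/-- On the arc the complex Bessel bound applies with ζ = -s². On the real segment the decay in z =
√(t²-s²) is rewritten through t² - s² ≥ t(t-s), which brings J₀(z) and tJ₁(z)/z under the same
majorant. -/
theorem exists_longDensity : ∃ C : ℝ, 0 ≤ C ∧ ∀ t : ℝ, 1 ≤ t →
    LongDensity (sinDensity t) t C ∧ LongDensity (cosDensity t) t C := by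
  obtain ⟨A, hA0, hA⟩ := exists_besselEntire_sq_le
  obtain ⟨B, hB0, hB⟩ := exists_besselEntire_sq_add_le
  obtain ⟨D, hD0, hD⟩ := exists_norm_integral_density_le
  refine ⟨A + B + D, by positivity, fun t ht => ?_⟩
  have ht0 : 0 < t := by linarith
  have hst0 : 0 < √t := Real.sqrt_pos.2 ht0
  have hsq : √t * √t = t := Real.mul_self_sqrt ht0.le
  have hhalf : t ^ (-(1 / 2) : ℝ) = 1 / √t := by
    rw [Real.rpow_neg ht0.le, ← Real.sqrt_eq_rpow, one_div]
  have hosc : D / √t ≤ (A + B + D) * t ^ (-(1 / 2) : ℝ) := by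
    rw [hhalf, mul_one_div]; gcongr; linarith
  have harc : ∀ s : ℂ, ‖s‖ = √t / 2 → ‖-s ^ 2‖ ≤ t / 4 := fun s hs => by
    rw [norm_neg, norm_pow, hs, div_pow, Real.sq_sqrt ht0.le]; norm_num
  have hsin : ∀ s : ℂ, ‖sinDensity t s‖ = 1 / 2 * ‖besselEntire 0 ((t : ℂ) ^ 2 - s ^ 2)‖ := fun s => by
    rw [sinDensity, norm_mul]; norm_num
  have hcos : ∀ s : ℂ, ‖cosDensity t s‖ = t / 4 * ‖besselEntire 1 ((t : ℂ) ^ 2 - s ^ 2)‖ := fun s => by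
    rw [cosDensity, norm_mul, norm_neg, norm_div, Complex.norm_real, Real.norm_of_nonneg ht0.le,
      Complex.norm_ofNat]
  have hseg : ∀ s : ℝ, 0 ≤ s → s < t →
      ‖besselEntire 0 ((t : ℂ) ^ 2 - (s : ℂ) ^ 2)‖ ≤ A * (t ^ 2 - s ^ 2) ^ (-(1 / 4) : ℝ) ∧
      ‖besselEntire 1 ((t : ℂ) ^ 2 - (s : ℂ) ^ 2)‖ ≤ A * (t ^ 2 - s ^ 2) ^ (-(3 / 4) : ℝ) := by
    intro s hs0 hst
    have hx : 0 < t ^ 2 - s ^ 2 := by nlinarith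
    have hz := hA (√(t ^ 2 - s ^ 2)) (Real.sqrt_pos.2 hx)
    have e : ((√(t ^ 2 - s ^ 2) : ℝ) : ℂ) ^ 2 = (t : ℂ) ^ 2 - (s : ℂ) ^ 2 := by
      rw [← Complex.ofReal_pow, Real.sq_sqrt hx.le]; push_cast; rfl
    rw [e] at hz
    have e1 : √√(t ^ 2 - s ^ 2) = (t ^ 2 - s ^ 2) ^ (1 / 4 : ℝ) := by
      rw [Real.sqrt_eq_rpow, Real.sqrt_eq_rpow, ← Real.rpow_mul hx.le]; norm_num
    have e2 : √(t ^ 2 - s ^ 2) * √√(t ^ 2 - s ^ 2) = (t ^ 2 - s ^ 2) ^ (3 / 4 : ℝ) := by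
      rw [e1, Real.sqrt_eq_rpow, ← Real.rpow_add hx]; norm_num
    rw [e2, e1] at hz
    rw [Real.rpow_neg hx.le, Real.rpow_neg hx.le]
    exact ⟨(le_mul_inv_iff₀ (by positivity)).2 hz.1, (le_mul_inv_iff₀ (by positivity)).2 hz.2⟩
  have hcmp : ∀ s : ℝ, 0 ≤ s → s < t →
      (t ^ 2 - s ^ 2) ^ (-(1 / 4) : ℝ) ≤ t ^ (1 / 4 : ℝ) * (t - s) ^ (-(3 / 4) : ℝ) ∧
      t * (t ^ 2 - s ^ 2) ^ (-(3 / 4) : ℝ) ≤ t ^ (1 / 4 : ℝ) * (t - s) ^ (-(3 / 4) : ℝ) := by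
    intro s hs0 hst
    have hts : 0 < t - s := by linarith
    have hy : 0 < t * (t - s) := by positivity
    have hle : t * (t - s) ≤ t ^ 2 - s ^ 2 := by nlinarith
    constructor
    · calc (t ^ 2 - s ^ 2) ^ (-(1 / 4) : ℝ) ≤ (t * (t - s)) ^ (-(1 / 4) : ℝ) :=
            Real.rpow_le_rpow_of_nonpos hy hle (by norm_num)
        _ = t ^ (-(1 / 4) : ℝ) * ((t - s) ^ (1 / 2 : ℝ) * (t - s) ^ (-(3 / 4) : ℝ)) := by
            rw [Real.mul_rpow ht0.le hts.le, ← Real.rpow_add hts]; norm_num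
        _ ≤ t ^ (-(1 / 4) : ℝ) * (t ^ (1 / 2 : ℝ) * (t - s) ^ (-(3 / 4) : ℝ)) := by
            gcongr; linarith
        _ = _ := by rw [← mul_assoc, ← Real.rpow_add ht0]; norm_num
    · calc t * (t ^ 2 - s ^ 2) ^ (-(3 / 4) : ℝ) ≤ t * (t * (t - s)) ^ (-(3 / 4) : ℝ) := by
            gcongr t * ?_
            exact Real.rpow_le_rpow_of_nonpos hy hle (by norm_num)
        _ = t ^ (1 : ℝ) * t ^ (-(3 / 4) : ℝ) * (t - s) ^ (-(3 / 4) : ℝ) := by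
            rw [Real.mul_rpow ht0.le hts.le, Real.rpow_one]; ring
        _ = _ := by rw [← Real.rpow_add ht0]; norm_num
  have hreal : ∀ (ν : ℕ) (s : ℝ), ∃ r : ℝ, besselEntire ν ((t : ℂ) ^ 2 - (s : ℂ) ^ 2) = r := by
    intro ν s
    refine ⟨(besselEntire ν ((t ^ 2 - s ^ 2 : ℝ) : ℂ)).re, ?_⟩
    have := besselEntire_ofReal_im ν (t ^ 2 - s ^ 2)
    rw [show (t : ℂ) ^ 2 - (s : ℂ) ^ 2 = ((t ^ 2 - s ^ 2 : ℝ) : ℂ) by push_cast; rfl]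
    exact Complex.ext rfl (by rw [this, Complex.ofReal_im])
  constructor
  · refine ⟨differentiable_sinDensity t, fun s => by simp only [sinDensity, neg_sq], fun s => ?_,
      fun s hs => ?_, fun s hs0 hst => ?_, fun X hX => ((hD t X ht hX).1).trans hosc⟩
    · obtain ⟨r, hr⟩ := hreal 0 s
      rw [sinDensity, hr, show (1 / 2 * (r : ℂ)) = ((1 / 2 * r : ℝ) : ℂ) by push_cast; ring,
        Complex.ofReal_im]
    · have h := (hB t (-s ^ 2) ht (harc s hs)).1
      rw [← sub_eq_add_neg] at h
      rw [hsin, hhalf, mul_one_div, le_div_iff₀ hst0]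
      nlinarith [norm_nonneg (besselEntire 0 ((t : ℂ) ^ 2 - s ^ 2))]
    · rw [hsin, mul_assoc]
      have h1 := (hseg s hs0 hst).1
      have h2 := (hcmp s hs0 hst).1
      have h3 : 0 ≤ t ^ (1 / 4 : ℝ) * (t - s) ^ (-(3 / 4) : ℝ) := by
        have : 0 < t - s := by linarith
        positivity
      have h4 := mul_le_mul_of_nonneg_left h2 hA0.le
      have h5 : 0 ≤ A * (t ^ (1 / 4 : ℝ) * (t - s) ^ (-(3 / 4) : ℝ)) := by positivity
      have h6 : 0 ≤ (B + D) * (t ^ (1 / 4 : ℝ) * (t - s) ^ (-(3 / 4) : ℝ)) := by positivity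
      linarith
  · refine ⟨differentiable_cosDensity t, fun s => by simp only [cosDensity, neg_sq], fun s => ?_,
      fun s hs => ?_, fun s hs0 hst => ?_, fun X hX => ((hD t X ht hX).2).trans hosc⟩
    · obtain ⟨r, hr⟩ := hreal 1 s
      rw [cosDensity, hr, show (-((t : ℂ) / 4) * (r : ℂ)) = ((-(t / 4) * r : ℝ) : ℂ) by
        push_cast; ring, Complex.ofReal_im]
    · have h := (hB t (-s ^ 2) ht (harc s hs)).2
      rw [← sub_eq_add_neg] at h
      rw [hcos, hhalf, mul_one_div, le_div_iff₀ hst0]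
      nlinarith [norm_nonneg (besselEntire 1 ((t : ℂ) ^ 2 - s ^ 2))]
    · rw [hcos, mul_assoc (A + B + D)]
      have h1 := (hseg s hs0 hst).2
      have h2 := (hcmp s hs0 hst).2
      have h3 : 0 ≤ t ^ (1 / 4 : ℝ) * (t - s) ^ (-(3 / 4) : ℝ) := by
        have : 0 < t - s := by linarith
        positivity
      have h4 := mul_le_mul_of_nonneg_left h2 hA0.le
      have h5 := mul_le_mul_of_nonneg_left h1 ht0.le
      have h6 : 0 ≤ (B + D) * (t ^ (1 / 4 : ℝ) * (t - s) ^ (-(3 / 4) : ℝ)) := by positivity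
      have h7 : 0 ≤ A * (t ^ (1 / 4 : ℝ) * (t - s) ^ (-(3 / 4) : ℝ)) := by positivity
      nlinarith

theorem one_le_beamFreq (ξ : RSpace n) : 1 ≤ beamFreq ξ :=
  Real.one_le_sqrt.2 (by nlinarith [sq_nonneg (laplaceSymbol ξ)])

theorem beamFreq_pos (ξ : RSpace n) : 0 < beamFreq ξ := zero_lt_one.trans_le (one_le_beamFreq ξ)

theorem norm_sin_div_beamFreq_le (t : ℝ) (ξ : RSpace n) :
    ‖((Real.sin (t * beamFreq ξ) / beamFreq ξ : ℝ) : ℂ)‖ ≤ 1 := by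
  rw [Complex.norm_real, norm_div, Real.norm_eq_abs, Real.norm_of_nonneg (beamFreq_pos ξ).le,
    div_le_one (beamFreq_pos ξ)]
  exact (Real.abs_sin_le_one _).trans (one_le_beamFreq ξ)

theorem norm_cos_beamFreq_le (t : ℝ) (ξ : RSpace n) :
    ‖((Real.cos (t * beamFreq ξ) : ℝ) : ℂ)‖ ≤ 1 := by
  rw [Complex.norm_real, Real.norm_eq_abs]
  exact Real.abs_cos_le_one _

theorem exists_formBound_long_of_two_le (hn : 2 ≤ n) {θ p : ℝ}
    (hθ0 : 0 ≤ θ) (hθ1 : θ ≤ 1) (hp : p * (1 + θ) = 2) :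
    ∃ C : ℝ, 0 ≤ C ∧ ∀ t : ℝ, 1 ≤ t →
      FormBound p (fun ξ : RSpace n => ((Real.sin (t * beamFreq ξ) / beamFreq ξ : ℝ) : ℂ))
        (C * t ^ (-((n : ℝ) * θ / 4))) ∧
      FormBound p (fun ξ : RSpace n => ((Real.cos (t * beamFreq ξ) : ℝ) : ℂ))
        (C * t ^ (-((n : ℝ) * θ / 4))) := by
  obtain ⟨C, hC0, hC⟩ := exists_longDensity
  have hpi := Real.pi_gt_three
  set A : ℝ := (16 + Real.pi) * C * 2 ^ ((n : ℝ) / 2) with hA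
  have hA0 : 0 ≤ A := by positivity
  -- The summand 1 pays for the two halves of cos(ta), whose kernels are O(t^{-n/2}) and hence
  -- O(t^{-n/4}).
  refine ⟨(1 + A) ^ θ, by positivity, fun t ht => ?_⟩
  have ht0 : 0 < t := by linarith
  have hpow : ((1 + A) * t ^ (-(n : ℝ) / 4)) ^ θ = (1 + A) ^ θ * t ^ (-((n : ℝ) * θ / 4)) := by
    rw [Real.mul_rpow (by positivity) (by positivity), ← Real.rpow_mul ht0.le]
    congr 2; ring
  have hts : A * t ^ (-(n : ℝ) / 4) ≤ (1 + A) * t ^ (-(n : ℝ) / 4) := by gcongr; linarith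
  constructor
  · have h := ((hC t ht).1.kernelBound ht hC0 hn).mono hts
    rw [← hpow]
    have e : (fun ξ : RSpace n => ((Real.sin (t * beamFreq ξ) / beamFreq ξ : ℝ) : ℂ)) =
        fun ξ : RSpace n => ∫ s in (-t)..t, sinDensity t s *
          Complex.exp (Complex.I * s * laplaceSymbol ξ) := by
      ext ξ
      rw [(sinDensity_cosDensity_integral (laplaceSymbol ξ) t).1, beamFreq]
      push_cast; rfl
    rw [← e] at h
    exact h.formBound (norm_sin_div_beamFreq_le t) hθ0 hθ1 hp
  · have h := (hC t ht).2.kernelBound ht hC0 hn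
    rw [← hpow]
    -- A single propagator is written as an integral against a Dirac mass so that the superposition
    -- bound covers it.
    have h1 : ∀ s : ℝ, |s| = t → KernelBound (fun ξ : RSpace n => ∫ _ : Unit, (1 / 2 : ℂ) *
        Complex.exp (Complex.I * (s : ℂ) * laplaceSymbol ξ) ∂(Measure.dirac ()))
        (1 / 2 * t ^ (-(n : ℝ) / 4)) := fun s hs => by
      refine kernelBound_superposition (ν := Measure.dirac ()) (w := fun _ => 1 / 2)
        (σ := fun _ => (s : ℂ)) measurable_const measurable_const (integrable_const _) ht0
        (Eventually.of_forall fun _ => by simp) (Eventually.of_forall fun _ => by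
          rw [Complex.norm_real, Real.norm_eq_abs, hs]) fun z => ?_
      rw [integral_dirac, norm_mul]
      refine mul_le_mul (by norm_num) ((norm_schrodingerKernel_le_rpow (by simp) ht0 (by
        rw [Complex.norm_real, Real.norm_eq_abs, hs]) z).trans ?_) (norm_nonneg _) (by norm_num)
      refine Real.rpow_le_rpow_of_exponent_le ht ?_
      have : (0 : ℝ) ≤ n := by positivity
      linarith
    have e : (fun ξ : RSpace n => ((Real.cos (t * beamFreq ξ) : ℝ) : ℂ)) =
        fun ξ : RSpace n => ((∫ _ : Unit, (1 / 2 : ℂ) *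
        Complex.exp (Complex.I * (t : ℂ) * laplaceSymbol ξ) ∂(Measure.dirac ())) +
        (∫ _ : Unit, (1 / 2 : ℂ) *
        Complex.exp (Complex.I * ((-t : ℝ) : ℂ) * laplaceSymbol ξ) ∂(Measure.dirac ()))) +
        ∫ s in (-t)..t, cosDensity t s *
          Complex.exp (Complex.I * s * laplaceSymbol ξ) := by
      ext ξ
      rw [beamFreq, ← (sinDensity_cosDensity_integral (laplaceSymbol ξ) t).2, integral_dirac,
        integral_dirac]
      congr 1
      rw [Complex.ofReal_cos, Complex.cos]
      push_cast
      rw [show (t : ℂ) * laplaceSymbol ξ * Complex.I = Complex.I * t * laplaceSymbol ξ by ring,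
        show -((t : ℂ) * laplaceSymbol ξ) * Complex.I = Complex.I * -t * laplaceSymbol ξ by ring]
      ring
    have h2 := ((h1 t (abs_of_pos ht0)).add (h1 (-t) (by rw [abs_neg, abs_of_pos ht0]))).add h
    rw [e]
    refine (h2.mono (N' := (1 + A) * t ^ (-(n : ℝ) / 4)) (le_of_eq (by ring))).formBound (fun ξ => ?_)
      hθ0 hθ1 hp
    have := norm_cos_beamFreq_le t ξ
    rwa [congrFun e ξ] at this

theorem FormBound.of_tendsto {p N B : ℝ} {m : RSpace n → ℂ} {mj : ℕ → RSpace n → ℂ}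
    (hmeas : ∀ j, AEStronglyMeasurable (mj j)) (hB : ∀ j ξ, ‖mj j ξ‖ ≤ B)
    (hlim : ∀ ξ, Tendsto (fun j => mj j ξ) atTop (𝓝 (m ξ))) (h : ∀ j, FormBound p (mj j) N) :
    FormBound p m N := fun f g hf hg => by
  have hI := integrable_fourier_mul_fourierInv f g
  have : Tendsto (fun j => ∫ ξ, mj j ξ * (𝓕 f ξ * 𝓕⁻ g ξ)) atTop
      (𝓝 (∫ ξ, m ξ * (𝓕 f ξ * 𝓕⁻ g ξ))) := by
    refine tendsto_integral_of_dominated_convergence (fun ξ => B * ‖𝓕 f ξ * 𝓕⁻ g ξ‖)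
      (fun j => (hmeas j).mul hI.aestronglyMeasurable) (hI.norm.const_mul B)
      (fun j => Eventually.of_forall fun ξ => ?_) (Eventually.of_forall fun ξ => ?_)
    · rw [norm_mul]
      exact mul_le_mul_of_nonneg_right (hB j ξ) (norm_nonneg _)
    · exact (hlim ξ).mul_const _
  exact le_of_tendsto this.norm (Eventually.of_forall fun j => h j f g hf hg)

/-- The isometry `ℝ → ℝ¹`. -/
noncomputable def lineEquiv : ℝ ≃ᵐ RSpace 1 :=
  (MeasurableEquiv.funUnique (Fin 1) ℝ).symm.trans (MeasurableEquiv.toLp 2 (Fin 1 → ℝ))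

theorem measurePreserving_lineEquiv : MeasurePreserving lineEquiv volume volume :=
  (PiLp.volume_preserving_toLp (Fin 1)).comp ((volume_preserving_funUnique (Fin 1) ℝ).symm _)

theorem lineEquiv_apply (x : ℝ) (i : Fin 1) : lineEquiv x i = x := rfl

theorem norm_lineEquiv (x : ℝ) : ‖lineEquiv x‖ = |x| := by
  rw [EuclideanSpace.norm_eq, Fin.sum_univ_one, lineEquiv_apply, Real.norm_eq_abs, sq_abs,
    Real.sqrt_sq_eq_abs]

theorem integral_rspace_one (F : RSpace 1 → ℂ) : ∫ ξ, F ξ = ∫ x : ℝ, F (lineEquiv x) :=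
  (measurePreserving_lineEquiv.integral_comp lineEquiv.measurableEmbedding F).symm

theorem beamFreq_lineEquiv (x : ℝ) : beamFreq (lineEquiv x) = quarticDisp (2 * Real.pi * x) := by
  rw [beamFreq, quarticDisp, laplaceSymbol, norm_lineEquiv]
  congr 2
  rw [← pow_mul, mul_pow, mul_pow _ x, pow_mul |x|, sq_abs, ← pow_mul]

/-- The one dimensional long time bound for an even decreasing amplitude. -/
theorem formBound_quartic {θ p : ℝ} (hθ0 : 0 ≤ θ) (hθ1 : θ ≤ 1) (hp : p * (1 + θ) = 2)
    {r ε : ℝ} (hr : 1 ≤ r) (hε : ε = 1 ∨ ε = -1)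
    {ψ ψ' : ℝ → ℝ} (hψ : ∀ x, HasDerivAt ψ (ψ' x) x) (hψ'c : Continuous ψ')
    (hψ' : ∀ x, 0 ≤ x → ψ' x ≤ 0) (h0 : ∀ x, 0 ≤ ψ x) (h1 : ∀ x, ψ x ≤ 1)
    (heven : ∀ x, ψ (-x) = ψ x) :
    FormBound p (fun ξ : RSpace 1 => (ψ (2 * Real.pi * ξ 0) : ℂ) *
      Complex.exp (Complex.I * ((ε * r ^ 4 * beamFreq ξ : ℝ) : ℂ))) ((40 / r) ^ θ) := by
  set m : RSpace 1 → ℂ := fun ξ => (ψ (2 * Real.pi * ξ 0) : ℂ) *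
      Complex.exp (Complex.I * ((ε * r ^ 4 * beamFreq ξ : ℝ) : ℂ)) with hm
  have hψc : Continuous ψ := continuous_iff_continuousAt.2 fun x => (hψ x).continuousAt
  have hmc : Continuous m := by
    have h2 : Continuous fun ξ : RSpace 1 => beamFreq ξ := by unfold beamFreq; fun_prop
    simp only [hm]
    fun_prop
  have hm1 : ∀ ξ, ‖m ξ‖ ≤ 1 := fun ξ => by
    simp only [hm]
    rw [norm_mul, mul_comm Complex.I, Complex.norm_exp_ofReal_mul_I, mul_one, Complex.norm_real,
      Real.norm_of_nonneg (h0 _)]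
    exact h1 _
  -- The multiplier is not integrable and is cut off to balls. The oscillatory bound does not depend
  -- on the radius, so it survives the limit.
  set S : ℕ → Set (RSpace 1) := fun j => Metric.closedBall 0 j with hS
  have hSm : ∀ j, MeasurableSet (S j) := fun j => Metric.isClosed_closedBall.measurableSet
  have hind : ∀ j ξ, ‖(S j).indicator m ξ‖ ≤ 1 := fun j ξ =>
    (norm_indicator_le_norm_self m ξ).trans (hm1 ξ)
  refine FormBound.of_tendsto (mj := fun j => (S j).indicator m) (B := 1)
    (fun j => hmc.aestronglyMeasurable.indicator (hSm j)) hind (fun ξ => ?_) fun j => ?_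
  · refine tendsto_const_nhds.congr' ?_
    obtain ⟨J, hJ⟩ := exists_nat_ge ‖ξ‖
    filter_upwards [eventually_ge_atTop J] with j hj
    rw [indicator_of_mem]
    rw [hS, mem_closedBall_zero_iff]
    exact hJ.trans (by exact_mod_cast hj)
  · have hint : Integrable ((S j).indicator m) :=
      (integrable_indicator_iff (hSm j)).2
        (hmc.continuousOn.integrableOn_compact (isCompact_closedBall 0 (j : ℝ)))
    refine (HasKernel.of_integrable hint).formBound (hind j)
      (VectorFourier.fourierIntegral_continuous Real.continuous_fourierChar (by
        exact continuous_inner.neg) hint).measurable (fun z => ?_) hθ0 hθ1 hp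
    have hj : (0 : ℝ) ≤ j := Nat.cast_nonneg j
    have hpi := Real.pi_gt_three
    have hstep := norm_integral_quartic_phase_symm_le (r := r) (y := z 0)
      (R := 2 * Real.pi * j) hr (by positivity) hε hψ hψ'c hψ' h0 h1 heven
    have hset : ∀ x : ℝ, lineEquiv x ∈ S j ↔ x ∈ Icc (-(j : ℝ)) j := fun x => by
      rw [hS, mem_closedBall_zero_iff, norm_lineEquiv, abs_le, mem_Icc]
    set G : ℝ → ℂ := fun y => (ψ y : ℂ) * Complex.exp (Complex.I *
      ((ε * r ^ 4 * quarticDisp y + z 0 * y : ℝ) : ℂ)) with hG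
    have e : 𝓕⁻ ((S j).indicator m) z = ∫ x in (-(j : ℝ))..j, G (2 * Real.pi * x) := by
      rw [Real.fourierInv_eq', integral_rspace_one, intervalIntegral.integral_of_le (by linarith),
        ← integral_Icc_eq_integral_Ioc, ← integral_indicator measurableSet_Icc]
      congr 1; ext x
      by_cases hx : x ∈ Icc (-(j : ℝ)) j
      · rw [indicator_of_mem hx, indicator_of_mem ((hset x).2 hx)]
        simp only [hm, hG, lineEquiv_apply, beamFreq_lineEquiv, smul_eq_mul]
        rw [mul_left_comm, ← Complex.exp_add]
        congr 2
        have : (inner ℝ (lineEquiv x) z : ℝ) = z 0 * x := by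
          rw [PiLp.inner_apply, Fin.sum_univ_one, lineEquiv_apply]
          simp
        rw [this]
        push_cast; ring
      · rw [indicator_of_notMem hx, indicator_of_notMem (fun h => hx ((hset x).1 h)), smul_zero]
    rw [e, intervalIntegral.integral_comp_mul_left G (by positivity), norm_smul, norm_inv,
      Real.norm_of_nonneg (by positivity), mul_neg]
    refine le_trans ?_ hstep
    refine mul_le_of_le_one_left (norm_nonneg _) (inv_le_one_of_one_le₀ (by linarith))

theorem exists_formBound_long_one {θ p : ℝ}
    (hθ0 : 0 ≤ θ) (hθ1 : θ ≤ 1) (hp : p * (1 + θ) = 2) :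
    ∃ C : ℝ, 0 ≤ C ∧ ∀ t : ℝ, 1 ≤ t →
      FormBound p (fun ξ : RSpace 1 => ((Real.sin (t * beamFreq ξ) / beamFreq ξ : ℝ) : ℂ))
        (C * t ^ (-(((1 : ℕ) : ℝ) * θ / 4))) ∧
      FormBound p (fun ξ : RSpace 1 => ((Real.cos (t * beamFreq ξ) : ℝ) : ℂ))
        (C * t ^ (-(((1 : ℕ) : ℝ) * θ / 4))) := by
  refine ⟨40 ^ θ, by positivity, fun t ht => ?_⟩
  have ht0 : 0 < t := by linarith
  -- The oscillatory estimate is scaled so that time is r⁴; its bound 40/r is then 40 t^{-1/4}.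
  set r : ℝ := t ^ (1 / 4 : ℝ) with hr
  have hr1 : 1 ≤ r := Real.one_le_rpow ht (by norm_num)
  have hr4 : r ^ 4 = t := by
    rw [hr, ← Real.rpow_natCast, ← Real.rpow_mul ht0.le]; norm_num
  have hN : (40 / r) ^ θ = 40 ^ θ * t ^ (-(((1 : ℕ) : ℝ) * θ / 4)) := by
    rw [Real.div_rpow (by norm_num) (by positivity), hr, ← Real.rpow_mul ht0.le, div_eq_mul_inv,
      ← Real.rpow_neg ht0.le]
    congr 2; push_cast; ring
  rw [← hN]
  have hfreq : ∀ ξ : RSpace 1, beamFreq ξ = quarticDisp (2 * Real.pi * ξ 0) := fun ξ => by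
    rw [← beamFreq_lineEquiv]
    congr 1; ext i
    rw [lineEquiv_apply, Subsingleton.elim i 0]
  have hbc : Continuous fun ξ : RSpace 1 => beamFreq ξ := by unfold beamFreq; fun_prop
  have key : ∀ {ψ ψ' : ℝ → ℝ} (c₁ c₂ : ℂ), ‖c₁‖ = 1 / 2 → ‖c₂‖ = 1 / 2 →
      (∀ x, HasDerivAt ψ (ψ' x) x) → Continuous ψ' → (∀ x, 0 ≤ x → ψ' x ≤ 0) → (∀ x, 0 ≤ ψ x) →
      (∀ x, ψ x ≤ 1) → (∀ x, ψ (-x) = ψ x) →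
      FormBound p (fun ξ : RSpace 1 =>
        c₁ * ((ψ (2 * Real.pi * ξ 0) : ℂ) *
          Complex.exp (Complex.I * ((1 * r ^ 4 * beamFreq ξ : ℝ) : ℂ))) +
        c₂ * ((ψ (2 * Real.pi * ξ 0) : ℂ) *
          Complex.exp (Complex.I * ((-1 * r ^ 4 * beamFreq ξ : ℝ) : ℂ)))) ((40 / r) ^ θ) := by
    intro ψ ψ' c₁ c₂ hc₁ hc₂ hψ hψ'c hψ' h0 h1 heven
    have hψc : Continuous ψ := continuous_iff_continuousAt.2 fun x => (hψ x).continuousAt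
    have hB : ∀ (c : ℂ) (ε : ℝ), ‖c‖ = 1 / 2 → ∀ ξ : RSpace 1, ‖c * ((ψ (2 * Real.pi * ξ 0) : ℂ) *
          Complex.exp (Complex.I * ((ε * r ^ 4 * beamFreq ξ : ℝ) : ℂ)))‖ ≤ 1 / 2 := by
      intro c ε hc ξ
      rw [norm_mul, norm_mul, hc, mul_comm Complex.I, Complex.norm_exp_ofReal_mul_I, mul_one,
        Complex.norm_real, Real.norm_of_nonneg (h0 _)]
      linarith [h1 (2 * Real.pi * ξ 0)]
    have a1 := (formBound_quartic hθ0 hθ1 hp hr1 (Or.inl rfl) hψ hψ'c hψ' h0 h1 heven).const_mul c₁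
    have a2 := (formBound_quartic hθ0 hθ1 hp hr1 (Or.inr rfl) hψ hψ'c hψ' h0 h1 heven).const_mul c₂
    refine (a1.add a2 (Continuous.aestronglyMeasurable (by fun_prop))
      (Continuous.aestronglyMeasurable (by fun_prop)) (hB c₁ 1 hc₁) (hB c₂ (-1) hc₂)).mono ?_
    rw [hc₁, hc₂]
    linarith
  constructor
  -- The factor 1/ω of the sine propagator is itself an admissible amplitude: even, decreasing for x
  -- ≥ 0, with values in [0,1].
  · have := key (ψ := fun x => (quarticDisp x)⁻¹)
      (ψ' := fun x => -(2 * x ^ 3 / quarticDisp x) / quarticDisp x ^ 2)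
      (1 / (2 * Complex.I)) (-1 / (2 * Complex.I)) (by simp) (by simp)
      (fun x => (hasDerivAt_quarticDisp x).fun_inv (quarticDisp_pos x).ne')
      (by
        have hq := quarticDisp_continuous
        have hne : ∀ x, quarticDisp x ≠ 0 := fun x => (quarticDisp_pos x).ne'
        exact (((continuous_const.mul (continuous_id.pow 3)).div hq hne).neg).div (hq.pow 2)
          fun x => pow_ne_zero 2 (hne x))
      (fun x hx => by
        have := quarticDisp_pos x
        rw [neg_div]
        exact neg_nonpos.2 (by positivity))
      (fun x => (inv_pos.2 (quarticDisp_pos x)).le)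
      (fun x => inv_le_one_of_one_le₀ (one_le_quarticDisp x))
      (fun x => by simp only [quarticDisp]; rw [show (-x) ^ 4 = x ^ 4 by ring])
    convert this using 2 with ξ
    rw [← hfreq, one_mul, hr4, Complex.ofReal_div, Complex.ofReal_sin, Complex.sin]
    have hb : (beamFreq ξ : ℂ) ≠ 0 := by exact_mod_cast (beamFreq_pos ξ).ne'
    push_cast
    rw [show -((t : ℂ) * beamFreq ξ) * Complex.I = Complex.I * (-1 * t * beamFreq ξ) by ring,
      show ((t : ℂ) * beamFreq ξ) * Complex.I = Complex.I * (t * beamFreq ξ) by ring]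
    field_simp
    linear_combination (Complex.exp (-(Complex.I * t * beamFreq ξ)) -
      Complex.exp (Complex.I * t * beamFreq ξ)) * Complex.I_sq
  · have := key (ψ := fun _ => 1) (ψ' := fun _ => 0) (1 / 2) (1 / 2) (by simp) (by simp)
      (fun x => hasDerivAt_const x 1) continuous_const (fun _ _ => le_rfl) (fun _ => zero_le_one)
      (fun _ => le_rfl) (fun _ => rfl)
    convert this using 2 with ξ
    rw [one_mul, hr4, Complex.ofReal_cos, Complex.cos]
    push_cast
    rw [show -((t : ℂ) * beamFreq ξ) * Complex.I = Complex.I * (-1 * t * beamFreq ξ) by ring,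
      show ((t : ℂ) * beamFreq ξ) * Complex.I = Complex.I * (t * beamFreq ξ) by ring]
    ring

/-- The long time bounds. -/
theorem exists_formBound_long (hn : 1 ≤ n) {θ p : ℝ}
    (hθ0 : 0 ≤ θ) (hθ1 : θ ≤ 1) (hp : p * (1 + θ) = 2) :
    ∃ C : ℝ, 0 ≤ C ∧ ∀ t : ℝ, 1 ≤ t →
      FormBound p (fun ξ : RSpace n => ((Real.sin (t * beamFreq ξ) / beamFreq ξ : ℝ) : ℂ))
        (C * t ^ (-((n : ℝ) * θ / 4))) ∧
      FormBound p (fun ξ : RSpace n => ((Real.cos (t * beamFreq ξ) : ℝ) : ℂ))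
        (C * t ^ (-((n : ℝ) * θ / 4))) := by
  rcases hn.eq_or_lt with rfl | h
  · exact exists_formBound_long_one hθ0 hθ1 hp
  · exact exists_formBound_long_of_two_le h hθ0 hθ1 hp

end LongTimeBounds

/-! ### From bilinear forms on test functions to L^p distributions. -/

section Transfer

open Set Filter Topology FourierTransform

variable {n : ℕ}

theorem realLpNorm_eq_toReal {p : ℝ} (hp : 0 < p) {f : RSpace n → ℂ}
    (hf : MemLp f (ENNReal.ofReal p) volume) :
    realLpNorm p f = (eLpNorm f (ENNReal.ofReal p) volume).toReal := by
  rw [hf.eLpNorm_eq_integral_rpow_norm (by simpa using hp) ENNReal.ofReal_ne_top,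
    ENNReal.toReal_ofReal hp.le, ENNReal.toReal_ofReal (Real.rpow_nonneg
      (integral_nonneg fun _ => by positivity) _), realLpNorm, one_div]

/-- The pairing of `L^p` and `L^q`. -/
noncomputable def mulPairing (n : ℕ) (P Q : ℝ≥0∞) [Fact (1 ≤ P)] [Fact (1 ≤ Q)]
    [P.HolderConjugate Q] :
    Lp ℂ P (volume : Measure (RSpace n)) →L[ℂ] Lp ℂ Q (volume : Measure (RSpace n)) →L[ℂ] ℂ :=
  (ContinuousLinearMap.mul ℂ ℂ).lpPairing volume P Q

theorem mulPairing_eq_integral {P Q : ℝ≥0∞} [Fact (1 ≤ P)] [Fact (1 ≤ Q)]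
    [P.HolderConjugate Q] {f g : RSpace n → ℂ} {F : Lp ℂ P (volume : Measure (RSpace n))}
    {G : Lp ℂ Q (volume : Measure (RSpace n))} (hF : F =ᵐ[volume] f) (hG : G =ᵐ[volume] g) :
    mulPairing n P Q F G = ∫ x, f x * g x := by
  rw [mulPairing, ContinuousLinearMap.lpPairing_eq_integral]
  refine integral_congr_ae ?_
  filter_upwards [hF, hG] with x h1 h2
  rw [ContinuousLinearMap.mul_apply', h1, h2]

theorem norm_mulPairing_le_of_forall_schwartz {P Q : ℝ≥0∞} [Fact (1 ≤ P)] [Fact (1 ≤ Q)]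
    [P.HolderConjugate Q] (hP : P ≠ ⊤) (V : Lp ℂ Q (volume : Measure (RSpace n))) {B : ℝ}
    (h : ∀ φ : 𝓢(RSpace n, ℂ), HasCompactSupport φ →
      ‖mulPairing n P Q (φ.toLp P volume) V‖ ≤ B * ‖φ.toLp P (volume : Measure (RSpace n))‖)
    (X : Lp ℂ P (volume : Measure (RSpace n))) : ‖mulPairing n P Q X V‖ ≤ B * ‖X‖ := by
  have hd := Lp.dense_hasCompactSupport_contDiff (E := RSpace n) (F := ℂ) (μ := volume) (p := P) hP
  have hc : IsClosed {X : Lp ℂ P (volume : Measure (RSpace n)) |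
      ‖mulPairing n P Q X V‖ ≤ B * ‖X‖} :=
    isClosed_le (((mulPairing n P Q).flip V).continuous.norm) (continuous_const.mul continuous_norm)
  refine hc.closure_subset_iff.2 ?_ (hd X)
  rintro Y ⟨g, hYg, hg1, hg2⟩
  have hY : Y = (hg1.toSchwartzMap hg2).toLp P volume := by
    refine Lp.ext ?_
    filter_upwards [hYg, (hg1.toSchwartzMap hg2).coeFn_toLp P volume] with x h1 h2
    rw [h1, h2]; rfl
  rw [mem_ofPred_eq, hY]
  exact h _ hg1

/-- The conjugate of z|z|^{q-2} is the extremal function of Hölder's inequality, used below to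
recover the L^q norm from pairings. -/
theorem conj_signedPow_mul_self {q : ℝ} (hq : 1 < q) (z : ℂ) :
    (starRingEnd ℂ) (signedPow ((q - 1 : ℝ) : ℂ) z) * z = ((‖z‖ ^ q : ℝ) : ℂ) := by
  rcases eq_or_ne z 0 with h0 | h0
  · rw [h0, mul_zero, norm_zero, Real.zero_rpow (by linarith), Complex.ofReal_zero]
  · have hv : 0 < ‖z‖ := norm_pos_iff.2 h0
    rw [signedPow, ← Complex.ofReal_mul, ← Complex.ofReal_exp, map_mul, map_div₀,
      Complex.conj_ofReal, Complex.conj_ofReal, mul_comm (q - 1) (Real.log _),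
      ← Real.rpow_def_of_pos hv]
    have e2 : (starRingEnd ℂ) z * z = ((‖z‖ ^ 2 : ℝ) : ℂ) := by
      rw [mul_comm, Complex.mul_conj, Complex.normSq_eq_norm_sq]
    rw [div_mul_eq_mul_div, div_mul_eq_mul_div, mul_right_comm, e2, ← Complex.ofReal_mul,
      ← Complex.ofReal_div]
    congr 1
    rw [Real.rpow_sub_one hv.ne']
    field_simp

theorem norm_conj_signedPow {q : ℝ} (hq : 1 < q) (z : ℂ) :
    ‖(starRingEnd ℂ) (signedPow ((q - 1 : ℝ) : ℂ) z)‖ = ‖z‖ ^ (q - 1) := by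
  rw [RCLike.norm_conj, norm_signedPow (by rw [Complex.ofReal_re]; linarith), Complex.ofReal_re]

/-- The converse of Hölder's inequality, tested on smooth functions. -/
theorem norm_le_of_forall_mulPairing_le {p q : ℝ} (hpq : p.HolderConjugate q) {P Q : ℝ≥0∞}
    (hPp : P = ENNReal.ofReal p) (hQq : Q = ENNReal.ofReal q)
    [Fact (1 ≤ P)] [Fact (1 ≤ Q)] [P.HolderConjugate Q]
    (V : Lp ℂ Q (volume : Measure (RSpace n))) {B : ℝ} (hB : 0 ≤ B)
    (h : ∀ φ : 𝓢(RSpace n, ℂ), HasCompactSupport φ →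
      ‖mulPairing n P Q (φ.toLp P volume) V‖ ≤
        B * ‖φ.toLp P (volume : Measure (RSpace n))‖) : ‖V‖ ≤ B := by
  have hP : P ≠ ⊤ := by rw [hPp]; exact ENNReal.ofReal_ne_top
  have hall := norm_mulPairing_le_of_forall_schwartz hP V h
  have hq : 1 < q := hpq.symm.lt
  set χ : RSpace n → ℂ := fun x => (starRingEnd ℂ) (signedPow ((q - 1 : ℝ) : ℂ) (V x)) with hχ
  have hχm : AEStronglyMeasurable χ volume :=
    (Complex.continuous_conj.comp (signedPow_continuous
      (by rw [Complex.ofReal_re]; linarith))).comp_aestronglyMeasurable (Lp.aestronglyMeasurable V)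
  have hexp : (q - 1) * p = q := by
    have := hpq.symm.sub_one_mul_conj; linarith
  have hχn : ∀ x, ‖χ x‖ ^ p = ‖V x‖ ^ q := fun x => by
    rw [hχ, norm_conj_signedPow hq, ← Real.rpow_mul (norm_nonneg _), hexp]
  have hVL : MemLp V (ENNReal.ofReal q) volume := hQq ▸ Lp.memLp V
  have hVi : Integrable (fun x => ‖V x‖ ^ q) volume := by
    have := hVL.integrable_norm_rpow (by simpa using hpq.symm.pos) ENNReal.ofReal_ne_top
    rwa [ENNReal.toReal_ofReal hpq.symm.nonneg] at this
  have hχL' : MemLp χ (ENNReal.ofReal p) volume := by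
    rw [← integrable_norm_rpow_iff hχm (by simpa using hpq.pos) ENNReal.ofReal_ne_top,
      ENNReal.toReal_ofReal hpq.nonneg]
    simpa only [hχn] using hVi
  have hχL : MemLp χ P volume := hPp ▸ hχL'
  set A := ∫ x, ‖V x‖ ^ q with hA
  have hA0 : 0 ≤ A := integral_nonneg fun _ => by positivity
  have h1 := hall (hχL.toLp χ)
  have e1 : mulPairing n P Q (hχL.toLp χ) V = (A : ℂ) := by
    rw [mulPairing_eq_integral hχL.coeFn_toLp (ae_eq_refl _), hA, ← integral_complex_ofReal]
    exact integral_congr_ae (ae_of_all _ fun x => conj_signedPow_mul_self hq (V x))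
  have e3 : ‖hχL.toLp χ‖ = A ^ (1 / p) := by
    rw [Lp.norm_toLp, hPp, ← realLpNorm_eq_toReal hpq.pos hχL', realLpNorm]
    simp only [hχn]; rfl
  have e4 : ‖V‖ = A ^ (1 / q) := by
    rw [Lp.norm_def, show eLpNorm V Q volume = eLpNorm V (ENNReal.ofReal q) volume by rw [← hQq],
      ← realLpNorm_eq_toReal hpq.symm.pos hVL, realLpNorm]
  rw [e1, e3, Complex.norm_real, Real.norm_of_nonneg hA0] at h1
  rw [e4]
  rcases hA0.eq_or_lt with h0 | h0
  · rw [← h0, Real.zero_rpow (one_div_ne_zero hpq.symm.pos.ne')]; exact hB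
  -- Testing with the extremal function gives A ≤ B A^{1/p} for A = ‖V‖_q^q, and 1 - 1/p = 1/q.
  · have hsum : 1 / q + 1 / p = 1 := by
      have := hpq.inv_add_inv_eq_one
      simpa [one_div, add_comm] using this
    have h2 : A ^ (1 / q) * A ^ (1 / p) ≤ B * A ^ (1 / p) := by
      rw [← Real.rpow_add h0, hsum, Real.rpow_one]; exact h1
    exact le_of_mul_le_mul_right h2 (by positivity)

theorem integral_fourierMultiplier_mul {m : RSpace n → ℂ} (hm : m.HasTemperateGrowth)
    (f φ : 𝓢(RSpace n, ℂ)) :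
    ∫ x, fourierMultiplierCLM ℂ m f x * φ x = ∫ ξ, m ξ * (𝓕 f ξ * 𝓕⁻ φ ξ) := by
  rw [fourierMultiplierCLM_apply, integral_fourierInv_mul_eq]
  congr 1; ext ξ
  rw [smulLeftCLM_apply_apply hm, smul_eq_mul, mul_assoc]

/-- Together with `integral_fourierMultiplier_mul` this shows that the transposed operator defining
the multiplier on distributions agrees with the multiplier on Schwartz functions. -/
theorem integral_mul_fourier_smul_fourierInv {m : RSpace n → ℂ} (hm : m.HasTemperateGrowth)
    (f φ : 𝓢(RSpace n, ℂ)) :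
    ∫ x, f x * 𝓕 (smulLeftCLM ℂ m (𝓕⁻ φ)) x = ∫ ξ, m ξ * (𝓕 f ξ * 𝓕⁻ φ ξ) := by
  rw [← integral_fourier_mul_eq]
  congr 1; ext ξ
  rw [smulLeftCLM_apply_apply hm, smul_eq_mul]
  ring

theorem exists_schwartz_tendsto_toLp {P : ℝ≥0∞} [Fact (1 ≤ P)] (hP : P ≠ ⊤) {g : RSpace n → ℂ}
    (hg : MemLp g P volume) : ∃ f : ℕ → 𝓢(RSpace n, ℂ), (∀ j, HasCompactSupport (f j)) ∧
      Tendsto (fun j => (f j).toLp P (volume : Measure (RSpace n))) atTop (𝓝 (hg.toLp g)) := by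
  have happ : ∀ j : ℕ, ∃ f : 𝓢(RSpace n, ℂ), HasCompactSupport f ∧
      eLpNorm (g - (fun x => f x)) P volume ≤ ENNReal.ofReal (1 / ((j : ℝ) + 1)) := fun j => by
    obtain ⟨f, hf1, hf2, hf3⟩ := hg.exist_eLpNorm_sub_le hP (Fact.out : 1 ≤ P)
      (ε := 1 / ((j : ℝ) + 1)) (by positivity)
    exact ⟨hf1.toSchwartzMap hf2, hf1, hf3⟩
  choose f hfc hfe using happ
  refine ⟨f, hfc, ?_⟩
  rw [tendsto_iff_norm_sub_tendsto_zero]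
  refine squeeze_zero (fun _ => norm_nonneg _) (fun j => ?_)
    tendsto_one_div_add_atTop_nhds_zero_nat
  rw [norm_sub_rev, show (f j).toLp P (volume : Measure (RSpace n)) =
    ((f j).memLp P volume).toLp (f j) from rfl, ← MemLp.toLp_sub, Lp.norm_toLp]
  exact ENNReal.toReal_le_of_le_ofReal (by positivity) (hfe j)

theorem toLp_sub_toLp {P : ℝ≥0∞} [Fact (1 ≤ P)] (f g : 𝓢(RSpace n, ℂ)) :
    f.toLp P (volume : Measure (RSpace n)) - g.toLp P volume = (f - g).toLp P volume :=
  ((toLpCLM ℂ ℂ P (volume : Measure (RSpace n))).map_sub f g).symm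

theorem exists_tendsto_fourierMultiplier_toLp {P Q : ℝ≥0∞} [Fact (1 ≤ P)] [Fact (1 ≤ Q)]
    {m : RSpace n → ℂ} {N : ℝ} (hN : 0 ≤ N)
    (core : ∀ f : 𝓢(RSpace n, ℂ), HasCompactSupport f →
      ‖(fourierMultiplierCLM ℂ m f).toLp Q (volume : Measure (RSpace n))‖ ≤
        N * ‖f.toLp P (volume : Measure (RSpace n))‖)
    {f : ℕ → 𝓢(RSpace n, ℂ)} (hfc : ∀ j, HasCompactSupport (f j))
    {X : Lp ℂ P (volume : Measure (RSpace n))}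
    (hX : Tendsto (fun j => (f j).toLp P (volume : Measure (RSpace n))) atTop (𝓝 X)) :
    ∃ G : Lp ℂ Q (volume : Measure (RSpace n)), ‖G‖ ≤ N * ‖X‖ ∧
      Tendsto (fun j => (fourierMultiplierCLM ℂ m (f j)).toLp Q (volume : Measure (RSpace n)))
        atTop (𝓝 G) := by
  have hFd : ∀ j k, dist ((fourierMultiplierCLM ℂ m (f j)).toLp Q (volume : Measure (RSpace n)))
      ((fourierMultiplierCLM ℂ m (f k)).toLp Q volume) ≤
      N * dist ((f j).toLp P (volume : Measure (RSpace n))) ((f k).toLp P volume) := by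
    intro j k
    rw [dist_eq_norm, dist_eq_norm, toLp_sub_toLp, toLp_sub_toLp, ← map_sub]
    exact core _ ((hfc j).sub (hfc k))
  have hcau : CauchySeq fun j =>
      (fourierMultiplierCLM ℂ m (f j)).toLp Q (volume : Measure (RSpace n)) := by
    have h1 := hX.cauchySeq
    rw [Metric.cauchySeq_iff] at h1 ⊢
    intro ε hε
    -- Dividing by N + 1 rather than N admits N = 0.
    obtain ⟨J, hJ⟩ := h1 (ε / (N + 1)) (by positivity)
    refine ⟨J, fun j hj k hk => (hFd j k).trans_lt ?_⟩
    have h2 := hJ j hj k hk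
    rw [lt_div_iff₀ (by positivity)] at h2
    have h3 := dist_nonneg (x := (f j).toLp P (volume : Measure (RSpace n)))
      (y := (f k).toLp P volume)
    nlinarith
  obtain ⟨G, hG⟩ := cauchySeq_tendsto_of_complete hcau
  exact ⟨G, le_of_tendsto_of_tendsto' hG.norm (hX.norm.const_mul N) fun j => core (f j) (hfc j), hG⟩

/-- On distributions the multiplier acts by transposition on the test function. The two pairings
agree along the Schwartz approximations of g, and both converge, by continuity of the duality
between L^p and L^q. -/
theorem isGivenBy_fourierMultiplier_of_tendsto {P Q : ℝ≥0∞} [Fact (1 ≤ P)] [Fact (1 ≤ Q)]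
    [P.HolderConjugate Q] {m : RSpace n → ℂ} (hm : m.HasTemperateGrowth)
    {w : 𝓢'(RSpace n, ℂ)} {g : RSpace n → ℂ} (hg : MemLp g P volume) (hw : IsGivenBy w g)
    {f : ℕ → 𝓢(RSpace n, ℂ)}
    (hf : Tendsto (fun j => (f j).toLp P (volume : Measure (RSpace n))) atTop (𝓝 (hg.toLp g)))
    {G : Lp ℂ Q (volume : Measure (RSpace n))}
    (hG : Tendsto (fun j => (fourierMultiplierCLM ℂ m (f j)).toLp Q (volume : Measure (RSpace n)))
        atTop (𝓝 G)) :
    IsGivenBy (TemperedDistribution.fourierMultiplierCLM ℂ m w) G := by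
  intro φ
  rw [TemperedDistribution.fourierMultiplierCLM_apply_apply, hw]
  set ψ := 𝓕 (smulLeftCLM ℂ m (𝓕⁻ φ)) with hψ
  have t1 : Tendsto (fun j => mulPairing n P Q ((f j).toLp P volume) (ψ.toLp Q volume)) atTop
      (𝓝 (mulPairing n P Q (hg.toLp g) (ψ.toLp Q volume))) :=
    (((mulPairing n P Q).flip (ψ.toLp Q volume)).continuous.tendsto _).comp hf
  have t2 : Tendsto (fun j => mulPairing n P Q (φ.toLp P volume)
      ((fourierMultiplierCLM ℂ m (f j)).toLp Q volume)) atTop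
      (𝓝 (mulPairing n P Q (φ.toLp P volume) G)) :=
    ((mulPairing n P Q (φ.toLp P volume)).continuous.tendsto _).comp hG
  have e : ∀ j, mulPairing n P Q ((f j).toLp P volume) (ψ.toLp Q volume) =
      mulPairing n P Q (φ.toLp P volume) ((fourierMultiplierCLM ℂ m (f j)).toLp Q volume) := by
    intro j
    rw [mulPairing_eq_integral ((f j).coeFn_toLp P volume) (ψ.coeFn_toLp Q volume),
      mulPairing_eq_integral (φ.coeFn_toLp P volume) (coeFn_toLp _ Q volume), hψ,
      integral_mul_fourier_smul_fourierInv hm, ← integral_fourierMultiplier_mul hm]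
    congr 1; ext x; ring
  have e' := tendsto_nhds_unique (t1.congr e) t2
  rw [mulPairing_eq_integral hg.coeFn_toLp (ψ.coeFn_toLp Q volume),
    mulPairing_eq_integral (φ.coeFn_toLp P volume) (ae_eq_refl _)] at e'
  rw [← e']
  congr 1; ext x; ring

theorem lebesgueNorm_le_of_isGivenBy {p : ℝ≥0∞} {f : 𝓢'(RSpace n, ℂ)} {g : RSpace n → ℂ}
    (hg : MemLp g p volume) (h : IsGivenBy f g) : lebesgueNorm p f ≤ eLpNorm g p volume :=
  (iInf_le _ g).trans ((iInf_le _ hg).trans (iInf_le _ h))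

/-- A bounded form gives an `L^p → L^q` bounded multiplier on distributions. -/
theorem FormBound.lebesgueNorm_le_eLpNorm {p q : ℝ} (hpq : p.HolderConjugate q) {m : RSpace n → ℂ}
    (hm : m.HasTemperateGrowth) {N : ℝ} (hN : 0 ≤ N) (h : FormBound p m N)
    {w : 𝓢'(RSpace n, ℂ)} {g : RSpace n → ℂ} (hg : MemLp g (ENNReal.ofReal p) volume)
    (hw : IsGivenBy w g) :
    lebesgueNorm (ENNReal.ofReal q) (TemperedDistribution.fourierMultiplierCLM ℂ m w) ≤
      ENNReal.ofReal N * eLpNorm g (ENNReal.ofReal p) volume := by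
  have hp1 : 1 ≤ ENNReal.ofReal p := by
    rw [← ENNReal.ofReal_one]; exact ENNReal.ofReal_le_ofReal hpq.lt.le
  have hq1 : 1 ≤ ENNReal.ofReal q := by
    rw [← ENNReal.ofReal_one]; exact ENNReal.ofReal_le_ofReal hpq.symm.lt.le
  have hnorm : ∀ f : 𝓢(RSpace n, ℂ), (eLpNorm f (ENNReal.ofReal p) volume).toReal =
      realLpNorm p f := fun f => (realLpNorm_eq_toReal hpq.pos (f.memLp _ volume)).symm
  have hPQ := hpq.ennrealOfReal
  have hP : ENNReal.ofReal p ≠ ⊤ := ENNReal.ofReal_ne_top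
  generalize hPp : ENNReal.ofReal p = P at *
  generalize hQq : ENNReal.ofReal q = Q at *
  have : Fact (1 ≤ P) := ⟨hp1⟩
  have : Fact (1 ≤ Q) := ⟨hq1⟩
  have core : ∀ f : 𝓢(RSpace n, ℂ), HasCompactSupport f →
      ‖(fourierMultiplierCLM ℂ m f).toLp Q (volume : Measure (RSpace n))‖ ≤
        N * ‖f.toLp P (volume : Measure (RSpace n))‖ := by
    intro f hf
    refine norm_le_of_forall_mulPairing_le hpq hPp.symm hQq.symm _ (by positivity) fun φ hφ => ?_
    rw [mulPairing_eq_integral (φ.coeFn_toLp P volume) (coeFn_toLp _ Q volume)]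
    have e : ∫ x, φ x * fourierMultiplierCLM ℂ m f x = ∫ ξ, m ξ * (𝓕 f ξ * 𝓕⁻ φ ξ) := by
      rw [← integral_fourierMultiplier_mul hm]
      congr 1; ext x; ring
    rw [e, norm_toLp, norm_toLp, hnorm, hnorm, mul_assoc]
    exact h f φ hf hφ
  obtain ⟨f, hfc, hf⟩ := exists_schwartz_tendsto_toLp hP hg
  obtain ⟨G, hGn, hG⟩ := exists_tendsto_fourierMultiplier_toLp hN core hfc hf
  have hgiven := isGivenBy_fourierMultiplier_of_tendsto hm hg hw hf hG
  refine (lebesgueNorm_le_of_isGivenBy (Lp.memLp G) hgiven).trans ?_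
  rw [← ENNReal.ofReal_toReal (Lp.memLp G).eLpNorm_ne_top, ← Lp.norm_def,
    ← ENNReal.ofReal_toReal hg.eLpNorm_ne_top, ← Lp.norm_toLp g hg, ← ENNReal.ofReal_mul hN]
  exact ENNReal.ofReal_le_ofReal hGn

/-- The estimate for each representing function passes to the infimum. Positivity of N rules out the
product 0·∞ when w is not in L^p. -/
theorem FormBound.lebesgueNorm_le {p q : ℝ} (hpq : p.HolderConjugate q) {m : RSpace n → ℂ}
    (hm : m.HasTemperateGrowth) {N : ℝ} (hN : 0 < N) (h : FormBound p m N) (w : 𝓢'(RSpace n, ℂ)) :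
    lebesgueNorm (ENNReal.ofReal q) (TemperedDistribution.fourierMultiplierCLM ℂ m w) ≤
      ENNReal.ofReal N * lebesgueNorm (ENNReal.ofReal p) w := by
  have h0 : ENNReal.ofReal N ≠ 0 := by simpa using hN
  rw [lebesgueNorm.eq_def (ENNReal.ofReal p)]
  simp only [ENNReal.mul_iInf_of_ne h0 ENNReal.ofReal_ne_top]
  exact le_iInf fun g => le_iInf fun hg => le_iInf fun hw =>
    h.lebesgueNorm_le_eLpNorm hpq hm hN.le hg hw

end Transfer

/-! ### Temperate growth of the propagator symbols. -/

section TemperateSymbols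

open Set Filter Topology FourierTransform

theorem hasTemperateGrowth_real_cos : Real.cos.HasTemperateGrowth :=
  ⟨Real.contDiff_cos, fun k => ⟨0, 1, fun x => by
    rw [norm_iteratedFDeriv_eq_norm_iteratedDeriv, pow_zero, mul_one]
    exact Real.abs_iteratedDeriv_cos_le_one k x⟩⟩

theorem hasTemperateGrowth_real_sin : Real.sin.HasTemperateGrowth :=
  ⟨Real.contDiff_sin, fun k => ⟨0, 1, fun x => by
    rw [norm_iteratedFDeriv_eq_norm_iteratedDeriv, pow_zero, mul_one]
    exact Real.abs_iteratedDeriv_sin_le_one k x⟩⟩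

theorem hasTemperateGrowth_cexp_mul_I :
    (fun x : ℝ => Complex.exp (x * Complex.I)).HasTemperateGrowth := by
  have h : (fun x : ℝ => Complex.exp (x * Complex.I)) =
      fun x : ℝ => ((Real.cos x : ℝ) : ℂ) + ((Real.sin x : ℝ) : ℂ) * Complex.I := by
    ext x
    rw [Complex.exp_mul_I, Complex.ofReal_cos, Complex.ofReal_sin]
  rw [h]
  exact (Function.Complex.hasTemperateGrowth_ofReal.comp hasTemperateGrowth_real_cos).add
    ((Function.Complex.hasTemperateGrowth_ofReal.comp hasTemperateGrowth_real_sin).mul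
      (Function.HasTemperateGrowth.const _))

/-- With all moments integrable, every derivative of the Fourier transform is the transform of an
integrable function and hence bounded. -/
theorem hasTemperateGrowth_fourier {f : ℝ → ℂ} (hf : ∀ k : ℕ, Integrable (fun x => x ^ k • f x)) :
    (𝓕 f).HasTemperateGrowth := by
  refine ⟨Real.contDiff_fourier fun k _ => ?_, fun k => ⟨0, ∫ x : ℝ,
    ‖(-2 * Real.pi * Complex.I * x) ^ k • f x‖, fun x => ?_⟩⟩
  · convert! (hf k).norm with x
    simp
  · rw [norm_iteratedFDeriv_eq_norm_iteratedDeriv, pow_zero, mul_one,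
      Real.iteratedDeriv_fourier (N := ⊤) (fun k _ => hf k) le_top]
    exact VectorFourier.norm_fourierIntegral_le_integral_norm _ _ _ _ _

/-- The second order Taylor remainder `(exp(ix) - 1 - ix) / x²`. -/
noncomputable def expRemainder (x : ℝ) : ℂ :=
  -∫ σ in (0 : ℝ)..1, ((1 - σ : ℝ) : ℂ) * Complex.exp ((σ * x : ℝ) * Complex.I)

theorem sq_mul_expRemainder (x : ℝ) :
    (x : ℂ) ^ 2 * expRemainder x = Complex.exp (x * Complex.I) - 1 - x * Complex.I := by
  have hd : ∀ σ : ℝ, HasDerivAt (fun σ : ℝ => ((1 - σ : ℝ) : ℂ) * (Complex.I * x) *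
      Complex.exp ((σ * x : ℝ) * Complex.I) + Complex.exp ((σ * x : ℝ) * Complex.I))
      (-(x : ℂ) ^ 2 * (((1 - σ : ℝ) : ℂ) * Complex.exp ((σ * x : ℝ) * Complex.I))) σ := by
    intro σ
    have h1 : HasDerivAt (fun σ : ℝ => ((1 - σ : ℝ) : ℂ)) (((-1 : ℝ) : ℂ)) σ :=
      ((hasDerivAt_id σ).const_sub 1).ofReal_comp
    have h2 : HasDerivAt (fun σ : ℝ => ((σ * x : ℝ) : ℂ)) ((x : ℝ) : ℂ) σ := by
      simpa using ((hasDerivAt_id σ).mul_const x).ofReal_comp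
    have h3 := (h2.mul_const Complex.I).cexp
    refine (((h1.mul_const (Complex.I * x)).mul h3).add h3).congr_deriv ?_
    push_cast
    linear_combination (1 - (σ : ℂ)) * (x : ℂ) ^ 2 * Complex.exp (σ * x * Complex.I) * Complex.I_sq
  have hi := intervalIntegral.integral_eq_sub_of_hasDerivAt (a := 0) (b := 1) (fun σ _ => hd σ)
    (Continuous.intervalIntegrable (by fun_prop) _ _)
  rw [intervalIntegral.integral_const_mul] at hi
  rw [expRemainder, mul_neg, ← neg_mul, hi]
  simp
  ring

/-- Up to sign and a dilation the remainder is the Fourier transform of the compactly supported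
function 1 - σ on (0,1]. -/
theorem hasTemperateGrowth_expRemainder : expRemainder.HasTemperateGrowth := by
  set f : ℝ → ℂ := indicator (Ioc 0 1) (fun σ => ((1 - σ : ℝ) : ℂ)) with hf
  have h1 : ∀ k : ℕ, Integrable (fun x : ℝ => x ^ k • f x) := by
    intro k
    have e : (fun x : ℝ => x ^ k • f x) =
        indicator (Ioc 0 1) (fun σ : ℝ => σ ^ k • ((1 - σ : ℝ) : ℂ)) := by
      ext x
      by_cases hx : x ∈ Ioc (0 : ℝ) 1 <;> simp [hf, hx]
    rw [e, integrable_indicator_iff measurableSet_Ioc]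
    exact (Continuous.integrableOn_Icc (by fun_prop)).mono_set Ioc_subset_Icc_self
  have h2 : expRemainder = fun x => -𝓕 f (-(2 * Real.pi)⁻¹ * x) := by
    ext x
    rw [expRemainder, Real.fourier_real_eq_integral_exp_smul,
      intervalIntegral.integral_of_le zero_le_one, ← integral_indicator measurableSet_Ioc]
    congr 2
    ext σ
    by_cases hx : σ ∈ Ioc (0 : ℝ) 1
    · simp only [hf, indicator_of_mem hx, smul_eq_mul]
      rw [mul_comm]
      congr 3
      push_cast
      have : (Real.pi : ℂ) ≠ 0 := by exact_mod_cast Real.pi_ne_zero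
      field_simp
    · simp [hf, hx]
  rw [h2]
  have h3 : (fun x : ℝ => -(2 * Real.pi)⁻¹ * x).HasTemperateGrowth :=
    (Function.HasTemperateGrowth.const _).mul Function.HasTemperateGrowth.id'
  exact ((hasTemperateGrowth_fourier h1).comp h3).neg

variable {n : ℕ}

theorem hasTemperateGrowth_beamFreq : (beamFreq (n := n)).HasTemperateGrowth := by
  have h := (Function.hasTemperateGrowth_one_add_norm_sq_rpow ℝ (1 / 2)).comp
    (hasTemperateGrowth_laplaceSymbol (n := n))
  refine (funext fun ξ => ?_ : _ = beamFreq (n := n)) ▸ h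
  rw [Function.comp_apply, Real.norm_eq_abs, sq_abs, beamFreq, Real.sqrt_eq_rpow]

theorem hasTemperateGrowth_inv_beamFreq :
    (fun ξ : RSpace n => (beamFreq ξ)⁻¹).HasTemperateGrowth := by
  have h := (Function.hasTemperateGrowth_one_add_norm_sq_rpow ℝ (-(1 / 2))).comp
    (hasTemperateGrowth_laplaceSymbol (n := n))
  refine (funext fun ξ => ?_ : _ = fun ξ : RSpace n => (beamFreq ξ)⁻¹) ▸ h
  rw [Function.comp_apply, Real.norm_eq_abs, sq_abs, beamFreq, Real.sqrt_eq_rpow,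
    Real.rpow_neg (by positivity)]

theorem hasTemperateGrowth_cos_beamFreq (t : ℝ) :
    (fun ξ : RSpace n => ((Real.cos (t * beamFreq ξ) : ℝ) : ℂ)).HasTemperateGrowth :=
  Function.Complex.hasTemperateGrowth_ofReal.comp (hasTemperateGrowth_real_cos.comp
    ((Function.HasTemperateGrowth.const t).mul hasTemperateGrowth_beamFreq))

theorem hasTemperateGrowth_sin_div_beamFreq (t : ℝ) :
    (fun ξ : RSpace n => ((Real.sin (t * beamFreq ξ) / beamFreq ξ : ℝ) : ℂ)).HasTemperateGrowth := by
  refine Function.Complex.hasTemperateGrowth_ofReal.comp ?_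
  simp only [div_eq_mul_inv]
  exact (hasTemperateGrowth_real_sin.comp
    ((Function.HasTemperateGrowth.const t).mul hasTemperateGrowth_beamFreq)).mul
      hasTemperateGrowth_inv_beamFreq

end TemperateSymbols

/-! ### Uniform boundedness for tempered distributions along bounded sequences. -/

section UniformBoundedness

open Set Filter Topology FourierTransform

variable {E : Type*} [NormedAddCommGroup E] [NormedSpace ℝ E]

/-- An absolutely convergent series of Schwartz functions. -/
theorem exists_schwartz_eq_tsum (g : ℕ → 𝓢(E, ℂ)) (v : ℕ → ℕ → ℕ → ℝ)
    (hv : ∀ k l, Summable (v k l)) (h : ∀ k l j, SchwartzMap.seminorm ℂ k l (g j) ≤ v k l j) :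
    ∃ G : 𝓢(E, ℂ), (∀ x, HasSum (fun j => g j x) (G x)) ∧
      ∀ k l, SchwartzMap.seminorm ℂ k l G ≤ ∑' j, v k l j := by
  have h0 : ∀ l j x, ‖iteratedFDeriv ℝ l (g j) x‖ ≤ v 0 l j := fun l j x =>
    (by simpa using (g j).le_seminorm ℂ 0 l x : _ ≤ SchwartzMap.seminorm ℂ 0 l (g j)).trans (h 0 l j)
  have hb : ∀ k l x, ‖x‖ ^ k * ‖iteratedFDeriv ℝ l (fun y => ∑' j, g j y) x‖ ≤ ∑' j, v k l j := by
    intro k l x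
    rw [iteratedFDeriv_tsum_apply (N := ⊤) (v := v 0) (fun j => (g j).smooth ⊤)
      (fun l _ => hv 0 l) (fun l j x _ => h0 l j x) le_top]
    have hs : Summable fun j => ‖iteratedFDeriv ℝ l (g j) x‖ :=
      (hv 0 l).of_nonneg_of_le (fun _ => norm_nonneg _) fun j => h0 l j x
    refine (mul_le_mul_of_nonneg_left (norm_tsum_le_tsum_norm hs) (by positivity)).trans ?_
    rw [← tsum_mul_left]
    exact (hs.mul_left _).tsum_le_tsum (fun j => ((g j).le_seminorm ℂ k l x).trans (h k l j)) (hv k l)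
  refine ⟨⟨fun x => ∑' j, g j x, contDiff_tsum (N := ⊤) (v := v 0) (fun j => (g j).smooth ⊤)
    (fun l _ => hv 0 l) (fun l j x _ => h0 l j x), fun k l => ⟨_, hb k l⟩⟩, fun x => ?_, fun k l => ?_⟩
  · refine Summable.hasSum (f := fun j => g j x) (.of_norm ?_)
    refine (hv 0 0).of_nonneg_of_le (fun _ => norm_nonneg _) fun j => ?_
    simpa using h0 0 j x
  · exact SchwartzMap.seminorm_le_bound ℂ k l _ (tsum_nonneg fun j =>
      (apply_nonneg _ _).trans (h k l j)) fun x => hb k l x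

/-- A sequence that is bounded in every seminorm is the image of the unit vectors under the
continuous map ε ↦ Σ εⱼφⱼ on ℓ¹. Composing distributions with it makes the Banach–Steinhaus theorem
available on a Banach space. -/
theorem exists_l1_to_schwartz (φ : ℕ → 𝓢(E, ℂ)) (B : ℕ → ℕ → ℝ)
    (h : ∀ k l j, SchwartzMap.seminorm ℂ k l (φ j) ≤ B k l) :
    ∃ Λ : lp (fun _ : ℕ => ℂ) 1 →L[ℂ] 𝓢(E, ℂ), ∀ j, Λ (lp.single 1 j 1) = φ j := by
  have hsum : ∀ ε : lp (fun _ : ℕ => ℂ) 1, Summable fun j => ‖ε j‖ := fun ε => by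
    simpa using (lp.memℓp ε).summable (by norm_num)
  have hex : ∀ ε : lp (fun _ : ℕ => ℂ) 1, ∃ G : 𝓢(E, ℂ),
      (∀ x, HasSum (fun j => ε j * φ j x) (G x)) ∧
      ∀ k l, SchwartzMap.seminorm ℂ k l G ≤ ‖ε‖ * B k l := fun ε => by
    obtain ⟨G, hG1, hG2⟩ := exists_schwartz_eq_tsum (fun j => ε j • φ j)
      (fun k l j => ‖ε j‖ * B k l) (fun k l => (hsum ε).mul_right _) fun k l j => by
        rw [map_smul_eq_mul]
        exact mul_le_mul_of_nonneg_left (h k l j) (norm_nonneg _)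
    refine ⟨G, fun x => by simpa using hG1 x, fun k l => (hG2 k l).trans_eq ?_⟩
    rw [tsum_mul_right, lp.norm_eq_tsum_rpow (by norm_num)]
    simp
  choose G hG1 hG2 using hex
  let Λ : lp (fun _ : ℕ => ℂ) 1 →ₗ[ℂ] 𝓢(E, ℂ) :=
    { toFun := G
      map_add' := fun a b => by
        ext x
        refine (hG1 (a + b) x).unique ?_
        simpa [add_mul] using (hG1 a x).add (hG1 b x)
      map_smul' := fun c a => by
        ext x
        refine (hG1 (c • a) x).unique ?_
        simpa [mul_assoc] using (hG1 a x).mul_left c }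
  have hc : Continuous Λ := by
    refine WithSeminorms.continuous_normedSpace_dom _ (schwartz_withSeminorms ℂ E ℂ) Λ fun i => ?_
    refine ⟨(B i.1 i.2).toNNReal, fun ε => (hG2 ε i.1 i.2).trans ?_⟩
    have hB : 0 ≤ B i.1 i.2 := (apply_nonneg _ _).trans (h i.1 i.2 0)
    rw [mul_comm]
    simp [NNReal.smul_def, hB]
  refine ⟨⟨Λ, hc⟩, fun j => ?_⟩
  ext x
  refine (hG1 (lp.single 1 j 1) x).unique ?_
  convert! hasSum_ite_eq j (φ j x) using 2 with i
  by_cases hi : i = j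
  · subst hi; simp
  · simp [hi]

/-- The uniform boundedness principle for tempered distributions. -/
theorem exists_norm_apply_le_of_pointwise_bounded (T : ℕ → 𝓢(E, ℂ) →L[ℂ] ℂ)
    (hT : ∀ φ : 𝓢(E, ℂ), ∃ C, ∀ j, ‖T j φ‖ ≤ C) (φ : ℕ → 𝓢(E, ℂ))
    (hφ : ∀ k l, ∃ B, ∀ j, SchwartzMap.seminorm ℂ k l (φ j) ≤ B) : ∃ C, ∀ j, ‖T j (φ j)‖ ≤ C := by
  choose B hB using hφ
  obtain ⟨Λ, hΛ⟩ := exists_l1_to_schwartz φ B hB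
  obtain ⟨C, hC⟩ := banach_steinhaus (g := fun j =>
    ((T j).comp Λ)) fun ε => hT (Λ ε)
  refine ⟨C, fun j => ?_⟩
  have h1 := ((T j).comp Λ).le_of_opNorm_le (hC j) (lp.single 1 j 1)
  rw [lp.norm_single (by norm_num), norm_one, mul_one] at h1
  rw [← hΛ j]
  exact h1

end UniformBoundedness

/-! ### Multiplication by symbols that depend on a parameter. -/

section ParametricMultiplier

open Set Filter Topology FourierTransform

variable {E : Type*} [NormedAddCommGroup E] [NormedSpace ℝ E]

theorem Function.HasTemperateGrowth.comp_prodMk_left {M : ℝ × E → ℂ} (hM : M.HasTemperateGrowth)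
    (h : ℝ) : (fun x => M (h, x)).HasTemperateGrowth := by
  have h1 : (fun x : E => (h, (0 : E)) + ContinuousLinearMap.inr ℝ ℝ E x).HasTemperateGrowth :=
    (Function.HasTemperateGrowth.const _).add (ContinuousLinearMap.inr ℝ ℝ E).hasTemperateGrowth
  refine (funext fun x => ?_ : _ = fun x => M (h, x)) ▸ hM.comp h1
  simp

theorem norm_iteratedFDeriv_comp_prodMk_left_le {M : ℝ × E → ℂ} (hM : M.HasTemperateGrowth)
    (h : ℝ) (x : E) (l : ℕ) :
    ‖iteratedFDeriv ℝ l (fun x => M (h, x)) x‖ ≤ ‖iteratedFDeriv ℝ l M (h, x)‖ := by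
  have e : (fun x => M (h, x)) =
      (fun z : ℝ × E => M ((h, (0 : E)) + z)) ∘ ContinuousLinearMap.inr ℝ ℝ E := by
    ext y; simp
  have hsm : ContDiff ℝ l (fun z : ℝ × E => M ((h, (0 : E)) + z)) :=
    (hM.1.of_le (by exact_mod_cast le_top)).comp (contDiff_const.add contDiff_id)
  rw [e, (ContinuousLinearMap.inr ℝ ℝ E).iteratedFDeriv_comp_right hsm x le_rfl,
    iteratedFDeriv_comp_add_left]
  refine (ContinuousMultilinearMap.norm_compContinuousLinearMap_le _ _).trans ?_
  have h2 : ∏ _i : Fin l, ‖ContinuousLinearMap.inr ℝ ℝ E‖ ≤ 1 :=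
    Finset.prod_le_one (fun _ _ => norm_nonneg _) fun _ _ =>
      ContinuousLinearMap.norm_inr_le_one ℝ ℝ E
  refine (mul_le_of_le_one_right (norm_nonneg _) h2).trans_eq ?_
  simp

/-- Temperate growth jointly in (h, x) gives polynomial bounds on the x-derivatives that are uniform
for |h| ≤ 1; Leibniz' rule lets the Schwartz decay of ψ absorb them. -/
theorem exists_seminorm_smulLeft_le {M : ℝ × E → ℂ} (hM : M.HasTemperateGrowth) (ψ : 𝓢(E, ℂ))
    (k l : ℕ) : ∃ B, ∀ h : ℝ, |h| ≤ 1 →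
      SchwartzMap.seminorm ℂ k l (smulLeftCLM ℂ (fun x => M (h, x)) ψ) ≤ B := by
  obtain ⟨d, C, hC, hd⟩ := hM.norm_iteratedFDeriv_le_uniform l
  set S := (2 : ℝ) ^ (k + d) *
    (Finset.Iic (k + d, l)).sup (fun m => SchwartzMap.seminorm ℂ m.1 m.2) ψ with hS
  have hS0 : 0 ≤ S := by positivity
  refine ⟨∑ i ∈ Finset.range (l + 1), (l.choose i : ℝ) * (C * 2 ^ d * S), fun h hh => ?_⟩
  have ht := hM.comp_prodMk_left h
  refine SchwartzMap.seminorm_le_bound ℂ k l _ (by positivity) fun x => ?_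
  rw [smulLeftCLM_apply ht]
  have h1 := norm_iteratedFDeriv_mul_le (n := l) (N := (⊤ : ℕ∞)) ht.1 (ψ.smooth ⊤) x
    (by exact_mod_cast le_top)
  refine (mul_le_mul_of_nonneg_left h1 (by positivity)).trans ?_
  rw [Finset.mul_sum]
  refine Finset.sum_le_sum fun i hi => ?_
  have hil : i ≤ l := by simpa [Nat.lt_succ_iff] using hi
  have h2 := (norm_iteratedFDeriv_comp_prodMk_left_le hM h x i).trans (hd i hil (h, x))
  have h3 : (1 + ‖x‖) ^ (k + d) * ‖iteratedFDeriv ℝ (l - i) ψ x‖ ≤ S :=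
    one_add_le_sup_seminorm_apply (m := (k + d, l)) le_rfl (Nat.sub_le _ _) ψ x
  have h4 : (1 + ‖(h, x)‖) ^ d ≤ 2 ^ d * (1 + ‖x‖) ^ d := by
    rw [← mul_pow]
    refine pow_le_pow_left₀ (by positivity) ?_ _
    have := norm_nonneg x
    have h5 : ‖(h, x)‖ ≤ 1 + ‖x‖ := by
      rw [Prod.norm_def]
      exact max_le (by rw [Real.norm_eq_abs]; linarith) (by linarith)
    linarith
  have h6 : ‖x‖ ^ k ≤ (1 + ‖x‖) ^ k :=
    pow_le_pow_left₀ (norm_nonneg _) (by linarith) _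
  calc ‖x‖ ^ k * ((l.choose i : ℝ) * ‖iteratedFDeriv ℝ i (fun x => M (h, x)) x‖ *
        ‖iteratedFDeriv ℝ (l - i) ψ x‖)
      ≤ (1 + ‖x‖) ^ k * ((l.choose i : ℝ) * (C * (2 ^ d * (1 + ‖x‖) ^ d)) *
        ‖iteratedFDeriv ℝ (l - i) ψ x‖) := by
        gcongr
        exact h2.trans (mul_le_mul_of_nonneg_left h4 hC)
    _ = (l.choose i : ℝ) * (C * 2 ^ d *
        ((1 + ‖x‖) ^ (k + d) * ‖iteratedFDeriv ℝ (l - i) ψ x‖)) := by rw [pow_add]; ring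
    _ ≤ (l.choose i : ℝ) * (C * 2 ^ d * S) := by gcongr

end ParametricMultiplier

/-! ### Transposed multipliers acting on test functions. -/

section Evolution

open Set Filter Topology FourierTransform

variable {n : ℕ}

/-- The transpose of the Fourier multiplier with symbol `m`. -/
noncomputable def dualMultiplier (m : RSpace n → ℂ) : 𝓢(RSpace n, ℂ) →L[ℂ] 𝓢(RSpace n, ℂ) :=
  (fourierCLM ℂ 𝓢(RSpace n, ℂ)).comp
    ((smulLeftCLM ℂ m).comp (fourierInvCLM ℂ 𝓢(RSpace n, ℂ)))

theorem dualMultiplier_apply (m : RSpace n → ℂ) (φ : 𝓢(RSpace n, ℂ)) :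
    dualMultiplier m φ = 𝓕 (smulLeftCLM ℂ m (𝓕⁻ φ)) := rfl

theorem fourierMultiplier_apply_eq_dualMultiplier (m : RSpace n → ℂ) (w : 𝓢'(RSpace n, ℂ))
    (φ : 𝓢(RSpace n, ℂ)) :
    TemperedDistribution.fourierMultiplierCLM ℂ m w φ = w (dualMultiplier m φ) := rfl

theorem dualMultiplier_dualMultiplier {m₁ m₂ : RSpace n → ℂ} (h₁ : m₁.HasTemperateGrowth)
    (h₂ : m₂.HasTemperateGrowth) (φ : 𝓢(RSpace n, ℂ)) :
    dualMultiplier m₁ (dualMultiplier m₂ φ) = dualMultiplier (fun ξ => m₁ ξ * m₂ ξ) φ := by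
  simp only [dualMultiplier_apply, FourierTransform.fourierInv_fourier_eq,
    smulLeftCLM_smulLeftCLM_apply h₁ h₂]
  rfl

theorem dualMultiplier_add {m₁ m₂ : RSpace n → ℂ} (h₁ : m₁.HasTemperateGrowth)
    (h₂ : m₂.HasTemperateGrowth) (φ : 𝓢(RSpace n, ℂ)) :
    dualMultiplier (fun ξ => m₁ ξ + m₂ ξ) φ = dualMultiplier m₁ φ + dualMultiplier m₂ φ := by
  have : smulLeftCLM ℂ (fun ξ => m₁ ξ + m₂ ξ) = smulLeftCLM ℂ m₁ + smulLeftCLM ℂ m₂ :=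
    smulLeftCLM_add (F := ℂ) h₁ h₂
  simp only [dualMultiplier_apply, this, add_apply,
    FourierTransform.fourier_add]

theorem dualMultiplier_const_mul {m : RSpace n → ℂ} (h : m.HasTemperateGrowth) (c : ℂ)
    (φ : 𝓢(RSpace n, ℂ)) :
    dualMultiplier (fun ξ => c * m ξ) φ = c • dualMultiplier m φ := by
  have : smulLeftCLM ℂ (fun ξ => c * m ξ) = c • smulLeftCLM ℂ m :=
    smulLeftCLM_smul (F := ℂ) h c
  simp only [dualMultiplier_apply, this, smul_apply,
    FourierTransform.fourier_smul]

theorem dualMultiplier_one (φ : 𝓢(RSpace n, ℂ)) :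
    dualMultiplier (fun _ => (1 : ℂ)) φ = φ := by
  simp [dualMultiplier_apply]

end Evolution

/-! ### Weak solutions are given by the cosine and sine propagators. -/

section Propagation

open Set Filter Topology FourierTransform

variable {n : ℕ}

theorem hasTemperateGrowth_fun_mul {f g : RSpace n → ℂ} (hf : f.HasTemperateGrowth)
    (hg : g.HasTemperateGrowth) : (fun ξ => f ξ * g ξ).HasTemperateGrowth := hf.mul hg

theorem hasTemperateGrowth_fun_add {f g : RSpace n → ℂ} (hf : f.HasTemperateGrowth)
    (hg : g.HasTemperateGrowth) : (fun ξ => f ξ + g ξ).HasTemperateGrowth := hf.add hg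

/-- The symbol `c exp(isη)`. -/
noncomputable def phaseSymbol (η : RSpace n → ℝ) (c : RSpace n → ℂ) (s : ℝ) (ξ : RSpace n) : ℂ :=
  c ξ * Complex.exp ((s * η ξ : ℝ) * Complex.I)

theorem hasTemperateGrowth_phaseSymbol {η : RSpace n → ℝ} {c : RSpace n → ℂ}
    (hη : η.HasTemperateGrowth) (hc : c.HasTemperateGrowth) (s : ℝ) :
    (phaseSymbol η c s).HasTemperateGrowth :=
  hc.mul (hasTemperateGrowth_cexp_mul_I.comp ((Function.HasTemperateGrowth.const s).mul hη))

theorem hasTemperateGrowth_remainder {η : RSpace n → ℝ} (hη : η.HasTemperateGrowth) :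
    (fun z : ℝ × RSpace n => expRemainder (z.1 * η z.2)).HasTemperateGrowth := by
  have h1 : (fun z : ℝ × RSpace n => z.1).HasTemperateGrowth :=
    (ContinuousLinearMap.fst ℝ ℝ (RSpace n)).hasTemperateGrowth
  have h2 : (fun z : ℝ × RSpace n => z.2).HasTemperateGrowth :=
    (ContinuousLinearMap.snd ℝ ℝ (RSpace n)).hasTemperateGrowth
  exact hasTemperateGrowth_expRemainder.comp (h1.mul (hη.comp h2))

theorem hasTemperateGrowth_I_mul {η : RSpace n → ℝ} {c : RSpace n → ℂ}
    (hη : η.HasTemperateGrowth) (hc : c.HasTemperateGrowth) :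
    (fun ξ => Complex.I * η ξ * c ξ).HasTemperateGrowth :=
  ((Function.HasTemperateGrowth.const Complex.I).mul
    (Function.Complex.hasTemperateGrowth_ofReal.comp hη)).mul hc

/-- Second order Taylor expansion in time. The remainder is kept as an exact symbol, the product of
a symbol fixed in h and `expRemainder (hη)`, so that it acts as a multiplier of temperate growth. -/
theorem phaseSymbol_add (η : RSpace n → ℝ) (c : RSpace n → ℂ) (s h : ℝ) (ξ : RSpace n) :
    phaseSymbol η c (s + h) ξ = phaseSymbol η c s ξ +
      h * phaseSymbol η (fun ξ => Complex.I * η ξ * c ξ) s ξ +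
      (h : ℂ) ^ 2 * (phaseSymbol η (fun ξ => (η ξ : ℂ) ^ 2 * c ξ) s ξ *
        expRemainder (h * η ξ)) := by
  have h1 := sq_mul_expRemainder (h * η ξ)
  have h2 : Complex.exp (((s + h) * η ξ : ℝ) * Complex.I) =
      Complex.exp ((s * η ξ : ℝ) * Complex.I) * Complex.exp ((h * η ξ : ℝ) * Complex.I) := by
    rw [← Complex.exp_add]; congr 1; push_cast; ring
  simp only [phaseSymbol, h2]
  push_cast at h1 ⊢
  linear_combination -(c ξ * Complex.exp (s * η ξ * Complex.I)) * h1

theorem dualMultiplier_phaseSymbol_add {η : RSpace n → ℝ} {c : RSpace n → ℂ}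
    (hη : η.HasTemperateGrowth) (hc : c.HasTemperateGrowth) (s h : ℝ) (χ : 𝓢(RSpace n, ℂ)) :
    dualMultiplier (phaseSymbol η c (s + h)) χ = dualMultiplier (phaseSymbol η c s) χ +
      (h : ℂ) • dualMultiplier (phaseSymbol η (fun ξ => Complex.I * η ξ * c ξ) s) χ +
      (h : ℂ) ^ 2 • (dualMultiplier (phaseSymbol η (fun ξ => (η ξ : ℂ) ^ 2 * c ξ) s)
        (dualMultiplier (fun ξ => expRemainder (h * η ξ)) χ)) := by
  have t1 := hasTemperateGrowth_phaseSymbol hη hc s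
  have t2 := hasTemperateGrowth_phaseSymbol hη (hasTemperateGrowth_I_mul hη hc) s
  have t3 : (phaseSymbol η (fun ξ => (η ξ : ℂ) ^ 2 * c ξ) s).HasTemperateGrowth :=
    hasTemperateGrowth_phaseSymbol hη
      (((Function.Complex.hasTemperateGrowth_ofReal.comp hη).pow 2).mul hc) s
  have t4 : (fun ξ => expRemainder (h * η ξ)).HasTemperateGrowth :=
    (hasTemperateGrowth_remainder hη).comp_prodMk_left h
  have t34 := hasTemperateGrowth_fun_mul t3 t4
  have t2' := hasTemperateGrowth_fun_mul (.const (h : ℂ)) t2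
  rw [dualMultiplier_dualMultiplier t3 t4, ← dualMultiplier_const_mul t2,
    ← dualMultiplier_const_mul t34, ← dualMultiplier_add t1 t2',
    ← dualMultiplier_add (hasTemperateGrowth_fun_add t1 t2') (hasTemperateGrowth_fun_mul (.const _) t34)]
  congr 2
  ext ξ
  exact phaseSymbol_add η c s h ξ

/-- Both the distribution and the test function depend on h. If no bound existed, sequences could be
chosen along which the distributions are pointwise bounded, by continuity on a compact interval, and
the test functions are bounded in every Schwartz seminorm. This contradicts uniform boundedness. -/
theorem exists_norm_apply_remainder_le {η : RSpace n → ℝ} (hη : η.HasTemperateGrowth)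
    {u : ℝ → 𝓢'(RSpace n, ℂ)} (hu : ∀ φ : 𝓢(RSpace n, ℂ), Continuous fun s => u s φ)
    (A : 𝓢(RSpace n, ℂ) →L[ℂ] 𝓢(RSpace n, ℂ)) (s : ℝ) (χ : 𝓢(RSpace n, ℂ)) :
    ∃ C, ∀ h : ℝ, |h| ≤ 1 →
      ‖u (s + h) (A (dualMultiplier (fun ξ => expRemainder (h * η ξ)) χ))‖ ≤ C := by
  by_contra! hcon
  choose h hh1 hh2 using fun j : ℕ => hcon j
  obtain ⟨C, hC⟩ := exists_norm_apply_le_of_pointwise_bounded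
    (fun j => ((u (s + h j) : 𝓢(RSpace n, ℂ) →L[ℂ] ℂ).comp
      (A.comp (fourierCLM ℂ 𝓢(RSpace n, ℂ)))))
    (fun φ => by
      obtain ⟨C, hC⟩ := (isCompact_Icc (a := s - 1) (b := s + 1)).exists_bound_of_continuousOn
        (hu (A (𝓕 φ))).continuousOn
      refine ⟨C, fun j => hC _ ?_⟩
      have := abs_le.1 (hh1 j)
      constructor <;> linarith)
    (fun j => smulLeftCLM ℂ (fun ξ => expRemainder (h j * η ξ)) (𝓕⁻ χ))
    (fun k l => by
      obtain ⟨B, hB⟩ := exists_seminorm_smulLeft_le (hasTemperateGrowth_remainder hη) (𝓕⁻ χ) k l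
      exact ⟨B, fun j => hB (h j) (hh1 j)⟩)
  obtain ⟨j, hj⟩ := exists_nat_gt C
  exact absurd ((hh2 j).trans_le (hC j)) (not_lt.2 hj.le)

/-- A product rule. After the Taylor expansion of the symbol around s, the zeroth and first order
terms have fixed test functions and the rest is O((r-s)²). -/
theorem hasDerivAt_apply_dualMultiplier_phaseSymbol {η : RSpace n → ℝ} {c : RSpace n → ℂ}
    (hη : η.HasTemperateGrowth) (hc : c.HasTemperateGrowth) {u v : ℝ → 𝓢'(RSpace n, ℂ)}
    (hu : ∀ (t : ℝ) (φ : 𝓢(RSpace n, ℂ)), HasDerivAt (fun s => u s φ) (v t φ) t)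
    (χ : 𝓢(RSpace n, ℂ)) (s : ℝ) :
    HasDerivAt (fun s => u s (dualMultiplier (phaseSymbol η c s) χ))
      (v s (dualMultiplier (phaseSymbol η c s) χ) +
        u s (dualMultiplier (phaseSymbol η (fun ξ => Complex.I * η ξ * c ξ) s) χ)) s := by
  have hcont : ∀ φ : 𝓢(RSpace n, ℂ), Continuous fun s => u s φ := fun φ =>
    continuous_iff_continuousAt.2 fun t => (hu t φ).continuousAt
  set A := dualMultiplier (phaseSymbol η (fun ξ => (η ξ : ℂ) ^ 2 * c ξ) s) with hA
  set R : ℝ → ℂ := fun r => ((r - s : ℝ) : ℂ) ^ 2 *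
    u r (A (dualMultiplier (fun ξ => expRemainder ((r - s) * η ξ)) χ)) with hR
  have e : (fun r => u r (dualMultiplier (phaseSymbol η c r) χ)) = fun r =>
      u r (dualMultiplier (phaseSymbol η c s) χ) + ((r - s : ℝ) : ℂ) *
        u r (dualMultiplier (phaseSymbol η (fun ξ => Complex.I * η ξ * c ξ) s) χ) + R r := by
    ext r
    have h1 := dualMultiplier_phaseSymbol_add hη hc s (r - s) χ
    rw [add_sub_cancel] at h1
    rw [h1, map_add, map_add, map_smul, map_smul, smul_eq_mul, smul_eq_mul]
  obtain ⟨C, hC⟩ := exists_norm_apply_remainder_le hη hcont A s χ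
  have hR0 : HasDerivAt R 0 s := by
    have hO : R =O[𝓝 s] fun r => ‖r - s‖ ^ 2 := by
      refine Asymptotics.IsBigO.of_bound C ?_
      filter_upwards [Metric.closedBall_mem_nhds s one_pos] with r hr
      have h1 := hC (r - s) (by rwa [Metric.mem_closedBall, Real.dist_eq] at hr)
      rw [add_sub_cancel] at h1
      rw [hR, norm_mul, norm_pow, Complex.norm_real, norm_pow, norm_norm, mul_comm]
      exact mul_le_mul_of_nonneg_right h1 (by positivity)
    exact (hO.hasFDerivAt (𝕜 := ℝ) one_lt_two).hasDerivAt
  have h2 : HasDerivAt (fun r : ℝ => ((r - s : ℝ) : ℂ)) 1 s := by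
    simpa using ((hasDerivAt_id s).sub_const s).ofReal_comp
  rw [e]
  refine (((hu s _).add (h2.mul (hu s _))).add hR0).congr_deriv ?_
  simp

theorem laplacian_laplacian_add_apply (w : 𝓢'(RSpace n, ℂ)) (φ : 𝓢(RSpace n, ℂ)) :
    (-(Δ (Δ w)) - w) φ = -w (dualMultiplier (fun ξ => ((beamFreq ξ : ℝ) : ℂ) ^ 2) φ) := by
  have ht : (fun ξ : RSpace n => Complex.ofReal (‖ξ‖ ^ 2)).HasTemperateGrowth :=
    Function.Complex.hasTemperateGrowth_ofReal.comp (Function.hasTemperateGrowth_norm_sq _)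
  have h1 : ∀ w : 𝓢'(RSpace n, ℂ), Δ w = (-(2 * (Real.pi : ℂ)) ^ 2) •
      TemperedDistribution.fourierMultiplierCLM ℂ (fun ξ => Complex.ofReal (‖ξ‖ ^ 2)) w := by
    intro w
    rw [TemperedDistribution.laplacian_eq_fourierMultiplierCLM]
    ext φ
    simp
  have h2 : (fun ξ : RSpace n => ((beamFreq ξ : ℝ) : ℂ) ^ 2) = fun ξ => 1 +
      (2 * (Real.pi : ℂ)) ^ 4 * (Complex.ofReal (‖ξ‖ ^ 2) * Complex.ofReal (‖ξ‖ ^ 2)) := by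
    ext ξ
    rw [beamFreq, ← Complex.ofReal_pow, Real.sq_sqrt (by positivity), laplaceSymbol]
    push_cast
    ring
  have ht2 := hasTemperateGrowth_fun_mul ht ht
  rw [h1 (Δ w), h1 w, h2, dualMultiplier_add (.const _)
      (hasTemperateGrowth_fun_mul (.const _) ht2),
    dualMultiplier_one, dualMultiplier_const_mul ht2, ← dualMultiplier_dualMultiplier ht ht]
  simp only [map_smul, sub_apply, neg_apply, smul_apply, map_add,
    fourierMultiplier_apply_eq_dualMultiplier, smul_eq_mul]
  ring

/-- The first order factor `v - iηu` of the beam equation is transported along `exp(isη)`. -/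
theorem IsBeamSolution.transport {u v : ℝ → 𝓢'(RSpace n, ℂ)}
    (hu : ∀ (t : ℝ) (φ : 𝓢(RSpace n, ℂ)), HasDerivAt (fun s => u s φ) (v t φ) t)
    (hv : ∀ (t : ℝ) (φ : 𝓢(RSpace n, ℂ)),
      HasDerivAt (fun s => v s φ) ((-(Δ (Δ (u t))) - u t) φ) t)
    {η : RSpace n → ℝ} (hη : η.HasTemperateGrowth) (hηω : ∀ ξ, η ξ ^ 2 = beamFreq ξ ^ 2)
    {c : RSpace n → ℂ} (hc : c.HasTemperateGrowth) (χ : 𝓢(RSpace n, ℂ)) (t : ℝ) :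
    v t (dualMultiplier (phaseSymbol η c t) χ) -
        u t (dualMultiplier (phaseSymbol η (fun ξ => Complex.I * η ξ * c ξ) t) χ) =
      v 0 (dualMultiplier (phaseSymbol η c 0) χ) -
        u 0 (dualMultiplier (phaseSymbol η (fun ξ => Complex.I * η ξ * c ξ) 0) χ) := by
  have hd : ∀ s, HasDerivAt (fun s => v s (dualMultiplier (phaseSymbol η c s) χ) -
        u s (dualMultiplier (phaseSymbol η (fun ξ => Complex.I * η ξ * c ξ) s) χ)) 0 s := by
    intro s
    have hc' := hasTemperateGrowth_I_mul hη hc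
    refine ((hasDerivAt_apply_dualMultiplier_phaseSymbol hη hc
      (v := fun t => -(Δ (Δ (u t))) - u t) hv χ s).sub
      (hasDerivAt_apply_dualMultiplier_phaseSymbol hη hc' hu χ s)).congr_deriv ?_
    have hω : (fun ξ : RSpace n => ((beamFreq ξ : ℝ) : ℂ) ^ 2).HasTemperateGrowth :=
      (Function.Complex.hasTemperateGrowth_ofReal.comp hasTemperateGrowth_beamFreq).pow 2
    have e : phaseSymbol η (fun ξ => Complex.I * η ξ * (Complex.I * η ξ * c ξ)) s =
        fun ξ => (-1) * (((beamFreq ξ : ℝ) : ℂ) ^ 2 * phaseSymbol η c s ξ) := by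
      ext ξ
      have h1 : (η ξ : ℂ) ^ 2 = (beamFreq ξ : ℂ) ^ 2 := by exact_mod_cast hηω ξ
      rw [phaseSymbol, phaseSymbol, ← h1]
      linear_combination (η ξ : ℂ) ^ 2 * c ξ *
        Complex.exp ((s * η ξ : ℝ) * Complex.I) * Complex.I_sq
    have ht := hasTemperateGrowth_phaseSymbol hη hc s
    rw [laplacian_laplacian_add_apply, dualMultiplier_dualMultiplier hω ht, e,
      dualMultiplier_const_mul (hasTemperateGrowth_fun_mul hω ht), map_smul, smul_eq_mul]
    ring
  exact is_const_of_deriv_eq_zero (fun s => (hd s).differentiableAt) (fun s => (hd s).deriv) t 0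

/-- Representation of the solution by the cosine and sine propagators. -/
theorem IsBeamSolution.eq_propagator {u₀ u₁ : 𝓢'(RSpace n, ℂ)} {u : ℝ → 𝓢'(RSpace n, ℂ)}
    (h : IsBeamSolution u₀ u₁ u) (t : ℝ) :
    u t = TemperedDistribution.fourierMultiplierCLM ℂ
        (fun ξ => ((Real.cos (t * beamFreq ξ) : ℝ) : ℂ)) u₀ +
      TemperedDistribution.fourierMultiplierCLM ℂ
        (fun ξ => ((Real.sin (t * beamFreq ξ) / beamFreq ξ : ℝ) : ℂ)) u₁ := by
  obtain ⟨v, hu, hv, rfl, rfl⟩ := h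
  ext φ
  have hω := hasTemperateGrowth_beamFreq (n := n)
  have hinv := hasTemperateGrowth_inv_beamFreq (n := n)
  -- Transport with η = σω, σ = ±1. The coefficient c = -iσω⁻¹e^{-iσtω} is chosen so that the phase
  -- at time t cancels and iηc becomes 1, which isolates u(t) tested against φ itself.
  have key : ∀ σ : ℝ, σ ^ 2 = 1 →
      v t (dualMultiplier (fun ξ => ((-σ : ℝ) : ℂ) * (Complex.I * ((beamFreq ξ)⁻¹ : ℝ))) φ) - u t φ =
      v 0 (dualMultiplier (fun ξ => ((-σ : ℝ) : ℂ) * (Complex.I * ((beamFreq ξ)⁻¹ : ℝ) *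
        Complex.exp ((-(σ * (t * beamFreq ξ)) : ℝ) * Complex.I))) φ) -
      u 0 (dualMultiplier (fun ξ =>
        Complex.exp ((-(σ * (t * beamFreq ξ)) : ℝ) * Complex.I)) φ) := by
    intro σ hσ
    set η : RSpace n → ℝ := fun ξ => σ * beamFreq ξ with hη
    set c : RSpace n → ℂ := fun ξ => ((-σ : ℝ) : ℂ) * (Complex.I * ((beamFreq ξ)⁻¹ : ℝ) *
        Complex.exp ((-(σ * (t * beamFreq ξ)) : ℝ) * Complex.I)) with hc
    have tη : η.HasTemperateGrowth := .mul (.const _) hω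
    have tc : c.HasTemperateGrowth := by
      refine .mul (.const _) (.mul (.mul (.const _)
        (Function.Complex.hasTemperateGrowth_ofReal.comp hinv)) ?_)
      refine hasTemperateGrowth_cexp_mul_I.comp (Function.HasTemperateGrowth.neg ?_)
      exact .mul (.const _) (.mul (.const _) hω)
    have hσ' : (σ : ℂ) ^ 2 = 1 := by exact_mod_cast hσ
    have e0 : ∀ ξ, Complex.I * (η ξ : ℂ) * c ξ =
        Complex.exp ((-(σ * (t * beamFreq ξ)) : ℝ) * Complex.I) := by
      intro ξ
      have hp : (beamFreq ξ : ℂ) ≠ 0 := by exact_mod_cast (beamFreq_pos ξ).ne'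
      have h3 : (beamFreq ξ : ℂ) * ((beamFreq ξ)⁻¹ : ℝ) = 1 := by
        push_cast; exact mul_inv_cancel₀ hp
      simp only [hη, hc]
      set X := Complex.exp ((-(σ * (t * beamFreq ξ)) : ℝ) * Complex.I)
      rw [Complex.ofReal_mul, Complex.ofReal_neg]
      linear_combination (-(σ : ℂ) ^ 2 * Complex.I ^ 2 * X) * h3 - (Complex.I ^ 2 * X) * hσ' -
        X * Complex.I_sq
    have hexp : ∀ ξ, Complex.exp ((-(σ * (t * beamFreq ξ)) : ℝ) * Complex.I) *
        Complex.exp ((t * η ξ : ℝ) * Complex.I) = 1 := by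
      intro ξ
      rw [← Complex.exp_add, ← Complex.exp_zero]
      congr 1
      simp only [hη]
      push_cast
      ring
    have key := IsBeamSolution.transport hu hv tη (fun ξ => by rw [hη, mul_pow, hσ, one_mul]) tc φ t
    have e1 : phaseSymbol η c t =
        fun ξ => ((-σ : ℝ) : ℂ) * (Complex.I * ((beamFreq ξ)⁻¹ : ℝ)) := by
      ext ξ
      rw [phaseSymbol, hc, mul_assoc, mul_assoc, hexp, mul_one]
    have e2 : phaseSymbol η (fun ξ => Complex.I * η ξ * c ξ) t = fun _ => 1 := by
      ext ξ
      rw [phaseSymbol, e0, hexp]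
    have e3 : phaseSymbol η c 0 = c := by
      ext ξ; simp [phaseSymbol]
    have e4 : phaseSymbol η (fun ξ => Complex.I * η ξ * c ξ) 0 = fun ξ =>
        Complex.exp ((-(σ * (t * beamFreq ξ)) : ℝ) * Complex.I) := by
      ext ξ
      rw [phaseSymbol, e0]; simp
    rwa [e1, e2, e3, e4, dualMultiplier_one] at key
  have tE : ∀ σ : ℝ, (fun ξ : RSpace n =>
      Complex.exp ((-(σ * (t * beamFreq ξ)) : ℝ) * Complex.I)).HasTemperateGrowth := fun σ =>
    hasTemperateGrowth_cexp_mul_I.comp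
      (Function.HasTemperateGrowth.neg (.mul (.const _) (.mul (.const _) hω)))
  have tI : (fun ξ : RSpace n => Complex.I * (((beamFreq ξ)⁻¹ : ℝ) : ℂ)).HasTemperateGrowth :=
    .mul (.const _) (Function.Complex.hasTemperateGrowth_ofReal.comp hinv)
  have tIE := fun σ => hasTemperateGrowth_fun_mul tI (tE σ)
  have k1 := key 1 (by norm_num)
  have k2 := key (-1) (by norm_num)
  rw [dualMultiplier_const_mul tI, dualMultiplier_const_mul (tIE _), map_smul, map_smul,
    smul_eq_mul, smul_eq_mul] at k1 k2
  rw [add_apply, fourierMultiplier_apply_eq_dualMultiplier,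
    fourierMultiplier_apply_eq_dualMultiplier]
  have hcos : dualMultiplier (fun ξ => ((Real.cos (t * beamFreq ξ) : ℝ) : ℂ)) φ = (1 / 2 : ℂ) •
      (dualMultiplier (fun ξ => Complex.exp ((-(1 * (t * beamFreq ξ)) : ℝ) * Complex.I)) φ +
       dualMultiplier (fun ξ => Complex.exp ((-(-1 * (t * beamFreq ξ)) : ℝ) * Complex.I)) φ) := by
    rw [← dualMultiplier_add (tE _) (tE _), ← dualMultiplier_const_mul (hasTemperateGrowth_fun_add (tE _) (tE _))]
    congr 2
    ext ξ
    rw [Complex.ofReal_cos, Complex.cos]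
    push_cast
    ring_nf
  have hsin : dualMultiplier (fun ξ => ((Real.sin (t * beamFreq ξ) / beamFreq ξ : ℝ) : ℂ)) φ =
      (1 / 2 : ℂ) •
      (dualMultiplier (fun ξ => Complex.I * ((beamFreq ξ)⁻¹ : ℝ) *
        Complex.exp ((-(1 * (t * beamFreq ξ)) : ℝ) * Complex.I)) φ +
       (-1 : ℂ) • dualMultiplier (fun ξ => Complex.I * ((beamFreq ξ)⁻¹ : ℝ) *
        Complex.exp ((-(-1 * (t * beamFreq ξ)) : ℝ) * Complex.I)) φ) := by
    rw [← dualMultiplier_const_mul (tIE _),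
      ← dualMultiplier_add (tIE _) (hasTemperateGrowth_fun_mul (.const _) (tIE _)),
      ← dualMultiplier_const_mul (hasTemperateGrowth_fun_add (tIE _)
        (hasTemperateGrowth_fun_mul (.const _) (tIE _)))]
    congr 2
    ext ξ
    rw [div_eq_mul_inv, Complex.ofReal_mul, Complex.ofReal_sin, Complex.sin]
    push_cast
    ring_nf
  rw [hcos, hsin]
  simp only [map_smul, map_add, smul_eq_mul]
  rw [show (((-1 : ℝ)) : ℂ) = -1 by push_cast; ring] at k1
  rw [show (((- -1 : ℝ)) : ℂ) = 1 by push_cast; ring] at k2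
  -- The terms with v(t) carry opposite signs for σ = ±1 and cancel in the sum, while u(t) doubles.
  linear_combination -(1 / 2 : ℂ) * k1 - (1 / 2 : ℂ) * k2

end Propagation

/-! ### Properties of the extended norms on distributions. -/

section LebesgueNorm

open Set Filter Topology

variable {n : ℕ}

theorem integrable_schwartz_mul {p q : ℝ} (hpq : p.HolderConjugate q) (φ : 𝓢(RSpace n, ℂ))
    {g : RSpace n → ℂ} (hg : MemLp g (ENNReal.ofReal p) volume) :
    Integrable (fun x => φ x * g x) volume := by
  have := hpq.symm.ennrealOfReal
  exact (φ.memLp (ENNReal.ofReal q) volume).integrable_mul hg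

theorem lebesgueNorm_add_le {p q : ℝ} (hpq : p.HolderConjugate q) (f g : 𝓢'(RSpace n, ℂ)) :
    lebesgueNorm (ENNReal.ofReal p) (f + g) ≤
      lebesgueNorm (ENNReal.ofReal p) f + lebesgueNorm (ENNReal.ofReal p) g := by
  have hp1 : 1 ≤ ENNReal.ofReal p := by
    rw [← ENNReal.ofReal_one]; exact ENNReal.ofReal_le_ofReal hpq.lt.le
  rw [lebesgueNorm.eq_def _ f, lebesgueNorm.eq_def _ g]
  simp only [ENNReal.iInf_add]
  refine le_iInf fun a => le_iInf fun ha => le_iInf fun hfa => ?_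
  simp only [ENNReal.add_iInf]
  refine le_iInf fun b => le_iInf fun hb => le_iInf fun hgb => ?_
  have h : IsGivenBy (f + g) (a + b) := fun φ => by
    rw [add_apply, hfa, hgb, ← integral_add (integrable_schwartz_mul hpq φ ha)
      (integrable_schwartz_mul hpq φ hb)]
    congr 1; ext x; rw [Pi.add_apply, mul_add]
  exact (lebesgueNorm_le_of_isGivenBy (ha.add hb) h).trans (eLpNorm_add_le ha.1 hb.1 hp1)

theorem lebesgueNorm_zero (p : ℝ≥0∞) : lebesgueNorm p (0 : 𝓢'(RSpace n, ℂ)) = 0 := by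
  have h : IsGivenBy (0 : 𝓢'(RSpace n, ℂ)) 0 := fun φ => by simp
  simpa using lebesgueNorm_le_of_isGivenBy (MemLp.zero (p := p)) h

theorem lebesgueNorm_neg_le (p : ℝ≥0∞) (f : 𝓢'(RSpace n, ℂ)) :
    lebesgueNorm p (-f) ≤ lebesgueNorm p f := by
  rw [lebesgueNorm.eq_def _ f]
  refine le_iInf fun a => le_iInf fun ha => le_iInf fun hfa => ?_
  have h : IsGivenBy (-f) (-a) := fun φ => by
    rw [neg_apply, hfa, ← integral_neg]
    congr 1; ext x; rw [Pi.neg_apply, mul_neg]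
  exact (lebesgueNorm_le_of_isGivenBy ha.neg h).trans_eq (eLpNorm_neg _ _ _)

theorem lebesgueNorm_sum_le {p q : ℝ} (hpq : p.HolderConjugate q) {ι : Type*} (s : Finset ι)
    (f : ι → 𝓢'(RSpace n, ℂ)) :
    lebesgueNorm (ENNReal.ofReal p) (∑ i ∈ s, f i) ≤
      ∑ i ∈ s, lebesgueNorm (ENNReal.ofReal p) (f i) := by
  classical
  induction s using Finset.induction_on with
  | empty => simp [lebesgueNorm_zero]
  | insert a s ha ih =>
    rw [Finset.sum_insert ha, Finset.sum_insert ha]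
    exact (lebesgueNorm_add_le hpq _ _).trans (by gcongr)

/-- Hölder's inequality for each representative. The summand 1 makes the constant nonzero, so that
it can be moved inside the infimum. -/
theorem enorm_apply_le {p q : ℝ} (hpq : p.HolderConjugate q) (f : 𝓢'(RSpace n, ℂ))
    (φ : 𝓢(RSpace n, ℂ)) : ‖f φ‖ₑ ≤
      (eLpNorm φ (ENNReal.ofReal q) volume + 1) * lebesgueNorm (ENNReal.ofReal p) f := by
  have htop : eLpNorm φ (ENNReal.ofReal q) volume + 1 ≠ ⊤ :=
    ENNReal.add_ne_top.2 ⟨(φ.memLp (ENNReal.ofReal q) volume).eLpNorm_ne_top, ENNReal.one_ne_top⟩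
  rw [lebesgueNorm]
  simp only [ENNReal.mul_iInf_of_ne (by simp : eLpNorm φ (ENNReal.ofReal q) volume + 1 ≠ 0) htop]
  refine le_iInf fun a => le_iInf fun ha => le_iInf fun hfa => ?_
  have := hpq.symm.ennrealOfReal
  rw [hfa]
  refine (enorm_integral_le_lintegral_enorm _).trans ?_
  rw [← eLpNorm_one_eq_lintegral_enorm]
  refine (eLpNorm_smul_le_mul_eLpNorm (p := ENNReal.ofReal q) (q := ENNReal.ofReal p) (r := 1)
    (f := a) (φ := φ) ha.1 (φ.memLp (ENNReal.ofReal q) volume).1).trans ?_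
  gcongr
  exact le_self_add

theorem eq_zero_of_lebesgueNorm_eq_zero {p q : ℝ} (hpq : p.HolderConjugate q)
    {f : 𝓢'(RSpace n, ℂ)} (h : lebesgueNorm (ENNReal.ofReal p) f = 0) : f = 0 := by
  ext φ
  have h1 := enorm_apply_le hpq f φ
  rw [h, mul_zero] at h1
  simpa using h1

theorem hasTemperateGrowth_one_add_laplaceSymbol :
    (fun ξ : RSpace n => 1 + (laplaceSymbol ξ : ℂ)).HasTemperateGrowth :=
  (Function.HasTemperateGrowth.const 1).add
    (Function.Complex.hasTemperateGrowth_ofReal.comp hasTemperateGrowth_laplaceSymbol)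

theorem fourierMultiplier_one_add_laplaceSymbol (w : 𝓢'(RSpace n, ℂ)) :
    TemperedDistribution.fourierMultiplierCLM ℂ (fun ξ => 1 + (laplaceSymbol ξ : ℂ)) w =
      w + -∑ i : Fin n, ∂_{stdVec i} (∂_{stdVec i} w) := by
  have h1 : Δ w = ∑ i : Fin n, ∂_{stdVec i} (∂_{stdVec i} w) := by
    rw [TemperedDistribution.laplacian_eq_sum (EuclideanSpace.basisFun (Fin n) ℝ)]
    simp [stdVec]
  have ht : (fun ξ : RSpace n => Complex.ofReal (‖ξ‖ ^ 2)).HasTemperateGrowth :=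
    Function.Complex.hasTemperateGrowth_ofReal.comp (Function.hasTemperateGrowth_norm_sq _)
  have e : (fun ξ : RSpace n => 1 + (laplaceSymbol ξ : ℂ)) = fun ξ => 1 +
      (2 * (Real.pi : ℂ)) ^ 2 * Complex.ofReal (‖ξ‖ ^ 2) := by
    ext ξ
    rw [laplaceSymbol]
    push_cast
    ring
  rw [← h1, TemperedDistribution.laplacian_eq_fourierMultiplierCLM]
  ext φ
  rw [fourierMultiplier_apply_eq_dualMultiplier, e, dualMultiplier_add (.const _)
      (hasTemperateGrowth_fun_mul (.const _) ht),
    dualMultiplier_one, dualMultiplier_const_mul ht]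
  simp [dualMultiplier_apply]

theorem lebesgueNorm_le_sobolevTwoNorm (p : ℝ≥0∞) (w : 𝓢'(RSpace n, ℂ)) :
    lebesgueNorm p w ≤ sobolevTwoNorm p w := by
  rw [sobolevTwoNorm, add_assoc]; exact le_self_add

/-- Only w and its pure second derivatives enter 1 - Δ; they are among the summands of the Sobolev
norm. -/
theorem lebesgueNorm_one_sub_laplacian_le {p q : ℝ} (hpq : p.HolderConjugate q)
    (w : 𝓢'(RSpace n, ℂ)) : lebesgueNorm (ENNReal.ofReal p)
      (TemperedDistribution.fourierMultiplierCLM ℂ (fun ξ => 1 + (laplaceSymbol ξ : ℂ)) w) ≤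
      sobolevTwoNorm (ENNReal.ofReal p) w := by
  rw [fourierMultiplier_one_add_laplaceSymbol, sobolevTwoNorm]
  refine (lebesgueNorm_add_le hpq _ _).trans (add_le_add le_self_add ?_)
  refine ((lebesgueNorm_neg_le _ _).trans (lebesgueNorm_sum_le hpq _ _)).trans ?_
  refine Finset.sum_le_sum fun i _ => ?_
  exact Finset.single_le_sum (f := fun j : Fin n =>
    lebesgueNorm (ENNReal.ofReal p) (∂_{stdVec i} (∂_{stdVec j} w))) (fun _ _ => zero_le)
    (Finset.mem_univ i)

end LebesgueNorm

/-! ### Assembling the estimates. -/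

section MainEstimate

open Set Filter Topology

variable {n : ℕ}

theorem FormBound.sin_of_abs {p N t : ℝ}
    (h : FormBound p (fun ξ : RSpace n =>
      ((Real.sin (|t| * beamFreq ξ) / beamFreq ξ : ℝ) : ℂ)) N) :
    FormBound p (fun ξ : RSpace n => ((Real.sin (t * beamFreq ξ) / beamFreq ξ : ℝ) : ℂ)) N := by
  rcases abs_cases t with ⟨ht, _⟩ | ⟨ht, _⟩
  · rwa [ht] at h
  · rw [ht] at h
    have h1 := h.const_mul (-1)
    simpa [neg_div] using h1

theorem cos_abs_mul (t x : ℝ) : Real.cos (|t| * x) = Real.cos (t * x) := by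
  rcases abs_choice t with h | h <;> simp [h]

theorem FormBound.lebesgueNorm_le_rpow {p q : ℝ} (hpq : p.HolderConjugate q) {m : RSpace n → ℂ}
    (hm : m.HasTemperateGrowth) {K t a : ℝ} (hK : 0 < K) (ht : 0 < t)
    (h : FormBound p m (K * t ^ a)) (w : 𝓢'(RSpace n, ℂ)) :
    lebesgueNorm (ENNReal.ofReal q) (TemperedDistribution.fourierMultiplierCLM ℂ m w) ≤
      ENNReal.ofReal K * ENNReal.ofReal t ^ a * lebesgueNorm (ENNReal.ofReal p) w := by
  rw [ENNReal.ofReal_rpow_of_pos ht, ← ENNReal.ofReal_mul hK.le]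
  exact h.lebesgueNorm_le hpq hm (by positivity) w

theorem hasTemperateGrowth_cos_mul_resolvent (t : ℝ) :
    (fun ξ : RSpace n => ((Real.cos (t * beamFreq ξ) : ℝ) : ℂ) *
      (1 / (1 + laplaceSymbol ξ : ℂ))).HasTemperateGrowth := by
  refine (hasTemperateGrowth_cos_beamFreq t).mul ?_
  have h := Function.Complex.hasTemperateGrowth_ofReal.comp (hasTemperateGrowth_resolvent (n := n))
  refine (funext fun ξ => ?_ : _ = fun ξ : RSpace n => 1 / (1 + laplaceSymbol ξ : ℂ)) ▸ h
  simp

theorem norm_cos_mul_resolvent_le (t : ℝ) (ξ : RSpace n) :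
    ‖((Real.cos (t * beamFreq ξ) : ℝ) : ℂ) * (1 / (1 + laplaceSymbol ξ : ℂ))‖ ≤
      1 / (1 + laplaceSymbol ξ) := by
  have h : ‖(1 / (1 + laplaceSymbol ξ : ℂ))‖ = 1 / (1 + laplaceSymbol ξ) := by
    rw [show (1 / (1 + laplaceSymbol ξ : ℂ)) = ((1 / (1 + laplaceSymbol ξ) : ℝ) : ℂ) by push_cast; rfl,
      Complex.norm_real, Real.norm_of_nonneg (one_div_nonneg.2 (one_add_laplaceSymbol_pos ξ).le)]
  rw [norm_mul, h]
  exact mul_le_of_le_one_left (one_div_nonneg.2 (one_add_laplaceSymbol_pos ξ).le)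
    (norm_cos_beamFreq_le t ξ)

theorem exists_formBound_cos_le_one {θ p : ℝ} (hθ0 : 0 ≤ θ) (hθ1 : θ < 1) (hp : p * (1 + θ) = 2) :
    ∃ C : ℝ, 0 ≤ C ∧ ∀ t : ℝ, 0 < t → t ≤ 1 →
      FormBound p (fun ξ : RSpace n => ((Real.cos (t * beamFreq ξ) : ℝ) : ℂ) *
        (1 / (1 + laplaceSymbol ξ : ℂ))) (C * t ^ min (1 - (n : ℝ) * θ / 2) 0) := by
  by_cases hκ : (n : ℝ) * θ / 2 = 1
  · obtain ⟨C, hC0, hC⟩ := exists_formBound_of_norm_le_resolvent hθ1 hp hκ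
    refine ⟨C, hC0, fun t _ _ => ?_⟩
    rw [hκ, sub_self, min_self, Real.rpow_zero, mul_one]
    exact hC _ (norm_cos_mul_resolvent_le t)
  · exact exists_formBound_cos_short hθ0 hθ1.le hp hκ

/-- At t = 0 the claim is the embedding of W^{2,q'} into L^q; it is the limit of bounds that are
uniform in small positive times. -/
theorem FormBound.cos_zero_of_pos {p C : ℝ} (h : ∀ t : ℝ, 0 < t → t ≤ 1 →
      FormBound p (fun ξ : RSpace n => ((Real.cos (t * beamFreq ξ) : ℝ) : ℂ) *
        (1 / (1 + laplaceSymbol ξ : ℂ))) C) :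
    FormBound p (fun ξ : RSpace n => ((Real.cos (0 * beamFreq ξ) : ℝ) : ℂ) *
        (1 / (1 + laplaceSymbol ξ : ℂ))) C := by
  refine FormBound.of_tendsto (B := 1) (mj := fun (j : ℕ) ξ =>
    ((Real.cos (1 / ((j : ℝ) + 1) * beamFreq ξ) : ℝ) : ℂ) * (1 / (1 + laplaceSymbol ξ : ℂ)))
    (fun j => (hasTemperateGrowth_cos_mul_resolvent _).1.continuous.aestronglyMeasurable)
    (fun j ξ => (norm_cos_mul_resolvent_le _ ξ).trans ?_) (fun ξ => ?_) fun j => ?_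
  · rw [div_le_one (one_add_laplaceSymbol_pos ξ)]
    linarith [laplaceSymbol_nonneg ξ]
  · refine Tendsto.mul_const _ ?_
    have hc : Continuous fun s : ℝ => ((Real.cos (s * beamFreq ξ) : ℝ) : ℂ) := by fun_prop
    exact (hc.tendsto 0).comp tendsto_one_div_add_atTop_nhds_zero_nat
  · refine h _ (by positivity) ?_
    rw [div_le_one (by positivity)]
    linarith [(Nat.cast_nonneg j : (0 : ℝ) ≤ j)]

theorem fourierMultiplier_cos_eq (t : ℝ) (w : 𝓢'(RSpace n, ℂ)) :
    TemperedDistribution.fourierMultiplierCLM ℂ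
        (fun ξ => ((Real.cos (t * beamFreq ξ) : ℝ) : ℂ)) w =
      TemperedDistribution.fourierMultiplierCLM ℂ (fun ξ => ((Real.cos (t * beamFreq ξ) : ℝ) : ℂ) *
        (1 / (1 + laplaceSymbol ξ : ℂ)))
        (TemperedDistribution.fourierMultiplierCLM ℂ (fun ξ => 1 + (laplaceSymbol ξ : ℂ)) w) := by
  rw [TemperedDistribution.fourierMultiplierCLM_fourierMultiplierCLM_apply
    hasTemperateGrowth_one_add_laplaceSymbol (hasTemperateGrowth_cos_mul_resolvent t)]
  congr 2
  ext ξ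
  have h : (1 + laplaceSymbol ξ : ℂ) ≠ 0 := by
    exact_mod_cast (one_add_laplaceSymbol_pos ξ).ne'
  rw [Pi.mul_apply]
  field_simp

/-- The multiplier bounds for the propagators, for all times. -/
theorem exists_formBound_propagator (hn : 1 ≤ n) {θ p : ℝ} (hθ0 : 0 ≤ θ) (hθ1 : θ < 1)
    (hp : p * (1 + θ) = 2) : ∃ K : ℝ, 0 < K ∧
      (∀ t : ℝ, t ≠ 0 → |t| ≤ 1 → FormBound p (fun ξ : RSpace n =>
        ((Real.sin (t * beamFreq ξ) / beamFreq ξ : ℝ) : ℂ)) (K * |t| ^ (1 - (n : ℝ) * θ / 2))) ∧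
      (∀ t : ℝ, t ≠ 0 → |t| ≤ 1 → FormBound p (fun ξ : RSpace n =>
        ((Real.cos (t * beamFreq ξ) : ℝ) : ℂ) * (1 / (1 + laplaceSymbol ξ : ℂ)))
          (K * |t| ^ min (1 - (n : ℝ) * θ / 2) 0)) ∧
      (∀ t : ℝ, 1 ≤ |t| → FormBound p (fun ξ : RSpace n =>
        ((Real.sin (t * beamFreq ξ) / beamFreq ξ : ℝ) : ℂ)) (K * |t| ^ (-((n : ℝ) * θ / 4)))) ∧
      (∀ t : ℝ, 1 ≤ |t| → FormBound p (fun ξ : RSpace n =>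
        ((Real.cos (t * beamFreq ξ) : ℝ) : ℂ)) (K * |t| ^ (-((n : ℝ) * θ / 4)))) := by
  obtain ⟨C₁, h₁, H₁⟩ := exists_formBound_sin_short (n := n) hθ0 hθ1.le hp
  obtain ⟨C₂, h₂, H₂⟩ := exists_formBound_cos_le_one (n := n) hθ0 hθ1 hp
  obtain ⟨C₃, h₃, H₃⟩ := exists_formBound_long hn hθ0 hθ1.le hp
  refine ⟨C₁ + C₂ + C₃ + 1, by positivity, fun t ht ht1 => ?_, fun t ht ht1 => ?_, fun t ht => ?_,
    fun t ht => ?_⟩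
  · exact ((H₁ |t| (abs_pos.2 ht) ht1).mono (by gcongr; linarith)).sin_of_abs
  · have h := (H₂ |t| (abs_pos.2 ht) ht1).mono (N' := (C₁ + C₂ + C₃ + 1) *
      |t| ^ min (1 - (n : ℝ) * θ / 2) 0) (by gcongr; linarith)
    simpa only [cos_abs_mul] using h
  · exact ((H₃ |t| ht).1.mono (by gcongr; linarith)).sin_of_abs
  · have h := (H₃ |t| ht).2.mono (N' := (C₁ + C₂ + C₃ + 1) *
      |t| ^ (-((n : ℝ) * θ / 4))) (by gcongr; linarith)
    simpa only [cos_abs_mul] using h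

theorem mainTheorem6 (n : ℕ) (hn : 1 ≤ n) (q q' : ℝ) (hq : 2 ≤ q) (hqq' : q.HolderConjugate q') :
    ∃ C : ℝ≥0, ∀ (u₀ u₁ : 𝓢'(RSpace n, ℂ)) (u : ℝ → 𝓢'(RSpace n, ℂ)),
      IsBeamSolution u₀ u₁ u →
        (∀ t : ℝ, lebesgueNorm (ENNReal.ofReal q) (u t) ≤
          C * beamDecay n q t *
            (sobolevTwoNorm (ENNReal.ofReal q') u₀ + lebesgueNorm (ENNReal.ofReal q') u₁)) ∧
        (u₀ = 0 → ∀ t : ℝ, |t| ≤ 1 →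
          lebesgueNorm (ENNReal.ofReal q) (u t) ≤
            C * ENNReal.ofReal |t| ^ (1 + (n : ℝ) / q - (n : ℝ) / 2) *
              lebesgueNorm (ENNReal.ofReal q') u₁) := by
  have hq0 : 0 < q := by linarith
  have hpq := hqq'.symm
  -- The interpolation parameter: q'(1+θ) = 2, and nθ/2 = n/2 - n/q expresses both exponents of the
  -- theorem.
  set θ := 1 - 2 / q with hθ
  have hθ0 : 0 ≤ θ := by
    rw [hθ, sub_nonneg, div_le_one hq0]; exact hq
  have hθ1 : θ < 1 := by
    have : 0 < 2 / q := by positivity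
    linarith
  have hp : q' * (1 + θ) = 2 := by
    have h1 := hqq'.inv_add_inv_eq_one
    have hq'0 := hqq'.symm.pos
    rw [hθ]
    field_simp at h1 ⊢
    linarith
  have e1 : 1 + (n : ℝ) / q - (n : ℝ) / 2 = 1 - (n : ℝ) * θ / 2 := by rw [hθ]; ring
  have e2 : (n : ℝ) / (2 * q) - (n : ℝ) / 4 = -((n : ℝ) * θ / 4) := by
    rw [hθ]; field_simp; ring
  obtain ⟨K, hK, Hs, Hc, Hsl, Hcl⟩ := exists_formBound_propagator hn hθ0 hθ1 hp
  refine ⟨K.toNNReal, fun u₀ u₁ u hu => ⟨fun t => ?_, fun h0 t ht => ?_⟩⟩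
  · have hsin := hasTemperateGrowth_sin_div_beamFreq (n := n) t
    have hu0 : u 0 = u₀ := by obtain ⟨v, -, -, h, -⟩ := hu; exact h
    rw [beamDecay, e1, e2]
    change _ ≤ ENNReal.ofReal K * _ * _
    split_ifs with ht
    · rcases eq_or_ne t 0 with rfl | ht0
      · rw [hu0, abs_zero, ENNReal.ofReal_zero]
        rcases lt_or_ge (1 - (n : ℝ) * θ / 2) 0 with hneg | hpos
        · rw [min_eq_left hneg.le, ENNReal.zero_rpow_of_neg hneg]
          -- Here the decay factor is 0^s = ∞, so the right side is ∞ unless the norms of the data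
          -- add up to zero. If the L^{q'} norm of u₀ vanishes then u₀ = 0; otherwise the right side
          -- is ∞.
          rcases eq_or_ne (lebesgueNorm (ENNReal.ofReal q') u₀) 0 with hz | hz
          · rw [eq_zero_of_lebesgueNorm_eq_zero hpq hz, lebesgueNorm_zero]
            exact zero_le
          · have hz' : sobolevTwoNorm (ENNReal.ofReal q') u₀ +
                lebesgueNorm (ENNReal.ofReal q') u₁ ≠ 0 := fun h => hz <| le_zero_iff.1 <|
              (lebesgueNorm_le_sobolevTwoNorm _ _).trans (le_self_add.trans_eq h)
            rw [ENNReal.mul_top (by simpa using hK), ENNReal.top_mul hz']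
            exact le_top
        · rw [min_eq_right hpos, ENNReal.rpow_zero, mul_one]
          have hF : FormBound q' (fun ξ : RSpace n => ((Real.cos (0 * beamFreq ξ) : ℝ) : ℂ) *
              (1 / (1 + laplaceSymbol ξ : ℂ))) K := FormBound.cos_zero_of_pos fun t h1 h2 => by
            have h := Hc t h1.ne' (by rwa [abs_of_pos h1])
            rwa [min_eq_right hpos, Real.rpow_zero, mul_one] at h
          have h3 := hF.lebesgueNorm_le hpq (hasTemperateGrowth_cos_mul_resolvent 0) hK
            (TemperedDistribution.fourierMultiplierCLM ℂ (fun ξ => 1 + (laplaceSymbol ξ : ℂ)) u₀)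
          rw [← fourierMultiplier_cos_eq] at h3
          have h4 : TemperedDistribution.fourierMultiplierCLM ℂ
              (fun ξ : RSpace n => ((Real.cos (0 * beamFreq ξ) : ℝ) : ℂ)) u₀ = u₀ := by
            simp
          rw [h4] at h3
          refine h3.trans ?_
          gcongr
          exact (lebesgueNorm_one_sub_laplacian_le hpq _).trans le_self_add
      · have htp : 0 < |t| := abs_pos.2 ht0
        rw [hu.eq_propagator t, fourierMultiplier_cos_eq, mul_add]
        refine (lebesgueNorm_add_le hqq' _ _).trans (add_le_add ?_ ?_)
        · refine ((Hc t ht0 ht).lebesgueNorm_le_rpow hpq (hasTemperateGrowth_cos_mul_resolvent t)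
            hK htp _).trans ?_
          gcongr
          exact lebesgueNorm_one_sub_laplacian_le hpq _
        · refine FormBound.lebesgueNorm_le_rpow hpq hsin hK htp ((Hs t ht0 ht).mono ?_) _
          -- For |t| ≤ 1 the sine bound |t|^{1-nθ/2} is no worse than the exponent min(1-nθ/2, 0) of
          -- the cosine.
          exact mul_le_mul_of_nonneg_left
            (Real.rpow_le_rpow_of_exponent_ge htp ht (min_le_left _ _)) hK.le
    · have ht1 : 1 ≤ |t| := (not_le.1 ht).le
      have htp : 0 < |t| := by linarith
      rw [hu.eq_propagator t, mul_add]
      refine (lebesgueNorm_add_le hqq' _ _).trans (add_le_add ?_ ?_)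
      · refine ((Hcl t ht1).lebesgueNorm_le_rpow hpq (hasTemperateGrowth_cos_beamFreq t)
            hK htp _).trans ?_
        gcongr
        exact lebesgueNorm_le_sobolevTwoNorm _ _
      · exact (Hsl t ht1).lebesgueNorm_le_rpow hpq hsin hK htp _
  · rw [e1]
    subst h0
    change _ ≤ ENNReal.ofReal K * _ * _
    -- At t = 0 the left side is zero whatever value the power 0^s takes.
    rcases eq_or_ne t 0 with rfl | ht0
    · have hu0 : u 0 = 0 := by obtain ⟨v, -, -, h, -⟩ := hu; exact h
      rw [hu0, lebesgueNorm_zero]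
      exact zero_le
    · rw [hu.eq_propagator t, map_zero, zero_add]
      exact (Hs t ht0 ht).lebesgueNorm_le_rpow hpq (hasTemperateGrowth_sin_div_beamFreq t) hK
        (abs_pos.2 ht0) _

end MainEstimate
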